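/- Let $\omega,\sigma_a,\lambda_a>0$, put $\kappa=(\sigma_a\lambda_a)^{-1/2}$, and let $J_n$ be the Bessel function of the first kind. For $1<R<2$ let $(\sigma_R,\lambda_R)$ be the following material parameters on the disc $\Omega=B_3=\{|x|<3\}\subset\mathbb R^2$: with $\Pi(x)=|x|^{-2}xx^{t}$, $$(\sigma_R,\lambda_R)(x)=\begin{cases}(\sigma_a I,\ \lambda_a), & |x|\le R,\\[2pt] \Big(\tfrac{|x|-1}{|x|}\Pi(x)+\tfrac{|x|}{|x|-1}(I-\Pi(x)),\ \tfrac{|x|}{4(|x|-1)}\Big), & R<|x|\le 2,\\[2pt] (I,\ 1), & 2<|x|<3.\end{cases}$$ Assume that $\omega$ is non-resonant, that is, $$\sigma_a\kappa\omega J_n'(\kappa\omega)+nJ_n(\kappa\omega)\neq0\quad\text{and}\quad J_n(3\omega)\neq0\qquad\text{for all integers } n\ge 0 .$$ Then there is $R_0\in(1,2]$ such that for every $N\ge0$, every point source $p=\kappa^{-2}\sum_{|\alpha|\le N}q_\alpha\partial^\alpha\delta_0$ with $q_\alpha\in\mathbb C$, and every $f\in H^{1/2}(\partial\Omega)$ the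 following holds. (i) For every $R\in(1,R_0)$ the Helmholtz problem $$(\lambda_R\nabla\cdot\sigma_R\nabla+\omega^2)u_R=p\ \text{ in }\Omega,\qquad u_R|_{\partial\Omega}=f$$ has a unique solution $u_R$. Here a solution is a distribution on $\Omega$ that is an $H^1$ function away from the origin with trace $f$ on $\partial\Omega$, satisfies the equation in the sense of distributions in $|x|<R$, and satisfies $\nabla\cdot\sigma_R\nabla u_R+\omega^2\lambda_R^{-1}u_R=0$ weakly in $\Omega\setminus\{0\}$. (ii) For every integer $n$ with $|n|\le N$, the Fourier coefficient $v_{R,n}^-(r)=\int_0^{2\pi}e^{-in\theta}u_R(r,\theta)\,d\theta$, $0<r\le R$, of the solution in the cloaked region (taken as a function that is continuously differentiable up to $r=R$ from the inside) satisfies $$E_n(R):=\big(\sigma_a\, r\,\partial_r v_{R,n}^-(r)+|n|\,v_{R,n}^-(r)\big)\big|_{r=R}\longrightarrow0\qquad\text{as }R\to1^+ .$$ (iii) With $\rho=2(R-1)\to0^+$ the rates are: $E_0(R)=O(1/\ln\rho)$; $E_n(R)=O(\rho^2)$ for $2\le|n|\le N$; and, if $N\ge1$, for $n=\pm1$, $E_{n}(R)=O(\rho)$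 in general and $E_{n}(R)=O(\rho^2|\ln\rho|)$ if the $n$-th Fourier coefficient of $f$ vanishes (in particular if $f=0$). -/

import Mathlib

open MeasureTheory Filter Topology Asymptotics
open scoped Distributions LineDeriv

namespace Cloak

noncomputable section

/-- The Euclidean plane. -/
abbrev Plane : Type := EuclideanSpace ℝ (Fin 2)

/-- The standard basis vectors of the plane. -/
def e (j : Fin 2) : Plane := EuclideanSpace.single j 1

/-- The point with polar coordinates `(r, θ)`. -/
def polar (r θ : ℝ) : Plane := !₂[r * Real.cos θ, r * Real.sin θ]

/-- The domain `Ω`: the open disc of radius `3` centred at the origin. -/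
def Omega : TopologicalSpace.Opens Plane := ⟨Metric.ball 0 3, Metric.isOpen_ball⟩

/-- The plane without the origin. -/
def Punctured : TopologicalSpace.Opens Plane := ⟨{0}ᶜ, isOpen_compl_singleton⟩

/-- The Bessel function of the first kind of integer order `n ≥ 0` on the real line. -/
def besselJ (n : ℕ) (x : ℝ) : ℝ :=
  ∑' m : ℕ, (-1 : ℝ) ^ m / ((m.factorial : ℝ) * ((m + n).factorial : ℝ)) * (x / 2) ^ (2 * m + n)

/-- The constant `κ > 0` with `κ² = (σ_a λ_a)⁻¹`. -/
def kappa (σa lam : ℝ) : ℝ := (Real.sqrt (σa * lam))⁻¹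

/-- `ω` is non-resonant: for every order `n ≥ 0`,
`σ_a r ∂_r J_n(κ ω r) + n J_n(κ ω r) ≠ 0` at `r = 1` and `J_n(3ω) ≠ 0`. -/
def NonResonant (ω σa lam : ℝ) : Prop :=
  ∀ n : ℕ,
    σa * (kappa σa lam * ω * deriv (besselJ n) (kappa σa lam * ω))
        + n * besselJ n (kappa σa lam * ω) ≠ 0 ∧
    besselJ n (3 * ω) ≠ 0

/-- The matrix of the orthogonal projection onto the radial direction at `x ≠ 0`. -/
def radialProj (x : Plane) : Matrix (Fin 2) (Fin 2) ℝ :=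
  Matrix.of fun j k => x j * x k / ‖x‖ ^ 2

/-- The mass tensor `σ_R` of the approximate cloak: the isotropic constant `σ_a` in the closed disc
of radius `R`, the push-forward of the identity by the blow-up map
`y ↦ (1 + |y|/2) y/|y|` for `R < |x| ≤ 2`, and the identity for `|x| > 2`. -/
def sigmaR (σa R : ℝ) (x : Plane) : Matrix (Fin 2) (Fin 2) ℝ :=
  if ‖x‖ ≤ R then σa • (1 : Matrix (Fin 2) (Fin 2) ℝ)
  else if ‖x‖ ≤ 2 then
    ((‖x‖ - 1) / ‖x‖) • radialProj x + (‖x‖ / (‖x‖ - 1)) • (1 - radialProj x)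
  else 1

/-- The bulk modulus `λ_R` of the approximate cloak. -/
def lambdaR (lam R : ℝ) (x : Plane) : ℝ :=
  if ‖x‖ ≤ R then lam
  else if ‖x‖ ≤ 2 then ‖x‖ / (4 * (‖x‖ - 1))
  else 1

/-- The Dirac mass at the origin, as a complex distribution on `Ω`. -/
def dirac : 𝓓'(Omega, ℂ) := Distribution.mapCLM Complex.ofRealCLM (Distribution.delta 0)

/-- The partial derivative `∂^α` of multi-index `α` of a distribution. -/
def partialDeriv (α : ℕ × ℕ) (T : 𝓓'(Omega, ℂ)) : 𝓓'(Omega, ℂ) :=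
  (fun S : 𝓓'(Omega, ℂ) => ∂_{e 0} S)^[α.1] ((fun S : 𝓓'(Omega, ℂ) => ∂_{e 1} S)^[α.2] T)

/-- The point source `p = κ⁻² ∑_{|α| ≤ N} q_α ∂^α δ_0`. -/
def source (σa lam : ℝ) (N : ℕ) (q : ℕ × ℕ → ℂ) : 𝓓'(Omega, ℂ) :=
  (((kappa σa lam) ^ 2)⁻¹ : ℂ) •
    ∑ α ∈ Finset.range (N + 1) ×ˢ Finset.range (N + 1) with α.1 + α.2 ≤ N,
      q α • partialDeriv α dirac

/-- `f ∈ H^{1/2}(∂Ω)`, where a function on the circle of radius `3` is given as a function of the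
angle `θ ∈ (0, 2π]`: `f` is square integrable and `∑ₙ (1 + n²)^{1/2} |f_n|² < ∞`. -/
def MemHHalf (f : ℝ → ℂ) : Prop :=
  MemLp f 2 (volume.restrict (Set.Ioc 0 (2 * Real.pi))) ∧
  Summable fun n : ℤ =>
    Real.sqrt (1 + (n : ℝ) ^ 2) * ‖fourierCoeffOn Real.two_pi_pos f n‖ ^ 2

/-- `u` is a solution on `Ω` of `λ_R ∇·(σ_R ∇u) + ω² u = p`, `u|_∂Ω = f`, where `p` is the point
source at the origin with coefficients `q`. The source is too singular for `u` to be a function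
near the origin, so `u` is a distribution on `Ω`, which on `Ω ∖ {0}` is the function `U`,
of class `H¹` away from the origin with weak gradient `G`. -/
structure IsSolution (ω σa lam R : ℝ) (N : ℕ) (q : ℕ × ℕ → ℂ) (f : ℝ → ℂ)
    (u : 𝓓'(Omega, ℂ)) (U : Plane → ℂ) : Prop where
  /-- Away from the origin, `u` is the function `U`. -/
  eq_fun : ∀ φ : 𝓓(Omega, ℝ), (0 : Plane) ∉ tsupport φ →
    u φ = ∫ x in Metric.ball (0 : Plane) 3, (φ x : ℂ) * U x
  /-- `U` is square integrable away from the origin. -/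
  memLp : ∀ ε : ℝ, 0 < ε →
    MemLp U 2 (volume.restrict (Metric.ball (0 : Plane) 3 \ Metric.ball 0 ε))
  /-- In the disc of radius `R` the equation holds in the sense of distributions, with the
  source. -/
  inner_eq : ∀ φ : 𝓓(Omega, ℝ), tsupport φ ⊆ Metric.ball (0 : Plane) R →
    (lam * σa : ℂ) * ∑ j : Fin 2, (∂_{e j} (∂_{e j} u)) φ + (ω : ℂ) ^ 2 * u φ
      = source σa lam N q φ
  /-- There is a weak gradient `G`, square integrable away from the origin, such that Green's
  formula holds with boundary values `f` on the circle of radius `3`, and such that the equation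
  (divided by `λ_R`) holds in the weak sense on `Ω ∖ {0}`, where there is no source. -/
  outer_eq : ∃ G : Fin 2 → Plane → ℂ,
    (∀ j, ∀ ε : ℝ, 0 < ε →
      MemLp (G j) 2 (volume.restrict (Metric.ball (0 : Plane) 3 \ Metric.ball 0 ε))) ∧
    (∀ j, ∀ ψ : 𝓓(Punctured, ℝ),
      ∫ x in Metric.ball (0 : Plane) 3,
          (U x * (fderiv ℝ ψ x (e j) : ℂ) + G j x * (ψ x : ℂ))
        = ∫ θ in (0 : ℝ)..(2 * Real.pi),
            3 * (f θ * (polar 1 θ j : ℂ) * (ψ (polar 3 θ) : ℂ))) ∧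
    (∀ φ : 𝓓(Omega, ℝ), (0 : Plane) ∉ tsupport φ →
      ∫ x in Metric.ball (0 : Plane) 3,
        (-(∑ j : Fin 2, ∑ k : Fin 2,
              (sigmaR σa R x j k : ℂ) * G k x * (fderiv ℝ φ x (e j) : ℂ))
          + (ω : ℂ) ^ 2 / (lambdaR lam R x : ℂ) * U x * (φ x : ℂ)) = 0)

/-- `v` is the `n`-th Fourier coefficient `r ↦ ∫_0^{2π} e^{-inθ} U(r, θ) dθ` of the restriction of
`U` to the disc of radius `R`. As `U` is defined only almost everywhere, `v` is the (unique)
representative on `(0, R]` that is continuously differentiable up to the end point `R`. -/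
def IsInnerCoeff (U : Plane → ℂ) (R : ℝ) (n : ℤ) (v : ℝ → ℂ) : Prop :=
  ContDiffOn ℝ 1 v (Set.Ioc 0 R) ∧
  ∀ᵐ r ∂(volume.restrict (Set.Ioo 0 R)),
    v r = ∫ θ in (0 : ℝ)..(2 * Real.pi),
      Complex.exp (-((n : ℂ) * (θ : ℂ) * Complex.I)) * U (polar r θ)

/-- The boundary expression `σ_a r ∂_r v + |n| v` at `r = R`, with the derivative taken from the
inside. -/
def boundaryExpr (σa R : ℝ) (n : ℤ) (v : ℝ → ℂ) : ℂ :=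
  (σa : ℂ) * (R : ℂ) * derivWithin v (Set.Ioc 0 R) R + ((|n| : ℤ) : ℂ) * v R

end

end Cloak

/-!
The disc and the material parameters are invariant under rotations, so that the problem separates.
Each Fourier coefficient of a solution, together with its flux, solves a first order system on
`(0, 3]` (`ModeSol`, `WeakSol.exists_modeSol`). Inside the cloaked region this is Bessel's equation
with wave number `k = κω`; outside, the blow-up map turns it into Bessel's equation in the radius
before the blow-up (`preRadius`), so that the circle `r = R` becomes the small circle of radius
`ρ = 2(R - 1)`. A mode is thus given by four coefficients, and the transmission conditions at
`r = R` are a linear system with determinant `transDet`.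

The determinant does not vanish in any order once `R` is close to `1`
(`exists_forall_transDet_ne_zero`): in high order by the signs of the Bessel functions below their
turning points (`transDet_ne_zero_of_large`), uniformly in `R`, and in each of the finitely many
other orders because it behaves like the non-resonance expression times `ρ⁻ⁿ`, or times `log ρ` for
`n = 0`.

The coefficient of the singular solution in the cloaked region depends on the source only, as
testing with cut off Bessel modes shows (`IsSolution.detect`). Hence the boundary expression is an
explicit function of `R` with fixed data (`ModeSol.bdry_eq`, `IsSolution.exists_innerCoeff`). In it
the leading singular term of the exterior solution is annihilated, since
`x Y_n' + n Y_n = x Y_{n-1}` (`extDB_add`), while the determinant keeps its full size. The quotient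
gives the rates.

For existence, boundary data without sources are attained by a series of regular modes, which
converges in the energy norm by an energy estimate for high orders (`ModeSol.energy`,
`exists_regSol`). For point sources, derivatives of the fundamental solution `Y₀(k|x|) / 2π`
(`integral_besselY_helm`, `PointSol.lineDeriv`) solve the equation near the origin; they are
finite combinations of singular modes, each of which continues to the whole disc
(`exists_continuation`). For uniqueness, all modes of a difference vanish (`ModeSol.eq_zero`), so
that the difference is supported at the origin; since the Helmholtz equation is locally solvable by
convolution with the fundamental solution, it is zero (`dist_eq_zero`).
-/

namespace Cloak

open Complex (I exp)
open Set (Ioo Ioc Icc Ioi Iio Ico)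
open scoped Real

/-- The disc `Ω` as a set. -/
local notation "𝔹" => Metric.ball (0 : Plane) 3

/-- Infinite differentiability over the reals. -/
local notation "Smooth" => ContDiff ℝ (⊤ : ℕ∞)

/-- The measure of the angular variable. -/
local notation "dθ" => (volume.restrict (Ioc 0 (2 * π)) : Measure ℝ)

noncomputable section

/-! ### Entire power series with factorially small coefficients -/

/-- The sum of the power series with coefficients `a`. -/
def powerSum (a : ℕ → ℝ) (t : ℝ) : ℝ := ∑' m, a m * t ^ m

/-- The coefficients of the derivative of a power series. -/
def derivCoeff (a : ℕ → ℝ) (m : ℕ) : ℝ := (m + 1) * a (m + 1)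

/-- Coefficients bounded by those of the exponential series. This class is stable under
differentiation, so that the sums of such series are smooth. -/
def ExpBounded (a : ℕ → ℝ) : Prop := ∀ m, |a m| ≤ 1 / (m.factorial : ℝ)

lemma ExpBounded.derivCoeff {a : ℕ → ℝ} (ha : ExpBounded a) : ExpBounded (derivCoeff a) := by
  intro m
  have h := ha (m + 1)
  have h1 : (0 : ℝ) < m + 1 := by positivity
  have h2 : (0 : ℝ) < m.factorial := by positivity
  rw [Cloak.derivCoeff, abs_mul, abs_of_pos h1]
  calc ((m : ℝ) + 1) * |a (m + 1)| ≤ (m + 1) * (1 / ((m + 1).factorial : ℝ)) := by gcongr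
    _ = 1 / (m.factorial : ℝ) := by
      rw [Nat.factorial_succ]; push_cast; field_simp

lemma ExpBounded.summable {a : ℕ → ℝ} (ha : ExpBounded a) (t : ℝ) :
    Summable fun m => a m * t ^ m := by
  refine Summable.of_norm_bounded (Real.summable_pow_div_factorial |t|) fun m => ?_
  rw [Real.norm_eq_abs, abs_mul, abs_pow]
  calc |a m| * |t| ^ m ≤ 1 / (m.factorial : ℝ) * |t| ^ m := by gcongr; exact ha m
    _ = |t| ^ m / m.factorial := by ring

lemma ExpBounded.hasDerivAt {a : ℕ → ℝ} (ha : ExpBounded a) (t : ℝ) :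
    HasDerivAt (powerSum a) (powerSum (Cloak.derivCoeff a) t) t := by
  set M := |t| + 1
  have hu : Summable fun m : ℕ => m * (M ^ (m - 1) / m.factorial) := by
    rw [← summable_nat_add_iff 1]
    refine (Real.summable_pow_div_factorial M).congr fun m => ?_
    rw [Nat.factorial_succ]; push_cast
    field_simp
  have key := hasDerivAt_tsum_of_isPreconnected (g := fun m y => a m * y ^ m)
    (g' := fun m y => a m * (m * y ^ (m - 1))) (t := Metric.ball 0 M) (y₀ := 0) (y := t) hu
    Metric.isOpen_ball (convex_ball 0 M).isPreconnected
    (fun m y _ => (hasDerivAt_pow m y).const_mul (a m)) ?_ (by simp [M]; positivity)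
    (ha.summable 0) (by simp [M])
  · refine HasDerivAt.congr_deriv key ?_
    have hs : Summable fun m : ℕ => a m * (m * t ^ (m - 1)) := by
      rw [← summable_nat_add_iff 1]
      refine (ha.derivCoeff.summable t).congr fun m => ?_
      simp [Cloak.derivCoeff]; ring
    rw [hs.tsum_eq_zero_add, powerSum, Nat.cast_zero, zero_mul, mul_zero, zero_add]
    refine tsum_congr fun m => ?_
    simp [Cloak.derivCoeff]; ring
  · intro m y hy
    have hy' : |y| ≤ M := by simpa using (Metric.mem_ball.1 hy).le
    rw [Real.norm_eq_abs, abs_mul, abs_mul, abs_pow, Nat.abs_cast]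
    calc |a m| * (m * |y| ^ (m - 1)) ≤ 1 / (m.factorial : ℝ) * (m * M ^ (m - 1)) := by
          gcongr; exact ha m
      _ = m * (M ^ (m - 1) / m.factorial) := by ring

lemma ExpBounded.contDiff {a : ℕ → ℝ} (ha : ExpBounded a) (n : ℕ∞) :
    ContDiff ℝ n (powerSum a) := by
  suffices h : ∀ m : ℕ, ContDiff ℝ m (powerSum a) from contDiff_iff_forall_nat_le.2 fun m _ => h m
  intro m
  induction m generalizing a with
  | zero =>
    exact contDiff_zero.2 (continuous_iff_continuousAt.2 fun t => (ha.hasDerivAt t).continuousAt)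
  | succ m ih =>
    have : deriv (powerSum a) = powerSum (Cloak.derivCoeff a) :=
      funext fun t => (ha.hasDerivAt t).deriv
    rw [Nat.cast_succ]
    refine contDiff_succ_iff_deriv.2 ⟨fun t => (ha.hasDerivAt t).differentiableAt,
      fun h => absurd h (mod_cast WithTop.coe_ne_top), ?_⟩
    rw [this]
    exact ih ha.derivCoeff

lemma powerSum_zero (a : ℕ → ℝ) : powerSum a 0 = a 0 := by
  rw [powerSum, tsum_eq_single 0]
  · simp
  · intro m hm; simp [hm]

/-! ### Bessel functions of both kinds -/

/-- Taylor coefficients of the entire function `g_n` with `J_n(x) = (x/2)^n g_n(x²/4)`. -/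
def besselCoeff (n m : ℕ) : ℝ := (-1) ^ m / ((m.factorial : ℝ) * ((m + n).factorial : ℝ))

lemma expBounded_besselCoeff (n : ℕ) : ExpBounded (besselCoeff n) := by
  intro m
  have h2 : (0 : ℝ) < m.factorial := by positivity
  have h3 : (1 : ℝ) ≤ (m + n).factorial := mod_cast Nat.one_le_iff_ne_zero.2 (Nat.factorial_ne_zero _)
  rw [besselCoeff, abs_div, abs_pow, abs_neg, abs_one, one_pow, abs_of_pos (by positivity)]
  gcongr
  nlinarith

/-- The entire function `g_n` with `J_n(x) = (x/2)^n g_n(x²/4)`. -/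
def besselEntire (n : ℕ) : ℝ → ℝ := powerSum (besselCoeff n)

lemma besselJ_eq (n : ℕ) (x : ℝ) : besselJ n x = (x / 2) ^ n * besselEntire n (x ^ 2 / 4) := by
  rw [besselJ, besselEntire, powerSum, ← tsum_mul_left]
  refine tsum_congr fun m => ?_
  rw [besselCoeff, pow_add, pow_mul, show (x / 2) ^ 2 = x ^ 2 / 4 by ring]
  ring

lemma derivCoeff_besselCoeff (n : ℕ) :
    derivCoeff (besselCoeff n) = fun m => -besselCoeff (n + 1) m := by
  funext m
  have h1 : (m : ℝ) + 1 ≠ 0 := by positivity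
  rw [derivCoeff, besselCoeff, besselCoeff, Nat.factorial_succ,
    show m + 1 + n = m + (n + 1) by ring]
  push_cast
  field_simp
  ring

lemma hasDerivAt_besselEntire (n : ℕ) (t : ℝ) :
    HasDerivAt (besselEntire n) (-besselEntire (n + 1) t) t := by
  have h := (expBounded_besselCoeff n).hasDerivAt t
  rw [derivCoeff_besselCoeff] at h
  refine h.congr_deriv ?_
  simp [besselEntire, powerSum, tsum_neg]

lemma besselEntire_recurrence (n : ℕ) (t : ℝ) :
    besselEntire n t = (n + 1) * besselEntire (n + 1) t - t * besselEntire (n + 2) t := by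
  have s0 := (expBounded_besselCoeff n).summable t
  have s1 := (expBounded_besselCoeff (n + 1)).summable t
  have s2 := (expBounded_besselCoeff (n + 2)).summable t
  rw [besselEntire, besselEntire, besselEntire, powerSum, powerSum, powerSum,
    s0.tsum_eq_zero_add, s1.tsum_eq_zero_add, mul_add, ← tsum_mul_left, ← tsum_mul_left]
  have h0 : besselCoeff n 0 * t ^ 0 = (n + 1) * (besselCoeff (n + 1) 0 * t ^ 0) := by
    simp only [besselCoeff, zero_add, Nat.factorial_succ]; push_cast; field_simp
  rw [h0, add_sub_assoc, ← Summable.tsum_sub]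
  · congr 1
    refine tsum_congr fun m => ?_
    simp only [besselCoeff]
    rw [show m + 1 + n = (m + n) + 1 by ring, show m + 1 + (n + 1) = (m + n) + 1 + 1 by ring,
      show m + (n + 2) = (m + n) + 1 + 1 by ring]
    simp only [Nat.factorial_succ]
    push_cast
    field_simp
    ring
  · exact ((summable_nat_add_iff 1).2 s1).mul_left _
  · exact s2.mul_left _

/-- The derivative relations shared by the Bessel functions of both kinds, on the positive half
line. -/
structure BesselFamily (C : ℕ → ℝ → ℝ) : Prop where
  hasDerivAt_down : ∀ n x, 0 < x → HasDerivAt (C n) (n / x * C n x - C (n + 1) x) x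
  hasDerivAt_up : ∀ n x, 0 < x → HasDerivAt (C (n + 1)) (C n x - (n + 1) / x * C (n + 1) x) x

lemma besselFamily_besselJ : BesselFamily besselJ := by
  have hd (n : ℕ) (x : ℝ) : HasDerivAt (besselJ n)
      (n * (x / 2) ^ (n - 1) * (1 / 2) * besselEntire n (x ^ 2 / 4)
        + (x / 2) ^ n * (-besselEntire (n + 1) (x ^ 2 / 4) * (x / 2))) x := by
    have h1 : HasDerivAt (fun x : ℝ => x ^ 2 / 4) (x / 2) x := by
      refine ((hasDerivAt_pow 2 x).div_const 4).congr_deriv ?_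
      push_cast; ring
    have h2 : HasDerivAt (fun x : ℝ => x / 2) (1 / 2) x := (hasDerivAt_id x).div_const 2
    have h3 := (h2.pow n).mul ((hasDerivAt_besselEntire n (x ^ 2 / 4)).comp x h1)
    refine h3.congr_of_eventuallyEq (Eventually.of_forall fun y => ?_)
    simp [besselJ_eq]
  refine ⟨fun n x hx => ?_, fun n x hx => ?_⟩
  · refine (hd n x).congr_deriv ?_
    rw [besselJ_eq, besselJ_eq]
    rcases n with _ | n
    · simp; ring
    · simp only [Nat.add_sub_cancel, pow_succ]
      field_simp
      ring
  · refine (hd (n + 1) x).congr_deriv ?_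
    rw [besselJ_eq, besselJ_eq, besselEntire_recurrence n]
    simp only [Nat.add_sub_cancel, pow_succ]
    push_cast
    field_simp
    ring

/-- Coefficients of the entire part of the second solution of order `0`: minus the harmonic numbers
times those of `J_0`. -/
def neumannCoeff (m : ℕ) : ℝ := -(harmonic m : ℝ) * besselCoeff 0 m

lemma harmonic_le (m : ℕ) : 0 ≤ (harmonic m : ℝ) ∧ (harmonic m : ℝ) ≤ m := by
  induction m with
  | zero => simp
  | succ m ih =>
    rw [harmonic_succ]
    push_cast
    have : (0 : ℝ) ≤ ((m : ℝ) + 1)⁻¹ := by positivity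
    have h' : ((m : ℝ) + 1)⁻¹ ≤ 1 := inv_le_one_of_one_le₀ (by linarith [Nat.cast_nonneg (α := ℝ) m])
    constructor <;> linarith [ih.1, ih.2]

lemma expBounded_neumannCoeff : ExpBounded neumannCoeff := by
  intro m
  have h2 : (0 : ℝ) < m.factorial := by positivity
  have h3 : (m : ℝ) ≤ m.factorial := mod_cast Nat.self_le_factorial m
  rw [neumannCoeff, abs_mul, abs_neg, abs_of_nonneg (harmonic_le m).1, besselCoeff, abs_div, abs_pow,
    abs_neg, abs_one, one_pow, abs_of_pos (by positivity), add_zero, mul_one_div,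
    div_le_div_iff₀ (by positivity) h2]
  have := (harmonic_le m).2
  nlinarith

/-- The entire part of the second solution of order `0`. -/
def neumannEntire : ℝ → ℝ := powerSum neumannCoeff

/-- The derivative of the entire part of the second solution of order `0`. -/
def neumannEntire' : ℝ → ℝ := powerSum (derivCoeff neumannCoeff)

lemma hasDerivAt_neumannEntire (t : ℝ) : HasDerivAt neumannEntire (neumannEntire' t) t :=
  expBounded_neumannCoeff.hasDerivAt t

/-- The inhomogeneous equation `t h'' + h' + h = -g_0'` of the entire part `h`, with the right-hand
side produced by the logarithm. -/
lemma hasDerivAt_neumannEntire' (t : ℝ) : ∃ d, HasDerivAt neumannEntire' d t ∧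
    t * d + neumannEntire' t + neumannEntire t = besselEntire 1 t := by
  refine ⟨_, expBounded_neumannCoeff.derivCoeff.hasDerivAt t, ?_⟩
  have s0 := expBounded_neumannCoeff.summable t
  have s1 := expBounded_neumannCoeff.derivCoeff.summable t
  have s2 := expBounded_neumannCoeff.derivCoeff.derivCoeff.summable t
  have s3 := (expBounded_besselCoeff 1).summable t
  rw [neumannEntire', neumannEntire, besselEntire, powerSum, powerSum, powerSum, powerSum,
    s1.tsum_eq_zero_add, s0.tsum_eq_zero_add, s3.tsum_eq_zero_add, ← tsum_mul_left]
  have e0 : derivCoeff neumannCoeff 0 * t ^ 0 = besselCoeff 1 0 * t ^ 0 := by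
    simp [derivCoeff, neumannCoeff, besselCoeff, harmonic]
  have e1 : neumannCoeff 0 * t ^ 0 = 0 := by simp [neumannCoeff]
  have e2 : (∑' m, t * (derivCoeff (derivCoeff neumannCoeff) m * t ^ m))
      + (∑' m, derivCoeff neumannCoeff (m + 1) * t ^ (m + 1))
      + (∑' m, neumannCoeff (m + 1) * t ^ (m + 1))
      = ∑' m, besselCoeff 1 (m + 1) * t ^ (m + 1) := by
    rw [← Summable.tsum_add (s2.mul_left t) ((summable_nat_add_iff 1).2 s1),
      ← Summable.tsum_add ((s2.mul_left t).add ((summable_nat_add_iff 1).2 s1))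
        ((summable_nat_add_iff 1).2 s0)]
    refine tsum_congr fun m => ?_
    simp only [derivCoeff, neumannCoeff, besselCoeff, harmonic_succ, Nat.factorial_succ, add_zero]
    push_cast
    have hm : (m : ℝ) + 1 ≠ 0 := by positivity
    have hm2 : (m : ℝ) + 1 + 1 ≠ 0 := by positivity
    field_simp
    ring
  linear_combination e0 + e1 + e2

/-- The Bessel functions of the second kind, up to normalization (`J_n Y_n' - J_n' Y_n = 1 / x`) and
to the addition of a multiple of `J_n`. -/
def besselY : ℕ → ℝ → ℝ
  | 0, x => besselJ 0 x * Real.log x + neumannEntire (x ^ 2 / 4)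
  | 1, x => besselJ 1 x * Real.log x - besselJ 0 x / x - neumannEntire' (x ^ 2 / 4) * (x / 2)
  | n + 2, x => 2 * (n + 1) / x * besselY (n + 1) x - besselY n x

lemma besselFamily_besselY : BesselFamily besselY := by
  have h1 (x : ℝ) : HasDerivAt (fun x : ℝ => x ^ 2 / 4) (x / 2) x := by
    refine ((hasDerivAt_pow 2 x).div_const 4).congr_deriv ?_
    push_cast; ring
  have base0 (x : ℝ) (hx : 0 < x) :
      HasDerivAt (besselY 0) ((0 : ℕ) / x * besselY 0 x - besselY 1 x) x := by
    have := ((besselFamily_besselJ.hasDerivAt_down 0 x hx).mul (Real.hasDerivAt_log hx.ne')).add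
      ((hasDerivAt_neumannEntire (x ^ 2 / 4)).comp x (h1 x))
    refine (this.congr_of_eventuallyEq (Eventually.of_forall fun y => ?_)).congr_deriv ?_
    · simp [besselY]
    · simp [besselY]; ring
  have base1 (x : ℝ) (hx : 0 < x) :
      HasDerivAt (besselY 1) (besselY 0 x - ((0 : ℕ) + 1) / x * besselY 1 x) x := by
    obtain ⟨d, hd, hd'⟩ := hasDerivAt_neumannEntire' (x ^ 2 / 4)
    have h2 : HasDerivAt (fun x : ℝ => x / 2) (1 / 2) x := (hasDerivAt_id x).div_const 2
    have := (((besselFamily_besselJ.hasDerivAt_up 0 x hx).mul (Real.hasDerivAt_log hx.ne')).sub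
      ((besselFamily_besselJ.hasDerivAt_down 0 x hx).div (hasDerivAt_id x) hx.ne')).sub
      ((hd.comp x (h1 x)).mul h2)
    refine (this.congr_of_eventuallyEq (Eventually.of_forall fun y => ?_)).congr_deriv ?_
    · simp [besselY]
    · have hJ : besselJ 1 x = x / 2 * besselEntire 1 (x ^ 2 / 4) := by rw [besselJ_eq]; simp
      simp only [besselY, Function.comp]
      simp only [zero_add, Nat.cast_zero, id, zero_div, zero_mul]
      rw [hJ]
      field_simp
      linear_combination (-4 * x ^ 2) * hd'
  have step (n : ℕ) : (∀ x, 0 < x → HasDerivAt (besselY n) (n / x * besselY n x - besselY (n + 1) x) x) ∧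
      (∀ x, 0 < x →
        HasDerivAt (besselY (n + 1)) (besselY n x - (n + 1) / x * besselY (n + 1) x) x) := by
    induction n with
    | zero => exact ⟨base0, base1⟩
    | succ n ih =>
      have hrec (x : ℝ) : besselY (n + 2) x = 2 * (n + 1) / x * besselY (n + 1) x - besselY n x := by
        rw [besselY]
      refine ⟨fun x hx => (ih.2 x hx).congr_deriv ?_, fun x hx => ?_⟩
      · rw [hrec]; push_cast; field_simp; ring
      · have h3 : HasDerivAt (fun x : ℝ => 2 * ((n : ℝ) + 1) / x) (-(2 * (n + 1)) / x ^ 2) x := by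
          refine ((hasDerivAt_const x (2 * ((n : ℝ) + 1))).div (hasDerivAt_id x) hx.ne').congr_deriv ?_
          simp
        have := (h3.mul (ih.2 x hx)).sub (ih.1 x hx)
        refine (this.congr_of_eventuallyEq (Eventually.of_forall fun y => ?_)).congr_deriv ?_
        · simp [hrec]
        · rw [show n + 1 + 1 = n + 2 from rfl, hrec]; push_cast; field_simp; ring
  exact ⟨fun n => (step n).1, fun n => (step n).2⟩

end

noncomputable section

/-- The Euler derivative `x C_n'(x)` of a member of a Bessel family, written without derivatives. -/
def besselD (C : ℕ → ℝ → ℝ) (n : ℕ) (x : ℝ) : ℝ := n * C n x - x * C (n + 1) x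

namespace BesselFamily

variable {C : ℕ → ℝ → ℝ} (hC : BesselFamily C)
include hC

lemma hasDerivAt (n : ℕ) {x : ℝ} (hx : 0 < x) : HasDerivAt (C n) (besselD C n x / x) x := by
  refine (hC.hasDerivAt_down n x hx).congr_deriv ?_
  rw [besselD]; field_simp

lemma hasDerivAt_besselD (n : ℕ) {x : ℝ} (hx : 0 < x) :
    HasDerivAt (besselD C n) ((n ^ 2 - x ^ 2) / x * C n x) x := by
  refine (((hC.hasDerivAt_down n x hx).const_mul (n : ℝ)).sub
    ((hasDerivAt_id x).mul (hC.hasDerivAt_up n x hx))).congr_deriv ?_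
  simp only [id]
  field_simp
  ring

lemma recurrence (n : ℕ) {x : ℝ} (hx : 0 < x) :
    C (n + 2) x = 2 * (n + 1) / x * C (n + 1) x - C n x := by
  have := (hC.hasDerivAt_down (n + 1) x hx).unique (hC.hasDerivAt_up n x hx)
  push_cast at this
  rw [show n + 1 + 1 = n + 2 from rfl] at this
  linear_combination -this

lemma besselD_add (n : ℕ) {x : ℝ} (hx : 0 < x) :
    besselD C (n + 1) x + (n + 1) * C (n + 1) x = x * C n x := by
  rw [besselD, show n + 1 + 1 = n + 2 from rfl, hC.recurrence n hx]
  push_cast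
  field_simp
  ring

end BesselFamily

lemma continuous_besselJ (n : ℕ) : Continuous (besselJ n) := by
  have : besselJ n = fun x => (x / 2) ^ n * besselEntire n (x ^ 2 / 4) :=
    funext (besselJ_eq n)
  rw [this]
  have h : Continuous (besselEntire n) := ((expBounded_besselCoeff n).contDiff 0).continuous
  fun_prop

lemma continuous_besselD_besselJ (n : ℕ) : Continuous (besselD besselJ n) := by
  have h1 := continuous_besselJ n
  have h2 := continuous_besselJ (n + 1)
  unfold besselD
  fun_prop

lemma besselJ_zero_zero : besselJ 0 0 = 1 := by
  rw [besselJ_eq, besselEntire]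
  simp [powerSum_zero, besselCoeff]

lemma besselJ_succ_zero (n : ℕ) : besselJ (n + 1) 0 = 0 := by
  rw [besselJ_eq]; simp

lemma besselD_besselJ_zero (n : ℕ) : besselD besselJ n 0 = 0 := by
  rcases n with _ | n
  · simp [besselD]
  · simp [besselD, besselJ_succ_zero]

lemma tendsto_nhdsGT_of_continuous {g : ℝ → ℝ} (hg : Continuous g) (a : ℝ) :
    Tendsto g (𝓝[>] a) (𝓝 (g a)) :=
  (hg.tendsto a).mono_left nhdsWithin_le_nhds

lemma continuous_neumannEntire : Continuous neumannEntire :=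
  continuous_iff_continuousAt.2 fun t => (hasDerivAt_neumannEntire t).continuousAt

lemma continuous_neumannEntire' : Continuous neumannEntire' :=
  continuous_iff_continuousAt.2 fun t => (hasDerivAt_neumannEntire' t).choose_spec.1.continuousAt

/-- The Wronskian of `J_n` and `Y_n`. It does not depend on `n` by the recurrence, nor on `x` by the
differential equation; its value is read off as `x → 0` for `n = 0`. -/
lemma wronskian (n : ℕ) {x : ℝ} (hx : 0 < x) :
    besselJ n x * besselD besselY n x - besselD besselJ n x * besselY n x = 1 := by
  induction n with
  | zero =>
    set W : ℝ → ℝ := fun x => besselJ 0 x * besselD besselY 0 x - besselD besselJ 0 x * besselY 0 x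
    have hW (y : ℝ) (hy : 0 < y) : HasDerivAt W 0 y := by
      refine (((besselFamily_besselJ.hasDerivAt 0 hy).mul
        (besselFamily_besselY.hasDerivAt_besselD 0 hy)).sub
        ((besselFamily_besselJ.hasDerivAt_besselD 0 hy).mul
          (besselFamily_besselY.hasDerivAt 0 hy))).congr_deriv ?_
      ring
    have hconst (y : ℝ) (hy : 0 < y) : W y = W x :=
      isOpen_Ioi.is_const_of_deriv_eq_zero (s := Ioi 0) isPreconnected_Ioi
        (fun y hy => (hW y hy).differentiableAt.differentiableWithinAt)
        (fun y hy => (hW y hy).deriv) hy hx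
    have hlim : Tendsto W (𝓝[>] 0) (𝓝 1) := by
      set g : ℝ → ℝ := fun y => y * besselJ 1 y * neumannEntire (y ^ 2 / 4) + besselJ 0 y ^ 2
        + y * besselJ 0 y * (neumannEntire' (y ^ 2 / 4) * (y / 2))
      have hg : Continuous g := by
        have h1 := continuous_besselJ 0
        have h2 := continuous_besselJ 1
        have h3 := continuous_neumannEntire
        have h4 := continuous_neumannEntire'
        fun_prop
      have h0 : g 0 = 1 := by simp [g, besselJ_zero_zero]
      have := tendsto_nhdsGT_of_continuous hg 0
      rw [h0] at this
      refine this.congr' ?_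
      filter_upwards [self_mem_nhdsWithin] with y hy
      have hy' : y ≠ 0 := ne_of_gt hy
      simp only [g, W, besselD, besselY]
      field_simp
      push_cast
      ring
    have : Tendsto W (𝓝[>] 0) (𝓝 (W x)) :=
      tendsto_const_nhds.congr' (by
        filter_upwards [self_mem_nhdsWithin] with y hy using (hconst y hy).symm)
    exact tendsto_nhds_unique this hlim
  | succ n ih =>
    rw [← ih]
    simp only [besselD, show n + 1 + 1 = n + 2 from rfl, besselFamily_besselJ.recurrence n hx,
      besselFamily_besselY.recurrence n hx]
    push_cast
    field_simp
    ring

/-- The leading coefficient of `x ^ n Y_n(x)` as `x → 0`, for `n ≥ 1`. -/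
def leadY : ℕ → ℝ
  | 0 => 0
  | 1 => -1
  | n + 2 => 2 * (n + 1) * leadY (n + 1)

lemma leadY_ne_zero (n : ℕ) : leadY (n + 1) ≠ 0 := by
  induction n with
  | zero => simp [leadY]
  | succ n ih =>
    rw [leadY]
    exact mul_ne_zero (by positivity) ih

lemma tendsto_besselY_zero_div_log :
    Tendsto (fun x => besselY 0 x / Real.log x) (𝓝[>] 0) (𝓝 1) := by
  have h1 := tendsto_nhdsGT_of_continuous (continuous_besselJ 0) 0
  have h2 : Tendsto (fun x : ℝ => neumannEntire (x ^ 2 / 4)) (𝓝[>] 0) (𝓝 (neumannEntire ((0 : ℝ) ^ 2 / 4))) :=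
    tendsto_nhdsGT_of_continuous (g := fun x => neumannEntire (x ^ 2 / 4))
      (continuous_neumannEntire.comp (by fun_prop)) 0
  have h3 : Tendsto (fun x => (Real.log x)⁻¹) (𝓝[>] 0) (𝓝 0) :=
    tendsto_inv_atBot_zero.comp Real.tendsto_log_nhdsGT_zero
  have := h1.add (h2.mul h3)
  rw [besselJ_zero_zero, mul_zero, add_zero] at this
  refine this.congr' ?_
  filter_upwards [Ioo_mem_nhdsGT (zero_lt_one' ℝ)] with x hx
  have : Real.log x ≠ 0 := (Real.log_neg hx.1 hx.2).ne
  rw [besselY]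
  field_simp

lemma tendsto_mul_besselY_zero : Tendsto (fun x => x * besselY 0 x) (𝓝[>] 0) (𝓝 0) := by
  have h1 : Tendsto (fun x => Real.log x * x) (𝓝[>] 0) (𝓝 0) := by
    simpa using tendsto_log_mul_rpow_nhdsGT_zero (zero_lt_one' ℝ)
  have := tendsto_besselY_zero_div_log.mul h1
  rw [mul_zero] at this
  refine this.congr' ?_
  filter_upwards [Ioo_mem_nhdsGT (zero_lt_one' ℝ)] with x hx
  have : Real.log x ≠ 0 := (Real.log_neg hx.1 hx.2).ne
  field_simp

lemma tendsto_pow_mul_besselY (n : ℕ) :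
    Tendsto (fun x => x ^ (n + 1) * besselY (n + 1) x) (𝓝[>] 0) (𝓝 (leadY (n + 1))) := by
  have hid : Tendsto (fun x : ℝ => x) (𝓝[>] 0) (𝓝 0) := tendsto_nhdsGT_of_continuous continuous_id 0
  have base : Tendsto (fun x => x ^ (0 + 1) * besselY (0 + 1) x) (𝓝[>] 0) (𝓝 (leadY (0 + 1))) := by
    have h1 : Tendsto (fun x => x * Real.log x) (𝓝[>] 0) (𝓝 0) := by
      simpa [mul_comm] using tendsto_log_mul_rpow_nhdsGT_zero (zero_lt_one' ℝ)
    have hg : Continuous fun x : ℝ => besselJ 0 x + neumannEntire' (x ^ 2 / 4) * (x / 2) * x := by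
      have h1 := continuous_besselJ 0
      have h4 := continuous_neumannEntire'
      fun_prop
    have := ((tendsto_nhdsGT_of_continuous (continuous_besselJ 1) 0).mul h1).sub
      (tendsto_nhdsGT_of_continuous hg 0)
    rw [mul_zero, besselJ_zero_zero] at this
    have h0 : leadY (0 + 1) = 0 - (1 + neumannEntire' (0 ^ 2 / 4) * (0 / 2) * 0) := by simp [leadY]
    rw [h0]
    refine this.congr' ?_
    filter_upwards [self_mem_nhdsWithin] with x hx
    have : x ≠ 0 := ne_of_gt hx
    rw [zero_add, besselY]
    field_simp
    ring
  have step (n : ℕ) : Tendsto (fun x => x ^ (n + 1) * besselY (n + 1) x) (𝓝[>] 0) (𝓝 (leadY (n + 1))) ∧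
      Tendsto (fun x => x ^ (n + 2) * besselY n x) (𝓝[>] 0) (𝓝 0) := by
    induction n with
    | zero =>
      refine ⟨base, ?_⟩
      have := hid.mul tendsto_mul_besselY_zero
      rw [mul_zero] at this
      exact this.congr fun x => by ring
    | succ n ih =>
      constructor
      · have := (ih.1.const_mul (2 * ((n : ℝ) + 1))).sub ih.2
        rw [sub_zero] at this
        rw [leadY]
        refine this.congr' ?_
        filter_upwards [self_mem_nhdsWithin] with x hx
        have : x ≠ 0 := ne_of_gt hx
        rw [besselFamily_besselY.recurrence n hx]
        field_simp
        ring
      · have := (hid.mul hid).mul ih.1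
        rw [mul_zero, zero_mul] at this
        exact this.congr fun x => by ring
  exact (step n).1

/-! ### The transmission determinant -/

section

variable (ω σ k : ℝ)

/-- The solution in the exterior region that vanishes on the circle of radius `3`. -/
def extB (n : ℕ) (x : ℝ) : ℝ := besselY n x - besselY n (3 * ω) / besselJ n (3 * ω) * besselJ n x

/-- The Euler derivative of `extB`. -/
def extDB (n : ℕ) (x : ℝ) : ℝ :=
  besselD besselY n x - besselY n (3 * ω) / besselJ n (3 * ω) * besselD besselJ n x

/-- The determinant of the transmission conditions at `|x| = R` for the mode `n`, for the regular
solution inside and the solution outside that vanishes at the outer boundary. -/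
def transDet (n : ℕ) (R : ℝ) : ℝ :=
  extB ω n (ω * (2 * (R - 1))) * (σ * besselD besselJ n (k * R))
    - extDB ω n (ω * (2 * (R - 1))) * besselJ n (k * R)

variable {ω σ k}

lemma hasDerivAt_extB (n : ℕ) {x : ℝ} (hx : 0 < x) :
    HasDerivAt (extB ω n) (extDB ω n x / x) x := by
  refine ((besselFamily_besselY.hasDerivAt n hx).sub
    ((besselFamily_besselJ.hasDerivAt n hx).const_mul _)).congr_deriv ?_
  rw [extDB]; ring

lemma hasDerivAt_extDB (n : ℕ) {x : ℝ} (hx : 0 < x) :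
    HasDerivAt (extDB ω n) ((n ^ 2 - x ^ 2) / x * extB ω n x) x := by
  refine ((besselFamily_besselY.hasDerivAt_besselD n hx).sub
    ((besselFamily_besselJ.hasDerivAt_besselD n hx).const_mul _)).congr_deriv ?_
  rw [extB]; ring

lemma extB_end {n : ℕ} (h : besselJ n (3 * ω) ≠ 0) : extB ω n (3 * ω) = 0 := by
  rw [extB]; field_simp; ring

lemma wronskian_ext (n : ℕ) {x : ℝ} (hx : 0 < x) :
    besselJ n x * extDB ω n x - besselD besselJ n x * extB ω n x = 1 := by
  rw [← wronskian n hx, extB, extDB]; ring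

/-- Below the turning point `x = n`, the product `J_n · x J_n'` is positive: it vanishes at `0` and
is increasing. -/
lemma besselJ_mul_besselD_pos {n : ℕ} {x : ℝ} (hx : 0 < x) (hxn : x ≤ n) :
    0 < besselJ n x * besselD besselJ n x := by
  set g : ℝ → ℝ := fun y => besselJ n y * besselD besselJ n y
  have hg : Continuous g := (continuous_besselJ n).mul (continuous_besselD_besselJ n)
  have hd (y : ℝ) (hy : 0 < y) : HasDerivAt g
      ((besselD besselJ n y ^ 2 + (n ^ 2 - y ^ 2) * besselJ n y ^ 2) / y) y := by
    refine ((besselFamily_besselJ.hasDerivAt n hy).mul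
      (besselFamily_besselJ.hasDerivAt_besselD n hy)).congr_deriv ?_
    field_simp
  have hmono : MonotoneOn g (Icc 0 x) := by
    refine monotoneOn_of_deriv_nonneg (convex_Icc 0 x) hg.continuousOn
      (fun y hy => ?_) (fun y hy => ?_)
    · rw [interior_Icc] at hy
      exact (hd y hy.1).differentiableAt.differentiableWithinAt
    · rw [interior_Icc] at hy
      rw [(hd y hy.1).deriv]
      have : 0 ≤ (n : ℝ) ^ 2 - y ^ 2 := by nlinarith [hy.1, hy.2]
      have := hy.1
      positivity
  have h0 : g 0 = 0 := by simp [g, besselD_besselJ_zero]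
  have hle : 0 ≤ g x := h0 ▸ hmono ⟨le_rfl, hx.le⟩ ⟨hx.le, le_rfl⟩ hx.le
  refine lt_of_le_of_ne hle fun hgx => ?_
  have hconst (y : ℝ) (hy : y ∈ Icc 0 x) : g y = 0 :=
    le_antisymm (by rw [show (0 : ℝ) = g x from hgx]; exact hmono hy ⟨hx.le, le_rfl⟩ hy.2)
      (by rw [← h0]; exact hmono ⟨le_rfl, hx.le⟩ hy hy.1)
  have hx2 : 0 < x / 2 := by positivity
  have hz : HasDerivAt g 0 (x / 2) := by
    refine (hasDerivAt_const (x / 2) (0 : ℝ)).congr_of_eventuallyEq ?_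
    filter_upwards [Ioo_mem_nhds hx2 (by linarith : x / 2 < x)] with y hy
    exact hconst y ⟨hy.1.le, hy.2.le⟩
  have := (hd (x / 2) hx2).unique hz
  have hpos : 0 < (n : ℝ) ^ 2 - (x / 2) ^ 2 := by nlinarith
  rw [div_eq_zero_iff, or_iff_left hx2.ne'] at this
  have h1 : besselJ n (x / 2) = 0 := by
    by_contra h
    have : 0 < (n ^ 2 - (x / 2) ^ 2) * besselJ n (x / 2) ^ 2 := by positivity
    nlinarith [sq_nonneg (besselD besselJ n (x / 2))]
  have h2 : besselD besselJ n (x / 2) = 0 := by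
    rw [h1] at this; simpa using this
  have := wronskian n hx2
  rw [h1, h2] at this
  simp at this

/-- Below the turning point, the product of `extB` with its Euler derivative increases, and it vanishes
at the outer end `3ω`. -/
lemma extB_mul_extDB_nonpos {n : ℕ} (hJ : besselJ n (3 * ω) ≠ 0) {x : ℝ} (hx : 0 < x)
    (hx3 : x ≤ 3 * ω) (hn : 3 * ω ≤ n) : extB ω n x * extDB ω n x ≤ 0 := by
  set g : ℝ → ℝ := fun y => extB ω n y * extDB ω n y
  have hd (y : ℝ) (hy : 0 < y) : HasDerivAt g
      ((extDB ω n y ^ 2 + (n ^ 2 - y ^ 2) * extB ω n y ^ 2) / y) y := by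
    refine ((hasDerivAt_extB n hy).mul (hasDerivAt_extDB n hy)).congr_deriv ?_
    field_simp
  have hmono : MonotoneOn g (Icc x (3 * ω)) := by
    refine monotoneOn_of_deriv_nonneg (convex_Icc _ _)
      (fun y hy => (hd y (hx.trans_le hy.1)).continuousAt.continuousWithinAt)
      (fun y hy => ?_) (fun y hy => ?_)
    · rw [interior_Icc] at hy
      exact (hd y (hx.trans hy.1)).differentiableAt.differentiableWithinAt
    · rw [interior_Icc] at hy
      have hy0 := hx.trans hy.1
      rw [(hd y hy0).deriv]
      have : 0 ≤ (n : ℝ) ^ 2 - y ^ 2 := by nlinarith [hy.1, hy.2]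
      positivity
  have := hmono ⟨le_rfl, hx3⟩ ⟨hx3, le_rfl⟩ hx3
  simpa [g, extB_end hJ] using this

/-- For high orders the two products in the determinant have opposite signs, inside by
`besselJ_mul_besselD_pos` and outside by `extB_mul_extDB_nonpos`, so that nothing can cancel. -/
lemma transDet_ne_zero_of_large {n : ℕ} (hω : 0 < ω) (hσ : 0 < σ) (hk : 0 < k)
    (hJ : besselJ n (3 * ω) ≠ 0) (hn : 3 * ω ≤ n) (hn' : 2 * k ≤ n) {R : ℝ} (hR : 1 < R)
    (hR2 : R ≤ 2) : transDet ω σ k n R ≠ 0 := by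
  intro h
  set x := ω * (2 * (R - 1)) with hxdef
  have hx : 0 < x := mul_pos hω (by linarith)
  have hx3 : x ≤ 3 * ω := by rw [hxdef]; nlinarith
  have h1 := besselJ_mul_besselD_pos (n := n) (x := k * R) (by positivity) (by nlinarith)
  have h2 := extB_mul_extDB_nonpos hJ hx hx3 hn
  have hW := wronskian_ext (ω := ω) n hx
  rw [transDet, sub_eq_zero, ← hxdef] at h
  have hB : extB ω n x = 0 := by
    by_contra hB
    have h3 : 0 < extB ω n x ^ 2 * (σ * (besselJ n (k * R) * besselD besselJ n (k * R))) := by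
      positivity
    have h4 : extB ω n x * extDB ω n x * besselJ n (k * R) ^ 2 ≤ 0 :=
      mul_nonpos_of_nonpos_of_nonneg h2 (sq_nonneg _)
    have h5 : extB ω n x ^ 2 * (σ * (besselJ n (k * R) * besselD besselJ n (k * R)))
        = extB ω n x * extDB ω n x * besselJ n (k * R) ^ 2 := by
      linear_combination extB ω n x * besselJ n (k * R) * h
    linarith
  rw [hB, zero_mul, eq_comm, mul_eq_zero] at h
  rcases h with h | h
  · rw [hB, h] at hW; simp at hW
  · rw [h] at h1; simp at h1

end

end

noncomputable section

section

variable {ω σ k : ℝ}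

lemma tendsto_besselD_besselY_zero : Tendsto (besselD besselY 0) (𝓝[>] 0) (𝓝 1) := by
  have := (tendsto_pow_mul_besselY 0).neg
  simp only [zero_add, leadY, neg_neg] at this
  refine this.congr fun x => ?_
  simp [besselD]

lemma tendsto_extDB_zero : Tendsto (extDB ω 0) (𝓝[>] 0) (𝓝 1) := by
  have := tendsto_besselD_besselY_zero.sub
    ((tendsto_nhdsGT_of_continuous (continuous_besselD_besselJ 0) 0).const_mul
      (besselY 0 (3 * ω) / besselJ 0 (3 * ω)))
  rw [besselD_besselJ_zero, mul_zero, sub_zero] at this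
  exact this

lemma tendsto_inv_log : Tendsto (fun x => (Real.log x)⁻¹) (𝓝[>] 0) (𝓝 0) :=
  tendsto_inv_atBot_zero.comp Real.tendsto_log_nhdsGT_zero

lemma tendsto_extB_zero_div_log :
    Tendsto (fun x => extB ω 0 x / Real.log x) (𝓝[>] 0) (𝓝 1) := by
  have := tendsto_besselY_zero_div_log.sub
    (((tendsto_nhdsGT_of_continuous (continuous_besselJ 0) 0).const_mul
      (besselY 0 (3 * ω) / besselJ 0 (3 * ω))).mul tendsto_inv_log)
  rw [mul_zero, sub_zero] at this
  refine this.congr fun x => ?_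
  rw [extB]; ring

lemma tendsto_pow_mul_extB (n : ℕ) :
    Tendsto (fun x => x ^ (n + 1) * extB ω (n + 1) x) (𝓝[>] 0) (𝓝 (leadY (n + 1))) := by
  have h : Continuous fun x : ℝ => x ^ (n + 1) *
      (besselY (n + 1) (3 * ω) / besselJ (n + 1) (3 * ω) * besselJ (n + 1) x) := by
    have := continuous_besselJ (n + 1)
    fun_prop
  have := (tendsto_pow_mul_besselY n).sub (tendsto_nhdsGT_of_continuous h 0)
  rw [besselJ_succ_zero, mul_zero, mul_zero, sub_zero] at this
  refine this.congr fun x => ?_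
  rw [extB]; ring

/-- The combination entering the boundary expression: the leading singular term of `extB` is
annihilated, since `x Y_n' + n Y_n = x Y_{n-1}`. -/
lemma extDB_add (n : ℕ) {x : ℝ} (hx : 0 < x) :
    extDB ω (n + 1) x + (n + 1) * extB ω (n + 1) x
      = x * (besselY n x - besselY (n + 1) (3 * ω) / besselJ (n + 1) (3 * ω) * besselJ n x) := by
  have h1 := besselFamily_besselJ.besselD_add n hx
  have h2 := besselFamily_besselY.besselD_add n hx
  rw [extDB, extB]
  linear_combination h2 - besselY (n + 1) (3 * ω) / besselJ (n + 1) (3 * ω) * h1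

lemma isBigO_pow_mul_extDB_add (n : ℕ) :
    (fun x => x ^ (n + 2) * (extDB ω (n + 2) x + (n + 2) * extB ω (n + 2) x))
      =O[𝓝[>] 0] fun x => x ^ 2 := by
  set τ := besselY (n + 2) (3 * ω) / besselJ (n + 2) (3 * ω)
  have h : Continuous fun x : ℝ => x ^ (n + 1) * (τ * besselJ (n + 1) x) := by
    have := continuous_besselJ (n + 1)
    fun_prop
  have h1 := ((tendsto_pow_mul_besselY n).sub (tendsto_nhdsGT_of_continuous h 0)).isBigO_one ℝ
  have h2 := (isBigO_refl (fun x : ℝ => x ^ 2) (𝓝[>] 0)).mul h1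
  refine (h2.congr' ?_ (by simp))
  filter_upwards [self_mem_nhdsWithin] with x hx
  have := extDB_add (ω := ω) (n + 1) hx
  push_cast at this
  rw [show (n : ℝ) + 2 = n + 1 + 1 by ring, this]
  ring

lemma isBigO_mul_extDB_one_add :
    (fun x => x * (extDB ω 1 x + extB ω 1 x)) =O[𝓝[>] 0] fun x => x ^ 2 * Real.log x := by
  set τ := besselY 1 (3 * ω) / besselJ 1 (3 * ω)
  have := tendsto_besselY_zero_div_log.sub
    (((tendsto_nhdsGT_of_continuous (continuous_besselJ 0) 0).const_mul τ).mul tendsto_inv_log)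
  have h2 := (isBigO_refl (fun x : ℝ => x ^ 2 * Real.log x) (𝓝[>] 0)).mul (this.isBigO_one ℝ)
  refine (h2.congr' ?_ (by simp))
  filter_upwards [Ioo_mem_nhdsGT (zero_lt_one' ℝ)] with x hx
  have hl : Real.log x ≠ 0 := (Real.log_neg hx.1 hx.2).ne
  have := extDB_add (ω := ω) 0 hx.1
  simp only [zero_add, Nat.cast_zero, one_mul] at this
  rw [this]
  simp only [τ]
  field_simp

lemma tendsto_rho (hω : 0 < ω) : Tendsto (fun R : ℝ => ω * (2 * (R - 1))) (𝓝[>] 1) (𝓝[>] 0) := by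
  refine tendsto_nhdsWithin_iff.2 ⟨?_, ?_⟩
  · have : Continuous fun R : ℝ => ω * (2 * (R - 1)) := by fun_prop
    simpa using tendsto_nhdsGT_of_continuous this 1
  · filter_upwards [self_mem_nhdsWithin] with R hR
    exact mul_pos hω (by linarith [Set.mem_Ioi.1 hR])

lemma tendsto_inner (n : ℕ) :
    Tendsto (fun R : ℝ => besselJ n (k * R)) (𝓝[>] 1) (𝓝 (besselJ n k)) ∧
    Tendsto (fun R : ℝ => besselD besselJ n (k * R)) (𝓝[>] 1) (𝓝 (besselD besselJ n k)) := by
  have h1 : Continuous fun R : ℝ => besselJ n (k * R) :=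
    (continuous_besselJ n).comp (by fun_prop)
  have h2 : Continuous fun R : ℝ => besselD besselJ n (k * R) :=
    (continuous_besselD_besselJ n).comp (by fun_prop)
  exact ⟨by simpa using tendsto_nhdsGT_of_continuous h1 1,
    by simpa using tendsto_nhdsGT_of_continuous h2 1⟩

/-- In order `0` the determinant diverges like `log ρ`, with the non-resonance expression as factor. -/
lemma tendsto_transDet_zero (hω : 0 < ω) :
    Tendsto (fun R => transDet ω σ k 0 R / Real.log (ω * (2 * (R - 1)))) (𝓝[>] 1)
      (𝓝 (σ * besselD besselJ 0 k)) := by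
  obtain ⟨h1, h2⟩ := tendsto_inner (k := k) 0
  have h3 := (tendsto_extB_zero_div_log (ω := ω)).comp (tendsto_rho hω)
  have h4 := ((tendsto_extDB_zero (ω := ω)).comp (tendsto_rho hω)).mul
    (tendsto_inv_log.comp (tendsto_rho hω))
  have := (h3.mul (h2.const_mul σ)).sub (h4.mul h1)
  rw [mul_zero, zero_mul, sub_zero, one_mul] at this
  refine this.congr fun R => ?_
  simp only [transDet, Function.comp]
  ring

/-- In order `n ≥ 1` the determinant diverges like `ρ⁻ⁿ`, with the non-resonance expression
as factor. -/
lemma tendsto_transDet_succ (hω : 0 < ω) (n : ℕ) :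
    Tendsto (fun R => (ω * (2 * (R - 1))) ^ (n + 1) * transDet ω σ k (n + 1) R) (𝓝[>] 1)
      (𝓝 (leadY (n + 1) *
        (σ * besselD besselJ (n + 1) k + (n + 1) * besselJ (n + 1) k))) := by
  obtain ⟨h1, h2⟩ := tendsto_inner (k := k) (n + 1)
  have h3 := (tendsto_pow_mul_extB (ω := ω) n).comp (tendsto_rho hω)
  have h5 : Tendsto (fun x => x ^ (n + 1) * (extDB ω (n + 1) x + (n + 1) * extB ω (n + 1) x))
      (𝓝[>] 0) (𝓝 0) := by
    rcases n with _ | n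
    · simp only [zero_add, pow_one, Nat.cast_zero, one_mul]
      refine (isBigO_mul_extDB_one_add (ω := ω)).trans_tendsto ?_
      have hl : Tendsto (fun x => x * (Real.log x * x)) (𝓝[>] 0) (𝓝 (0 * 0)) :=
        (tendsto_nhdsGT_of_continuous continuous_id 0).mul
          (by simpa using tendsto_log_mul_rpow_nhdsGT_zero (zero_lt_one' ℝ))
      rw [zero_mul] at hl
      exact hl.congr fun x => by ring
    · refine ((isBigO_pow_mul_extDB_add (ω := ω) n).congr_left fun x => ?_).trans_tendsto ?_
      · push_cast; ring
      · have : Continuous fun x : ℝ => x ^ 2 := by fun_prop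
        simpa using tendsto_nhdsGT_of_continuous this 0
  have h6 := h5.comp (tendsto_rho hω)
  have := (h3.mul ((h2.const_mul σ).add (h1.const_mul ((n : ℝ) + 1)))).sub (h6.mul h1)
  rw [zero_mul, sub_zero] at this
  refine this.congr fun R => ?_
  simp only [transDet, Function.comp]
  ring

/-- The transmission problems of all modes are uniquely solvable if `R > 1` is close enough to `1`:
modes of high order by the sign of the determinant, the finitely many others by non-resonance. -/
lemma exists_forall_transDet_ne_zero (hω : 0 < ω) (hσ : 0 < σ) (hk : 0 < k)
    (hJ : ∀ n, besselJ n (3 * ω) ≠ 0)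
    (hres : ∀ n : ℕ, σ * besselD besselJ n k + n * besselJ n k ≠ 0) :
    ∃ R₀ : ℝ, 1 < R₀ ∧ R₀ ≤ 2 ∧ ∀ R ∈ Ioo 1 R₀, ∀ n, transDet ω σ k n R ≠ 0 := by
  have hev (n : ℕ) : ∀ᶠ R in 𝓝[>] (1 : ℝ), transDet ω σ k n R ≠ 0 := by
    rcases n with _ | n
    · have h := (tendsto_transDet_zero (σ := σ) (k := k) hω).eventually_ne
        (b₂ := 0) (by simpa using hres 0)
      filter_upwards [h] with R hR h0
      simp [h0] at hR
    · have h := (tendsto_transDet_succ (σ := σ) (k := k) hω n).eventually_ne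
        (mul_ne_zero (leadY_ne_zero n) (by simpa using hres (n + 1)))
      filter_upwards [h] with R hR h0
      simp [h0] at hR
  obtain ⟨n₀, hn₀⟩ := exists_nat_ge (max (3 * ω) (2 * k))
  have hall : ∀ᶠ R in 𝓝[>] (1 : ℝ), ∀ n ∈ Finset.range n₀, transDet ω σ k n R ≠ 0 :=
    (Filter.eventually_all_finset _).2 fun n _ => hev n
  obtain ⟨R₁, hR₁, h⟩ := (mem_nhdsGT_iff_exists_Ioo_subset).1 hall
  refine ⟨min R₁ 2, lt_min hR₁ (by norm_num), min_le_right _ _, fun R hR n => ?_⟩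
  have hR1 := lt_of_lt_of_le hR.2 (min_le_left _ _)
  have hR2 := lt_of_lt_of_le hR.2 (min_le_right _ _)
  by_cases hn : n < n₀
  · exact h ⟨hR.1, hR1⟩ n (Finset.mem_range.2 hn)
  · have hn' : (n₀ : ℝ) ≤ n := mod_cast not_lt.1 hn
    exact transDet_ne_zero_of_large hω hσ hk (hJ n)
      ((le_max_left _ _).trans (hn₀.trans hn')) ((le_max_right _ _).trans (hn₀.trans hn'))
      hR.1 hR2.le

/-! ### Rates of the boundary expression -/

variable (ω σ k) in
/-- The boundary expression of the mode `n`, in terms of the boundary value `F` on the outer circle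
and the coefficient `β` of the singular inner solution. -/
def modeBdry (n : ℕ) (F β : ℂ) (R : ℝ) : ℂ :=
  F * ((besselD besselJ n (ω * (2 * (R - 1))) + n * besselJ n (ω * (2 * (R - 1)))) /
      besselJ n (3 * ω) : ℝ)
    - (σ * β + F * ((σ * besselD besselJ n (k * R) * besselJ n (ω * (2 * (R - 1)))
        - besselJ n (k * R) * besselD besselJ n (ω * (2 * (R - 1)))) / besselJ n (3 * ω) : ℝ))
      * ((extDB ω n (ω * (2 * (R - 1))) + n * extB ω n (ω * (2 * (R - 1)))) /
          transDet ω σ k n R : ℝ)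

lemma isBigO_inv_of_tendsto {l : Filter ℝ} {g : ℝ → ℝ} {c : ℝ} (h : Tendsto g l (𝓝 c))
    (hc : c ≠ 0) : (fun x => (g x)⁻¹) =O[l] fun _ => (1 : ℝ) :=
  (h.inv₀ hc).isBigO_one ℝ

lemma isBigO_quot_zero (hω : 0 < ω) (hres : σ * besselD besselJ 0 k ≠ 0) :
    (fun R : ℝ => (extDB ω 0 (ω * (2 * (R - 1)))) / transDet ω σ k 0 R)
      =O[𝓝[>] 1] fun R => 1 / Real.log (ω * (2 * (R - 1))) := by
  have h1 := ((tendsto_extDB_zero (ω := ω)).comp (tendsto_rho hω)).isBigO_one ℝ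
  have h2 := isBigO_inv_of_tendsto (tendsto_transDet_zero (σ := σ) (k := k) hω) hres
  have h3 := (h1.mul h2).mul (isBigO_refl (fun R => 1 / Real.log (ω * (2 * (R - 1)))) (𝓝[>] 1))
  refine h3.congr' ?_ (by simp)
  have hsm := (tendsto_rho hω).eventually (Ioo_mem_nhdsGT (zero_lt_one' ℝ))
  filter_upwards [hsm] with R hR
  have hl : Real.log (ω * (2 * (R - 1))) ≠ 0 := (Real.log_neg hR.1 hR.2).ne
  simp only [Function.comp]
  generalize Real.log (ω * (2 * (R - 1))) = L at hl
  field_simp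

lemma isBigO_quot_succ (hω : 0 < ω) {n : ℕ}
    (hres : σ * besselD besselJ (n + 1) k + (n + 1) * besselJ (n + 1) k ≠ 0) {h : ℝ → ℝ}
    (hO : (fun x => x ^ (n + 1) * (extDB ω (n + 1) x + (n + 1) * extB ω (n + 1) x)) =O[𝓝[>] 0] h) :
    (fun R : ℝ => (extDB ω (n + 1) (ω * (2 * (R - 1)))
        + (n + 1) * extB ω (n + 1) (ω * (2 * (R - 1)))) / transDet ω σ k (n + 1) R)
      =O[𝓝[>] 1] fun R => h (ω * (2 * (R - 1))) := by
  have h1 := hO.comp_tendsto (tendsto_rho hω)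
  have h2 := isBigO_inv_of_tendsto (tendsto_transDet_succ (σ := σ) (k := k) hω n)
    (mul_ne_zero (leadY_ne_zero n) hres)
  refine (h1.mul h2).congr' ?_ (by simp)
  filter_upwards [(tendsto_rho hω).eventually self_mem_nhdsWithin] with R hR
  have hx : ω * (2 * (R - 1)) ≠ 0 := ne_of_gt hR
  simp only [Function.comp]
  rw [mul_inv, ← mul_assoc, mul_comm ((ω * (2 * (R - 1))) ^ (n + 1)), mul_assoc (_ + _),
    mul_inv_cancel₀ (pow_ne_zero _ hx), mul_one, div_eq_mul_inv]

lemma isBigO_besselD_add_succ (hω : 0 < ω) (n : ℕ) :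
    (fun R : ℝ => besselD besselJ (n + 1) (ω * (2 * (R - 1)))
        + (n + 1) * besselJ (n + 1) (ω * (2 * (R - 1))))
      =O[𝓝[>] 1] fun R => (2 * (R - 1)) * besselJ n (ω * (2 * (R - 1))) := by
  have h := (isBigO_refl (fun R : ℝ => (2 * (R - 1)) * besselJ n (ω * (2 * (R - 1))))
    (𝓝[>] 1)).const_mul_left ω
  refine h.congr' ?_ EventuallyEq.rfl
  filter_upwards [(tendsto_rho hω).eventually self_mem_nhdsWithin] with R hR
  rw [besselFamily_besselJ.besselD_add n hR]
  ring

lemma isBigO_besselJ_succ (n : ℕ) : besselJ (n + 1) =O[𝓝[>] 0] fun x => x := by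
  have h : besselJ (n + 1) = fun x => x * (1 / 2 * (x / 2) ^ n * besselEntire (n + 1) (x ^ 2 / 4)) := by
    funext x; rw [besselJ_eq]; ring
  have hc : Continuous fun x : ℝ => 1 / 2 * (x / 2) ^ n * besselEntire (n + 1) (x ^ 2 / 4) := by
    have h : Continuous (besselEntire (n + 1)) :=
      ((expBounded_besselCoeff (n + 1)).contDiff 0).continuous
    fun_prop
  have := (isBigO_refl (fun x : ℝ => x) (𝓝[>] 0)).mul
    ((tendsto_nhdsGT_of_continuous hc 0).isBigO_one ℝ)
  rw [h]
  simpa using this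

lemma isBigO_comp_rho (hω : 0 < ω) {g : ℝ → ℝ} (hg : g =O[𝓝[>] 0] fun x => x) :
    (fun R : ℝ => g (ω * (2 * (R - 1)))) =O[𝓝[>] 1] fun R => 2 * (R - 1) :=
  (hg.comp_tendsto (tendsto_rho hω)).trans
    ((isBigO_refl (fun R : ℝ => 2 * (R - 1)) _).const_mul_left ω)

lemma tendsto_two_mul_sub : Tendsto (fun R : ℝ => 2 * (R - 1)) (𝓝[>] 1) (𝓝[>] 0) := by
  simpa using tendsto_rho (ω := 1) one_pos

lemma tendsto_log_div_log (hω : 0 < ω) :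
    Tendsto (fun R : ℝ => Real.log (ω * (2 * (R - 1))) / Real.log (2 * (R - 1))) (𝓝[>] 1) (𝓝 1) := by
  have h1 := ((tendsto_inv_log.comp tendsto_two_mul_sub).const_mul (Real.log ω)).add_const 1
  rw [mul_zero, zero_add] at h1
  refine h1.congr' ?_
  filter_upwards [tendsto_two_mul_sub.eventually (Ioo_mem_nhdsGT (zero_lt_one' ℝ))]
    with R hR
  have hl : Real.log (2 * (R - 1)) ≠ 0 := (Real.log_neg hR.1 hR.2).ne
  rw [Real.log_mul hω.ne' hR.1.ne']
  simp only [Function.comp]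
  field_simp

lemma isBigO_log (hω : 0 < ω) : (fun R : ℝ => Real.log (ω * (2 * (R - 1))))
    =O[𝓝[>] 1] fun R => Real.log (2 * (R - 1)) := by
  have := ((tendsto_log_div_log hω).isBigO_one ℝ).mul
    (isBigO_refl (fun R : ℝ => Real.log (2 * (R - 1))) (𝓝[>] 1))
  refine this.congr' ?_ (by simp)
  filter_upwards [tendsto_two_mul_sub.eventually (Ioo_mem_nhdsGT (zero_lt_one' ℝ))]
    with R hR
  have hl : Real.log (2 * (R - 1)) ≠ 0 := (Real.log_neg hR.1 hR.2).ne
  field_simp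

lemma isBigO_inv_log (hω : 0 < ω) : (fun R : ℝ => 1 / Real.log (ω * (2 * (R - 1))))
    =O[𝓝[>] 1] fun R => 1 / Real.log (2 * (R - 1)) := by
  have := (isBigO_inv_of_tendsto (tendsto_log_div_log hω) one_ne_zero).mul
    (isBigO_refl (fun R : ℝ => 1 / Real.log (2 * (R - 1))) (𝓝[>] 1))
  refine this.congr' ?_ (by simp)
  filter_upwards [tendsto_two_mul_sub.eventually (Ioo_mem_nhdsGT (zero_lt_one' ℝ))]
    with R hR
  have hl : Real.log (2 * (R - 1)) ≠ 0 := (Real.log_neg hR.1 hR.2).ne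
  field_simp

lemma isBigO_ofReal {l : Filter ℝ} {g h : ℝ → ℝ} (hg : g =O[l] h) :
    (fun x => (g x : ℂ)) =O[l] h :=
  (isBigO_of_le l fun x => by simp).trans hg

/-- The factor of the singular exterior solution stays bounded as `R → 1`. -/
lemma isBigO_outer_coeff (n : ℕ) (F β : ℂ) :
    (fun R : ℝ => (σ * β + F * ((σ * besselD besselJ n (k * R) * besselJ n (ω * (2 * (R - 1)))
        - besselJ n (k * R) * besselD besselJ n (ω * (2 * (R - 1)))) / besselJ n (3 * ω) : ℝ)))
      =O[𝓝[>] 1] fun _ => (1 : ℝ) := by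
  have hc : Continuous fun R : ℝ => (σ * β + F * ((σ * besselD besselJ n (k * R)
      * besselJ n (ω * (2 * (R - 1))) - besselJ n (k * R) * besselD besselJ n (ω * (2 * (R - 1))))
        / besselJ n (3 * ω) : ℝ)) := by
    have h1 := continuous_besselJ n
    have h2 := continuous_besselD_besselJ n
    fun_prop
  exact ((hc.tendsto 1).mono_left nhdsWithin_le_nhds).isBigO_one ℝ

/-- The boundary expression is controlled by its regular part, if the boundary value is nonzero, and by
the quotient of the singular exterior solution and the determinant. -/
lemma modeBdry_isBigO (n : ℕ) (F β : ℂ) {h : ℝ → ℝ}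
    (h1 : F = 0 ∨ (fun R : ℝ => besselD besselJ n (ω * (2 * (R - 1)))
        + n * besselJ n (ω * (2 * (R - 1)))) =O[𝓝[>] 1] h)
    (h2 : (fun R : ℝ => (extDB ω n (ω * (2 * (R - 1))) + n * extB ω n (ω * (2 * (R - 1))))
        / transDet ω σ k n R) =O[𝓝[>] 1] h) :
    modeBdry ω σ k n F β =O[𝓝[>] 1] h := by
  have e1 : (fun R : ℝ => F * ((besselD besselJ n (ω * (2 * (R - 1)))
      + n * besselJ n (ω * (2 * (R - 1)))) / besselJ n (3 * ω) : ℝ)) =O[𝓝[>] 1] h := by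
    rcases h1 with rfl | h1
    · simpa using isBigO_zero h _
    · refine IsBigO.const_mul_left (isBigO_ofReal ?_) _
      simpa [div_eq_mul_inv, mul_comm] using h1.const_mul_left (besselJ n (3 * ω))⁻¹
  have e2 := (isBigO_outer_coeff (ω := ω) (σ := σ) (k := k) n F β).mul (isBigO_ofReal h2)
  simp only [one_mul] at e2
  exact e1.sub e2

lemma modeBdry_isBigO_zero (hω : 0 < ω) (hres : σ * besselD besselJ 0 k ≠ 0) (F β : ℂ) :
    modeBdry ω σ k 0 F β =O[𝓝[>] 1] fun R => 1 / Real.log (2 * (R - 1)) := by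
  refine modeBdry_isBigO 0 F β (Or.inr ?_) ?_
  · have h0 : (fun R : ℝ => besselD besselJ 0 (ω * (2 * (R - 1))))
        =O[𝓝[>] 1] fun R => 2 * (R - 1) := by
      have hb : (fun x : ℝ => besselJ 1 x) =O[𝓝[>] 0] fun _ => (1 : ℝ) :=
        (tendsto_nhdsGT_of_continuous (continuous_besselJ 1) 0).isBigO_one ℝ
      refine isBigO_comp_rho hω (g := besselD besselJ 0) ?_
      have := ((isBigO_refl (fun x : ℝ => x) (𝓝[>] 0)).mul hb).neg_left
      refine this.congr (fun x => ?_) fun x => by simp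
      simp [besselD]
    have h2 : (fun R : ℝ => 2 * (R - 1)) =O[𝓝[>] 1] fun R => 1 / Real.log (2 * (R - 1)) := by
      have ht : Tendsto (fun R : ℝ => Real.log (2 * (R - 1)) * (2 * (R - 1))) (𝓝[>] 1) (𝓝 0) := by
        have := (tendsto_log_mul_rpow_nhdsGT_zero (zero_lt_one' ℝ)).comp
          tendsto_two_mul_sub
        simpa [Function.comp_def] using this
      have := (ht.isBigO_one ℝ).mul (isBigO_refl (fun R : ℝ => 1 / Real.log (2 * (R - 1))) (𝓝[>] 1))
      refine this.congr' ?_ (by simp)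
      filter_upwards [tendsto_two_mul_sub.eventually
        (Ioo_mem_nhdsGT (zero_lt_one' ℝ))] with R hR
      have hl : Real.log (2 * (R - 1)) ≠ 0 := (Real.log_neg hR.1 hR.2).ne
      field_simp
    simpa using h0.trans h2
  · simpa using (isBigO_quot_zero hω hres).trans (isBigO_inv_log hω)

lemma isBigO_quot_one (hω : 0 < ω) (hres : σ * besselD besselJ 1 k + besselJ 1 k ≠ 0) :
    (fun R : ℝ => (extDB ω 1 (ω * (2 * (R - 1))) + (1 : ℕ) * extB ω 1 (ω * (2 * (R - 1))))
        / transDet ω σ k 1 R) =O[𝓝[>] 1] fun R => (2 * (R - 1)) ^ 2 * Real.log (2 * (R - 1)) := by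
  have h := isBigO_quot_succ (ω := ω) (σ := σ) (k := k) (n := 0) (h := fun x => x ^ 2 * Real.log x)
    hω (by simpa using hres) (by simpa using isBigO_mul_extDB_one_add (ω := ω))
  simp only [zero_add, Nat.cast_zero, Nat.cast_one, one_mul] at h ⊢
  refine h.trans ?_
  have h2 := (((isBigO_refl (fun R : ℝ => 2 * (R - 1)) (𝓝[>] 1)).const_mul_left ω).pow 2).mul
    (isBigO_log hω)
  exact h2

lemma modeBdry_isBigO_one (hω : 0 < ω) (hres : σ * besselD besselJ 1 k + besselJ 1 k ≠ 0)
    (F β : ℂ) : modeBdry ω σ k 1 F β =O[𝓝[>] 1] fun R => 2 * (R - 1) := by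
  refine modeBdry_isBigO 1 F β (Or.inr ?_) ((isBigO_quot_one hω hres).trans ?_)
  · have h := isBigO_besselD_add_succ hω 0
    simp only [zero_add, Nat.cast_zero, Nat.cast_one, one_mul] at h ⊢
    have hb : (fun R : ℝ => besselJ 0 (ω * (2 * (R - 1)))) =O[𝓝[>] 1] fun _ => (1 : ℝ) :=
      ((tendsto_nhdsGT_of_continuous (continuous_besselJ 0) 0).comp (tendsto_rho hω)).isBigO_one ℝ
    simpa using h.trans ((isBigO_refl (fun R : ℝ => 2 * (R - 1)) _).mul hb)
  · have ht : Tendsto (fun R : ℝ => Real.log (2 * (R - 1)) * (2 * (R - 1))) (𝓝[>] 1) (𝓝 0) := by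
      have := (tendsto_log_mul_rpow_nhdsGT_zero (zero_lt_one' ℝ)).comp
        tendsto_two_mul_sub
      simpa [Function.comp_def] using this
    have := (ht.isBigO_one ℝ).mul (isBigO_refl (fun R : ℝ => 2 * (R - 1)) (𝓝[>] 1))
    refine this.congr (fun R => by ring) fun R => by simp

lemma modeBdry_isBigO_one' (hω : 0 < ω) (hres : σ * besselD besselJ 1 k + besselJ 1 k ≠ 0)
    (β : ℂ) :
    modeBdry ω σ k 1 0 β =O[𝓝[>] 1] fun R => (2 * (R - 1)) ^ 2 * Real.log (2 * (R - 1)) :=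
  modeBdry_isBigO 1 0 β (Or.inl rfl) (isBigO_quot_one hω hres)

lemma modeBdry_isBigO_two (hω : 0 < ω) (n : ℕ)
    (hres : σ * besselD besselJ (n + 2) k + (n + 2) * besselJ (n + 2) k ≠ 0) (F β : ℂ) :
    modeBdry ω σ k (n + 2) F β =O[𝓝[>] 1] fun R => (2 * (R - 1)) ^ 2 := by
  refine modeBdry_isBigO (n + 2) F β (Or.inr ?_) ?_
  · have h := isBigO_besselD_add_succ hω (n + 1)
    push_cast at h ⊢
    rw [show (n : ℝ) + 1 + 1 = n + 2 by ring] at h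
    have := (isBigO_refl (fun R : ℝ => 2 * (R - 1)) (𝓝[>] 1)).mul
      (isBigO_comp_rho hω (isBigO_besselJ_succ n))
    exact (h.trans this).congr_right fun R => by ring
  · have h := isBigO_quot_succ (ω := ω) (σ := σ) (k := k) (n := n + 1) (h := fun x => x ^ 2) hω
      (by push_cast; rw [show (n : ℝ) + 1 + 1 = n + 2 by ring]; exact hres)
      ((isBigO_pow_mul_extDB_add (ω := ω) n).congr_left fun x => by push_cast; ring)
    refine (h.congr_left fun R => by push_cast; ring).trans ?_
    exact ((isBigO_refl (fun R : ℝ => 2 * (R - 1)) (𝓝[>] 1)).const_mul_left ω).pow 2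

end

end

noncomputable section

/-! ### The radial problem for a single angular mode -/

/-- The eigenvalue of `sigmaR` in the radial direction. -/
def sigRad (σa R r : ℝ) : ℝ := if r ≤ R then σa else if r ≤ 2 then (r - 1) / r else 1

/-- The eigenvalue of `sigmaR` in the tangential direction. -/
def sigTan (σa R r : ℝ) : ℝ := if r ≤ R then σa else if r ≤ 2 then r / (r - 1) else 1

/-- The bulk modulus as a function of the radius. -/
def lamRad (lam R r : ℝ) : ℝ := if r ≤ R then lam else if r ≤ 2 then r / (4 * (r - 1)) else 1

/-- The zeroth order coefficient of the radial equation of the mode `n`. -/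
def coefB (ω σa lam R : ℝ) (n : ℤ) (r : ℝ) : ℝ :=
  n ^ 2 * sigTan σa R r / r - ω ^ 2 * r / lamRad lam R r

/-- A solution of the radial equation of the mode `n`, as a first order system for the amplitude `u`
and the flux `p = r σ u'`. Both are continuous up to the outer boundary, in particular across the
interfaces `r = R` and `r = 2`, which encodes the transmission conditions. -/
structure ModeSol (ω σa lam R : ℝ) (n : ℤ) (u p : ℝ → ℂ) : Prop where
  cont_u : ContinuousOn u (Ioc 0 3)
  cont_p : ContinuousOn p (Ioc 0 3)
  deriv_u : ∀ r ∈ Ioo (0 : ℝ) 3, r ≠ R → r ≠ 2 →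
    HasDerivAt u (p r / (r * sigRad σa R r : ℝ)) r
  deriv_p : ∀ r ∈ Ioo (0 : ℝ) 3, r ≠ R → r ≠ 2 →
    HasDerivAt p ((coefB ω σa lam R n r : ℝ) * u r) r

/-- A function with vanishing derivative off a finite set, continuous up to the end points, is
constant. -/
lemma eq_of_hasDerivAt_zero_off {f : ℝ → ℂ} {a b : ℝ} (hab : a ≤ b) (S : Set ℝ) (hS : S.Countable)
    (hf : ContinuousOn f (Icc a b)) (hd : ∀ r ∈ Ioo a b \ S, HasDerivAt f 0 r) :
    f a = f b := by
  have := integral_eq_of_hasDerivAt_off_countable_of_le f (fun _ => 0) hab hS hf hd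
    (by simp)
  simp only [intervalIntegral.integral_zero] at this
  exact (sub_eq_zero.1 this.symm).symm

/-- In a phase variable `φ` the radial system becomes Bessel's equation, and `J_n ∘ φ` and `Y_n ∘ φ`
span its solutions. -/
lemma bessel_span {φ φ' : ℝ → ℝ} {u P : ℝ → ℂ} {a b : ℝ} (n : ℕ) (S : Set ℝ) (hS : S.Countable)
    (hφ : ContinuousOn φ (Icc a b)) (hpos : ∀ r ∈ Icc a b, 0 < φ r)
    (hφ' : ∀ r ∈ Ioo a b \ S, HasDerivAt φ (φ' r) r)
    (hu : ContinuousOn u (Icc a b)) (hP : ContinuousOn P (Icc a b))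
    (hu' : ∀ r ∈ Ioo a b \ S, HasDerivAt u ((φ' r / φ r : ℝ) * P r) r)
    (hP' : ∀ r ∈ Ioo a b \ S,
      HasDerivAt P ((φ' r / φ r * (n ^ 2 - φ r ^ 2) : ℝ) * u r) r)
    {α β : ℂ} (hα : α = u b * besselD besselY n (φ b) - P b * besselY n (φ b))
    (hβ : β = P b * besselJ n (φ b) - u b * besselD besselJ n (φ b)) {r : ℝ}
    (hr : r ∈ Icc a b) :
    u r = α * besselJ n (φ r) + β * besselY n (φ r) ∧
    P r = α * besselD besselJ n (φ r) + β * besselD besselY n (φ r) := by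
  have key (C : ℕ → ℝ → ℝ) (hC : BesselFamily C) :
      u r * besselD C n (φ r) - P r * C n (φ r) = u b * besselD C n (φ b) - P b * C n (φ b) := by
    have hsub : Icc r b ⊆ Icc a b := Set.Icc_subset_Icc_left hr.1
    have hsub' : Ioo r b ⊆ Ioo a b := Set.Ioo_subset_Ioo_left hr.1
    have h1 : ContinuousOn (fun r => C n (φ r)) (Icc r b) := fun y hy =>
      (hC.hasDerivAt n (hpos y (hsub hy))).continuousAt.comp_continuousWithinAt
        ((hφ y (hsub hy)).mono hsub)
    have h2 : ContinuousOn (fun r => besselD C n (φ r)) (Icc r b) := fun y hy =>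
      ContinuousAt.comp_continuousWithinAt (f := φ) (g := besselD C n)
        (hC.hasDerivAt_besselD n (hpos y (hsub hy))).continuousAt
        ((hφ y (hsub hy)).mono hsub)
    refine eq_of_hasDerivAt_zero_off (f := fun r => u r * besselD C n (φ r) - P r * C n (φ r))
      hr.2 S hS ?_ ?_
    · exact ((hu.mono hsub).mul (Complex.continuous_ofReal.comp_continuousOn h2)).sub
        ((hP.mono hsub).mul (Complex.continuous_ofReal.comp_continuousOn h1))
    · intro y hy
      have hy' : y ∈ Ioo a b \ S := ⟨hsub' hy.1, hy.2⟩
      have hp := hpos y ⟨hy'.1.1.le, hy'.1.2.le⟩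
      have d1 := ((hC.hasDerivAt n hp).comp y (hφ' y hy')).ofReal_comp
      have d2 := ((hC.hasDerivAt_besselD n hp).comp y (hφ' y hy')).ofReal_comp
      refine (((hu' y hy').mul d2).sub ((hP' y hy').mul d1)).congr_deriv ?_
      simp only [Function.comp]
      have : (φ y : ℂ) ≠ 0 := mod_cast hp.ne'
      push_cast
      field_simp
      ring
  have hJ := key besselJ besselFamily_besselJ
  have hY := key besselY besselFamily_besselY
  have hW := wronskian n (hpos r hr)
  have hW' : (besselJ n (φ r) : ℂ) * besselD besselY n (φ r)
      - besselD besselJ n (φ r) * besselY n (φ r) = 1 := mod_cast hW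
  rw [hα, hβ]
  constructor
  · linear_combination (-u r) * hW' + (besselJ n (φ r) : ℂ) * hY - (besselY n (φ r) : ℂ) * hJ
  · linear_combination (-P r) * hW' + (besselD besselJ n (φ r) : ℂ) * hY
      - (besselD besselY n (φ r) : ℂ) * hJ

/-- The radius before the blow-up, as a function of the radius outside the cloaked region. -/
def preRadius (r : ℝ) : ℝ := if r ≤ 2 then 2 * (r - 1) else r

lemma continuous_preRadius : Continuous preRadius := by
  refine Continuous.if_le (by fun_prop) (by fun_prop) (by fun_prop) (by fun_prop) ?_
  intro r hr; rw [hr]; norm_num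

lemma preRadius_pos {r : ℝ} (hr : 1 < r) : 0 < preRadius r := by
  rw [preRadius]; split_ifs <;> linarith

lemma preRadius_three : preRadius 3 = 3 := by rw [preRadius]; norm_num

lemma preRadius_of_le {r : ℝ} (hr : r ≤ 2) : preRadius r = 2 * (r - 1) := by
  rw [preRadius, if_pos hr]

/-- The derivative of `preRadius`, off `r = 2`. -/
def preRadius' (r : ℝ) : ℝ := if r ≤ 2 then 2 else 1

lemma hasDerivAt_preRadius {r : ℝ} (hr : r ≠ 2) : HasDerivAt preRadius (preRadius' r) r := by
  rcases lt_or_gt_of_ne hr with h | h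
  · have : HasDerivAt (fun r : ℝ => 2 * (r - 1)) 2 r := by
      simpa using ((hasDerivAt_id r).sub_const 1).const_mul 2
    rw [preRadius', if_pos h.le]
    refine this.congr_of_eventuallyEq ?_
    filter_upwards [Iio_mem_nhds h] with y hy
    rw [preRadius, if_pos (le_of_lt hy)]
  · rw [preRadius', if_neg (not_le.2 h)]
    refine (hasDerivAt_id r).congr_of_eventuallyEq ?_
    filter_upwards [Ioi_mem_nhds h] with y hy
    rw [preRadius, if_neg (not_le.2 hy)]; rfl

section

variable {ω σa lam R k : ℝ}

/-- The blow-up map turns the flux of `σ_R` into that of the Laplacian: `r σ_rad` is the factor relating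
`d/dr` to the Euler derivative in `preRadius r`. -/
lemma preRadius'_div (hR : 1 < R) {r : ℝ} (hr : R < r) :
    preRadius' r / preRadius r = 1 / (r * sigRad σa R r) := by
  rw [preRadius', preRadius, sigRad, if_neg (not_le.2 hr)]
  have h1 : r - 1 ≠ 0 := by linarith
  have h2 : r ≠ 0 := by linarith
  split_ifs <;> field_simp

/-- The blow-up map turns the zeroth order coefficient into that of the Bessel equation. -/
lemma coefB_outer (hR : 1 < R) {r : ℝ} (hr : R < r) (n : ℤ) :
    coefB ω σa lam R n r
      = preRadius' r / preRadius r * (n ^ 2 - (ω * preRadius r) ^ 2) := by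
  rw [coefB, preRadius', preRadius, sigTan, lamRad, if_neg (not_le.2 hr), if_neg (not_le.2 hr)]
  have h1 : r - 1 ≠ 0 := by linarith
  have h2 : r ≠ 0 := by linarith
  split_ifs <;> field_simp
  ring

lemma coefB_inner (hσ : 0 < σa) (hlam : 0 < lam) (hk2 : k ^ 2 * (σa * lam) = ω ^ 2) {r : ℝ}
    (hr0 : 0 < r) (hr : r ≤ R) (n : ℤ) :
    coefB ω σa lam R n r = σa * (1 / r * (n ^ 2 - (k * r) ^ 2)) := by
  rw [coefB, sigTan, lamRad, if_pos hr, if_pos hr, ← hk2]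
  field_simp

lemma sigRad_pos (hσ : 0 < σa) (hR : 1 < R) {r : ℝ} (hr : 0 < r) : 0 < sigRad σa R r := by
  rw [sigRad]; split_ifs with h1 h2
  · exact hσ
  · exact div_pos (by linarith) hr
  · exact one_pos

lemma natAbs_cast_sq (n : ℤ) : ((n.natAbs : ℕ) : ℝ) ^ 2 = (n : ℝ) ^ 2 := by
  rw [Nat.cast_natAbs]; push_cast; exact sq_abs _

namespace ModeSol

variable {n : ℤ} {u p : ℝ → ℂ}

/-- In the cloaked region the modes are the Bessel functions of wave number `k = κω`. -/
lemma inner_span (h : ModeSol ω σa lam R n u p) (hσ : 0 < σa) (hlam : 0 < lam) (hk : 0 < k)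
    (hk2 : k ^ 2 * (σa * lam) = ω ^ 2) (hR : 1 < R) (hR2 : R < 2) :
    ∃ α β : ℂ, ∀ r ∈ Ioc 0 R,
      u r = α * besselJ n.natAbs (k * r) + β * besselY n.natAbs (k * r) ∧
      p r = σa * (α * besselD besselJ n.natAbs (k * r) + β * besselD besselY n.natAbs (k * r)) := by
  refine ⟨u R * besselD besselY n.natAbs (k * R) - p R / σa * besselY n.natAbs (k * R),
    p R / σa * besselJ n.natAbs (k * R) - u R * besselD besselJ n.natAbs (k * R), fun r hr => ?_⟩
  have hsub : Icc r R ⊆ Ioc 0 3 := fun y hy => ⟨hr.1.trans_le hy.1, by linarith [hy.2]⟩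
  have hsub' : ∀ y ∈ Ioo r R \ (∅ : Set ℝ), y ∈ Ioo (0 : ℝ) 3 ∧ y ≠ R ∧ y ≠ 2 ∧ y ≤ R :=
    fun y hy => ⟨⟨hr.1.trans hy.1.1, by linarith [hy.1.2]⟩, hy.1.2.ne, by linarith [hy.1.2],
      hy.1.2.le⟩
  have hσ' : (σa : ℂ) ≠ 0 := mod_cast hσ.ne'
  have := bessel_span (φ := fun r => k * r) (φ' := fun _ => k) (u := u) (P := fun r => p r / σa)
    (a := r) (b := R) n.natAbs ∅ Set.countable_empty (by fun_prop)
    (fun y hy => mul_pos hk (hr.1.trans_le hy.1))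
    (fun y _ => by simpa using (hasDerivAt_id y).const_mul k)
    (h.cont_u.mono hsub) ((h.cont_p.mono hsub).div_const _) ?_ ?_ rfl rfl ⟨le_rfl, hr.2⟩
  · refine ⟨this.1, ?_⟩
    rw [← this.2]; field_simp
  · intro y hy
    obtain ⟨h1, h2, h3, h4⟩ := hsub' y hy
    refine (h.deriv_u y h1 h2 h3).congr_deriv ?_
    have : (y : ℂ) ≠ 0 := mod_cast h1.1.ne'
    have hk' : (k : ℂ) ≠ 0 := mod_cast hk.ne'
    rw [sigRad, if_pos h4]
    push_cast
    field_simp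
  · intro y hy
    obtain ⟨h1, h2, h3, h4⟩ := hsub' y hy
    refine ((h.deriv_p y h1 h2 h3).div_const _).congr_deriv ?_
    rw [coefB_inner hσ hlam hk2 h1.1 h4, natAbs_cast_sq]
    have : (y : ℂ) ≠ 0 := mod_cast h1.1.ne'
    have hk' : (k : ℂ) ≠ 0 := mod_cast hk.ne'
    push_cast
    field_simp

/-- Outside the cloaked region the modes are Bessel functions of the radius before the blow-up. -/
lemma outer_span (h : ModeSol ω σa lam R n u p) (hω : 0 < ω) (hR : 1 < R) :
    ∃ α β : ℂ, ∀ r ∈ Icc R 3,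
      u r = α * besselJ n.natAbs (ω * preRadius r) + β * besselY n.natAbs (ω * preRadius r) ∧
      p r = α * besselD besselJ n.natAbs (ω * preRadius r)
        + β * besselD besselY n.natAbs (ω * preRadius r) := by
  refine ⟨u 3 * besselD besselY n.natAbs (ω * preRadius 3)
      - p 3 * besselY n.natAbs (ω * preRadius 3),
    p 3 * besselJ n.natAbs (ω * preRadius 3)
      - u 3 * besselD besselJ n.natAbs (ω * preRadius 3), fun r hr => ?_⟩
  have hsub : Icc R 3 ⊆ Ioc 0 3 := fun y hy => ⟨by linarith [hy.1], hy.2⟩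
  have hsub' : ∀ y ∈ Ioo R 3 \ ({2} : Set ℝ), y ∈ Ioo (0 : ℝ) 3 ∧ y ≠ R ∧ y ≠ 2 ∧ R < y :=
    fun y hy => ⟨⟨by linarith [hy.1.1], hy.1.2⟩, hy.1.1.ne', hy.2, hy.1.1⟩
  refine bessel_span (φ := fun r => ω * preRadius r) (φ' := fun r => ω * preRadius' r)
    n.natAbs {2} (Set.countable_singleton _)
    ((continuous_const.mul continuous_preRadius).continuousOn)
    (fun y hy => mul_pos hω (preRadius_pos (by linarith [hy.1])))
    (fun y hy => (hasDerivAt_preRadius hy.2).const_mul ω)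
    (h.cont_u.mono hsub) (h.cont_p.mono hsub) ?_ ?_ rfl rfl hr
  · intro y hy
    obtain ⟨h1, h2, h3, h4⟩ := hsub' y hy
    refine (h.deriv_u y h1 h2 h3).congr_deriv ?_
    rw [mul_div_mul_left _ _ hω.ne', preRadius'_div hR h4 (σa := σa)]
    push_cast
    ring
  · intro y hy
    obtain ⟨h1, h2, h3, h4⟩ := hsub' y hy
    refine (h.deriv_p y h1 h2 h3).congr_deriv ?_
    rw [coefB_outer hR h4, mul_div_mul_left _ _ hω.ne', natAbs_cast_sq]

/-- The exterior coefficient of the singular solution: eliminating the regular inner amplitude from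
the transmission conditions leaves one equation, with coefficient `transDet`. -/
lemma transmission (h : ModeSol ω σa lam R n u p) (hω : 0 < ω) (hk : 0 < k) (hR : 1 < R)
    (hR2 : R < 2) (hJ : besselJ n.natAbs (3 * ω) ≠ 0) {α β : ℂ}
    (hin : u R = α * besselJ n.natAbs (k * R) + β * besselY n.natAbs (k * R) ∧
      p R = σa * (α * besselD besselJ n.natAbs (k * R) + β * besselD besselY n.natAbs (k * R))) :
    ∃ β' : ℂ,
      β' * transDet ω σa k n.natAbs R = -(σa * β + u 3 *
        ((σa * besselD besselJ n.natAbs (k * R) * besselJ n.natAbs (ω * (2 * (R - 1)))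
        - besselJ n.natAbs (k * R) * besselD besselJ n.natAbs (ω * (2 * (R - 1))))
          / besselJ n.natAbs (3 * ω) : ℝ)) ∧
      (∀ r ∈ Icc R 3,
        u r = u 3 / besselJ n.natAbs (3 * ω) * besselJ n.natAbs (ω * preRadius r)
          + β' * extB ω n.natAbs (ω * preRadius r) ∧
        p r = u 3 / besselJ n.natAbs (3 * ω) * besselD besselJ n.natAbs (ω * preRadius r)
          + β' * extDB ω n.natAbs (ω * preRadius r)) := by
  obtain ⟨α', β', hout⟩ := h.outer_span hω hR
  have h3 := (hout 3 ⟨by linarith, le_rfl⟩).1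
  rw [preRadius_three, mul_comm ω 3] at h3
  have hJ' : (besselJ n.natAbs (3 * ω) : ℂ) ≠ 0 := mod_cast hJ
  have hα' : α' = u 3 / besselJ n.natAbs (3 * ω)
      - β' * (besselY n.natAbs (3 * ω) / besselJ n.natAbs (3 * ω)) := by
    rw [h3]; field_simp; ring
  have hout' : ∀ r ∈ Icc R 3,
        u r = u 3 / besselJ n.natAbs (3 * ω) * besselJ n.natAbs (ω * preRadius r)
          + β' * extB ω n.natAbs (ω * preRadius r) ∧
        p r = u 3 / besselJ n.natAbs (3 * ω) * besselD besselJ n.natAbs (ω * preRadius r)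
          + β' * extDB ω n.natAbs (ω * preRadius r) := by
    intro r hr
    obtain ⟨e1, e2⟩ := hout r hr
    rw [e1, e2, hα', extB, extDB]
    push_cast
    constructor <;> ring
  refine ⟨β', ?_, hout'⟩
  obtain ⟨e1, e2⟩ := hout' R ⟨le_rfl, by linarith⟩
  rw [preRadius_of_le hR2.le] at e1 e2
  have hW : (besselJ n.natAbs (k * R) : ℂ) * besselD besselY n.natAbs (k * R)
      - besselD besselJ n.natAbs (k * R) * besselY n.natAbs (k * R) = 1 := by
    exact_mod_cast wronskian n.natAbs (mul_pos hk (by linarith : 0 < R))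
  rw [transDet]
  have e3 := hin.1.symm.trans e1
  have e4 := hin.2.symm.trans e2
  push_cast
  linear_combination (-(σa : ℂ) * besselD besselJ n.natAbs (k * R)) * e3
    + (besselJ n.natAbs (k * R) : ℂ) * e4 - σa * β * hW

/-- The transmission conditions express the boundary expression by the boundary value at `r = 3` and
the singular coefficient `β`. -/
lemma bdry_eq (h : ModeSol ω σa lam R n u p) (hω : 0 < ω) (hk : 0 < k) (hR : 1 < R)
    (hR2 : R < 2) (hJ : besselJ n.natAbs (3 * ω) ≠ 0) (hdet : transDet ω σa k n.natAbs R ≠ 0)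
    {α β : ℂ}
    (hin : u R = α * besselJ n.natAbs (k * R) + β * besselY n.natAbs (k * R) ∧
      p R = σa * (α * besselD besselJ n.natAbs (k * R) + β * besselD besselY n.natAbs (k * R))) :
    p R + n.natAbs * u R = modeBdry ω σa k n.natAbs (u 3) β R := by
  obtain ⟨β', h1, h2⟩ := h.transmission hω hk hR hR2 hJ hin
  obtain ⟨e1, e2⟩ := h2 R ⟨le_rfl, by linarith⟩
  have hdet' : (transDet ω σa k n.natAbs R : ℂ) ≠ 0 := mod_cast hdet
  have hβ := eq_div_of_mul_eq hdet' h1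
  rw [preRadius_of_le hR2.le] at e1 e2
  rw [e1, e2, hβ, modeBdry]
  push_cast
  ring

/-- A mode without boundary value and without singular part vanishes. -/
lemma eq_zero (h : ModeSol ω σa lam R n u p) (hω : 0 < ω) (hσ : 0 < σa)
    (hk : 0 < k) (hR : 1 < R)
    (hR2 : R < 2) (hJ : besselJ n.natAbs (3 * ω) ≠ 0) (hdet : transDet ω σa k n.natAbs R ≠ 0)
    {α : ℂ}
    (hin : ∀ r ∈ Ioc 0 R, u r = α * besselJ n.natAbs (k * r) ∧
      p r = σa * (α * besselD besselJ n.natAbs (k * r)))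
    (h3 : u 3 = 0) {r : ℝ} (hr : r ∈ Ioc (0 : ℝ) 3) : u r = 0 := by
  have hRR : R ∈ Ioc 0 R := ⟨by linarith, le_rfl⟩
  obtain ⟨β', h1, h2⟩ := h.transmission hω hk hR hR2 hJ (α := α) (β := 0)
    (by simpa using hin R hRR)
  have hdet' : (transDet ω σa k n.natAbs R : ℂ) ≠ 0 := mod_cast hdet
  rw [h3] at h1
  have hβ : β' = 0 := by
    rw [mul_zero, zero_mul, add_zero, neg_zero] at h1
    exact (mul_eq_zero.1 h1).resolve_right hdet'
  simp only [h3, hβ, zero_div, zero_mul, add_zero] at h2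
  rcases le_total R r with hRr | hrR
  · exact (h2 r ⟨hRr, hr.2⟩).1
  · have hα : α = 0 := by
      have e1 := (hin R hRR).1.symm.trans (h2 R ⟨le_rfl, by linarith⟩).1
      have e2 := (hin R hRR).2.symm.trans (h2 R ⟨le_rfl, by linarith⟩).2
      have hσ' : (σa : ℂ) ≠ 0 := mod_cast hσ.ne'
      have e3 := (mul_eq_zero.1 e2).resolve_left hσ'
      have hW : (besselJ n.natAbs (k * R) : ℂ) * besselD besselY n.natAbs (k * R)
          - besselD besselJ n.natAbs (k * R) * besselY n.natAbs (k * R) = 1 := by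
        exact_mod_cast wronskian n.natAbs (mul_pos hk (by linarith : 0 < R))
      linear_combination (-α) * hW + (besselD besselY n.natAbs (k * R) : ℂ) * e1
        - (besselY n.natAbs (k * R) : ℂ) * e3
    rw [(hin r ⟨hr.1, hrR⟩).1, hα, zero_mul]

end ModeSol

/-- Gluing an inner and an outer solution along the interface `r = R`. -/
lemma modeSol_glue (hω : 0 < ω) (hσ : 0 < σa) (hlam : 0 < lam) (hk : 0 < k)
    (hk2 : k ^ 2 * (σa * lam) = ω ^ 2) (hR : 1 < R) (hR2 : R < 2) (n : ℤ) {α β α' β' : ℂ}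
    (hu : α * besselJ n.natAbs (k * R) + β * besselY n.natAbs (k * R)
      = α' * besselJ n.natAbs (ω * (2 * (R - 1))) + β' * besselY n.natAbs (ω * (2 * (R - 1))))
    (hp : σa * (α * besselD besselJ n.natAbs (k * R) + β * besselD besselY n.natAbs (k * R))
      = α' * besselD besselJ n.natAbs (ω * (2 * (R - 1)))
        + β' * besselD besselY n.natAbs (ω * (2 * (R - 1)))) :
    ModeSol ω σa lam R n
      (fun r => if r ≤ R then α * besselJ n.natAbs (k * r) + β * besselY n.natAbs (k * r)
        else α' * besselJ n.natAbs (ω * preRadius r) + β' * besselY n.natAbs (ω * preRadius r))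
      (fun r => if r ≤ R then
          σa * (α * besselD besselJ n.natAbs (k * r) + β * besselD besselY n.natAbs (k * r))
        else α' * besselD besselJ n.natAbs (ω * preRadius r)
          + β' * besselD besselY n.natAbs (ω * preRadius r)) := by
  set m := n.natAbs
  have di (C : ℕ → ℝ → ℝ) (hC : BesselFamily C) (r : ℝ) (hr : 0 < r) :
      HasDerivAt (fun r : ℝ => (C m (k * r) : ℂ)) ((besselD C m (k * r) / r : ℝ)) r ∧
      HasDerivAt (fun r : ℝ => (besselD C m (k * r) : ℂ))
        (((m ^ 2 - (k * r) ^ 2) / r * C m (k * r) : ℝ)) r := by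
    have hk' : HasDerivAt (fun r => k * r) k r := by simpa using (hasDerivAt_id r).const_mul k
    constructor
    · refine ((hC.hasDerivAt m (mul_pos hk hr)).comp r hk').ofReal_comp.congr_deriv ?_
      congr 1; field_simp
    · refine ((hC.hasDerivAt_besselD m (mul_pos hk hr)).comp r hk').ofReal_comp.congr_deriv ?_
      congr 1; field_simp
  have ce (C : ℕ → ℝ → ℝ) (hC : BesselFamily C) (r : ℝ) (hr : 1 < r) :
      ContinuousAt (fun r : ℝ => (C m (ω * preRadius r) : ℂ)) r ∧
      ContinuousAt (fun r : ℝ => (besselD C m (ω * preRadius r) : ℂ)) r := by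
    have hpos := mul_pos hω (preRadius_pos hr)
    have hc : ContinuousAt (fun r => ω * preRadius r) r :=
      (continuous_const.mul continuous_preRadius).continuousAt
    exact ⟨Complex.continuous_ofReal.continuousAt.comp
        (ContinuousAt.comp (f := fun r => ω * preRadius r) (hC.hasDerivAt m hpos).continuousAt hc),
      Complex.continuous_ofReal.continuousAt.comp
        (ContinuousAt.comp (f := fun r => ω * preRadius r)
          (hC.hasDerivAt_besselD m hpos).continuousAt hc)⟩
  have de (C : ℕ → ℝ → ℝ) (hC : BesselFamily C) (r : ℝ) (hr : R < r) (h2 : r ≠ 2) :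
      HasDerivAt (fun r : ℝ => (C m (ω * preRadius r) : ℂ))
        ((besselD C m (ω * preRadius r) / (r * sigRad σa R r) : ℝ)) r ∧
      HasDerivAt (fun r : ℝ => (besselD C m (ω * preRadius r) : ℂ))
        ((coefB ω σa lam R n r * C m (ω * preRadius r) : ℝ)) r := by
    have hpos := preRadius_pos (hR.trans hr)
    have hd := (hasDerivAt_preRadius h2).const_mul ω
    constructor
    · refine ((hC.hasDerivAt m (mul_pos hω hpos)).comp r hd).ofReal_comp.congr_deriv ?_
      congr 1
      rw [div_eq_mul_one_div _ (r * sigRad σa R r), ← preRadius'_div hR hr (σa := σa)]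
      field_simp
    · refine ((hC.hasDerivAt_besselD m (mul_pos hω hpos)).comp r hd).ofReal_comp.congr_deriv ?_
      congr 1
      rw [coefB_outer hR hr, ← natAbs_cast_sq]
      rw [show ((n.natAbs : ℕ) : ℝ) = (m : ℝ) from rfl]
      field_simp
  have cglue (f g : ℝ → ℂ) (hf : ∀ r, 0 < r → ContinuousAt f r) (hg : ∀ r, 1 < r → ContinuousAt g r)
      (hfg : f R = g R) : ContinuousOn (fun r => if r ≤ R then f r else g r) (Ioc 0 3) := by
    have h1 : ContinuousOn (fun r => if r ≤ R then f r else g r) (Ioc 0 3) := by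
      refine ContinuousOn.if (p := fun r => r ≤ R) ?_ ?_ ?_
      · intro a ha
        have : a ∈ ({R} : Set ℝ) := frontier_le_subset_eq continuous_id continuous_const ha.2
        rw [Set.mem_singleton_iff.1 this, hfg]
      · exact fun r hr => (hf r hr.1.1).continuousWithinAt
      · intro r hr
        have : r ∈ {r : ℝ | R ≤ r} := by
          have h := hr.2
          have e : {a : ℝ | ¬ a ≤ R} = Ioi R := by ext; simp
          rw [e, closure_Ioi] at h; exact h
        exact (hg r (lt_of_lt_of_le hR this)).continuousWithinAt
    exact h1
  have hJ := besselFamily_besselJ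
  have hY := besselFamily_besselY
  have inl (f g : ℝ → ℂ) (r : ℝ) (hr : r < R) :
      (fun r => if r ≤ R then f r else g r) =ᶠ[𝓝 r] f := by
    filter_upwards [Iio_mem_nhds hr] with y hy
    rw [if_pos (le_of_lt hy)]
  have inr (f g : ℝ → ℂ) (r : ℝ) (hr : R < r) :
      (fun r => if r ≤ R then f r else g r) =ᶠ[𝓝 r] g := by
    filter_upwards [Ioi_mem_nhds hr] with y hy
    rw [if_neg (not_le.2 hy)]
  refine ⟨cglue _ _ (fun r hr => ?_) (fun r hr => ?_) ?_,
    cglue _ _ (fun r hr => ?_) (fun r hr => ?_) ?_, fun r hr h1 h2 => ?_, fun r hr h1 h2 => ?_⟩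
  · exact (((di _ hJ r hr).1.const_mul α).add ((di _ hY r hr).1.const_mul β)).continuousAt
  · exact (continuousAt_const.mul (ce _ hJ r hr).1).add (continuousAt_const.mul (ce _ hY r hr).1)
  · rw [preRadius_of_le hR2.le]; exact hu
  · exact ((((di _ hJ r hr).2.const_mul α).add
      ((di _ hY r hr).2.const_mul β)).const_mul (σa : ℂ)).continuousAt
  · exact (continuousAt_const.mul (ce _ hJ r hr).2).add (continuousAt_const.mul (ce _ hY r hr).2)
  · rw [preRadius_of_le hR2.le]; exact hp
  · have hr0 : (r : ℂ) ≠ 0 := mod_cast hr.1.ne'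
    have hσ' : (σa : ℂ) ≠ 0 := mod_cast hσ.ne'
    rcases lt_or_gt_of_ne h1 with h | h
    · refine ((((di _ hJ r hr.1).1.const_mul α).add
        ((di _ hY r hr.1).1.const_mul β)).congr_of_eventuallyEq (inl _ _ r h)).congr_deriv ?_
      rw [if_pos h.le, sigRad, if_pos h.le]
      push_cast
      field_simp
    · refine ((((de _ hJ r h h2).1.const_mul α').add
        ((de _ hY r h h2).1.const_mul β')).congr_of_eventuallyEq (inr _ _ r h)).congr_deriv ?_
      rw [if_neg (not_le.2 h)]
      push_cast
      ring
  · have hr0 : (r : ℂ) ≠ 0 := mod_cast hr.1.ne'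
    rcases lt_or_gt_of_ne h1 with h | h
    · refine (((((di _ hJ r hr.1).2.const_mul α).add
        ((di _ hY r hr.1).2.const_mul β)).const_mul (σa : ℂ)).congr_of_eventuallyEq
          (inl _ _ r h)).congr_deriv ?_
      rw [if_pos h.le, coefB_inner hσ hlam hk2 hr.1 h.le, ← natAbs_cast_sq]
      push_cast
      field_simp
      ring
    · refine ((((de _ hJ r h h2).2.const_mul α').add
        ((de _ hY r h h2).2.const_mul β')).congr_of_eventuallyEq (inr _ _ r h)).congr_deriv ?_
      rw [if_neg (not_le.2 h)]
      push_cast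
      ring

/-- The radial problem with prescribed singular inner part and prescribed outer boundary value. -/
lemma exists_modeSol (hω : 0 < ω) (hσ : 0 < σa) (hlam : 0 < lam) (hk : 0 < k)
    (hk2 : k ^ 2 * (σa * lam) = ω ^ 2) (hR : 1 < R) (hR2 : R < 2) (n : ℤ)
    (hJ : besselJ n.natAbs (3 * ω) ≠ 0) (hdet : transDet ω σa k n.natAbs R ≠ 0) (β F : ℂ) :
    ∃ (u p : ℝ → ℂ) (α : ℂ), ModeSol ω σa lam R n u p ∧ u 3 = F ∧ ∀ r ≤ R,
      u r = α * besselJ n.natAbs (k * r) + β * besselY n.natAbs (k * r) ∧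
      p r = σa * (α * besselD besselJ n.natAbs (k * r) + β * besselD besselY n.natAbs (k * r)) := by
  set m := n.natAbs
  set x := ω * (2 * (R - 1)) with hx
  have hx0 : 0 < x := mul_pos hω (by linarith)
  set N : ℂ := (((σa * besselD besselJ m (k * R) * besselJ m x
        - besselJ m (k * R) * besselD besselJ m x) / besselJ m (3 * ω) : ℝ) : ℂ) with hN
  have hdet' : (transDet ω σa k m R : ℂ) ≠ 0 := mod_cast hdet
  have hJ' : (besselJ m (3 * ω) : ℂ) ≠ 0 := mod_cast hJ
  have hσ' : (σa : ℂ) ≠ 0 := mod_cast hσ.ne'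
  set β' : ℂ := -(σa * β + F * N) / transDet ω σa k m R with hβ'
  have hβ'' : β' * transDet ω σa k m R = -(σa * β + F * N) := div_mul_cancel₀ _ hdet'
  set α' : ℂ := F / besselJ m (3 * ω) - β' * (besselY m (3 * ω) / besselJ m (3 * ω)) with hα'
  -- exterior value and flux at the interface
  set a : ℂ := α' * besselJ m x + β' * besselY m x with ha
  set b : ℂ := α' * besselD besselJ m x + β' * besselD besselY m x with hb
  have hW : (besselJ m (k * R) : ℂ) * besselD besselY m (k * R)
      - besselD besselJ m (k * R) * besselY m (k * R) = 1 := by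
    exact_mod_cast wronskian m (mul_pos hk (by linarith : 0 < R))
  have hcompat : σa * besselD besselJ m (k * R) * a - besselJ m (k * R) * b = -(σa * β) := by
    have e1 : a = F / besselJ m (3 * ω) * besselJ m x + β' * extB ω m x := by
      rw [ha, hα', extB]; push_cast; ring
    have e2 : b = F / besselJ m (3 * ω) * besselD besselJ m x + β' * extDB ω m x := by
      rw [hb, hα', extDB]; push_cast; ring
    rw [e1, e2]
    rw [transDet, ← hx, hN] at hβ''
    push_cast at hβ''
    linear_combination hβ''
  set α : ℂ := a * besselD besselY m (k * R) - b / σa * besselY m (k * R) with hα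
  have hu : α * besselJ m (k * R) + β * besselY m (k * R) = a := by
    have : β = (-(σa * besselD besselJ m (k * R) * a - besselJ m (k * R) * b)) / σa := by
      rw [hcompat]; field_simp
    rw [this, hα]
    field_simp
    linear_combination a * σa * hW
  have hp : σa * (α * besselD besselJ m (k * R) + β * besselD besselY m (k * R)) = b := by
    have : β = (-(σa * besselD besselJ m (k * R) * a - besselJ m (k * R) * b)) / σa := by
      rw [hcompat]; field_simp
    rw [this, hα]
    field_simp
    linear_combination b * hW
  refine ⟨_, _, α, modeSol_glue hω hσ hlam hk hk2 hR hR2 n hu hp, ?_, fun r hr => ?_⟩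
  · simp only [if_neg (show ¬ (3 : ℝ) ≤ R by linarith), preRadius_three, mul_comm ω 3]
    change α' * besselJ m (3 * ω) + β' * besselY m (3 * ω) = F
    rw [hα']; field_simp; ring
  · simp only [if_pos hr]
    exact ⟨rfl, rfl⟩

end

end

noncomputable section

/-! ### Energy estimate for the modes of high order -/

lemma le_of_hasDerivAt_nonneg {f f' : ℝ → ℝ} {a b : ℝ} (hab : a ≤ b)
    (hf : ContinuousOn f (Icc a b)) (hd : ∀ r ∈ Ioo a b, HasDerivAt f (f' r) r)
    (h0 : ∀ r ∈ Ioo a b, 0 ≤ f' r) : f a ≤ f b := by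
  refine monotoneOn_of_deriv_nonneg (convex_Icc a b) hf (fun y hy => ?_) (fun y hy => ?_)
    ⟨le_rfl, hab⟩ ⟨hab, le_rfl⟩ hab
  · rw [interior_Icc] at hy; exact (hd y hy).differentiableAt.differentiableWithinAt
  · rw [interior_Icc] at hy; rw [(hd y hy).deriv]; exact h0 y hy

lemma le_of_hasDerivAt_nonneg_off {f f' : ℝ → ℝ} {a b R : ℝ} (hR2 : R < 2) (hab : a ≤ b)
    (hf : ContinuousOn f (Icc a b))
    (hd : ∀ r ∈ Ioo a b, r ≠ R → r ≠ 2 → HasDerivAt f (f' r) r)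
    (h0 : ∀ r ∈ Ioo a b, r ≠ R → r ≠ 2 → 0 ≤ f' r) : f a ≤ f b := by
  set c := max a (min R b)
  set d := max a (min 2 b)
  have hac : a ≤ c := le_max_left _ _
  have hcd : c ≤ d := max_le_max le_rfl (min_le_min hR2.le le_rfl)
  have hdb : d ≤ b := max_le hab (min_le_right _ _)
  have piece (x y : ℝ) (hx : a ≤ x) (hxy : x ≤ y) (hy : y ≤ b)
      (h : ∀ r ∈ Ioo x y, r ≠ R ∧ r ≠ 2) : f x ≤ f y := by
    have hs : Ioo x y ⊆ Ioo a b := Set.Ioo_subset_Ioo hx hy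
    exact le_of_hasDerivAt_nonneg hxy (hf.mono (Set.Icc_subset_Icc hx hy))
      (fun r hr => hd r (hs hr) (h r hr).1 (h r hr).2)
      (fun r hr => h0 r (hs hr) (h r hr).1 (h r hr).2)
  have h1 := piece a c le_rfl hac (hcd.trans hdb) fun r hr => by
    have : r < min R b := (lt_max_iff.1 hr.2).resolve_left (not_lt.2 hr.1.le)
    have := (lt_min_iff.1 this).1
    exact ⟨this.ne, by linarith⟩
  have h2 := piece c d hac hcd hdb fun r hr => by
    have h3 : r < min 2 b := (lt_max_iff.1 hr.2).resolve_left (not_lt.2 (hac.trans hr.1.le))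
    have h4 := lt_min_iff.1 h3
    have h5 := (max_lt_iff.1 hr.1).2
    have h6 := (min_lt_iff.1 h5).resolve_right (not_lt.2 h4.2.le)
    exact ⟨h6.ne', h4.1.ne⟩
  have h3 := piece d b (hac.trans hcd) hdb le_rfl fun r hr => by
    have h5 := (max_lt_iff.1 hr.1).2
    have h6 := (min_lt_iff.1 h5).resolve_right (not_lt.2 hr.2.le)
    exact ⟨by linarith, h6.ne'⟩
  exact h1.trans (h2.trans h3)

lemma integrableOn_of_hasDerivAt_nonneg {f f' : ℝ → ℝ} {a b : ℝ} (hab : a ≤ b)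
    (hf : ContinuousOn f (Icc a b)) (hd : ∀ r ∈ Ioo a b, HasDerivAt f (f' r) r)
    (h0 : ∀ r ∈ Ioo a b, 0 ≤ f' r) :
    IntegrableOn f' (Ioc a b) ∧ ∫ r in Ioc a b, f' r = f b - f a := by
  have h1 := intervalIntegral.integrableOn_deriv_of_nonneg hf hd h0
  refine ⟨h1, ?_⟩
  rw [← intervalIntegral.integral_of_le hab]
  exact intervalIntegral.integral_eq_sub_of_hasDerivAt_of_le hab hf hd
    ((intervalIntegrable_iff_integrableOn_Ioc_of_le hab).2 h1)

section

variable {ω σa lam R k : ℝ}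

/-- The energy density of the mode `n`. -/
def energyDensity (ω σa lam R : ℝ) (n : ℤ) (u p : ℝ → ℂ) (r : ℝ) : ℝ :=
  ‖p r‖ ^ 2 / (r * sigRad σa R r) + coefB ω σa lam R n r * ‖u r‖ ^ 2

lemma sigTan_pos (hσ : 0 < σa) (hR : 1 < R) {r : ℝ} (hr : 0 < r) : 0 < sigTan σa R r := by
  rw [sigTan]; split_ifs with h1 h2
  · exact hσ
  · exact div_pos hr (by linarith)
  · exact one_pos

/-- For modes of high order the angular term dominates the zeroth order term. -/
lemma coefB_ge (hσ : 0 < σa) (hlam : 0 < lam) (hk : 0 < k)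
    (hk2 : k ^ 2 * (σa * lam) = ω ^ 2) (hR : 1 < R) (hR2 : R < 2) {n : ℤ}
    (hn : 18 * ω ^ 2 ≤ n ^ 2) (hn' : 8 * k ^ 2 ≤ n ^ 2) {r : ℝ} (hr : r ∈ Ioc (0 : ℝ) 3) :
    n ^ 2 * sigTan σa R r / (2 * r) ≤ coefB ω σa lam R n r := by
  obtain ⟨hr0, hr3⟩ := hr
  rcases le_or_gt r R with h | h
  · rw [coefB_inner hσ hlam hk2 hr0 h, sigTan, if_pos h, div_le_iff₀ (by positivity)]
    have : (k * r) ^ 2 ≤ (k * 2) ^ 2 := by gcongr; linarith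
    have e : σa * (1 / r * ((n : ℝ) ^ 2 - (k * r) ^ 2)) * (2 * r)
      = σa * (2 * (n ^ 2 - (k * r) ^ 2)) := by field_simp
    rw [e, mul_comm]
    gcongr
    nlinarith
  · rw [coefB_outer hR h, preRadius'_div hR h (σa := σa)]
    have hω2 : (ω * preRadius r) ^ 2 ≤ ω ^ 2 * 9 := by
      rw [mul_pow]
      have h1 := preRadius_pos (hR.trans h)
      have h2 : preRadius r ≤ 3 := by rw [preRadius]; split_ifs <;> linarith
      have : preRadius r ^ 2 ≤ 9 := by nlinarith
      gcongr
    have hst : sigTan σa R r = 1 / sigRad σa R r := by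
      rw [sigTan, sigRad, if_neg (not_le.2 h), if_neg (not_le.2 h)]
      split_ifs <;> simp
    have hsp := sigRad_pos hσ hR hr0
    rw [hst]
    have e : (n : ℝ) ^ 2 * (1 / sigRad σa R r) / (2 * r)
      = 1 / (r * sigRad σa R r) * (n ^ 2 / 2) := by field_simp
    rw [e]
    gcongr
    linarith

namespace ModeSol

variable {n : ℤ} {u p : ℝ → ℂ}

lemma continuousOn_Icc (h : ModeSol ω σa lam R n u p) (hR : 1 < R) {α : ℂ}
    (hin : ∀ r ≤ R, u r = α * besselJ n.natAbs (k * r) ∧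
      p r = σa * (α * besselD besselJ n.natAbs (k * r))) :
    ContinuousOn u (Icc 0 3) ∧ ContinuousOn p (Icc 0 3) := by
  have aux (f g : ℝ → ℂ) (hf : ContinuousOn f (Ioc 0 3)) (hg : Continuous g)
      (hfg : ∀ r ≤ R, f r = g r) : ContinuousOn f (Icc 0 3) := by
    intro r hr
    rcases lt_or_ge r 1 with h1 | h1
    · refine (hg.continuousAt.congr ?_).continuousWithinAt
      filter_upwards [Iio_mem_nhds (h1.trans hR)] with y hy
      exact (hfg y (le_of_lt hy)).symm
    · have hr0 : 0 < r := by linarith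
      refine (hf r ⟨hr0, hr.2⟩).mono_of_mem_nhdsWithin ?_
      filter_upwards [self_mem_nhdsWithin, mem_nhdsWithin_of_mem_nhds (Ioi_mem_nhds hr0)]
        with y hy hy0 using ⟨hy0, hy.2⟩
  refine ⟨aux u _ h.cont_u ?_ fun r hr => (hin r hr).1, aux p _ h.cont_p ?_ fun r hr => (hin r hr).2⟩
  · have := continuous_besselJ n.natAbs
    fun_prop
  · have := continuous_besselD_besselJ n.natAbs
    fun_prop

lemma hasDerivAt_inner (h : ModeSol ω σa lam R n u p) {r : ℝ} (hr : r ∈ Ioo (0 : ℝ) 3)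
    (h1 : r ≠ R) (h2 : r ≠ 2) :
    HasDerivAt (fun r => inner ℝ (u r) (p r)) (energyDensity ω σa lam R n u p r) r := by
  refine ((h.deriv_u r hr h1 h2).inner ℝ (h.deriv_p r hr h1 h2)).congr_deriv ?_
  rw [energyDensity, ← Complex.real_smul, real_inner_smul_right, real_inner_self_eq_norm_sq,
    div_eq_inv_mul, ← Complex.ofReal_inv, ← Complex.real_smul, real_inner_smul_left,
    real_inner_self_eq_norm_sq]
  ring

/-- The energy of a mode of high order that is regular at the origin is bounded by `|n|` times the
square of its boundary value. The boundary flux is controlled by the monotonicity of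
`C² n² |u|² - |p|²`. -/
lemma energy (h : ModeSol ω σa lam R n u p) (hσ : 0 < σa) (hlam : 0 < lam)
    (hk : 0 < k) (hk2 : k ^ 2 * (σa * lam) = ω ^ 2) (hR : 1 < R) (hR2 : R < 2) {α : ℂ}
    (hin : ∀ r ≤ R, u r = α * besselJ n.natAbs (k * r) ∧
      p r = σa * (α * besselD besselJ n.natAbs (k * r)))
    (hn : 18 * ω ^ 2 ≤ n ^ 2) (hn' : 8 * k ^ 2 ≤ n ^ 2) :
    IntegrableOn (energyDensity ω σa lam R n u p) (Ioc 0 3) ∧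
    ∫ r in Ioc 0 3, energyDensity ω σa lam R n u p r
      ≤ max 1 σa * n.natAbs * ‖u 3‖ ^ 2 := by
  obtain ⟨hcu, hcp⟩ := h.continuousOn_Icc hR hin
  have hn0 : n.natAbs ≠ 0 := by
    intro h0
    rw [Int.natAbs_eq_zero] at h0
    rw [h0] at hn'
    have : 0 < k ^ 2 := by positivity
    simp at hn'
    linarith
  obtain ⟨m, hm⟩ := Nat.exists_eq_succ_of_ne_zero hn0
  have hu0 : u 0 = 0 := by
    rw [(hin 0 (by linarith)).1, mul_zero, hm, besselJ_succ_zero]; simp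
  have hp0 : p 0 = 0 := by
    rw [(hin 0 (by linarith)).2, mul_zero, besselD_besselJ_zero]; simp
  set E : ℝ → ℝ := fun r => inner ℝ (u r) (p r)
  have hE : ContinuousOn E (Icc 0 3) := hcu.inner hcp
  have hE0 : E 0 = 0 := by simp [E, hu0]
  have hB (r : ℝ) (hr : r ∈ Ioc (0 : ℝ) 3) : 0 ≤ coefB ω σa lam R n r := by
    refine le_trans ?_ (coefB_ge hσ hlam hk hk2 hR hR2 hn hn' hr)
    have := sigTan_pos hσ hR hr.1 (R := R)
    have := hr.1
    positivity
  have hA (r : ℝ) (hr : 0 < r) : 0 < r * sigRad σa R r := mul_pos hr (sigRad_pos hσ hR hr)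
  have he (r : ℝ) (hr : r ∈ Ioc (0 : ℝ) 3) : 0 ≤ energyDensity ω σa lam R n u p r := by
    have := hA r hr.1
    have := hB r hr
    rw [energyDensity]
    positivity
  have hEnn (r : ℝ) (hr : r ∈ Icc (0 : ℝ) 3) : 0 ≤ E r := by
    rw [← hE0]
    refine le_of_hasDerivAt_nonneg_off hR2 hr.1 (hE.mono (Set.Icc_subset_Icc_right hr.2))
      (fun y hy => h.hasDerivAt_inner ⟨hy.1, hy.2.trans_le hr.2⟩)
      (fun y hy _ _ => he y ⟨hy.1, hy.2.le.trans hr.2⟩)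
  -- control of the flux
  have hsq {c : ℝ} {r : ℝ} (hr : r ∈ Ioo (0 : ℝ) 3) (h1 : r ≠ R) (h2 : r ≠ 2) :
      HasDerivAt (fun r => c * ‖u r‖ ^ 2 - ‖p r‖ ^ 2)
        (2 * E r * (c / (r * sigRad σa R r) - coefB ω σa lam R n r)) r := by
    refine (((h.deriv_u r hr h1 h2).norm_sq.const_mul c).sub
      (h.deriv_p r hr h1 h2).norm_sq).congr_deriv ?_
    rw [div_eq_inv_mul, ← Complex.ofReal_inv, ← Complex.real_smul, real_inner_smul_right,
      ← Complex.real_smul, real_inner_smul_right, real_inner_comm]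
    simp only [E]
    rw [real_inner_comm (p r) (u r)]
    ring
  have hcont (c : ℝ) : ContinuousOn (fun r => c * ‖u r‖ ^ 2 - ‖p r‖ ^ 2) (Icc 0 3) :=
    (continuousOn_const.mul (hcu.norm.pow 2)).sub (hcp.norm.pow 2)
  have hQin : ‖p R‖ ^ 2 ≤ (σa * n) ^ 2 * ‖u R‖ ^ 2 := by
    have := le_of_hasDerivAt_nonneg (f := fun r => (σa * n) ^ 2 * ‖u r‖ ^ 2 - ‖p r‖ ^ 2)
      (a := 0) (b := R) (by linarith)
      ((hcont _).mono (Set.Icc_subset_Icc_right (by linarith)))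
      (fun r hr => hsq ⟨hr.1, by linarith [hr.2]⟩ hr.2.ne (by linarith [hr.2])) (fun r hr => ?_)
    · simp only [hu0, hp0, norm_zero] at this
      norm_num at this
      linarith
    · have h1 := hEnn r ⟨hr.1.le, by linarith [hr.2]⟩
      rw [coefB_inner hσ hlam hk2 hr.1 hr.2.le, sigRad, if_pos hr.2.le]
      have h2 : (σa * n) ^ 2 / (r * σa) - σa * (1 / r * ((n : ℝ) ^ 2 - (k * r) ^ 2))
        = σa * k ^ 2 * r := by have := hr.1; field_simp; ring
      rw [h2]
      have := hr.1
      positivity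
  set C := max 1 σa with hC
  have hC1 : 1 ≤ C := le_max_left _ _
  have hCσ : σa ≤ C := le_max_right _ _
  have hQout : ‖p 3‖ ^ 2 ≤ (C * n) ^ 2 * ‖u 3‖ ^ 2 := by
    have := le_of_hasDerivAt_nonneg_off (f := fun r => (C * n) ^ 2 * ‖u r‖ ^ 2 - ‖p r‖ ^ 2)
      (a := R) (b := 3) hR2 (by linarith)
      ((hcont _).mono (Set.Icc_subset_Icc_left (by linarith)))
      (fun r hr h1 h2 => hsq ⟨by linarith [hr.1], hr.2⟩ h1 h2) (fun r hr _ _ => ?_)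
    · have h1 : (σa * n) ^ 2 * ‖u R‖ ^ 2 ≤ (C * n) ^ 2 * ‖u R‖ ^ 2 := by
        rw [mul_pow, mul_pow]
        gcongr
      linarith
    · have h1 := hEnn r ⟨by linarith [hr.1], by linarith [hr.2]⟩
      have h0 : 0 < r := by linarith [hr.1]
      have h4 := hA r h0
      rw [coefB_outer hR hr.1, preRadius'_div hR hr.1 (σa := σa)]
      have h2 : (C * n) ^ 2 / (r * sigRad σa R r)
          - 1 / (r * sigRad σa R r) * ((n : ℝ) ^ 2 - (ω * preRadius r) ^ 2)
        = ((C ^ 2 - 1) * n ^ 2 + (ω * preRadius r) ^ 2) / (r * sigRad σa R r) := by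
        field_simp; ring
      rw [h2]
      have h3 : 0 ≤ C ^ 2 - 1 := by nlinarith
      positivity
  have hflux : ‖p 3‖ ≤ C * n.natAbs * ‖u 3‖ := by
    refine le_of_sq_le_sq ?_ (by positivity)
    rw [mul_pow, mul_pow, natAbs_cast_sq, ← mul_pow]
    exact hQout
  have hE3 : E 3 ≤ C * n.natAbs * ‖u 3‖ ^ 2 := by
    calc E 3 ≤ ‖u 3‖ * ‖p 3‖ := real_inner_le_norm _ _
      _ ≤ ‖u 3‖ * (C * n.natAbs * ‖u 3‖) := by gcongr
      _ = _ := by ring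
  have piece (a b : ℝ) (ha : 0 ≤ a) (hab : a ≤ b) (hb : b ≤ 3)
      (hex : ∀ r ∈ Ioo a b, r ≠ R ∧ r ≠ 2) :=
    integrableOn_of_hasDerivAt_nonneg (f := E) (f' := energyDensity ω σa lam R n u p) hab
      (hE.mono (Set.Icc_subset_Icc ha hb))
      (fun r hr => h.hasDerivAt_inner ⟨ha.trans_lt hr.1, hr.2.trans_le hb⟩ (hex r hr).1 (hex r hr).2)
      (fun r hr => he r ⟨ha.trans_lt hr.1, hr.2.le.trans hb⟩)
  obtain ⟨i1, e1⟩ := piece 0 R le_rfl (by linarith) (by linarith)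
    fun r hr => ⟨hr.2.ne, by linarith [hr.2]⟩
  obtain ⟨i2, e2⟩ := piece R 2 (by linarith) hR2.le (by norm_num) fun r hr => ⟨hr.1.ne', hr.2.ne⟩
  obtain ⟨i3, e3⟩ := piece 2 3 (by norm_num) (by norm_num) le_rfl
    fun r hr => ⟨by linarith [hr.1], hr.1.ne'⟩
  have u12 : Ioc 0 R ∪ Ioc R 2 = Ioc 0 2 :=
    Set.Ioc_union_Ioc_eq_Ioc (by linarith) hR2.le
  have u123 : Ioc (0 : ℝ) 2 ∪ Ioc 2 3 = Ioc 0 3 :=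
    Set.Ioc_union_Ioc_eq_Ioc (by norm_num) (by norm_num)
  have i12 := i1.union i2
  rw [u12] at i12
  have i123 := i12.union i3
  rw [u123] at i123
  refine ⟨i123, ?_⟩
  rw [← u123, setIntegral_union (Set.Ioc_disjoint_Ioc_of_le le_rfl) measurableSet_Ioc i12 i3, ← u12,
    setIntegral_union (Set.Ioc_disjoint_Ioc_of_le le_rfl) measurableSet_Ioc i1 i2, e1, e2, e3, hE0]
  linarith

end ModeSol

end

end

noncomputable section

open scoped ContDiff

/-! ### Weak derivatives on an interval -/

lemma exists_Icc_of_tsupport_subset {ζ : ℝ → ℝ} {a b : ℝ} (hab : a < b) (hc : HasCompactSupport ζ)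
    (hs : tsupport ζ ⊆ Ioo a b) :
    ∃ c d, a < c ∧ c ≤ d ∧ d < b ∧ ∀ r, r ∉ Icc c d → ζ r = 0 := by
  rcases (tsupport ζ).eq_empty_or_nonempty with h | h
  · refine ⟨(a + b) / 2, (a + b) / 2, by linarith, le_rfl, by linarith, fun r _ => ?_⟩
    exact image_eq_zero_of_notMem_tsupport (by rw [h]; exact Set.notMem_empty r)
  · have hK : IsCompact (tsupport ζ) := hc
    obtain ⟨c, hc1, hc2⟩ := hK.exists_isLeast h
    obtain ⟨d, hd1, hd2⟩ := hK.exists_isGreatest h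
    refine ⟨c, d, (hs hc1).1, hc2 hd1, (hs hd1).2, fun r hr => ?_⟩
    exact image_eq_zero_of_notMem_tsupport fun hr' => hr ⟨hc2 hr', hd2 hr'⟩

lemma exists_lt_of_tsupport_subset_Ioi {ζ : ℝ → ℝ} (hc : HasCompactSupport ζ)
    (hs : tsupport ζ ⊆ Ioi 0) : ∃ ε, 0 < ε ∧ ε < 1 ∧ ∀ r ≤ ε, ζ r = 0 := by
  rcases (tsupport ζ).eq_empty_or_nonempty with h | h
  · exact ⟨1 / 2, by norm_num, by norm_num, fun r _ => image_eq_zero_of_notMem_tsupport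
      (by rw [h]; exact Set.notMem_empty r)⟩
  · have hK : IsCompact (tsupport ζ) := hc
    obtain ⟨c, hc1, hc2⟩ := hK.exists_isLeast h
    have hc0 : 0 < c := hs hc1
    refine ⟨min (c / 2) (1 / 2), by positivity, ?_, fun r hr => ?_⟩
    · exact lt_of_le_of_lt (min_le_right _ _) (by norm_num)
    · refine image_eq_zero_of_notMem_tsupport fun hr' => ?_
      have := hc2 hr'
      have := hr.trans (min_le_left _ _)
      linarith

/-- Integration by parts against the primitive of an integrable function that vanishes at `3`. -/
lemma integral_primitive_mul_deriv {g : ℝ → ℂ}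
    (hg : ∀ ε : ℝ, 0 < ε → IntegrableOn g (Ioo ε 3)) {ζ : ℝ → ℝ} (hζ : ContDiff ℝ ∞ ζ)
    (hc : HasCompactSupport ζ) (hs : tsupport ζ ⊆ Ioi 0) :
    ∫ r in Ioo (0 : ℝ) 3, (∫ s in r..3, g s) * ((deriv ζ r : ℝ) : ℂ)
      = ∫ r in Ioo (0 : ℝ) 3, g r * (ζ r : ℂ) := by
  obtain ⟨ε, hε, hε1, hz⟩ := exists_lt_of_tsupport_subset_Ioi hc hs
  have hcd : Continuous (deriv ζ) := hζ.continuous_deriv (by simp)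
  have hz' : ∀ r < ε, deriv ζ r = 0 := fun r hr => by
    have : ζ =ᶠ[𝓝 r] fun _ => 0 := by
      filter_upwards [Iio_mem_nhds hr] with y hy using hz y (le_of_lt hy)
    rw [this.deriv_eq]; simp
  -- both integrands vanish below `ε`
  have red (f : ℝ → ℂ) (hf : ∀ r < ε, f r = 0) :
      ∫ r in Ioo (0 : ℝ) 3, f r = ∫ r in Ioo (ε / 2) 3, f r := by
    refine setIntegral_eq_of_subset_of_forall_sdiff_eq_zero measurableSet_Ioo
      (Set.Ioo_subset_Ioo_left (by linarith)) fun r hr => hf r ?_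
    by_contra h
    exact hr.2 ⟨by linarith [not_lt.1 h], hr.1.2⟩
  rw [red _ fun r hr => by rw [hz' r hr]; simp, red _ fun r hr => by rw [hz r hr.le]; simp]
  set μ := volume.restrict (Ioo (ε / 2) 3) with hμ
  have hgi : Integrable g μ := hg _ (by positivity)
  have hζi : Integrable (fun r => ((deriv ζ r : ℝ) : ℂ)) μ :=
    ((Complex.continuous_ofReal.comp hcd).integrableOn_Icc (a := ε / 2) (b := 3)).mono_set
      Set.Ioo_subset_Icc_self
  set F : ℝ × ℝ → ℂ := fun q => {q : ℝ × ℝ | q.1 < q.2}.indicator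
    (fun q => ((deriv ζ q.1 : ℝ) : ℂ) * g q.2) q with hF
  have hmeas : MeasurableSet {q : ℝ × ℝ | q.1 < q.2} :=
    measurableSet_lt measurable_fst measurable_snd
  have hFi : Integrable F (μ.prod μ) := (hζi.mul_prod hgi).indicator hmeas
  have hswap := integral_integral_swap (f := fun r s => F (r, s)) hFi
  have h1 : ∫ r, ∫ s, F (r, s) ∂μ ∂μ = ∫ r, (∫ s in r..3, g s) * ((deriv ζ r : ℝ) : ℂ) ∂μ := by
    refine setIntegral_congr_fun measurableSet_Ioo fun r hr => ?_
    have e : (fun s => F (r, s)) = (Ioi r).indicator (fun s => ((deriv ζ r : ℝ) : ℂ) * g s) := by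
      funext s; simp [hF, Set.indicator]
    simp only [e]
    rw [hμ, setIntegral_indicator measurableSet_Ioi, integral_const_mul, mul_comm,
      intervalIntegral.integral_of_le hr.2.le, ← integral_Ioc_eq_integral_Ioo.symm]
    congr 1
    have : Ioo (ε / 2) 3 ∩ Ioi r = Ioo r 3 := by
      ext s; simp only [Set.mem_inter_iff, Set.mem_Ioo, Set.mem_Ioi]
      constructor
      · rintro ⟨⟨_, h2⟩, h3⟩; exact ⟨h3, h2⟩
      · rintro ⟨h1, h2⟩; exact ⟨⟨hr.1.trans h1, h2⟩, h1⟩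
    rw [this]
  have h2 : ∫ s, ∫ r, F (r, s) ∂μ ∂μ = ∫ s, g s * (ζ s : ℂ) ∂μ := by
    refine setIntegral_congr_fun measurableSet_Ioo fun s hs => ?_
    have e : (fun r => F (r, s)) = (Iio s).indicator (fun r => ((deriv ζ r : ℝ) : ℂ) * g s) := by
      funext r; simp [hF, Set.indicator]
    simp only [e]
    rw [hμ, setIntegral_indicator measurableSet_Iio, integral_mul_const, mul_comm]
    congr 1
    have : Ioo (ε / 2) 3 ∩ Iio s = Ioo (ε / 2) s := by
      ext r; simp only [Set.mem_inter_iff, Set.mem_Ioo, Set.mem_Iio]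
      constructor
      · rintro ⟨⟨h1, _⟩, h3⟩; exact ⟨h1, h3⟩
      · rintro ⟨h1, h2⟩; exact ⟨⟨h1, h2.trans hs.2⟩, h2⟩
    rw [this, integral_complex_ofReal]
    congr 1
    rw [← integral_Ioc_eq_integral_Ioo, ← intervalIntegral.integral_of_le hs.1.le,
      intervalIntegral.integral_deriv_eq_sub
        (fun y _ => (hζ.differentiable (by simp)).differentiableAt)
        (hcd.intervalIntegrable _ _), hz (ε / 2) (by linarith), sub_zero]
  rw [← h1, ← h2, hswap]

lemma exists_primitive {ψ : ℝ → ℝ} (hψ : ContDiff ℝ ∞ ψ) (hc : HasCompactSupport ψ)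
    (hs : tsupport ψ ⊆ Ioo 0 3) (h0 : ∫ r, ψ r = 0) :
    ∃ ζ : ℝ → ℝ, ContDiff ℝ ∞ ζ ∧ HasCompactSupport ζ ∧ tsupport ζ ⊆ Ioo 0 3 ∧
      deriv ζ = ψ := by
  obtain ⟨c, d, hc0, hcd, hd3, hz⟩ := exists_Icc_of_tsupport_subset (by norm_num) hc hs
  set ζ : ℝ → ℝ := fun r => ∫ s in (0 : ℝ)..r, ψ s
  have hd (r : ℝ) : HasDerivAt ζ (ψ r) r := intervalIntegral.integral_hasDerivAt_right
    (hψ.continuous.intervalIntegrable _ _) (hψ.continuous.stronglyMeasurableAtFilter _ _)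
    hψ.continuous.continuousAt
  have hdz : deriv ζ = ψ := funext fun r => (hd r).deriv
  have hsupp : Function.support ζ ⊆ Icc c d := by
    intro r hr
    by_contra hr'
    apply hr
    rcases lt_or_ge r c with h | h
    · refine intervalIntegral.integral_zero_ae (Eventually.of_forall fun s hs => ?_) |>.trans rfl
      refine hz s fun hs' => ?_
      have := hs.2
      rcases le_max_iff.1 this with h1 | h1 <;> linarith [hs'.1]
    · have h' : d < r := by
        by_contra h''
        exact hr' ⟨h, not_lt.1 h''⟩
      have : ∫ s in (0 : ℝ)..r, ψ s = ∫ s, ψ s := by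
        refine intervalIntegral.integral_eq_integral_of_support_subset fun s hs => ?_
        by_contra hs'
        refine hs (hz s fun hs'' => hs' ⟨by linarith [hs''.1], by linarith [hs''.2]⟩)
      change ∫ s in (0 : ℝ)..r, ψ s = 0
      rw [this, h0]
  have hts : tsupport ζ ⊆ Icc c d := closure_minimal hsupp isClosed_Icc
  refine ⟨ζ, contDiff_infty_iff_deriv.2 ⟨fun r => (hd r).differentiableAt, hdz ▸ hψ⟩,
    isCompact_Icc.of_isClosed_subset (isClosed_tsupport _) hts, fun r hr => ?_, hdz⟩
  exact ⟨hc0.trans_le (hts hr).1, (hts hr).2.trans_lt hd3⟩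

lemma exists_bump {a b : ℝ} (hab : a < b) : ∃ η : ℝ → ℝ, ContDiff ℝ ∞ η ∧ HasCompactSupport η ∧
    tsupport η ⊆ Ioo a b ∧ ∫ r, η r = 1 := by
  set f : ContDiffBump ((a + b) / 2 : ℝ) := ⟨(b - a) / 8, (b - a) / 4, by linarith, by linarith⟩
  refine ⟨f.normed volume, f.contDiff_normed, f.hasCompactSupport_normed, ?_, f.integral_normed⟩
  rw [f.tsupport_normed_eq, Real.closedBall_eq_Icc]
  intro r hr
  simp only [f] at hr
  constructor <;> linarith [hr.1, hr.2]

lemma locallyIntegrableOn_of_forall {u : ℝ → ℂ}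
    (hu : ∀ ε : ℝ, 0 < ε → IntegrableOn u (Ioo ε 3)) :
    LocallyIntegrableOn u (Ioo 0 3) := by
  intro x hx
  refine ⟨Ioo (x / 2) 3, ?_, hu _ (by linarith [hx.1])⟩
  exact mem_nhdsWithin_of_mem_nhds (Ioo_mem_nhds (by linarith [hx.1]) hx.2)

lemma integrableOn_mul_of_tsupport {u : ℝ → ℂ}
    (hu : ∀ ε : ℝ, 0 < ε → IntegrableOn u (Ioo ε 3)) {ζ : ℝ → ℝ} (hζ : Continuous ζ) {ε : ℝ}
    (hε : 0 < ε) (hz : ∀ r ≤ ε, ζ r = 0) :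
    IntegrableOn (fun r => u r * (ζ r : ℂ)) (Ioo 0 3) := by
  have h1 : IntegrableOn (fun r => u r * (ζ r : ℂ)) (Ioo (ε / 2) 3) := by
    obtain ⟨C, hC⟩ := isCompact_Icc.exists_bound_of_continuousOn
      (s := Icc (ε / 2) 3) hζ.continuousOn
    refine Integrable.mul_bdd (c := C) (hu _ (by positivity))
      (Complex.continuous_ofReal.comp hζ).aestronglyMeasurable ?_
    refine (ae_restrict_iff' measurableSet_Ioo).2 (Eventually.of_forall fun r hr => ?_)
    simpa using hC r ⟨hr.1.le, hr.2.le⟩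
  have h2 : IntegrableOn (fun r => u r * (ζ r : ℂ)) (Ioc 0 (ε / 2)) :=
    (integrableOn_zero (ε' := ℂ)).congr_fun (fun r hr => by
      rw [hz r (by linarith [hr.2])]; simp) measurableSet_Ioc
  refine (h2.union h1).mono_set fun r hr => ?_
  rcases le_or_gt r (ε / 2) with h | h
  · exact Or.inl ⟨hr.1, h⟩
  · exact Or.inr ⟨h, hr.2⟩

lemma primitive_integrableOn {g : ℝ → ℂ}
    (hg : ∀ ε : ℝ, 0 < ε → IntegrableOn g (Ioo ε 3)) :
    ContinuousOn (fun r => ∫ s in r..3, g s) (Ioc 0 3) := by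
  intro r hr
  have h1 : IntegrableOn g (Set.uIcc (r / 2) 3) := by
    rw [Set.uIcc_of_le (by linarith [hr.1, hr.2]), integrableOn_Icc_iff_integrableOn_Ioo]
    exact hg _ (by linarith [hr.1])
  have := intervalIntegral.continuousOn_primitive_interval_left h1
  rw [Set.uIcc_of_le (by linarith [hr.1, hr.2])] at this
  refine (this r ⟨by linarith [hr.1], hr.2⟩).mono_of_mem_nhdsWithin ?_
  filter_upwards [self_mem_nhdsWithin,
    mem_nhdsWithin_of_mem_nhds (Ioi_mem_nhds (show r / 2 < r by linarith [hr.1]))] with y hy hy2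
  exact ⟨le_of_lt hy2, hy.2⟩

lemma continuousOn_integrableOn {g : ℝ → ℂ} (hg : ContinuousOn g (Ioc 0 3)) (ε : ℝ)
    (hε : 0 < ε) : IntegrableOn g (Ioo ε 3) :=
  ((hg.mono (fun _ hr => ⟨hε.trans_le hr.1, hr.2⟩)).integrableOn_Icc).mono_set
    Set.Ioo_subset_Icc_self

/-- A function on `(0, 3)` with integrable weak derivative `g` is a primitive of `g`. -/
lemma ae_eq_primitive {u g : ℝ → ℂ}
    (hu : ∀ ε : ℝ, 0 < ε → IntegrableOn u (Ioo ε 3))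
    (hg : ∀ ε : ℝ, 0 < ε → IntegrableOn g (Ioo ε 3))
    (h : ∀ ζ : ℝ → ℝ, ContDiff ℝ ∞ ζ → HasCompactSupport ζ → tsupport ζ ⊆ Ioo 0 3 →
      ∫ r in Ioo (0 : ℝ) 3, (u r * ((deriv ζ r : ℝ) : ℂ) + g r * (ζ r : ℂ)) = 0) :
    ∃ c : ℂ, ∀ᵐ r, r ∈ Ioo (0 : ℝ) 3 → u r = c - ∫ s in r..3, g s := by
  set w : ℝ → ℂ := fun r => u r + ∫ s in r..3, g s with hw
  have hwi : ∀ ε : ℝ, 0 < ε → IntegrableOn w (Ioo ε 3) := fun ε hε =>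
    (hu ε hε).add (continuousOn_integrableOn (primitive_integrableOn hg) ε hε)
  have hI (v : ℝ → ℂ) (hv : ∀ ε : ℝ, 0 < ε → IntegrableOn v (Ioo ε 3)) (ζ : ℝ → ℝ)
      (hζ : Continuous ζ) (hc : HasCompactSupport ζ) (hs : tsupport ζ ⊆ Ioo 0 3) :
      IntegrableOn (fun r => v r * (ζ r : ℂ)) (Ioo 0 3) := by
    obtain ⟨ε, hε, -, hz⟩ := exists_lt_of_tsupport_subset_Ioi hc (hs.trans Set.Ioo_subset_Ioi_self)
    exact integrableOn_mul_of_tsupport hv hζ hε hz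
  have key (ζ : ℝ → ℝ) (hζ : ContDiff ℝ ∞ ζ) (hc : HasCompactSupport ζ)
      (hs : tsupport ζ ⊆ Ioo 0 3) :
      ∫ r in Ioo (0 : ℝ) 3, w r * ((deriv ζ r : ℝ) : ℂ) = 0 := by
    have hcd : Continuous (deriv ζ) := hζ.continuous_deriv (by simp)
    have hs' : tsupport (deriv ζ) ⊆ Ioo 0 3 := (tsupport_deriv_subset (f := ζ)).trans hs
    have h1 := h ζ hζ hc hs
    rw [integral_add (hI u hu _ hcd hc.deriv hs') (hI g hg _ hζ.continuous hc hs),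
      ← integral_primitive_mul_deriv hg hζ hc (hs.trans Set.Ioo_subset_Ioi_self),
      ← integral_add (hI u hu _ hcd hc.deriv hs') (hI _ (continuousOn_integrableOn
        (primitive_integrableOn hg)) _ hcd hc.deriv hs')] at h1
    rw [← h1]
    refine integral_congr_ae (Eventually.of_forall fun r => ?_)
    simp only [hw]; ring
  obtain ⟨η, hη, hηc, hηs, hη1⟩ := exists_bump (show (0 : ℝ) < 3 by norm_num)
  set c : ℂ := ∫ r in Ioo (0 : ℝ) 3, w r * (η r : ℂ) with hcdef
  refine ⟨c, ?_⟩
  have hae : ∀ᵐ r, r ∈ Ioo (0 : ℝ) 3 → w r - c = 0 := by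
    refine isOpen_Ioo.ae_eq_zero_of_integral_contDiff_smul_eq_zero ?_ fun ψ hψ hψc hψs => ?_
    · exact (locallyIntegrableOn_of_forall hwi).sub
        (locallyIntegrableOn_of_forall (u := fun _ => c) fun ε _ => by simp)
    · set a := ∫ r, ψ r with ha
      have hdiff : ContDiff ℝ ∞ (fun r => ψ r - a * η r) := hψ.sub (contDiff_const.mul hη)
      have hsuppd : tsupport (fun r => ψ r - a * η r) ⊆ Ioo 0 3 := by
        refine (tsupport_sub ψ (fun r => a * η r)).trans (Set.union_subset hψs ?_)
        exact (tsupport_mul_subset_right (f := fun _ => a) (g := η)).trans hηs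
      have hcd : HasCompactSupport (fun r => ψ r - a * η r) := hψc.sub (hηc.mul_left (f := fun _ => a))
      have hint0 : ∫ r, (ψ r - a * η r) = 0 := by
        rw [integral_sub (hψ.continuous.integrable_of_hasCompactSupport hψc)
          ((hη.continuous.integrable_of_hasCompactSupport hηc).const_mul a), integral_const_mul,
          hη1, ← ha]
        ring
      obtain ⟨ζ, hζ, hζc, hζs, hζd⟩ := exists_primitive hdiff hcd hsuppd hint0
      have hk := key ζ hζ hζc hζs
      rw [hζd] at hk
      have i1 := hI w hwi ψ hψ.continuous hψc hψs
      have i2 := hI w hwi η hη.continuous hηc hηs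
      have hk2 : ∫ r in Ioo (0 : ℝ) 3, w r * (ψ r : ℂ) = a * c := by
        have : ∫ r in Ioo (0 : ℝ) 3, (w r * (ψ r : ℂ) - a * (w r * (η r : ℂ))) = 0 := by
          rw [← hk]
          refine integral_congr_ae (Eventually.of_forall fun r => ?_)
          push_cast; ring
        rw [integral_sub i1 (i2.const_mul _), integral_const_mul] at this
        linear_combination this
      have hψ0 : ∀ r, r ∉ Ioo (0 : ℝ) 3 → ψ r = 0 := fun r hr =>
        image_eq_zero_of_notMem_tsupport fun h => hr (hψs h)
      have e1 : ∫ r, ψ r • (w r - c) = ∫ r in Ioo (0 : ℝ) 3, ψ r • (w r - c) :=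
        (setIntegral_eq_integral_of_forall_compl_eq_zero fun r hr => by simp [hψ0 r hr]).symm
      have e2 : ∫ r in Ioo (0 : ℝ) 3, (ψ r : ℂ) = a := by
        rw [setIntegral_eq_integral_of_forall_compl_eq_zero fun r hr => by simp [hψ0 r hr],
          integral_complex_ofReal]
      have e3 : ∫ r in Ioo (0 : ℝ) 3, ψ r • (w r - c)
          = ∫ r in Ioo (0 : ℝ) 3, (w r * (ψ r : ℂ) - (ψ r : ℂ) * c) :=
        integral_congr_ae (Eventually.of_forall fun r => by
          simp only [Complex.real_smul]; ring)
      rw [e1, e3, integral_sub i1, integral_mul_const, hk2, e2, sub_self]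
      exact ((Complex.continuous_ofReal.comp hψ.continuous).integrable_of_hasCompactSupport
        (hψc.comp_left (by simp))).integrableOn.mul_const c
  filter_upwards [hae] with r hr hr'
  have := hr hr'
  simp only [hw] at this
  linear_combination this

lemma exists_cutoff : ∃ ζ : ℝ → ℝ, ContDiff ℝ ∞ ζ ∧ HasCompactSupport ζ ∧ tsupport ζ ⊆ Ioi 0 ∧
    ζ 3 = 1 := by
  set f : ContDiffBump (3 : ℝ) := ⟨1, 2, by norm_num, by norm_num⟩
  refine ⟨f, f.contDiff, f.hasCompactSupport, ?_, f.one_of_mem_closedBall (by simp [f])⟩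
  rw [f.tsupport_eq, Real.closedBall_eq_Icc]
  intro r hr
  have : (3 : ℝ) - 2 ≤ r := hr.1
  exact Set.mem_Ioi.2 (by linarith)

/-- Version of `ae_eq_primitive` with a prescribed boundary value at the right end point. -/
lemma ae_eq_primitive_of_bdry {u g : ℝ → ℂ} {F : ℂ}
    (hu : ∀ ε : ℝ, 0 < ε → IntegrableOn u (Ioo ε 3))
    (hg : ∀ ε : ℝ, 0 < ε → IntegrableOn g (Ioo ε 3))
    (h : ∀ ζ : ℝ → ℝ, ContDiff ℝ ∞ ζ → HasCompactSupport ζ → tsupport ζ ⊆ Ioi 0 →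
      ∫ r in Ioo (0 : ℝ) 3, (u r * ((deriv ζ r : ℝ) : ℂ) + g r * (ζ r : ℂ)) = ζ 3 * F) :
    ∀ᵐ r, r ∈ Ioo (0 : ℝ) 3 → u r = F - ∫ s in r..3, g s := by
  obtain ⟨c, hc⟩ := ae_eq_primitive hu hg fun ζ hζ hζc hζs => by
    rw [h ζ hζ hζc (hζs.trans Set.Ioo_subset_Ioi_self),
      image_eq_zero_of_notMem_tsupport (f := ζ) (x := 3) fun h3 => (hζs h3).2.false]
    simp
  suffices hcF : c = F by rw [← hcF]; exact hc
  obtain ⟨ζ, hζ, hζc, hζs, hζ3⟩ := exists_cutoff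
  obtain ⟨ε, hε, hε1, hz⟩ := exists_lt_of_tsupport_subset_Ioi hζc hζs
  have hcd : Continuous (deriv ζ) := hζ.continuous_deriv (by simp)
  have hz' : ∀ r ≤ ε / 2, deriv ζ r = 0 := fun r hr => by
    have : ζ =ᶠ[𝓝 r] fun _ => 0 := by
      filter_upwards [Iio_mem_nhds (show r < ε by linarith)] with y hy using hz y (le_of_lt hy)
    rw [this.deriv_eq]; simp
  have h1 := h ζ hζ hζc hζs
  have i1 := integrableOn_mul_of_tsupport hg hζ.continuous hε hz
  have i2 := integrableOn_mul_of_tsupport (continuousOn_integrableOn (primitive_integrableOn hg))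
    hcd (half_pos hε) hz'
  have i3 := integrableOn_mul_of_tsupport (u := fun _ => c) (fun ε _ => by simp)
    hcd (half_pos hε) hz'
  have e1 : ∫ r in Ioo (0 : ℝ) 3, (u r * ((deriv ζ r : ℝ) : ℂ) + g r * (ζ r : ℂ))
      = ∫ r in Ioo (0 : ℝ) 3, ((c * ((deriv ζ r : ℝ) : ℂ) - (∫ s in r..3, g s) * ((deriv ζ r : ℝ) : ℂ))
        + g r * (ζ r : ℂ)) := by
    refine integral_congr_ae ((ae_restrict_iff' measurableSet_Ioo).2 ?_)
    filter_upwards [hc] with r hr hr'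
    rw [hr hr']; ring
  have e2 : ∫ r in Ioo (0 : ℝ) 3, c * ((deriv ζ r : ℝ) : ℂ) = c := by
    rw [integral_const_mul, integral_complex_ofReal, ← integral_Ioc_eq_integral_Ioo,
      ← intervalIntegral.integral_of_le (by norm_num),
      intervalIntegral.integral_deriv_eq_sub
        (fun y _ => (hζ.differentiable (by simp)).differentiableAt)
        (hcd.intervalIntegrable _ _), hz 0 hε.le, hζ3]
    simp
  have i32 : IntegrableOn (fun r => c * ((deriv ζ r : ℝ) : ℂ)
      - (∫ s in r..3, g s) * ((deriv ζ r : ℝ) : ℂ)) (Ioo 0 3) := i3.sub i2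
  rw [e1, integral_add i32 i1, integral_sub i3 i2, e2,
    integral_primitive_mul_deriv hg hζ hζc hζs, hζ3] at h1
  simpa using h1

end

noncomputable section

section

variable {ω σa lam R : ℝ}

lemma measurable_sigRad : Measurable (sigRad σa R) :=
  Measurable.ite measurableSet_Iic measurable_const
    (Measurable.ite measurableSet_Iic (by fun_prop) measurable_const)

lemma measurable_sigTan : Measurable (sigTan σa R) :=
  Measurable.ite measurableSet_Iic measurable_const
    (Measurable.ite measurableSet_Iic (by fun_prop) measurable_const)

lemma measurable_lamRad : Measurable (lamRad lam R) :=
  Measurable.ite measurableSet_Iic measurable_const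
    (Measurable.ite measurableSet_Iic (by fun_prop) measurable_const)

lemma measurable_coefB (n : ℤ) : Measurable (coefB ω σa lam R n) := by
  have h1 := measurable_sigTan (σa := σa) (R := R)
  have h2 := measurable_lamRad (lam := lam) (R := R)
  unfold coefB
  fun_prop

/-- On each of the three pieces, `coefB` and `sigRad` agree with continuous functions. -/
lemma continuousAt_coef (hlam : 0 < lam) (hR : 1 < R) (n : ℤ) {r : ℝ} (hr : 0 < r) (h1 : r ≠ R)
    (h2 : r ≠ 2) : ContinuousAt (sigRad σa R) r ∧ ContinuousAt (coefB ω σa lam R n) r := by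
  have hr0 : r ≠ 0 := hr.ne'
  rcases lt_or_gt_of_ne h1 with h | h
  · have e1 : sigRad σa R =ᶠ[𝓝 r] fun _ => σa := by
      filter_upwards [Iio_mem_nhds h] with y hy
      rw [sigRad, if_pos (le_of_lt hy)]
    have e2 : coefB ω σa lam R n =ᶠ[𝓝 r] fun y => n ^ 2 * σa / y - ω ^ 2 * y / lam := by
      filter_upwards [Iio_mem_nhds h] with y hy
      rw [coefB, sigTan, lamRad, if_pos (le_of_lt hy), if_pos (le_of_lt hy)]
    refine ⟨continuousAt_const.congr e1.symm, ContinuousAt.congr ?_ e2.symm⟩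
    fun_prop (disch := first | exact hr0 | exact hlam.ne')
  · rcases lt_or_gt_of_ne h2 with h' | h'
    · have hr1 : r - 1 ≠ 0 := by linarith
      have e1 : sigRad σa R =ᶠ[𝓝 r] fun y => (y - 1) / y := by
        filter_upwards [Iio_mem_nhds h', Ioi_mem_nhds h] with y hy hy'
        rw [sigRad, if_neg (not_le.2 hy'), if_pos (le_of_lt hy)]
      have e2 : coefB ω σa lam R n =ᶠ[𝓝 r]
          fun y => n ^ 2 * (y / (y - 1)) / y - ω ^ 2 * y / (y / (4 * (y - 1))) := by
        filter_upwards [Iio_mem_nhds h', Ioi_mem_nhds h] with y hy hy'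
        rw [coefB, sigTan, lamRad, if_neg (not_le.2 hy'), if_pos (le_of_lt hy),
          if_neg (not_le.2 hy'), if_pos (le_of_lt hy)]
      refine ⟨ContinuousAt.congr ?_ e1.symm, ContinuousAt.congr ?_ e2.symm⟩
      · fun_prop (disch := exact hr0)
      · have h3 : 4 * (r - 1) ≠ 0 := by simpa using hr1
        have h4 : r / (4 * (r - 1)) ≠ 0 := div_ne_zero hr0 h3
        fun_prop (disch := assumption)
    · have e1 : sigRad σa R =ᶠ[𝓝 r] fun _ => 1 := by
        filter_upwards [Ioi_mem_nhds h', Ioi_mem_nhds h] with y hy hy'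
        rw [sigRad, if_neg (not_le.2 hy'), if_neg (not_le.2 hy)]
      have e2 : coefB ω σa lam R n =ᶠ[𝓝 r] fun y => n ^ 2 * 1 / y - ω ^ 2 * y / 1 := by
        filter_upwards [Ioi_mem_nhds h', Ioi_mem_nhds h] with y hy hy'
        rw [coefB, sigTan, lamRad, if_neg (not_le.2 hy'), if_neg (not_le.2 hy),
          if_neg (not_le.2 hy'), if_neg (not_le.2 hy)]
      refine ⟨continuousAt_const.congr e1.symm, ContinuousAt.congr ?_ e2.symm⟩
      fun_prop (disch := exact hr0)

lemma sigTan_le (hσ : 0 < σa) (hR : 1 < R) (r : ℝ) :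
    sigTan σa R r ≤ σa + 2 / (R - 1) + 1 := by
  have h0 : 0 < 2 / (R - 1) := div_pos two_pos (by linarith)
  rw [sigTan]
  split_ifs with h1 h2
  · linarith
  · have : r / (r - 1) ≤ 2 / (R - 1) := div_le_div₀ (by norm_num) h2 (by linarith) (by linarith)
    linarith
  · linarith

lemma inv_lamRad_le (hlam : 0 < lam) (hR : 1 < R) {r : ℝ} (hr : 0 < r) :
    0 < lamRad lam R r ∧ 1 / lamRad lam R r ≤ 1 / lam + 4 := by
  have h0 : 0 < 1 / lam := by positivity
  rw [lamRad]
  split_ifs with h1 h2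
  · exact ⟨hlam, by linarith⟩
  · have h3 : 0 < r - 1 := by linarith
    refine ⟨by positivity, ?_⟩
    have : 1 / (r / (4 * (r - 1))) ≤ 4 := by
      rw [one_div_div, div_le_iff₀ hr]; linarith
    linarith
  · exact ⟨one_pos, by norm_num; linarith [inv_pos.2 hlam]⟩

lemma abs_coefB_le (hσ : 0 < σa) (hlam : 0 < lam) (hR : 1 < R) (n : ℤ) {ε : ℝ} (hε : 0 < ε) :
    ∃ C, ∀ r ∈ Ioo ε 3, |coefB ω σa lam R n r| ≤ C := by
  refine ⟨n ^ 2 * (σa + 2 / (R - 1) + 1) / ε + ω ^ 2 * 3 * (1 / lam + 4), fun r hr => ?_⟩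
  have hr0 := hε.trans hr.1
  have h1 := sigTan_le hσ hR r (σa := σa)
  have h1' := sigTan_pos hσ hR hr0 (σa := σa)
  obtain ⟨h2, h3⟩ := inv_lamRad_le hlam hR hr0
  rw [coefB]
  refine (abs_sub _ _).trans ?_
  rw [abs_of_nonneg (by positivity), abs_of_nonneg (by positivity),
    div_eq_mul_one_div _ (lamRad lam R r)]
  have := hr.1.le
  have := hr.2.le
  gcongr

/-- A pair of functions that satisfies the radial system weakly agrees almost everywhere with a
solution of it. -/
lemma exists_modeSol_ae_eq (hσ : 0 < σa) (hlam : 0 < lam) (hR : 1 < R) (n : ℤ)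
    {U P : ℝ → ℂ} {F : ℂ}
    (hU : ∀ ε : ℝ, 0 < ε → IntegrableOn U (Ioo ε 3))
    (hP : ∀ ε : ℝ, 0 < ε → IntegrableOn P (Ioo ε 3))
    (hP' : ∀ ε : ℝ, 0 < ε →
      IntegrableOn (fun r => P r / (r * sigRad σa R r : ℝ)) (Ioo ε 3))
    (h1 : ∀ ζ : ℝ → ℝ, Smooth ζ → HasCompactSupport ζ → tsupport ζ ⊆ Ioi 0 →
      ∫ r in Ioo (0 : ℝ) 3, (U r * ((deriv ζ r : ℝ) : ℂ)
        + P r / (r * sigRad σa R r : ℝ) * (ζ r : ℂ)) = ζ 3 * F)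
    (h2 : ∀ ζ : ℝ → ℝ, Smooth ζ → HasCompactSupport ζ → tsupport ζ ⊆ Ioo 0 3 →
      ∫ r in Ioo (0 : ℝ) 3, (P r * ((deriv ζ r : ℝ) : ℂ)
        + (coefB ω σa lam R n r : ℝ) * U r * (ζ r : ℂ)) = 0) :
    ∃ u p : ℝ → ℂ, ModeSol ω σa lam R n u p ∧ u 3 = F ∧
      (∀ᵐ r, r ∈ Ioo (0 : ℝ) 3 → U r = u r) ∧ (∀ᵐ r, r ∈ Ioo (0 : ℝ) 3 → P r = p r) := by
  have hBU : ∀ ε : ℝ, 0 < ε →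
      IntegrableOn (fun r => (coefB ω σa lam R n r : ℝ) * U r) (Ioo ε 3) := by
    intro ε hε
    obtain ⟨C, hC⟩ := abs_coefB_le (ω := ω) hσ hlam hR n hε
    refine Integrable.bdd_mul (c := C) (hU ε hε)
      (Complex.measurable_ofReal.comp (measurable_coefB n)).aestronglyMeasurable ?_
    refine (ae_restrict_iff' measurableSet_Ioo).2 (Eventually.of_forall fun r hr => ?_)
    simpa using hC r hr
  have ha := ae_eq_primitive_of_bdry hU hP' h1
  obtain ⟨c, hc⟩ := ae_eq_primitive hP hBU h2
  set u : ℝ → ℂ := fun r => F - ∫ s in r..3, P s / (s * sigRad σa R s : ℝ) with hu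
  set p : ℝ → ℂ := fun r => c - ∫ s in r..3, (coefB ω σa lam R n s : ℝ) * U s with hp
  have hcu : ContinuousOn u (Ioc 0 3) := continuousOn_const.sub (primitive_integrableOn hP')
  have hcp : ContinuousOn p (Ioc 0 3) := continuousOn_const.sub (primitive_integrableOn hBU)
  -- the fundamental theorem of calculus at points of continuity of the integrand
  have hd (c : ℂ) (g g' : ℝ → ℂ) (hg : ∀ ε : ℝ, 0 < ε → IntegrableOn g (Ioo ε 3))
      (hgg : ∀ᵐ r, r ∈ Ioo (0 : ℝ) 3 → g r = g' r) (r : ℝ) (hr : r ∈ Ioo (0 : ℝ) 3)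
      (hg' : ∀ᶠ y in 𝓝 r, ContinuousAt g' y) :
      HasDerivAt (fun r => c - ∫ s in r..3, g s) (g' r) r := by
    have hi : IntervalIntegrable g' volume r 3 := by
      rw [intervalIntegrable_iff_integrableOn_Ioo_of_le hr.2.le]
      refine (hg r hr.1).congr_fun_ae ?_
      refine (ae_restrict_iff' measurableSet_Ioo).2 ?_
      filter_upwards [hgg] with y hy hy' using hy ⟨hr.1.trans hy'.1, hy'.2⟩
    obtain ⟨s, hs, hso, hrs⟩ := mem_nhds_iff.1 hg'
    have hm : StronglyMeasurableAtFilter g' (𝓝 r) :=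
      ContinuousOn.stronglyMeasurableAtFilter (s := s) hso
        (fun y hy => (hs hy).continuousWithinAt) r hrs
    have := (intervalIntegral.integral_hasDerivAt_left hi hm hg'.self_of_nhds).const_sub c
    rw [neg_neg] at this
    refine this.congr_of_eventuallyEq ?_
    filter_upwards [Ioo_mem_nhds hr.1 hr.2] with y hy
    congr 1
    refine intervalIntegral.integral_congr_ae ?_
    have h3 : ∀ᵐ s : ℝ, s ≠ 3 := by simp [ae_iff]
    filter_upwards [hgg, h3] with s hs hs3 hs'
    rw [Set.uIoc_of_le hy.2.le] at hs'
    exact hs ⟨hy.1.trans hs'.1, lt_of_le_of_ne hs'.2 hs3⟩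
  have hev {r : ℝ} (hr : r ∈ Ioo (0 : ℝ) 3) (h1 : r ≠ R) (h2 : r ≠ 2) :
      ∀ᶠ y in 𝓝 r, y ∈ Ioo (0 : ℝ) 3 ∧ y ≠ R ∧ y ≠ 2 := by
    filter_upwards [Ioo_mem_nhds hr.1 hr.2, isOpen_ne.mem_nhds h1, isOpen_ne.mem_nhds h2]
      with y a b c using ⟨a, b, c⟩
  refine ⟨u, p, ⟨hcu, hcp, fun r hr h1 h2 => ?_, fun r hr h1 h2 => ?_⟩, by simp [hu], ha, hc⟩
  · refine hd F _ (fun r => p r / (r * sigRad σa R r : ℝ)) hP' ?_ r hr ?_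
    · filter_upwards [hc] with s hs hs'
      rw [hs hs']
    · filter_upwards [hev hr h1 h2] with y hy
      have hs := (continuousAt_coef (ω := ω) (σa := σa) hlam hR n hy.1.1 hy.2.1 hy.2.2).1
      have hp' : ContinuousAt p y := (hcp y ⟨hy.1.1, hy.1.2.le⟩).continuousAt
        (mem_of_superset (Ioo_mem_nhds hy.1.1 hy.1.2) Set.Ioo_subset_Ioc_self)
      refine hp'.div ?_ ?_
      · exact Complex.continuous_ofReal.continuousAt.comp
          (f := fun y => y * sigRad σa R y) (continuousAt_id.mul hs)
      · exact_mod_cast (mul_pos hy.1.1 (sigRad_pos hσ hR hy.1.1)).ne'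
  · refine hd c _ (fun r => (coefB ω σa lam R n r : ℝ) * u r) hBU ?_ r hr ?_
    · filter_upwards [ha] with s hs hs'
      rw [hs hs']
    · filter_upwards [hev hr h1 h2] with y hy
      have hs := (continuousAt_coef (ω := ω) (σa := σa) hlam hR n hy.1.1 hy.2.1 hy.2.2).2
      have hu' : ContinuousAt u y := (hcu y ⟨hy.1.1, hy.1.2.le⟩).continuousAt
        (mem_of_superset (Ioo_mem_nhds hy.1.1 hy.1.2) Set.Ioo_subset_Ioc_self)
      exact (Complex.continuous_ofReal.continuousAt.comp hs).mul hu'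

end

end

noncomputable section

/-! ### Polar coordinates -/

lemma polar_apply_zero (r θ : ℝ) : polar r θ 0 = r * Real.cos θ := rfl
lemma polar_apply_one (r θ : ℝ) : polar r θ 1 = r * Real.sin θ := rfl

lemma norm_polar (r θ : ℝ) : ‖polar r θ‖ = |r| := by
  rw [EuclideanSpace.norm_eq, Fin.sum_univ_two, polar_apply_zero, polar_apply_one,
    ← Real.sqrt_sq_eq_abs]
  congr 1
  simp only [Real.norm_eq_abs, sq_abs]
  linear_combination r ^ 2 * Real.sin_sq_add_cos_sq θ

lemma norm_polar_of_pos {r : ℝ} (hr : 0 < r) (θ : ℝ) : ‖polar r θ‖ = r := by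
  rw [norm_polar, abs_of_pos hr]

lemma continuous_polar : Continuous fun p : ℝ × ℝ => polar p.1 p.2 := by
  refine (PiLp.continuous_toLp 2 _).comp (continuous_pi fun i => ?_)
  fin_cases i <;> simp <;> fun_prop

lemma measurePreserving_prod_plane :
    MeasurePreserving (fun q : ℝ × ℝ => (!₂[q.1, q.2] : Plane)) := by
  have h1 := (MeasureTheory.volume_preserving_finTwoArrow ℝ).symm
  have h2 := PiLp.volume_preserving_toLp (Fin 2)
  have h3 := h2.comp h1
  have : (fun q : ℝ × ℝ => (!₂[q.1, q.2] : Plane)) =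
      WithLp.toLp 2 ∘ (MeasurableEquiv.finTwoArrow (α := ℝ)).symm := by
    funext q
    ext i
    fin_cases i <;> rfl
  rw [this]
  exact h3

/-- Integration in polar coordinates. The reflection `x ↦ -x` moves the angular range `(-π, π)` of
Mathlib to `(0, 2π]`. -/
lemma lintegral_polar {f : Plane → ENNReal} (hf : Measurable f) :
    ∫⁻ x, f x = ∫⁻ r in Ioi (0 : ℝ), ∫⁻ θ in Ioc (0 : ℝ) (2 * π),
      ENNReal.ofReal r * f (polar r θ) := by
  have hneg : ∫⁻ x, f x = ∫⁻ x, f (-x) :=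
    ((Measure.measurePreserving_neg (volume : Measure Plane)).lintegral_comp hf).symm
  have hfn : Measurable fun x => f (-x) := hf.comp measurable_neg
  rw [hneg, ← measurePreserving_prod_plane.lintegral_comp hfn, ← lintegral_comp_polarCoord_symm]
  have hpt : polarCoord.target = Ioi (0 : ℝ) ×ˢ Ioo (-π) π := rfl
  rw [hpt, Measure.volume_eq_prod, ← Measure.prod_restrict, lintegral_prod]
  · refine lintegral_congr fun r => ?_
    have hm : MeasurePreserving (fun θ : ℝ => θ + π) :=
      measurePreserving_add_right volume π
    have h5 := hm.setLIntegral_comp_preimage (s := Ioc 0 (2 * π)) measurableSet_Ioc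
      (f := fun θ => ENNReal.ofReal r * f (polar r θ))
      (by
        have := hf.comp (continuous_polar.measurable.comp (measurable_prodMk_left (x := r)))
        exact measurable_const.mul this)
    rw [← h5]
    have h6 : (fun θ : ℝ => θ + π) ⁻¹' Ioc 0 (2 * π)
        = Ioc (-π) π := by
      ext θ
      simp only [Set.mem_preimage, Set.mem_Ioc]
      constructor <;> rintro ⟨a, b⟩ <;> constructor <;> linarith
    rw [h6, setLIntegral_congr Ioo_ae_eq_Ioc]
    refine lintegral_congr fun θ => ?_
    simp only [polarCoord_symm_apply, smul_eq_mul]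
    congr 2
    ext i
    fin_cases i <;> simp [polar]
  · apply Measurable.aemeasurable
    refine (ENNReal.measurable_ofReal.comp measurable_fst).mul (hfn.comp ?_)
    exact measurePreserving_prod_plane.measurable.comp continuous_polarCoord_symm.measurable


/-- The measure `r dr dθ` on `(0, ∞) × (0, 2π]`. -/
def polarMeasure : Measure (ℝ × ℝ) :=
  ((volume.restrict (Ioi 0)).prod dθ).withDensity
    fun p => ENNReal.ofReal p.1

lemma measurable_ofReal_fst : Measurable fun p : ℝ × ℝ => ENNReal.ofReal p.1 :=
  ENNReal.measurable_ofReal.comp measurable_fst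

lemma measurePreserving_polar :
    MeasurePreserving (fun p : ℝ × ℝ => polar p.1 p.2) polarMeasure volume := by
  refine ⟨continuous_polar.measurable, Measure.ext fun s hs => ?_⟩
  have h1 := lintegral_polar (f := s.indicator 1) (measurable_one.indicator hs)
  rw [lintegral_indicator_one hs] at h1
  have hm : MeasurableSet ((fun p : ℝ × ℝ => polar p.1 p.2) ⁻¹' s) :=
    continuous_polar.measurable hs
  rw [Measure.map_apply continuous_polar.measurable hs, h1, polarMeasure, withDensity_apply _ hm,
    ← lintegral_indicator hm, lintegral_prod]
  · refine lintegral_congr fun r => lintegral_congr fun θ => ?_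
    by_cases h : polar r θ ∈ s
    · rw [Set.indicator_of_mem (by exact h), Set.indicator_of_mem h]; simp
    · rw [Set.indicator_of_notMem (by exact h), Set.indicator_of_notMem h]; simp
  · exact ((ENNReal.measurable_ofReal.comp measurable_fst).indicator hm).aemeasurable

lemma measurable_norm_mem {S : Set ℝ} (hS : MeasurableSet S) :
    MeasurableSet {x : Plane | ‖x‖ ∈ S} := measurable_norm hS

/-- An integrable function on the radial set `‖x‖ ∈ S` in polar coordinates. -/
lemma integrable_polar {E : Type*} [NormedAddCommGroup E] [NormedSpace ℝ E]
    {F : Plane → E} {S : Set ℝ} (hS : MeasurableSet S) (hS0 : S ⊆ Ioi 0)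
    (hF : IntegrableOn F {x | ‖x‖ ∈ S}) :
    Integrable (fun p : ℝ × ℝ => p.1 • F (polar p.1 p.2))
      ((volume.restrict S).prod dθ) := by
  rw [← integrable_indicator_iff (measurable_norm_mem hS)] at hF
  have h1 := measurePreserving_polar.integrable_comp_of_integrable hF
  rw [polarMeasure, integrable_withDensity_iff_integrable_smul'
    measurable_ofReal_fst (by simp)] at h1
  have h2 := h1.mono_measure (μ := (volume.restrict S).prod
    dθ) (by
      rw [Measure.prod_restrict, Measure.prod_restrict]
      exact Measure.restrict_mono (Set.prod_mono hS0 le_rfl) le_rfl)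
  refine h2.congr ?_
  rw [Measure.prod_restrict]
  refine (ae_restrict_iff' (hS.prod measurableSet_Ioc)).2 (Eventually.of_forall fun p hp => ?_)
  have hp0 : 0 < p.1 := hS0 hp.1
  have : polar p.1 p.2 ∈ {x : Plane | ‖x‖ ∈ S} := by
    simpa [norm_polar_of_pos hp0] using hp.1
  simp only [Function.comp_def, Set.indicator_of_mem this, ENNReal.toReal_ofReal hp0.le]

lemma setIntegral_polar {E : Type*} [NormedAddCommGroup E] [NormedSpace ℝ E] [CompleteSpace E]
    {F : Plane → E} {S : Set ℝ} (hS : MeasurableSet S) (hS0 : S ⊆ Ioi 0)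
    (hF : IntegrableOn F {x | ‖x‖ ∈ S}) :
    ∫ x in {x | ‖x‖ ∈ S}, F x
      = ∫ r in S, r • ∫ θ in 0..2 * π, F (polar r θ) := by
  have h0 := integrable_polar hS hS0 hF
  have hF' := (integrable_indicator_iff (measurable_norm_mem hS)).2 hF
  have h3 : ∫ r in S, r • ∫ θ in 0..2 * π, F (polar r θ)
      = ∫ p, p.1 • F (polar p.1 p.2)
        ∂((volume.restrict S).prod dθ) := by
    rw [integral_prod _ h0]
    refine integral_congr_ae (Eventually.of_forall fun r => ?_)
    simp only [integral_smul]
    rw [intervalIntegral.integral_of_le Real.two_pi_pos.le]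
  rw [h3, ← integral_indicator (measurable_norm_mem hS), ← measurePreserving_polar.map_eq,
    integral_map continuous_polar.aemeasurable
      (by rw [measurePreserving_polar.map_eq]; exact hF'.aestronglyMeasurable),
    polarMeasure, integral_withDensity_eq_integral_toReal_smul
      measurable_ofReal_fst (by simp), Measure.prod_restrict,
    Measure.prod_restrict, ← integral_indicator (measurableSet_Ioi.prod measurableSet_Ioc),
    ← integral_indicator (hS.prod measurableSet_Ioc)]
  congr 1
  funext p
  by_cases hp : p ∈ Ioi (0 : ℝ) ×ˢ Ioc (0 : ℝ) (2 * π)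
  · have hp0 : 0 < p.1 := hp.1
    rw [Set.indicator_of_mem hp]
    by_cases hp' : p.1 ∈ S
    · have hm : polar p.1 p.2 ∈ {x : Plane | ‖x‖ ∈ S} := by simpa [norm_polar_of_pos hp0]
      have hpS : p ∈ S ×ˢ Ioc (0 : ℝ) (2 * π) := ⟨hp', hp.2⟩
      rw [Set.indicator_of_mem hm, Set.indicator_of_mem hpS, ENNReal.toReal_ofReal hp0.le]
    · have hm : polar p.1 p.2 ∉ {x : Plane | ‖x‖ ∈ S} := by simpa [norm_polar_of_pos hp0]
      have hpS : p ∉ S ×ˢ Ioc (0 : ℝ) (2 * π) := fun h => hp' h.1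
      rw [Set.indicator_of_notMem hm, Set.indicator_of_notMem hpS, smul_zero]
  · rw [Set.indicator_of_notMem hp, Set.indicator_of_notMem fun h => hp ⟨hS0 h.1, h.2⟩]

/-- The integral over almost every circle of a function on the radial set `‖x‖ ∈ S`. -/
lemma integrableOn_circle {E : Type*} [NormedAddCommGroup E] [NormedSpace ℝ E] [CompleteSpace E]
    {F : Plane → E} {S : Set ℝ} (hS : MeasurableSet S) (hS0 : S ⊆ Ioi 0)
    (hF : IntegrableOn F {x | ‖x‖ ∈ S}) :
    IntegrableOn (fun r => r • ∫ θ in 0..2 * π, F (polar r θ)) S := by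
  refine (integrable_polar hS hS0 hF).integral_prod_left.congr
    (Eventually.of_forall fun r => ?_)
  simp only [integral_smul]
  rw [intervalIntegral.integral_of_le Real.two_pi_pos.le]

lemma ball_diff_ball_eq {ε : ℝ} :
    𝔹 \ Metric.ball 0 ε = {x | ‖x‖ ∈ Ico ε 3} := by
  ext x
  simp [and_comm]

lemma ball_ae_eq (a : ℝ) :
    (Metric.ball (0 : Plane) a : Set Plane) =ᵐ[volume] {x : Plane | ‖x‖ ∈ Ioo 0 a} := by
  have h0 : ∀ᵐ x : Plane, x ≠ 0 := by simp [ae_iff]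
  filter_upwards [h0] with x hx
  have : (x ∈ Metric.ball (0 : Plane) a) = (x ∈ {x : Plane | ‖x‖ ∈ Ioo 0 a}) := by
    simp [hx]
  exact this

end

noncomputable section

/-- The vector `x` rotated by a right angle. -/
def perp (x : Plane) : Plane := !₂[-x 1, x 0]

@[simp] lemma perp_apply_zero (x : Plane) : perp x 0 = -x 1 := rfl
@[simp] lemma perp_apply_one (x : Plane) : perp x 1 = x 0 := rfl

lemma eq_sum_e (x : Plane) : x = x 0 • e 0 + x 1 • e 1 := by
  ext i
  fin_cases i <;> simp [e]

lemma clm_apply_eq {E : Type*} [NormedAddCommGroup E] [NormedSpace ℝ E] (L : Plane →L[ℝ] E)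
    (v : Plane) : L v = v 0 • L (e 0) + v 1 • L (e 1) := by
  conv_lhs => rw [eq_sum_e v]
  simp

lemma norm_sq_eq (x : Plane) : ‖x‖ ^ 2 = x 0 ^ 2 + x 1 ^ 2 := by
  rw [EuclideanSpace.norm_sq_eq, Fin.sum_univ_two]; simp

/-- The point of the complex plane with the coordinates of `x`. -/
def toC (x : Plane) : ℂ := (x 0 : ℂ) + (x 1 : ℂ) * I

lemma norm_toC (x : Plane) : ‖toC x‖ = ‖x‖ := by
  have : ‖toC x‖ ^ 2 = ‖x‖ ^ 2 := by
    rw [norm_sq_eq, ← Complex.normSq_eq_norm_sq, toC, Complex.normSq_add_mul_I]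
  exact (sq_eq_sq₀ (norm_nonneg _) (norm_nonneg _)).1 this

lemma contDiff_apply (j : Fin 2) {n : WithTop ℕ∞} : ContDiff ℝ n fun x : Plane => x j :=
  (EuclideanSpace.proj (𝕜 := ℝ) j).contDiff

lemma contDiff_toC {n : WithTop ℕ∞} : ContDiff ℝ n toC :=
  (Complex.ofRealCLM.contDiff.comp (contDiff_apply 0)).add
    ((Complex.ofRealCLM.contDiff.comp (contDiff_apply 1)).mul contDiff_const)

/-- The function `e^{imθ}` on the plane, in polar coordinates. -/
def angular (m : ℤ) (x : Plane) : ℂ := (toC x / (‖x‖ : ℂ)) ^ m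

lemma exists_polar {x : Plane} (hx : x ≠ 0) : ∃ θ, x = polar ‖x‖ θ := by
  refine ⟨Complex.arg (toC x), ?_⟩
  have h1 : toC x ≠ 0 := by
    rw [← norm_pos_iff, norm_toC]; exact norm_pos_iff.2 hx
  have h0 : (toC x).re = x 0 := by simp [toC]
  have h2 : (toC x).im = x 1 := by simp [toC]
  have hc := Complex.cos_arg h1
  have hs := Complex.sin_arg (toC x)
  rw [norm_toC] at hc hs
  have hn : ‖x‖ ≠ 0 := norm_ne_zero_iff.2 hx
  ext i
  fin_cases i
  · change x 0 = ‖x‖ * Real.cos _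
    rw [hc, h0]; field_simp
  · change x 1 = ‖x‖ * Real.sin _
    rw [hs, h2]; field_simp

lemma toC_polar (r θ : ℝ) : toC (polar r θ) = r * exp (θ * I) := by
  rw [toC, polar_apply_zero, polar_apply_one, Complex.exp_mul_I]
  push_cast
  ring

lemma angular_polar (m : ℤ) {r : ℝ} (hr : 0 < r) (θ : ℝ) :
    angular m (polar r θ) = exp (m * θ * I) := by
  have hr' : (r : ℂ) ≠ 0 := mod_cast hr.ne'
  rw [angular, toC_polar, norm_polar_of_pos hr, mul_div_cancel_left₀ _ hr', ← Complex.exp_int_mul]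
  congr 1; ring

lemma norm_angular (m : ℤ) {x : Plane} (hx : x ≠ 0) : ‖angular m x‖ = 1 := by
  have hn : ‖x‖ ≠ 0 := norm_ne_zero_iff.2 hx
  rw [angular, norm_zpow, norm_div, norm_toC, Complex.norm_real, norm_norm, div_self hn, one_zpow]

lemma norm_angular_le (m : ℤ) (x : Plane) : ‖angular m x‖ ≤ 1 := by
  by_cases hx : x = 0
  · rw [hx, angular]
    rcases eq_or_ne m 0 with rfl | hm
    · simp
    · simp [zero_zpow m hm]
  · rw [norm_angular m hx]

lemma angular_add (m n : ℤ) {x : Plane} (hx : x ≠ 0) :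
    angular (m + n) x = angular m x * angular n x := by
  have h1 : toC x / (‖x‖ : ℂ) ≠ 0 := by
    have := norm_angular 1 hx
    rw [angular, zpow_one] at this
    rw [← norm_pos_iff, this]; exact one_pos
  exact zpow_add₀ h1 m n

@[simp] lemma angular_zero (x : Plane) : angular 0 x = 1 := by simp [angular]

lemma measurable_angular (m : ℤ) : Measurable (angular m) := by
  have h1 : Measurable toC := (contDiff_toC (n := 0)).continuous.measurable
  have h2 : Measurable fun x : Plane => toC x / (‖x‖ : ℂ) :=
    h1.div (Complex.measurable_ofReal.comp measurable_norm)
  exact h2.pow_const m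

lemma contDiffAt_angular (m : ℤ) {x : Plane} (hx : x ≠ 0) {n : WithTop ℕ∞} :
    ContDiffAt ℝ n (angular m) x := by
  have h0 : (‖x‖ : ℂ) ≠ 0 := mod_cast norm_ne_zero_iff.2 hx
  have h1 : ContDiffAt ℝ n (fun x : Plane => toC x / (‖x‖ : ℂ)) x := by
    have h3 : ContDiffAt ℝ n (fun x : Plane => (‖x‖ : ℂ)) x :=
      Complex.ofRealCLM.contDiff.contDiffAt.comp x (contDiffAt_norm ℝ hx)
    simp only [div_eq_mul_inv]
    exact contDiff_toC.contDiffAt.mul (h3.inv h0)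
  have h2 : toC x / (‖x‖ : ℂ) ≠ 0 := by
    refine div_ne_zero ?_ h0
    rw [← norm_pos_iff, norm_toC]; exact norm_pos_iff.2 hx
  rcases Int.eq_nat_or_neg m with ⟨k, rfl | rfl⟩
  · exact (h1.pow k).congr_of_eventuallyEq (Eventually.of_forall fun y => zpow_natCast _ k)
  · refine ((h1.pow k).inv (pow_ne_zero k h2)).congr_of_eventuallyEq
      (Eventually.of_forall fun y => ?_)
    change (toC y / (‖y‖ : ℂ)) ^ (-(k : ℤ)) = ((toC y / (‖y‖ : ℂ)) ^ k)⁻¹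
    rw [zpow_neg, zpow_natCast]

lemma polar_eq (r θ : ℝ) : polar r θ = (r * Real.cos θ) • e 0 + (r * Real.sin θ) • e 1 :=
  eq_sum_e (polar r θ)

lemma smul_polar (r θ : ℝ) : polar r θ = r • polar 1 θ := by
  ext i; fin_cases i <;> simp [polar]

lemma hasDerivAt_polar_radius (r θ : ℝ) : HasDerivAt (fun s => polar s θ) (polar 1 θ) r := by
  have h : (fun s => polar s θ) = fun s => s • polar 1 θ := funext fun s => smul_polar s θ
  rw [h]
  simpa using (hasDerivAt_id r).smul_const (polar 1 θ)

lemma hasDerivAt_polar_angle (r θ : ℝ) : HasDerivAt (polar r) (perp (polar r θ)) θ := by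
  have h : polar r = fun θ => (r * Real.cos θ) • e 0 + (r * Real.sin θ) • e 1 :=
    funext fun θ => polar_eq r θ
  rw [h]
  have := (((Real.hasDerivAt_cos θ).const_mul r).smul_const (e 0)).add
    (((Real.hasDerivAt_sin θ).const_mul r).smul_const (e 1))
  refine this.congr_deriv ?_
  ext i; fin_cases i <;> simp [e]

variable {E : Type*} [NormedAddCommGroup E] [NormedSpace ℝ E]

lemma hasDerivAt_comp_polar_radius {ψ : Plane → E} {r θ : ℝ}
    (h : DifferentiableAt ℝ ψ (polar r θ)) :
    HasDerivAt (fun s => ψ (polar s θ)) (fderiv ℝ ψ (polar r θ) (polar 1 θ)) r :=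
  h.hasFDerivAt.comp_hasDerivAt r (hasDerivAt_polar_radius r θ)

lemma hasDerivAt_comp_polar_angle {ψ : Plane → E} {r θ : ℝ}
    (h : DifferentiableAt ℝ ψ (polar r θ)) :
    HasDerivAt (fun t => ψ (polar r t)) (fderiv ℝ ψ (polar r θ) (perp (polar r θ))) θ :=
  h.hasFDerivAt.comp_hasDerivAt θ (hasDerivAt_polar_angle r θ)

lemma e_eq (j : Fin 2) (θ : ℝ) :
    e j = polar 1 θ j • polar 1 θ + perp (polar 1 θ) j • perp (polar 1 θ) := by
  have := Real.sin_sq_add_cos_sq θ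
  ext i
  fin_cases j <;> fin_cases i <;> simp [e, polar, perp] <;> nlinarith

/-- The function `h(r) e^{imθ}` in polar coordinates. -/
def radAng (h : ℝ → ℂ) (m : ℤ) (x : Plane) : ℂ := h ‖x‖ * angular m x

lemma radAng_polar (h : ℝ → ℂ) (m : ℤ) {r : ℝ} (hr : 0 < r) (θ : ℝ) :
    radAng h m (polar r θ) = h r * exp (m * θ * I) := by
  rw [radAng, norm_polar_of_pos hr, angular_polar m hr]

lemma contDiffAt_radAng {h : ℝ → ℂ} {n : WithTop ℕ∞} (m : ℤ) {x : Plane} (hx : x ≠ 0)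
    (hh : ContDiffAt ℝ n h ‖x‖) : ContDiffAt ℝ n (radAng h m) x :=
  (hh.comp x (contDiffAt_norm ℝ hx)).mul (contDiffAt_angular m hx)

lemma differentiableAt_radAng {h : ℝ → ℂ} (m : ℤ) {x : Plane} (hx : x ≠ 0)
    (hh : DifferentiableAt ℝ h ‖x‖) : DifferentiableAt ℝ (radAng h m) x :=
  (hh.comp x ((contDiffAt_norm (n := 1) ℝ hx).differentiableAt one_ne_zero)).mul
    ((contDiffAt_angular (n := 1) m hx).differentiableAt one_ne_zero)

/-- The radial derivative of `h(r) e^{imθ}`. -/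
lemma fderiv_radAng_self {h : ℝ → ℂ} (m : ℤ) {x : Plane} (hx : x ≠ 0)
    (hh : DifferentiableAt ℝ h ‖x‖) :
    fderiv ℝ (radAng h m) x x = ‖x‖ * deriv h ‖x‖ * angular m x := by
  have hr : 0 < ‖x‖ := norm_pos_iff.2 hx
  have hd := differentiableAt_radAng m hx hh
  obtain ⟨θ, hθ⟩ := exists_polar hx
  set r := ‖x‖
  rw [hθ] at hd ⊢
  have h1 := hasDerivAt_comp_polar_radius hd
  have h2 : HasDerivAt (fun s => radAng h m (polar s θ))
      (deriv h r * exp (m * θ * I)) r := by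
    refine (hh.hasDerivAt.mul_const _).congr_of_eventuallyEq ?_
    filter_upwards [Ioi_mem_nhds hr] with s hs
    rw [radAng_polar h m hs]
  have h3 := h1.unique h2
  have h4 : fderiv ℝ (radAng h m) (polar r θ) (polar r θ)
      = r • fderiv ℝ (radAng h m) (polar r θ) (polar 1 θ) := by
    rw [← map_smul, ← smul_polar]
  rw [h4, h3, angular_polar m hr, Complex.real_smul]
  ring

/-- The angular derivative of `h(r) e^{imθ}`. -/
lemma fderiv_radAng_perp {h : ℝ → ℂ} (m : ℤ) {x : Plane} (hx : x ≠ 0)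
    (hh : DifferentiableAt ℝ h ‖x‖) :
    fderiv ℝ (radAng h m) x (perp x) = I * m * radAng h m x := by
  have hr : 0 < ‖x‖ := norm_pos_iff.2 hx
  have hd := differentiableAt_radAng m hx hh
  obtain ⟨θ, hθ⟩ := exists_polar hx
  set r := ‖x‖
  rw [hθ] at hd ⊢
  have h1 := hasDerivAt_comp_polar_angle hd
  have h2 : HasDerivAt (fun t => radAng h m (polar r t))
      (I * m * (h r * exp (m * θ * I))) θ := by
    have h5 : (fun t : ℝ => radAng h m (polar r t))
        = fun t : ℝ => h r * exp (m * t * I) :=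
      funext fun t => radAng_polar h m hr t
    rw [h5]
    have h6 : HasDerivAt (fun t : ℝ => (m : ℂ) * (t : ℂ) * I) (m * 1 * I) θ :=
      ((Complex.ofRealCLM.hasDerivAt).const_mul _).mul_const _
    refine (h6.cexp.const_mul (h r)).congr_deriv ?_
    ring
  rw [h1.unique h2, radAng_polar h m hr]

/-- The combinations `∂₀ ± i ∂₁` act on `h(r) e^{imθ}` as raising and lowering operators. -/
lemma fderiv_radAng_add {h : ℝ → ℂ} (m : ℤ) {x : Plane} (hx : x ≠ 0)
    (hh : DifferentiableAt ℝ h ‖x‖) :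
    fderiv ℝ (radAng h m) x (e 0) + I * fderiv ℝ (radAng h m) x (e 1)
      = radAng (fun r => deriv h r - m * h r / r) (m + 1) x := by
  have hr : (‖x‖ : ℂ) ≠ 0 := mod_cast norm_ne_zero_iff.2 hx
  have h1 := fderiv_radAng_self m hx hh
  have h2 := fderiv_radAng_perp m hx hh
  rw [clm_apply_eq] at h1 h2
  simp only [perp_apply_zero, perp_apply_one, Complex.real_smul] at h1 h2
  push_cast at h2
  have h3 : ((‖x‖ : ℂ)) ^ 2 = (x 0 : ℂ) ^ 2 + (x 1 : ℂ) ^ 2 := mod_cast norm_sq_eq x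
  have h4 : angular 1 x = ((x 0 : ℂ) + (x 1 : ℂ) * I) / (‖x‖ : ℂ) := by
    simp [angular, toC]
  rw [radAng, angular_add m 1 hx, h4]
  rw [radAng] at h2
  have hI := Complex.I_sq
  apply mul_left_cancel₀ (pow_ne_zero 2 hr)
  field_simp
  linear_combination (((x 0 : ℂ) + (x 1 : ℂ) * I)) * (h1 + I * h2)
    + (fderiv ℝ (radAng h m) x (e 0) + I * fderiv ℝ (radAng h m) x (e 1)) * h3
    + (fderiv ℝ (radAng h m) x (e 0) * x 1 ^ 2 - fderiv ℝ (radAng h m) x (e 1) * x 0 * x 1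
      + angular m x * m * h ‖x‖ * (x 0 + I * x 1)) * hI

lemma fderiv_radAng_sub {h : ℝ → ℂ} (m : ℤ) {x : Plane} (hx : x ≠ 0)
    (hh : DifferentiableAt ℝ h ‖x‖) :
    fderiv ℝ (radAng h m) x (e 0) - I * fderiv ℝ (radAng h m) x (e 1)
      = radAng (fun r => deriv h r + m * h r / r) (m - 1) x := by
  have hr : (‖x‖ : ℂ) ≠ 0 := mod_cast norm_ne_zero_iff.2 hx
  have hz : toC x ≠ 0 := by
    rw [← norm_pos_iff, norm_toC]; exact norm_pos_iff.2 hx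
  have h1 := fderiv_radAng_self m hx hh
  have h2 := fderiv_radAng_perp m hx hh
  rw [clm_apply_eq] at h1 h2
  simp only [perp_apply_zero, perp_apply_one, Complex.real_smul] at h1 h2
  push_cast at h2
  have h4 : angular m x = angular (m - 1) x * (toC x / (‖x‖ : ℂ)) := by
    conv_lhs => rw [show m = m - 1 + 1 by ring, angular_add _ _ hx]
    simp [angular]
  apply mul_left_cancel₀ hz
  have h5 : toC x * (fderiv ℝ (radAng h m) x (e 0) - I * fderiv ℝ (radAng h m) x (e 1))
      = ‖x‖ * deriv h ‖x‖ * angular m x + m * radAng h m x := by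
    rw [toC]
    linear_combination h1 - I * h2
      - (x 1 * fderiv ℝ (radAng h m) x (e 1) + m * radAng h m x) * Complex.I_sq
  rw [h5, radAng, radAng, h4]
  field_simp

end

noncomputable section

/-! ### Fourier coefficients on circles -/

/-- Square integrability on `Ω` away from the origin. -/
def L2Away (V : Plane → ℂ) : Prop :=
  ∀ ε : ℝ, 0 < ε → MemLp V 2 (volume.restrict (𝔹 \ Metric.ball 0 ε))

lemma L2Away.add {V W : Plane → ℂ} (hV : L2Away V) (hW : L2Away W) :
    L2Away fun x => V x + W x := fun ε hε => (hV ε hε).add (hW ε hε)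

lemma L2Away.sub {V W : Plane → ℂ} (hV : L2Away V) (hW : L2Away W) :
    L2Away fun x => V x - W x := fun ε hε => (hV ε hε).sub (hW ε hε)

/-- Multiplication by a bounded function. -/
lemma L2Away.bdd_mul {V w : Plane → ℂ} (hV : L2Away V) (hw : Measurable w) {C : ℝ}
    (hC : ∀ x ∈ 𝔹, ‖w x‖ ≤ C) : L2Away fun x => w x * V x := by
  intro ε hε
  refine MemLp.of_le_mul (c := C) (hV ε hε)
    (hw.aestronglyMeasurable.mul (hV ε hε).aestronglyMeasurable) ?_
  filter_upwards [ae_restrict_mem (measurableSet_ball.diff measurableSet_ball)] with x hx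
  rw [norm_mul]
  exact mul_le_mul_of_nonneg_right (hC x hx.1) (norm_nonneg _)

lemma L2Away.integrableOn {V : Plane → ℂ} (hV : L2Away V) {ε : ℝ} (hε : 0 < ε) :
    IntegrableOn V (𝔹 \ Metric.ball 0 ε) := by
  have : IsFiniteMeasure (volume.restrict (𝔹 \ Metric.ball 0 ε)) :=
    ⟨by
      rw [Measure.restrict_apply_univ]
      exact (measure_mono Set.sdiff_subset).trans_lt measure_ball_lt_top⟩
  exact (hV ε hε).integrable one_le_two

lemma L2Away.integrableOn_mul {V w : Plane → ℂ} (hV : L2Away V) (hw : Measurable w)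
    {C ε : ℝ} (hε : 0 < ε) (hC : ∀ x ∈ 𝔹, ‖w x‖ ≤ C)
    (h0 : ∀ x, ‖x‖ < ε → w x = 0) :
    IntegrableOn (fun x => V x * w x) 𝔹 := by
  have h1 : IntegrableOn (fun x => V x * w x) (𝔹 \ Metric.ball 0 ε) := by
    refine Integrable.mul_bdd (c := C) (hV.integrableOn hε) hw.aestronglyMeasurable ?_
    filter_upwards [ae_restrict_mem (measurableSet_ball.diff measurableSet_ball)] with x hx
    exact hC x hx.1
  refine h1.of_forall_sdiff_eq_zero measurableSet_ball fun x hx => ?_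
  have : ‖x‖ < ε := by
    by_contra h
    exact hx.2 ⟨hx.1, by simpa using h⟩
  simp [h0 x this]

/-- The `l`-th Fourier coefficient of a function on the circle of radius `r`. -/
def circ (V : Plane → ℂ) (l : ℤ) (r : ℝ) : ℂ :=
  ∫ θ in 0..2 * π, exp (-((l : ℂ) * (θ : ℂ) * I)) * V (polar r θ)

lemma Ioo_subset_Ioi' {ε : ℝ} (hε : 0 < ε) : Ioo ε 3 ⊆ Ioi (0 : ℝ) :=
  fun _ hr => hε.trans hr.1

lemma L2Away.circ_integrableOn {V : Plane → ℂ} (hV : L2Away V) (l : ℤ) {ε : ℝ} (hε : 0 < ε) :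
    IntegrableOn (circ V l) (Ioo ε 3) := by
  have hsub : {x : Plane | ‖x‖ ∈ Ioo ε 3} ⊆ 𝔹 \ Metric.ball 0 ε := by
    rw [ball_diff_ball_eq]
    exact fun x hx => ⟨hx.1.le, hx.2⟩
  have h1 : IntegrableOn (fun x => angular (-l) x * V x) {x | ‖x‖ ∈ Ioo ε 3} :=
    Integrable.bdd_mul (c := 1) ((hV.integrableOn hε).mono_set hsub)
      (measurable_angular _).aestronglyMeasurable
      (Eventually.of_forall fun x => norm_angular_le _ x)
  have h2 := integrableOn_circle measurableSet_Ioo (Ioo_subset_Ioi' hε) h1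
  have h3 : IntegrableOn (fun r : ℝ => (r⁻¹ : ℝ) • (r • ∫ θ in 0..2 * π,
      angular (-l) (polar r θ) * V (polar r θ))) (Ioo ε 3) := by
    refine Integrable.bdd_smul (C := ε⁻¹) h2 measurable_inv.aestronglyMeasurable ?_
    filter_upwards [ae_restrict_mem measurableSet_Ioo] with r hr
    have := hε.trans hr.1
    rw [norm_inv, Real.norm_of_nonneg this.le]
    exact inv_anti₀ hε hr.1.le
  refine IntegrableOn.congr_fun h3 (fun r hr => ?_) measurableSet_Ioo
  have hr0 := hε.trans hr.1
  change _ = circ V l r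
  rw [smul_smul, inv_mul_cancel₀ hr0.ne', one_smul, circ]
  simp_rw [angular_polar _ hr0]
  refine intervalIntegral.integral_congr fun θ _ => ?_
  simp

/-- Radial factors of test functions: they vanish near `0` and are bounded. -/
def BddCut (K : ℝ → ℂ) : Prop :=
  Measurable K ∧ ∃ ε : ℝ, 0 < ε ∧ (∀ r < ε, K r = 0) ∧ ∃ C, ∀ r < 3, ‖K r‖ ≤ C

/-- Multipliers that are bounded away from `0`. -/
def BddMult (b : ℝ → ℂ) : Prop :=
  Measurable b ∧ ∀ ε : ℝ, 0 < ε → ∃ C, ∀ r ∈ Ico ε 3, ‖b r‖ ≤ C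

lemma BddCut.mul {K b : ℝ → ℂ} (hb : BddMult b) (hK : BddCut K) :
    BddCut fun r => b r * K r := by
  obtain ⟨hm, ε, hε, h0, C, hC⟩ := hK
  obtain ⟨C', hC'⟩ := hb.2 ε hε
  refine ⟨hb.1.mul hm, ε, hε, fun r hr => by simp [h0 r hr], max 0 C' * max 0 C, fun r hr => ?_⟩
  rw [norm_mul]
  by_cases h : r < ε
  · simp only [h0 r h, norm_zero, mul_zero]; positivity
  · exact mul_le_mul ((hC' r ⟨not_lt.1 h, hr⟩).trans (le_max_right _ _))
      ((hC r hr).trans (le_max_right _ _)) (norm_nonneg _) (le_max_left _ _)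

lemma BddCut.of_continuous {K : ℝ → ℂ} (hK : Continuous K) {ε : ℝ} (hε : 0 < ε)
    (h0 : ∀ r < ε, K r = 0) : BddCut K := by
  obtain ⟨C, hC⟩ := isCompact_Icc.exists_bound_of_continuousOn (s := Icc ε 3) hK.continuousOn
  refine ⟨hK.measurable, ε, hε, h0, max 0 C, fun r hr => ?_⟩
  by_cases h : r < ε
  · simp [h0 r h]
  · exact (hC r ⟨not_lt.1 h, hr.le⟩).trans (le_max_right _ _)

lemma BddMult.of_continuousOn {b : ℝ → ℂ} (hm : Measurable b)
    (h : ContinuousOn b (Ioi 0)) : BddMult b := by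
  refine ⟨hm, fun ε hε => ?_⟩
  obtain ⟨C, hC⟩ := isCompact_Icc.exists_bound_of_continuousOn (s := Icc ε 3)
    (h.mono fun r hr => hε.trans_le hr.1)
  exact ⟨C, fun r hr => hC r ⟨hr.1, hr.2.le⟩⟩

lemma BddCut.integrableOn {V : Plane → ℂ} (hV : L2Away V) {K : ℝ → ℂ} (hK : BddCut K) (m : ℤ) :
    IntegrableOn (fun x => V x * radAng K m x) 𝔹 := by
  obtain ⟨hm, ε, hε, h0, C, hC⟩ := hK
  refine hV.integrableOn_mul ((hm.comp measurable_norm).mul (measurable_angular m)) (C := C) hε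
    (fun x hx => ?_) fun x hx => by simp [radAng, h0 _ hx]
  rw [radAng, norm_mul]
  have h1 := hC ‖x‖ (by simpa using hx)
  calc _ ≤ C * 1 := mul_le_mul h1 (norm_angular_le m x) (norm_nonneg _) ((norm_nonneg _).trans h1)
    _ = C := mul_one C

lemma integral_circle_radAng (V : Plane → ℂ) (K : ℝ → ℂ) (l : ℤ) {r : ℝ} (hr : 0 < r) :
    ∫ θ in 0..2 * π, V (polar r θ) * radAng K (-l) (polar r θ)
      = K r * circ V l r := by
  rw [circ, ← intervalIntegral.integral_const_mul (K r)]
  refine intervalIntegral.integral_congr fun θ _ => ?_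
  simp only [radAng_polar _ _ hr]
  have : ((-l : ℤ) : ℂ) * θ * I = -(l * θ * I) := by push_cast; ring
  rw [this]
  ring

/-- Integration against a test function with separated variables only sees one Fourier
coefficient. -/
lemma integral_mul_radAng {V : Plane → ℂ} (hV : L2Away V) {K : ℝ → ℂ} (hK : BddCut K) (l : ℤ) :
    ∫ x in 𝔹, V x * radAng K (-l) x
      = ∫ r in Ioo (0 : ℝ) 3, r * K r * circ V l r := by
  have hi := hK.integrableOn hV (-l)
  have hi' : IntegrableOn (fun x => V x * radAng K (-l) x) {x | ‖x‖ ∈ Ioo (0 : ℝ) 3} :=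
    hi.mono_set fun x hx => by simpa using hx.2
  rw [setIntegral_congr_set (ball_ae_eq 3),
    setIntegral_polar measurableSet_Ioo (fun r hr => hr.1) hi']
  refine setIntegral_congr_fun measurableSet_Ioo fun r hr => ?_
  simp only [Complex.real_smul, integral_circle_radAng V K l hr.1, mul_assoc]

lemma BddCut.integrableOn_circ {V : Plane → ℂ} (hV : L2Away V) {K : ℝ → ℂ} (hK : BddCut K)
    (l : ℤ) : IntegrableOn (fun r => r * K r * circ V l r) (Ioo (0 : ℝ) 3) := by
  have hi := hK.integrableOn hV (-l)
  have hi' : IntegrableOn (fun x => V x * radAng K (-l) x) {x | ‖x‖ ∈ Ioo (0 : ℝ) 3} :=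
    hi.mono_set fun x hx => by simpa using hx.2
  refine IntegrableOn.congr_fun (integrableOn_circle measurableSet_Ioo (fun r hr => hr.1) hi')
    (fun r hr => ?_) measurableSet_Ioo
  simp only [Complex.real_smul, integral_circle_radAng V K l hr.1, mul_assoc]

lemma bddMult_inv : BddMult fun r : ℝ => (r : ℂ)⁻¹ :=
  BddMult.of_continuousOn (Complex.measurable_ofReal.inv)
    (Complex.continuous_ofReal.continuousOn.inv₀ fun r hr => mod_cast (ne_of_gt hr))

lemma bddMult_sigRad {σa R : ℝ} (hσ : 0 < σa) (hR : 1 < R) :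
    BddMult fun r : ℝ => (sigRad σa R r : ℂ) := by
  refine ⟨Complex.measurable_ofReal.comp measurable_sigRad, fun ε hε => ⟨σa + 1, fun r hr => ?_⟩⟩
  have hr0 := hε.trans_le hr.1
  have h1 := sigRad_pos hσ hR hr0
  rw [Complex.norm_real, Real.norm_of_nonneg h1.le, sigRad]
  split_ifs with h1 h2
  · linarith
  · have : (r - 1) / r ≤ 1 := by rw [div_le_one hr0]; linarith
    linarith
  · linarith

lemma bddMult_sigTan {σa R : ℝ} (hσ : 0 < σa) (hR : 1 < R) :
    BddMult fun r : ℝ => (sigTan σa R r : ℂ) := by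
  refine ⟨Complex.measurable_ofReal.comp measurable_sigTan,
    fun ε hε => ⟨σa + 2 / (R - 1) + 1, fun r hr => ?_⟩⟩
  rw [Complex.norm_real, Real.norm_of_nonneg (sigTan_pos hσ hR (hε.trans_le hr.1)).le]
  exact sigTan_le hσ hR r

lemma bddMult_lamRad {lam R : ℝ} (hlam : 0 < lam) (hR : 1 < R) :
    BddMult fun r : ℝ => (lamRad lam R r : ℂ)⁻¹ := by
  refine ⟨(Complex.measurable_ofReal.comp measurable_lamRad).inv,
    fun ε hε => ⟨1 / lam + 4, fun r hr => ?_⟩⟩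
  have h := inv_lamRad_le hlam hR (hε.trans_le hr.1) (lam := lam)
  rw [norm_inv, Complex.norm_real, Real.norm_of_nonneg h.1.le, ← one_div]
  exact h.2

lemma sigmaR_eq (σa R : ℝ) {x : Plane} : sigmaR σa R x
    = sigRad σa R ‖x‖ • radialProj x + sigTan σa R ‖x‖ • (1 - radialProj x) := by
  rw [sigmaR, sigRad, sigTan]
  split_ifs
  · rw [← smul_add, add_sub_cancel]
  · rfl
  · rw [one_smul, one_smul, add_sub_cancel]

lemma lambdaR_eq (lam R : ℝ) (x : Plane) : lambdaR lam R x = lamRad lam R ‖x‖ := rfl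

/-- The conductivity is diagonal in the radial and the tangential direction. -/
lemma sum_sigmaR (σa R : ℝ) {x : Plane} (hx : x ≠ 0) (a b : Fin 2 → ℂ) :
    ∑ j : Fin 2, ∑ k : Fin 2, (sigmaR σa R x j k : ℂ) * a k * b j
      = (sigRad σa R ‖x‖ * (∑ k, (x k : ℂ) * a k) * (∑ j, (x j : ℂ) * b j)
        + sigTan σa R ‖x‖ * (∑ k, (perp x k : ℂ) * a k) * (∑ j, (perp x j : ℂ) * b j))
          / (‖x‖ : ℂ) ^ 2 := by
  have hr : (‖x‖ : ℂ) ≠ 0 := mod_cast norm_ne_zero_iff.2 hx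
  have h3 : ((‖x‖ : ℂ)) ^ 2 = (x 0 : ℂ) ^ 2 + (x 1 : ℂ) ^ 2 := mod_cast norm_sq_eq x
  have h4 : (x 0 : ℂ) ^ 2 + (x 1 : ℂ) ^ 2 ≠ 0 := h3 ▸ pow_ne_zero 2 hr
  rw [sigmaR_eq]
  simp only [Fin.sum_univ_two, radialProj, Matrix.add_apply, Matrix.smul_apply, Matrix.sub_apply,
    Matrix.of_apply, Matrix.one_apply, perp_apply_zero, perp_apply_one, smul_eq_mul]
  push_cast
  rw [h3]
  simp only [Fin.isValue]
  field_simp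
  ring

end

noncomputable section

/-! ### Weak solutions away from the origin -/

lemma abs_radialProj_le (x : Plane) (j k : Fin 2) : |radialProj x j k| ≤ 1 := by
  have hj : |x j| ≤ ‖x‖ := by simpa using PiLp.norm_apply_le x j
  have hk : |x k| ≤ ‖x‖ := by simpa using PiLp.norm_apply_le x k
  rw [radialProj, Matrix.of_apply, abs_div, abs_mul, abs_of_nonneg (sq_nonneg ‖x‖)]
  refine div_le_one_of_le₀ ?_ (sq_nonneg _)
  rw [pow_two]
  exact mul_le_mul hj hk (abs_nonneg _) (norm_nonneg _)

lemma abs_sigmaR_le {σa R : ℝ} (hσ : 0 < σa) (hR : 1 < R) (j k : Fin 2) :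
    ∃ C, ∀ x, |sigmaR σa R x j k| ≤ C := by
  refine ⟨(σa + 1) * 1 + (σa + 2 / (R - 1) + 1) * (1 + 1), fun x => ?_⟩
  have h0 : 0 ≤ sigRad σa R ‖x‖ ∧ sigRad σa R ‖x‖ ≤ σa + 1 := by
    rw [sigRad]
    split_ifs with h1 h2
    · constructor <;> linarith
    · have h3 : 0 < ‖x‖ := by linarith
      refine ⟨div_nonneg (by linarith) h3.le, ?_⟩
      have : (‖x‖ - 1) / ‖x‖ ≤ 1 := by rw [div_le_one h3]; linarith
      linarith
    · constructor <;> linarith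
  have h1 : 0 ≤ sigTan σa R ‖x‖ := by
    rw [sigTan]
    split_ifs with h1 h2
    · exact hσ.le
    · exact div_nonneg (by linarith) (by linarith)
    · exact zero_le_one
  have h2 := sigTan_le hσ hR ‖x‖ (σa := σa)
  have h3 := abs_radialProj_le x j k
  have h4 : |(1 : Matrix (Fin 2) (Fin 2) ℝ) j k - radialProj x j k| ≤ 1 + 1 := by
    refine (abs_sub _ _).trans (add_le_add ?_ h3)
    rw [Matrix.one_apply]; split_ifs <;> simp
  rw [sigmaR_eq, Matrix.add_apply, Matrix.smul_apply, Matrix.smul_apply, Matrix.sub_apply]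
  refine (abs_add_le _ _).trans ?_
  rw [smul_eq_mul, smul_eq_mul, abs_mul, abs_mul, abs_of_nonneg h0.1, abs_of_nonneg h1]
  exact add_le_add (mul_le_mul h0.2 h3 (abs_nonneg _) (h0.1.trans h0.2))
    (mul_le_mul h2 h4 (abs_nonneg _) (h1.trans h2))

lemma measurable_sigmaR (σa R : ℝ) (j k : Fin 2) : Measurable fun x => sigmaR σa R x j k := by
  have h1 : Measurable fun x : Plane => radialProj x j k := by
    simp only [radialProj, Matrix.of_apply]
    have hj : Measurable fun x : Plane => x j := (contDiff_apply (n := 0) j).continuous.measurable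
    have hk : Measurable fun x : Plane => x k := (contDiff_apply (n := 0) k).continuous.measurable
    exact (hj.mul hk).div (measurable_norm.pow_const 2)
  simp_rw [sigmaR_eq]
  have ha := (measurable_sigRad (σa := σa) (R := R)).comp (measurable_norm (α := Plane))
  have hb := (measurable_sigTan (σa := σa) (R := R)).comp (measurable_norm (α := Plane))
  exact (ha.mul h1).add (hb.mul (measurable_const.sub h1))

lemma inv_lambdaR_bdd {lam R : ℝ} (hlam : 0 < lam) (hR : 1 < R) (x : Plane) :
    ‖((lambdaR lam R x : ℝ) : ℂ)⁻¹‖ ≤ 1 / lam + 4 := by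
  rw [lambdaR_eq, norm_inv, Complex.norm_real]
  rcases eq_or_ne x 0 with rfl | hx
  · have : lamRad lam R 0 = lam := by rw [lamRad, if_pos (by linarith)]
    rw [norm_zero, this, Real.norm_of_nonneg hlam.le, one_div]; linarith [inv_pos.2 hlam]
  · have h := inv_lamRad_le hlam hR (norm_pos_iff.2 hx) (lam := lam)
    rw [Real.norm_of_nonneg h.1.le, ← one_div]; exact h.2

lemma measurable_lambdaR (lam R : ℝ) : Measurable (lambdaR lam R) :=
  (measurable_lamRad (lam := lam) (R := R)).comp measurable_norm

lemma L2Away.flux {σa R : ℝ} (hσ : 0 < σa) (hR : 1 < R) {G : Fin 2 → Plane → ℂ}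
    (hG : ∀ j, L2Away (G j)) (j : Fin 2) :
    L2Away fun x => ∑ k, (sigmaR σa R x j k : ℂ) * G k x := by
  have h (k : Fin 2) : L2Away fun x => (sigmaR σa R x j k : ℂ) * G k x := by
    obtain ⟨C, hC⟩ := abs_sigmaR_le hσ hR j k
    exact (hG k).bdd_mul (Complex.measurable_ofReal.comp (measurable_sigmaR σa R j k))
      fun x _ => by simpa using hC x
  simp only [Fin.sum_univ_two]
  exact (h 0).add (h 1)

lemma L2Away.inv_lambdaR {lam R : ℝ} (hlam : 0 < lam) (hR : 1 < R) {U : Plane → ℂ}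
    (hU : L2Away U) (c : ℂ) : L2Away fun x => c / (lambdaR lam R x : ℂ) * U x := by
  refine hU.bdd_mul (C := ‖c‖ * (1 / lam + 4)) ?_ fun x _ => ?_
  · exact measurable_const.div (Complex.measurable_ofReal.comp (measurable_lambdaR lam R))
  · rw [div_eq_mul_inv, norm_mul]
    exact mul_le_mul_of_nonneg_left (inv_lambdaR_bdd hlam hR x) (norm_nonneg _)

lemma exists_ball_zero {E : Type*} [NormedAddCommGroup E] [NormedSpace ℝ E] {ψ : Plane → E}
    (h : (0 : Plane) ∉ tsupport ψ) :
    ∃ ε : ℝ, 0 < ε ∧ ∀ x, ‖x‖ < ε → ψ x = 0 ∧ fderiv ℝ ψ x = 0 := by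
  obtain ⟨ε, hε, hb⟩ := Metric.isOpen_iff.1 (isClosed_tsupport ψ).isOpen_compl 0 h
  refine ⟨ε, hε, fun x hx => ?_⟩
  have hx' : x ∉ tsupport ψ := hb (by simpa using hx)
  exact ⟨image_eq_zero_of_notMem_tsupport hx',
    image_eq_zero_of_notMem_tsupport fun h' => hx' (tsupport_fderiv_subset ℝ h')⟩

lemma L2Away.integrableOn_mul_of_continuous {V w : Plane → ℂ} (hV : L2Away V) (hw : Continuous w)
    {ε : ℝ} (hε : 0 < ε) (h0 : ∀ x, ‖x‖ < ε → w x = 0) :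
    IntegrableOn (fun x => V x * w x) 𝔹 := by
  obtain ⟨C, hC⟩ := (isCompact_closedBall (0 : Plane) 3).exists_bound_of_continuousOn
    hw.continuousOn
  exact hV.integrableOn_mul hw.measurable hε (fun x hx => hC x (Metric.ball_subset_closedBall hx))
    h0

/-- A complex-valued function, through its real and imaginary parts, gives two test functions. -/
def testPart (L : ℂ →L[ℝ] ℝ) (Ω : TopologicalSpace.Opens Plane) (ψ : Plane → ℂ)
    (h1 : Smooth ψ) (h2 : HasCompactSupport ψ) (h3 : tsupport ψ ⊆ Ω) :
    𝓓(Ω, ℝ) where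
  toFun x := L (ψ x)
  contDiff' := L.contDiff.comp h1
  hasCompactSupport' := h2.comp_left (map_zero L)
  tsupport_subset' := (tsupport_comp_subset (map_zero L) ψ).trans h3

lemma testPart_apply (L : ℂ →L[ℝ] ℝ) (Ω : TopologicalSpace.Opens Plane) (ψ : Plane → ℂ)
    (h1 : Smooth ψ) (h2 : HasCompactSupport ψ) (h3 : tsupport ψ ⊆ Ω) (x : Plane) :
    testPart L Ω ψ h1 h2 h3 x = L (ψ x) := rfl

lemma fderiv_testPart (L : ℂ →L[ℝ] ℝ) (Ω : TopologicalSpace.Opens Plane) (ψ : Plane → ℂ)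
    (h1 : Smooth ψ) (h2 : HasCompactSupport ψ) (h3 : tsupport ψ ⊆ Ω) (x v : Plane) :
    fderiv ℝ (testPart L Ω ψ h1 h2 h3) x v = L (fderiv ℝ ψ x v) := by
  have h := L.hasFDerivAt.comp x (h1.differentiable (by simp) x).hasFDerivAt
  have : ⇑(testPart L Ω ψ h1 h2 h3) = L ∘ ψ := rfl
  rw [this, h.fderiv]; rfl

/-- The weak formulation on `Ω ∖ {0}`, with complex-valued test functions. -/
structure WeakSol (ω σa lam R : ℝ) (f : ℝ → ℂ) (U : Plane → ℂ) (G : Fin 2 → Plane → ℂ) :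
    Prop where
  memU : L2Away U
  memG : ∀ j, L2Away (G j)
  green : ∀ j, ∀ ψ : Plane → ℂ, Smooth ψ → HasCompactSupport ψ →
    (0 : Plane) ∉ tsupport ψ →
    ∫ x in 𝔹, (U x * fderiv ℝ ψ x (e j) + G j x * ψ x)
      = ∫ θ in 0..2 * π, 3 * (f θ * (polar 1 θ j : ℂ) * ψ (polar 3 θ))
  weak : ∀ φ : Plane → ℂ, Smooth φ → HasCompactSupport φ →
    tsupport φ ⊆ 𝔹 → (0 : Plane) ∉ tsupport φ →
    ∫ x in 𝔹,
      (-(∑ j : Fin 2, ∑ k : Fin 2, (sigmaR σa R x j k : ℂ) * G k x * fderiv ℝ φ x (e j))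
        + (ω : ℂ) ^ 2 / (lambdaR lam R x : ℂ) * U x * φ x) = 0

lemma intervalIntegrable_of_memLp {f : ℝ → ℂ}
    (hf : MemLp f 2 dθ) :
    IntervalIntegrable f volume 0 (2 * π) :=
  (intervalIntegrable_iff_integrableOn_Ioc_of_le Real.two_pi_pos.le).2 (hf.integrable one_le_two)

lemma continuous_polar_angle (r : ℝ) : Continuous (polar r) :=
  continuous_polar.comp (Continuous.prodMk_right r)

lemma continuous_fderiv_apply {E : Type*} [NormedAddCommGroup E] [NormedSpace ℝ E] {ψ : Plane → E}
    (h : Smooth ψ) (v : Plane) : Continuous fun x => fderiv ℝ ψ x v :=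
  (h.continuous_fderiv (by simp)).clm_apply continuous_const

/-- Real test functions suffice, by splitting complex ones into real and imaginary part. -/
lemma IsSolution.exists_weakSol {ω σa lam R : ℝ} {N : ℕ} {q : ℕ × ℕ → ℂ} {f : ℝ → ℂ}
    {u : 𝓓'(Omega, ℂ)} {U : Plane → ℂ} (hσ : 0 < σa) (hlam : 0 < lam) (hR : 1 < R)
    (hf : MemLp f 2 dθ)
    (h : IsSolution ω σa lam R N q f u U) : ∃ G, WeakSol ω σa lam R f U G := by
  obtain ⟨G, hG, hgreen, hweak⟩ := h.outer_eq
  have hU : L2Away U := h.memLp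
  have hG' : ∀ j, L2Away (G j) := hG
  refine ⟨G, hU, hG', fun j ψ h1 h2 h3 => ?_, fun φ h1 h2 h3 h4 => ?_⟩
  · have hs : tsupport ψ ⊆ (Punctured : Set Plane) := fun x hx h0 => h3 (by
      rw [Set.mem_singleton_iff.1 h0] at hx; exact hx)
    obtain ⟨ε, hε, h0⟩ := exists_ball_zero h3
    have key (L : ℂ →L[ℝ] ℝ) := hgreen j (testPart L _ ψ h1 h2 hs)
    simp only [testPart_apply, fderiv_testPart] at key
    have hi (L : ℂ →L[ℝ] ℝ) : IntegrableOn (fun x => U x * (L (fderiv ℝ ψ x (e j)) : ℂ)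
        + G j x * (L (ψ x) : ℂ)) 𝔹 := by
      refine Integrable.add ?_ ?_
      · exact hU.integrableOn_mul_of_continuous
          (Complex.continuous_ofReal.comp (L.continuous.comp (continuous_fderiv_apply h1 _))) hε
          fun x hx => by simp [(h0 x hx).2]
      · exact (hG' j).integrableOn_mul_of_continuous
          (Complex.continuous_ofReal.comp (L.continuous.comp h1.continuous)) hε
          fun x hx => by simp [(h0 x hx).1]
    have hb (L : ℂ →L[ℝ] ℝ) : IntervalIntegrable
        (fun θ => 3 * (f θ * (polar 1 θ j : ℂ) * (L (ψ (polar 3 θ)) : ℂ))) volume 0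
          (2 * π) := by
      have hc : Continuous fun θ => 3 * ((polar 1 θ j : ℂ) * (L (ψ (polar 3 θ)) : ℂ)) := by
        have h5 : Continuous fun θ => polar 1 θ j :=
          (contDiff_apply (n := 0) j).continuous.comp (continuous_polar_angle 1)
        have h6 : Continuous fun θ => L (ψ (polar 3 θ)) :=
          L.continuous.comp (h1.continuous.comp (continuous_polar_angle 3))
        exact continuous_const.mul
          ((Complex.continuous_ofReal.comp h5).mul (Complex.continuous_ofReal.comp h6))
      refine ((intervalIntegrable_of_memLp hf).mul_continuousOn hc.continuousOn).congr ?_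
      exact fun θ _ => by ring
    have e1 : ∀ z : ℂ, z = (Complex.reCLM z : ℂ) + I * (Complex.imCLM z : ℂ) := fun z => by
      rw [mul_comm]; exact (Complex.re_add_im z).symm
    calc _ = ∫ x in 𝔹, ((U x * (Complex.reCLM (fderiv ℝ ψ x (e j)) : ℂ)
        + G j x * (Complex.reCLM (ψ x) : ℂ))
        + I * (U x * (Complex.imCLM (fderiv ℝ ψ x (e j)) : ℂ)
        + G j x * (Complex.imCLM (ψ x) : ℂ))) := by
          congr 1; funext x
          rw [e1 (fderiv ℝ ψ x (e j)), e1 (ψ x)]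
          simp
          ring
      _ = _ := by
          rw [integral_add (hi _) ((hi _).const_mul _), integral_const_mul, key, key,
            ← intervalIntegral.integral_const_mul, ← intervalIntegral.integral_add (hb _)
            ((hb _).const_mul _)]
          congr 1; funext θ
          rw [e1 (ψ (polar 3 θ))]
          simp
          ring
  · obtain ⟨ε, hε, h0⟩ := exists_ball_zero h4
    have key (L : ℂ →L[ℝ] ℝ) : ∫ x in 𝔹,
        (-(∑ j : Fin 2, ∑ k : Fin 2,
          (sigmaR σa R x j k : ℂ) * G k x * (L (fderiv ℝ φ x (e j)) : ℂ))
        + (ω : ℂ) ^ 2 / (lambdaR lam R x : ℂ) * U x * (L (φ x) : ℂ)) = 0 := by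
      rw [← hweak (testPart L _ φ h1 h2 h3) fun hx => h4
        (tsupport_comp_subset (map_zero L) φ hx)]
      refine integral_congr_ae (Eventually.of_forall fun x => ?_)
      refine congrArg₂ (· + ·) (congrArg Neg.neg ?_) rfl
      refine Finset.sum_congr rfl fun j _ => Finset.sum_congr rfl fun k _ => ?_
      exact congrArg (fun z : ℝ => (sigmaR σa R x j k : ℂ) * G k x * (z : ℂ))
        (fderiv_testPart L Omega φ h1 h2 h3 x (e j)).symm
    have hi (L : ℂ →L[ℝ] ℝ) : IntegrableOn (fun x =>
        (-(∑ j : Fin 2, ∑ k : Fin 2,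
          (sigmaR σa R x j k : ℂ) * G k x * (L (fderiv ℝ φ x (e j)) : ℂ))
        + (ω : ℂ) ^ 2 / (lambdaR lam R x : ℂ) * U x * (L (φ x) : ℂ)))
        𝔹 := by
      refine Integrable.add (Integrable.neg (integrable_finsetSum _ fun j _ => ?_)) ?_
      · simp_rw [← Finset.sum_mul]
        exact (L2Away.flux hσ hR hG' j).integrableOn_mul_of_continuous
          (Complex.continuous_ofReal.comp (L.continuous.comp (continuous_fderiv_apply h1 _))) hε
          fun x hx => by simp [(h0 x hx).2]
      · exact (hU.inv_lambdaR hlam hR _).integrableOn_mul_of_continuous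
          (Complex.continuous_ofReal.comp (L.continuous.comp h1.continuous)) hε
          fun x hx => by simp [(h0 x hx).1]
    have e1 : ∀ z : ℂ, z = (Complex.reCLM z : ℂ) + I * (Complex.imCLM z : ℂ) := fun z => by
      rw [mul_comm]; exact (Complex.re_add_im z).symm
    have := (integral_add (hi Complex.reCLM) ((hi Complex.imCLM).const_mul I))
    rw [integral_const_mul, key, key, mul_zero, add_zero] at this
    rw [← this]
    congr 1; funext x
    rw [e1 (φ x), Fin.sum_univ_two, Fin.sum_univ_two, Fin.sum_univ_two, e1 (fderiv ℝ φ x (e 0)),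
      e1 (fderiv ℝ φ x (e 1))]
    simp [Fin.sum_univ_two]
    ring

end

noncomputable section

/-! ### The radial equations of a weak solution -/

/-- Smooth radial profiles that vanish near `0` and beyond the radius `M`. -/
structure RadCut (h : ℝ → ℂ) (M : ℝ) : Prop where
  smooth : Smooth h
  near : ∃ ε : ℝ, 0 < ε ∧ ∀ r < ε, h r = 0
  far : ∀ r, M < r → h r = 0

namespace RadCut

variable {h : ℝ → ℂ} {M : ℝ}

lemma radAng_near (hh : RadCut h M) (m : ℤ) : radAng h m =ᶠ[𝓝 0] 0 := by
  obtain ⟨ε, hε, h0⟩ := hh.near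
  filter_upwards [Metric.ball_mem_nhds (0 : Plane) hε] with x hx
  simp [radAng, h0 _ (mem_ball_zero_iff.1 hx)]

lemma contDiff (hh : RadCut h M) (m : ℤ) : Smooth (radAng h m) := by
  refine contDiff_iff_contDiffAt.2 fun x => ?_
  rcases eq_or_ne x 0 with rfl | hx
  · exact (contDiffAt_const (c := (0 : ℂ))).congr_of_eventuallyEq (hh.radAng_near m)
  · exact contDiffAt_radAng m hx hh.smooth.contDiffAt

lemma tsupport_subset (hh : RadCut h M) (m : ℤ) : tsupport (radAng h m) ⊆ Metric.closedBall 0 M := by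
  refine closure_minimal (fun x hx => ?_) Metric.isClosed_closedBall
  by_contra hx'
  rw [mem_closedBall_zero_iff, not_le] at hx'
  exact hx (by simp [radAng, hh.far _ hx'])

lemma hasCompactSupport (hh : RadCut h M) (m : ℤ) : HasCompactSupport (radAng h m) :=
  (isCompact_closedBall (0 : Plane) M).of_isClosed_subset (isClosed_tsupport _)
    (hh.tsupport_subset m)

lemma zero_notMem (hh : RadCut h M) (m : ℤ) : (0 : Plane) ∉ tsupport (radAng h m) :=
  notMem_tsupport_iff_eventuallyEq.2 (hh.radAng_near m)

lemma bddCut (hh : RadCut h M) : BddCut h := by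
  obtain ⟨ε, hε, h0⟩ := hh.near
  exact BddCut.of_continuous hh.smooth.continuous hε h0

lemma bddCut_deriv (hh : RadCut h M) : BddCut (deriv h) := by
  obtain ⟨ε, hε, h0⟩ := hh.near
  refine BddCut.of_continuous (hh.smooth.continuous_deriv (by simp)) hε fun r hr => ?_
  have : h =ᶠ[𝓝 r] fun _ => 0 := by
    filter_upwards [Iio_mem_nhds hr] with y hy using h0 y hy
  rw [this.deriv_eq, deriv_const]

lemma differentiable (hh : RadCut h M) : Differentiable ℝ h := hh.smooth.differentiable (by simp)

end RadCut

lemma exists_radCut_of {ζ : ℝ → ℝ} (h1 : Smooth ζ) (h2 : HasCompactSupport ζ)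
    (h3 : tsupport ζ ⊆ Ioi 0) (k : ℕ) :
    ∃ M, RadCut (fun r => (ζ r : ℂ) * ((r : ℂ)⁻¹) ^ k) M := by
  obtain ⟨ε, hε, -, h0⟩ := exists_lt_of_tsupport_subset_Ioi h2 h3
  obtain ⟨M, hM⟩ := h2.isBounded.subset_closedBall 0
  refine ⟨M, contDiff_iff_contDiffAt.2 fun r => ?_, ⟨ε, hε, fun r hr => by simp [h0 r hr.le]⟩,
    fun r hr => ?_⟩
  · rcases lt_or_ge r ε with h | h
    · refine (contDiffAt_const (c := (0 : ℂ))).congr_of_eventuallyEq ?_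
      filter_upwards [Iio_mem_nhds h] with y hy
      simp [h0 y (le_of_lt hy)]
    · have hr : (r : ℂ) ≠ 0 := mod_cast (hε.trans_le h).ne'
      have h4 : ContDiffAt ℝ (⊤ : ℕ∞) (fun r : ℝ => (r : ℂ)) r :=
        Complex.ofRealCLM.contDiff.contDiffAt
      exact (Complex.ofRealCLM.contDiff.contDiffAt.comp r h1.contDiffAt).mul ((h4.inv hr).pow k)
  · have : r ∉ tsupport ζ := fun h => by
      have := hM h
      rw [Real.closedBall_eq_Icc] at this
      linarith [this.2]
    simp [image_eq_zero_of_notMem_tsupport this]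

lemma integral_neg_add_add {α : Type*} [MeasurableSpace α] {μ : Measure α} {A B C : α → ℂ}
    (hA : Integrable A μ) (hB : Integrable B μ) (hC : Integrable C μ) :
    ∫ x, (-A x + B x + C x) ∂μ = -∫ x, A x ∂μ + ∫ x, B x ∂μ + ∫ x, C x ∂μ := by
  have e1 := integral_add (f := fun x => -A x + B x) (hA.neg.add hB) hC
  have e2 := integral_add (f := fun x => -A x) hA.neg hB
  rw [integral_neg] at e2
  rw [e1, e2]

namespace WeakSol

variable {ω σa lam R : ℝ} {f : ℝ → ℂ} {U : Plane → ℂ} {G : Fin 2 → Plane → ℂ}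

/-- Green's formula for the product of a function and a linear vector field. -/
lemma green_vec (h : WeakSol ω σa lam R f U G)
    (hf : MemLp f 2 dθ)
    (c : Fin 2 → (Plane →L[ℝ] ℝ)) {w : Plane → ℂ} (h1 : Smooth w)
    (h2 : HasCompactSupport w) (h3 : (0 : Plane) ∉ tsupport w) :
    ∫ x in 𝔹, (U x * ∑ j, (fderiv ℝ w x (e j) * c j x + w x * c j (e j))
        + (∑ j, c j x * G j x) * w x)
      = ∫ θ in 0..2 * π,
          3 * (f θ * (∑ j, (polar 1 θ j : ℂ) * c j (polar 3 θ)) * w (polar 3 θ)) := by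
  have hsm (j : Fin 2) : Smooth fun x => w x * (c j x : ℂ) :=
    h1.mul (Complex.ofRealCLM.contDiff.comp (c j).contDiff)
  have hts (j : Fin 2) : tsupport (fun x => w x * (c j x : ℂ)) ⊆ tsupport w :=
    closure_mono (Function.support_mul_subset_left _ _)
  have hg (j : Fin 2) := h.green j _ (hsm j) (h2.mul_right) fun h0 => h3 (hts j h0)
  obtain ⟨ε, hε, h0⟩ := exists_ball_zero h3
  have hi (j : Fin 2) : IntegrableOn (fun x => U x * fderiv ℝ (fun x => w x * (c j x : ℂ)) x (e j)
      + G j x * (w x * (c j x : ℂ))) 𝔹 := by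
    obtain ⟨ε', hε', h0'⟩ := exists_ball_zero fun h0 => h3 (hts j h0)
    exact (h.memU.integrableOn_mul_of_continuous (continuous_fderiv_apply (hsm j) _) hε'
      fun x hx => by simp [(h0' x hx).2]).add
      ((h.memG j).integrableOn_mul_of_continuous (hsm j).continuous hε' fun x hx => (h0' x hx).1)
  have hb (j : Fin 2) : IntervalIntegrable (fun θ => 3 * (f θ * (polar 1 θ j : ℂ)
      * (w (polar 3 θ) * (c j (polar 3 θ) : ℂ)))) volume 0 (2 * π) := by
    have h5 : Continuous fun θ => polar 1 θ j :=
      (contDiff_apply (n := 0) j).continuous.comp (continuous_polar_angle 1)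
    have h6 : Continuous fun θ => w (polar 3 θ) * (c j (polar 3 θ) : ℂ) :=
      (hsm j).continuous.comp (continuous_polar_angle 3)
    have hc : Continuous fun θ => 3 * ((polar 1 θ j : ℂ) * (w (polar 3 θ) * (c j (polar 3 θ) : ℂ))) :=
      continuous_const.mul ((Complex.continuous_ofReal.comp h5).mul h6)
    refine ((intervalIntegrable_of_memLp hf).mul_continuousOn hc.continuousOn).congr ?_
    exact fun θ _ => by ring
  have h7 := congrArg₂ (· + ·) (hg 0) (hg 1)
  simp only at h7
  rw [← integral_add (hi 0) (hi 1), ← intervalIntegral.integral_add (hb 0) (hb 1)] at h7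
  have hfd (j : Fin 2) (x : Plane) : fderiv ℝ (fun x => w x * (c j x : ℂ)) x (e j)
      = fderiv ℝ w x (e j) * c j x + w x * c j (e j) := by
    have ha := (h1.differentiable (by simp) x).hasFDerivAt
    have hb : HasFDerivAt (fun x => (c j x : ℂ)) (Complex.ofRealCLM.comp (c j)) x :=
      (Complex.ofRealCLM.comp (c j)).hasFDerivAt
    have hm : HasFDerivAt (fun x => w x * (c j x : ℂ)) _ x := ha.mul hb
    rw [hm.fderiv]
    simp
    ring
  simp only [hfd] at h7
  convert h7 using 2
  · funext x
    simp only [Fin.sum_univ_two]; ring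
  · funext θ
    simp only [Fin.sum_univ_two]; ring

lemma memRadial (h : WeakSol ω σa lam R f U G) : L2Away fun x => ∑ j, (x j : ℂ) * G j x := by
  have h1 (j : Fin 2) : L2Away fun x => (x j : ℂ) * G j x :=
    (h.memG j).bdd_mul (C := 3) (Complex.measurable_ofReal.comp
      (contDiff_apply (n := 0) j).continuous.measurable) fun x hx => by
        have := PiLp.norm_apply_le x j
        rw [mem_ball_zero_iff] at hx
        simpa using this.trans hx.le
  simpa only [Fin.sum_univ_two] using (h1 0).add (h1 1)

lemma memTan (h : WeakSol ω σa lam R f U G) : L2Away fun x => ∑ j, (perp x j : ℂ) * G j x := by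
  have h1 (i j : Fin 2) (s : ℝ) (hs : |s| ≤ 1) : L2Away fun x => ((s * x i : ℝ) : ℂ) * G j x :=
    (h.memG j).bdd_mul (C := 3) (Complex.measurable_ofReal.comp
      ((contDiff_apply (n := 0) i).continuous.measurable.const_mul s)) fun x hx => by
        have h2 := PiLp.norm_apply_le x i
        rw [mem_ball_zero_iff] at hx
        rw [Complex.norm_real, norm_mul]
        calc ‖s‖ * ‖x i‖ ≤ 1 * ‖x i‖ := mul_le_mul_of_nonneg_right hs (norm_nonneg _)
          _ ≤ 3 := by linarith
  have := (h1 1 0 (-1) (by simp)).add (h1 0 1 1 (by simp))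
  simpa only [Fin.sum_univ_two, perp_apply_zero, perp_apply_one, one_mul, neg_mul] using this

variable (hf : MemLp f 2 dθ)
include hf

/-- Green's formula for the gradient, tested with `k(r) e^{-ilθ} x`: the radial derivative of a Fourier
coefficient, together with its boundary value. -/
lemma radial_test (h : WeakSol ω σa lam R f U G) (l : ℤ) {k : ℝ → ℂ} {M : ℝ} (hk : RadCut k M) :
    ∫ r in Ioo (0 : ℝ) 3, ((2 * r * k r + r ^ 2 * deriv k r) * circ U l r
        + r * k r * circ (fun x => ∑ j, (x j : ℂ) * G j x) l r)
      = 9 * k 3 * ∫ θ in 0..2 * π,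
          exp (-((l : ℂ) * (θ : ℂ) * I)) * f θ := by
  have h1 := h.green_vec hf (fun j => EuclideanSpace.proj j) (hk.contDiff (-l))
    (hk.hasCompactSupport _) (hk.zero_notMem _)
  set g : Plane → ℂ := fun x => ∑ j, (x j : ℂ) * G j x with hg
  set K : ℝ → ℂ := fun r => 2 * k r + r * deriv k r with hK
  have hKb : BddCut K := by
    obtain ⟨ε, hε, h0⟩ := hk.near
    have hc : Continuous K := (continuous_const.mul hk.smooth.continuous).add
      (Complex.continuous_ofReal.mul (hk.smooth.continuous_deriv (by simp)))
    refine BddCut.of_continuous hc hε fun r hr => ?_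
    have : k =ᶠ[𝓝 r] fun _ => 0 := by
      filter_upwards [Iio_mem_nhds hr] with y hy using h0 y hy
    simp [hK, h0 r hr, this.deriv_eq]
  have h2 : ∫ x in 𝔹, (U x * radAng K (-l) x + g x * radAng k (-l) x)
      = 9 * k 3 * ∫ θ in 0..2 * π,
          exp (-((l : ℂ) * (θ : ℂ) * I)) * f θ := by
    rw [← intervalIntegral.integral_const_mul]
    refine (integral_congr_ae ?_).trans (h1.trans ?_)
    · have h0 : ∀ᵐ x : Plane, x ≠ 0 := by simp [ae_iff]
      filter_upwards [ae_restrict_of_ae h0] with x hx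
      have h3 := fderiv_radAng_self (-l) hx (hk.differentiable ‖x‖)
      rw [clm_apply_eq] at h3
      simp only [Complex.real_smul] at h3
      simp only [Fin.sum_univ_two, hg, hK, PiLp.proj_apply]
      simp only [e, PiLp.single_apply, radAng, Fin.isValue, if_true] at h3 ⊢
      push_cast
      linear_combination (-U x) * h3
    · refine intervalIntegral.integral_congr fun θ _ => ?_
      have h5 : (-l : ℤ) * (θ : ℂ) * I = -(l * θ * I) := by push_cast; ring
      simp only [radAng_polar k (-l) three_pos, h5, Fin.sum_univ_two, PiLp.proj_apply,
        polar_apply_zero, polar_apply_one]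
      have := Real.sin_sq_add_cos_sq θ
      have h6 : (Real.sin θ : ℂ) ^ 2 + (Real.cos θ : ℂ) ^ 2 = 1 := mod_cast this
      push_cast at h6 ⊢
      linear_combination (9 * f θ * k 3 * exp (-(l * θ * I))) * h6
  rw [← h2, integral_add (hKb.integrableOn h.memU _) (hk.bddCut.integrableOn h.memRadial _),
    integral_mul_radAng h.memU hKb, integral_mul_radAng h.memRadial hk.bddCut,
    ← integral_add (hKb.integrableOn_circ h.memU _) (hk.bddCut.integrableOn_circ h.memRadial _)]
  congr 1; funext r
  simp only [hK, hg]; ring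

/-- Green's formula for the gradient, tested with `k(r) e^{-ilθ}` times the rotated position vector: the
angular derivative acts as multiplication by `il`. -/
lemma tangential_test (h : WeakSol ω σa lam R f U G) (l : ℤ) {k : ℝ → ℂ} {M : ℝ}
    (hk : RadCut k M) :
    ∫ r in Ioo (0 : ℝ) 3, (r * k r * circ (fun x => ∑ j, (perp x j : ℂ) * G j x) l r
        - I * l * (r * k r * circ U l r)) = 0 := by
  have h1 := h.green_vec hf ![-(EuclideanSpace.proj 1), EuclideanSpace.proj 0] (hk.contDiff (-l))
    (hk.hasCompactSupport _) (hk.zero_notMem _)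
  set t : Plane → ℂ := fun x => ∑ j, (perp x j : ℂ) * G j x with ht
  have h2 : ∫ x in 𝔹,
      (t x * radAng k (-l) x - I * l * (U x * radAng k (-l) x)) = 0 := by
    refine (integral_congr_ae ?_).trans (h1.trans ?_)
    · have h0 : ∀ᵐ x : Plane, x ≠ 0 := by simp [ae_iff]
      filter_upwards [ae_restrict_of_ae h0] with x hx
      have h3 := fderiv_radAng_perp (-l) hx (hk.differentiable ‖x‖)
      rw [clm_apply_eq] at h3
      simp only [Complex.real_smul, perp_apply_zero, perp_apply_one] at h3
      simp only [Fin.sum_univ_two, ht, PiLp.proj_apply, Matrix.cons_val_zero, Matrix.cons_val_one,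
        neg_apply, perp_apply_zero, perp_apply_one]
      simp only [e, PiLp.single_apply, Fin.isValue] at h3 ⊢
      push_cast at h3 ⊢
      linear_combination (-U x) * h3
    · have : ∀ θ, 3 * (f θ * (∑ j, (polar 1 θ j : ℂ) * ((![-(EuclideanSpace.proj 1),
          EuclideanSpace.proj 0] : Fin 2 → (Plane →L[ℝ] ℝ)) j (polar 3 θ) : ℝ))
          * radAng k (-l) (polar 3 θ)) = 0 := by
        intro θ
        simp only [Fin.sum_univ_two, PiLp.proj_apply, Matrix.cons_val_zero, Matrix.cons_val_one,
          neg_apply, polar_apply_zero, polar_apply_one]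
        push_cast
        ring
      simp only [this, intervalIntegral.integral_zero]
  rw [integral_sub (hk.bddCut.integrableOn h.memTan _)
    ((hk.bddCut.integrableOn h.memU _).const_mul _), integral_const_mul,
    integral_mul_radAng h.memU hk.bddCut, integral_mul_radAng h.memTan hk.bddCut,
    ← integral_const_mul, ← integral_sub (hk.bddCut.integrableOn_circ h.memTan _)
    ((hk.bddCut.integrableOn_circ h.memU _).const_mul _)] at h2
  exact h2

omit hf in
/-- The equation tested with `k(r) e^{-ilθ}`. -/
lemma weak_test (h : WeakSol ω σa lam R f U G) (hσ : 0 < σa) (hlam : 0 < lam) (hR : 1 < R) (l : ℤ)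
    {k : ℝ → ℂ} {M : ℝ} (hM : M < 3) (hk : RadCut k M) :
    ∫ r in Ioo (0 : ℝ) 3,
      (-(r * ((r : ℂ)⁻¹ * (sigRad σa R r * deriv k r))
          * circ (fun x => ∑ j, (x j : ℂ) * G j x) l r)
        + I * l * (r * ((r : ℂ)⁻¹ * ((r : ℂ)⁻¹ * (sigTan σa R r * k r)))
          * circ (fun x => ∑ j, (perp x j : ℂ) * G j x) l r)
        + (ω : ℂ) ^ 2 * (r * ((lamRad lam R r : ℂ)⁻¹ * k r) * circ U l r)) = 0 := by
  have h1 := h.weak _ (hk.contDiff (-l)) (hk.hasCompactSupport _)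
    ((hk.tsupport_subset _).trans (Metric.closedBall_subset_ball hM)) (hk.zero_notMem _)
  set g : Plane → ℂ := fun x => ∑ j, (x j : ℂ) * G j x with hg
  set t : Plane → ℂ := fun x => ∑ j, (perp x j : ℂ) * G j x with ht
  set K1 : ℝ → ℂ := fun r => (r : ℂ)⁻¹ * (sigRad σa R r * deriv k r) with hK1
  set K2 : ℝ → ℂ := fun r => (r : ℂ)⁻¹ * ((r : ℂ)⁻¹ * (sigTan σa R r * k r)) with hK2
  set K3 : ℝ → ℂ := fun r => (lamRad lam R r : ℂ)⁻¹ * k r with hK3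
  have b1 : BddCut K1 := ((hk.bddCut_deriv).mul (bddMult_sigRad hσ hR)).mul bddMult_inv
  have b2 : BddCut K2 := (((hk.bddCut).mul (bddMult_sigTan hσ hR)).mul bddMult_inv).mul bddMult_inv
  have b3 : BddCut K3 := hk.bddCut.mul (bddMult_lamRad hlam hR)
  have h2 : ∫ x in 𝔹, (-(g x * radAng K1 (-l) x)
      + I * l * (t x * radAng K2 (-l) x) + (ω : ℂ) ^ 2 * (U x * radAng K3 (-l) x)) = 0 := by
    refine (integral_congr_ae ?_).trans h1
    have h0 : ∀ᵐ x : Plane, x ≠ 0 := by simp [ae_iff]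
    filter_upwards [ae_restrict_of_ae h0] with x hx
    have hr : (‖x‖ : ℂ) ≠ 0 := mod_cast norm_ne_zero_iff.2 hx
    have h3 := fderiv_radAng_perp (-l) hx (hk.differentiable ‖x‖)
    have h4 := fderiv_radAng_self (-l) hx (hk.differentiable ‖x‖)
    rw [clm_apply_eq] at h3 h4
    simp only [Complex.real_smul] at h3 h4
    rw [sum_sigmaR σa R hx (fun k => G k x) fun j => fderiv ℝ (radAng k (-l)) x (e j),
      Fin.sum_univ_two (fun j => (x j : ℂ) * fderiv ℝ (radAng k (-l)) x (e j)),
      Fin.sum_univ_two (fun j => (perp x j : ℂ) * fderiv ℝ (radAng k (-l)) x (e j)), h3, h4,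
      lambdaR_eq]
    simp only [radAng, hK1, hK2, hK3, hg, ht]
    push_cast
    field_simp
    ring
  have i1 := b1.integrableOn h.memRadial (-l)
  have i2 := (b2.integrableOn h.memTan (-l)).const_mul (I * l)
  have i3 := (b3.integrableOn h.memU (-l)).const_mul ((ω : ℂ) ^ 2)
  have j1 := b1.integrableOn_circ h.memRadial l
  have j2 := (b2.integrableOn_circ h.memTan l).const_mul (I * l)
  have j3 := (b3.integrableOn_circ h.memU l).const_mul ((ω : ℂ) ^ 2)
  have h3 := (integral_neg_add_add i1 i2 i3).symm.trans h2
  rw [integral_const_mul, integral_const_mul, integral_mul_radAng h.memU b3,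
    integral_mul_radAng h.memTan b2, integral_mul_radAng h.memRadial b1, ← integral_const_mul,
    ← integral_const_mul] at h3
  exact (integral_neg_add_add j1 j2 j3).trans h3

/-- The Fourier coefficients of a weak solution solve the radial system. -/
lemma exists_modeSol (h : WeakSol ω σa lam R f U G) (hσ : 0 < σa) (hlam : 0 < lam) (hR : 1 < R)
    (l : ℤ) : ∃ u p : ℝ → ℂ, ModeSol ω σa lam R l u p ∧
      u 3 = (∫ θ in 0..2 * π,
          exp (-((l : ℂ) * (θ : ℂ) * I)) * f θ) ∧
      ∀ᵐ r, r ∈ Ioo (0 : ℝ) 3 → circ U l r = u r := by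
  set g : Plane → ℂ := fun x => ∑ j, (x j : ℂ) * G j x with hg
  set t : Plane → ℂ := fun x => ∑ j, (perp x j : ℂ) * G j x with ht
  have hgI (ε : ℝ) (hε : 0 < ε) : IntegrableOn (circ g l) (Ioo ε 3) :=
    h.memRadial.circ_integrableOn l hε
  have hUI (ε : ℝ) (hε : 0 < ε) : IntegrableOn (circ U l) (Ioo ε 3) :=
    h.memU.circ_integrableOn l hε
  have htI (ε : ℝ) (hε : 0 < ε) : IntegrableOn (circ t l) (Ioo ε 3) :=
    h.memTan.circ_integrableOn l hε
  have hmul {b V : ℝ → ℂ} (hb : BddMult b) (ε : ℝ) (hε : 0 < ε) (hV : IntegrableOn V (Ioo ε 3)) :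
      IntegrableOn (fun r => b r * V r) (Ioo ε 3) := by
    obtain ⟨C, hC⟩ := hb.2 ε hε
    refine Integrable.bdd_mul (c := C) hV hb.1.aestronglyMeasurable ?_
    filter_upwards [ae_restrict_mem measurableSet_Ioo] with r hr using hC r ⟨hr.1.le, hr.2⟩
  have htU : ∀ᵐ r, r ∈ Ioo (0 : ℝ) 3 → circ t l r = I * l * circ U l r := by
    have hloc : LocallyIntegrableOn (fun r => circ t l r - I * l * circ U l r)
        (Ioo 0 3) := locallyIntegrableOn_of_forall fun ε hε =>
          (htI ε hε).sub ((hUI ε hε).const_mul _)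
    have := isOpen_Ioo.ae_eq_zero_of_integral_contDiff_smul_eq_zero hloc fun ζ h1 h2 h3 => by
      obtain ⟨M, hk⟩ := exists_radCut_of h1 h2 (h3.trans Set.Ioo_subset_Ioi_self) 1
      have h4 := h.tangential_test hf l hk
      rw [← setIntegral_eq_integral_of_forall_compl_eq_zero (s := Ioo 0 3), ← h4]
      · refine setIntegral_congr_fun measurableSet_Ioo fun r hr => ?_
        have hr0 : (r : ℂ) ≠ 0 := mod_cast hr.1.ne'
        simp only [Complex.real_smul]
        field_simp
        rfl
      · intro r hr
        have : ζ r = 0 := image_eq_zero_of_notMem_tsupport fun hh => hr (h3 hh)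
        simp [this]
    filter_upwards [this] with r hr hr' using sub_eq_zero.1 (hr hr')
  suffices hs : ∃ u p : ℝ → ℂ, ModeSol ω σa lam R l u p ∧
      u 3 = (∫ θ in 0..2 * π,
          exp (-((l : ℂ) * (θ : ℂ) * I)) * f θ) ∧
      (∀ᵐ r, r ∈ Ioo (0 : ℝ) 3 → circ U l r = u r) ∧
      (∀ᵐ r, r ∈ Ioo (0 : ℝ) 3 → sigRad σa R r * circ g l r = p r) by
    obtain ⟨u, p, hup, h3, hU, -⟩ := hs
    exact ⟨u, p, hup, h3, hU⟩
  refine exists_modeSol_ae_eq (ω := ω) (U := circ U l)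
    (P := fun r => sigRad σa R r * circ g l r) (F := ∫ θ in 0..2 * π,
          exp (-((l : ℂ) * (θ : ℂ) * I)) * f θ) hσ hlam hR l hUI
    (fun ε hε => hmul (bddMult_sigRad hσ hR) ε hε (hgI ε hε)) (fun ε hε => by
      refine IntegrableOn.congr_fun (hmul bddMult_inv ε hε (hgI ε hε)) (fun r hr => ?_)
        measurableSet_Ioo
      have hr0 := hε.trans hr.1
      have hr0' : (r : ℂ) ≠ 0 := mod_cast hr0.ne'
      have hs : (sigRad σa R r : ℂ) ≠ 0 := mod_cast (sigRad_pos hσ hR hr0).ne'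
      push_cast
      field_simp) (fun ζ h1 h2 h3 => ?_) (fun ζ h1 h2 h3 => ?_)
  · obtain ⟨M, hk⟩ := exists_radCut_of h1 h2 h3 2
    have h4 := h.radial_test hf l hk
    have e3 : (9 : ℂ) * (ζ 3 * (((3 : ℝ) : ℂ)⁻¹) ^ 2) = ζ 3 := by push_cast; ring
    rw [e3] at h4
    rw [← h4]
    refine setIntegral_congr_fun measurableSet_Ioo fun r hr => ?_
    have hr0' : (r : ℂ) ≠ 0 := mod_cast hr.1.ne'
    have hs : (sigRad σa R r : ℂ) ≠ 0 := mod_cast (sigRad_pos hσ hR hr.1).ne'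
    have hd : HasDerivAt (fun r : ℝ => (ζ r : ℂ) * ((r : ℂ)⁻¹) ^ 2)
        ((deriv ζ r : ℝ) * ((r : ℂ)⁻¹) ^ 2
          + ζ r * (2 * ((r : ℂ)⁻¹) ^ 1 * (-1 / (r : ℂ) ^ 2))) r := by
      have h5 : HasDerivAt (fun r : ℝ => (ζ r : ℂ)) ((deriv ζ r : ℝ) : ℂ) r :=
        (h1.differentiable (by simp) r).hasDerivAt.ofReal_comp
      have h6 : HasDerivAt (fun r : ℝ => (r : ℂ)) 1 r := Complex.ofRealCLM.hasDerivAt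
      exact h5.mul ((h6.fun_inv hr0').fun_pow 2)
    simp only [hd.deriv]
    push_cast
    field_simp
    ring_nf
    simp only [hg, mul_comm]
  · obtain ⟨c, d, hc, -, hd, h0⟩ := exists_Icc_of_tsupport_subset three_pos h2 h3
    have hk : RadCut (fun r => (ζ r : ℂ)) d := by
      refine ⟨Complex.ofRealCLM.contDiff.comp h1, ⟨c, hc, fun r hr => ?_⟩, fun r hr => ?_⟩
      · rw [h0 r fun hh => absurd hh.1 (not_le.2 hr)]; simp
      · rw [h0 r fun hh => absurd hh.2 (not_le.2 hr)]; simp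
    have h4 := h.weak_test hσ hlam hR l hd hk
    rw [← neg_eq_zero, ← integral_neg, ← h4]
    refine setIntegral_congr_ae measurableSet_Ioo ?_
    filter_upwards [htU] with r hr hr'
    have hr0' : (r : ℂ) ≠ 0 := mod_cast hr'.1.ne'
    have hl : (lamRad lam R r : ℂ) ≠ 0 := mod_cast (inv_lamRad_le hlam hR hr'.1).1.ne'
    have hd : deriv (fun r : ℝ => (ζ r : ℂ)) r = ((deriv ζ r : ℝ) : ℂ) :=
      ((h1.differentiable (by simp) r).hasDerivAt.ofReal_comp).deriv
    rw [hd, hr hr']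
    simp only [coefB]
    push_cast
    field_simp
    linear_combination (-(l : ℂ) ^ 2 * sigTan σa R r * lamRad lam R r * circ U l r * ζ r)
      * Complex.I_sq

end WeakSol

end

noncomputable section

/-! ### Detecting the singular part -/

/-- The Laplacian, as the sum of the second partial derivatives. -/
def lap (φ : Plane → ℂ) (x : Plane) : ℂ :=
  ∑ j, fderiv ℝ (fun y => fderiv ℝ φ y (e j)) x (e j)

/-- The Laplacian of `h(r) e^{imθ}`. -/
lemma lap_radAng {h h1 h2 : ℝ → ℂ} (hd : ∀ r > 0, HasDerivAt h (h1 r) r)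
    (hd1 : ∀ r > 0, HasDerivAt h1 (h2 r) r) (m : ℤ) {x : Plane} (hx : x ≠ 0) :
    lap (radAng h m) x
      = radAng (fun r => h2 r + h1 r / r - (m : ℂ) ^ 2 * h r / (r : ℂ) ^ 2) m x := by
  set a : ℝ → ℂ := fun r => h1 r - m * h r / r with ha
  set b : ℝ → ℂ := fun r => h1 r + m * h r / r with hb
  have hq (r : ℝ) (hr : 0 < r) : HasDerivAt (fun r : ℝ => m * h r / (r : ℂ))
      ((m * h1 r * r - m * h r * 1) / (r : ℂ) ^ 2) r :=
    ((hd r hr).const_mul _).div Complex.ofRealCLM.hasDerivAt (mod_cast hr.ne')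
  have hda (r : ℝ) (hr : 0 < r) := (hd1 r hr).sub (hq r hr)
  have hdb (r : ℝ) (hr : 0 < r) := (hd1 r hr).add (hq r hr)
  have hplus (y : Plane) (hy : y ≠ 0) : fderiv ℝ (radAng h m) y (e 0)
      + I * fderiv ℝ (radAng h m) y (e 1) = radAng a (m + 1) y := by
    have hy' := norm_pos_iff.2 hy
    rw [fderiv_radAng_add m hy (hd _ hy').differentiableAt]
    simp only [radAng, ha, (hd _ hy').deriv]
  have hminus (y : Plane) (hy : y ≠ 0) : fderiv ℝ (radAng h m) y (e 0)
      - I * fderiv ℝ (radAng h m) y (e 1) = radAng b (m - 1) y := by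
    have hy' := norm_pos_iff.2 hy
    rw [fderiv_radAng_sub m hy (hd _ hy').differentiableAt]
    simp only [radAng, hb, (hd _ hy').deriv]
  have hI := Complex.I_sq
  have hx' := norm_pos_iff.2 hx
  have hev : ∀ᶠ y in 𝓝 x, y ≠ 0 := isOpen_ne.mem_nhds hx
  have e0 : (fun y => fderiv ℝ (radAng h m) y (e 0)) =ᶠ[𝓝 x]
      fun y => (1 / 2 : ℂ) * (radAng a (m + 1) y + radAng b (m - 1) y) := by
    filter_upwards [hev] with y hy
    linear_combination (1 / 2 : ℂ) * (hplus y hy + hminus y hy)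
  have e1 : (fun y => fderiv ℝ (radAng h m) y (e 1)) =ᶠ[𝓝 x]
      fun y => (-I / 2) * (radAng a (m + 1) y - radAng b (m - 1) y) := by
    filter_upwards [hev] with y hy
    linear_combination (-I / 2) * (hplus y hy - hminus y hy)
      + fderiv ℝ (radAng h m) y (e 1) * hI
  have da := differentiableAt_radAng (m + 1) hx (h := a) (hda _ hx').differentiableAt
  have db := differentiableAt_radAng (m - 1) hx (h := b) (hdb _ hx').differentiableAt
  have f0 := ((da.hasFDerivAt.add db.hasFDerivAt).const_mul (1 / 2 : ℂ)).congr_of_eventuallyEq e0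
  have f1 := ((da.hasFDerivAt.sub db.hasFDerivAt).const_mul
    (-I / 2)).congr_of_eventuallyEq e1
  have g1 := fderiv_radAng_sub (m + 1) hx (h := a) (hda _ hx').differentiableAt
  have g2 := fderiv_radAng_add (m - 1) hx (h := b) (hdb _ hx').differentiableAt
  rw [add_sub_cancel_right] at g1
  rw [sub_add_cancel] at g2
  rw [lap, Fin.sum_univ_two, f0.fderiv, f1.fderiv]
  simp only [smul_apply, add_apply, smul_eq_mul,
    sub_apply]
  have da' : deriv a ‖x‖ = _ := (hda _ hx').deriv
  have db' : deriv b ‖x‖ = _ := (hdb _ hx').deriv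
  have hr : (‖x‖ : ℂ) ≠ 0 := mod_cast hx'.ne'
  have key : radAng (fun r => h2 r + h1 r / r - (m : ℂ) ^ 2 * h r / (r : ℂ) ^ 2) m x
      = (1 / 2 : ℂ) * (radAng (fun r => deriv a r + ((m + 1 : ℤ) : ℂ) * a r / r) m x
        + radAng (fun r => deriv b r - ((m - 1 : ℤ) : ℂ) * b r / r) m x) := by
    simp only [radAng]
    rw [da', db']
    simp only [ha, hb]
    push_cast
    field_simp
    ring
  rw [key, ← g1, ← g2]
  ring

/-- `J_{|m|}(k r) e^{imθ}` is smooth across the origin. -/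
lemma contDiff_besselMode (k : ℝ) (m : ℤ) {n : ℕ∞} :
    ContDiff ℝ n (radAng (fun r => (besselJ m.natAbs (k * r) : ℂ)) m) := by
  set N := m.natAbs with hN
  have hE : ContDiff ℝ n fun x : Plane => ((besselEntire N (k ^ 2 * ‖x‖ ^ 2 / 4) : ℝ) : ℂ) := by
    have h1 : ContDiff ℝ n (besselEntire N) := (expBounded_besselCoeff N).contDiff n
    exact Complex.ofRealCLM.contDiff.comp (h1.comp
      ((contDiff_const.mul (contDiff_norm_sq ℝ)).div_const 4))
  have hJ (x : Plane) : ((besselJ N (k * ‖x‖) : ℝ) : ℂ)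
      = (k / 2 : ℂ) ^ N * (‖x‖ : ℂ) ^ N * (besselEntire N (k ^ 2 * ‖x‖ ^ 2 / 4) : ℝ) := by
    rw [besselJ_eq]
    push_cast
    rw [← mul_pow, mul_pow k]
    congr 2; ring
  have hz (x : Plane) : (‖x‖ : ℂ) ^ N * angular m x
      = if 0 ≤ m then toC x ^ N else (starRingEnd ℂ (toC x)) ^ N := by
    rcases eq_or_ne x 0 with rfl | hx
    · have h0 : toC 0 = 0 := by simp [toC]
      rcases eq_or_ne m 0 with rfl | hm
      · simp [hN]
      · have : N ≠ 0 := by omega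
        simp [h0, this]
    · have hr : (‖x‖ : ℂ) ≠ 0 := mod_cast norm_ne_zero_iff.2 hx
      have hz0 : toC x ≠ 0 := by
        rw [← norm_pos_iff, norm_toC]; exact norm_pos_iff.2 hx
      rw [angular]
      split_ifs with h
      · have : m = (N : ℤ) := by omega
        rw [this, zpow_natCast, ← mul_pow, mul_div_cancel₀ _ hr]
      · have : m = -(N : ℤ) := by omega
        rw [this, zpow_neg, zpow_natCast, ← inv_pow, ← mul_pow, inv_div]
        congr 1
        field_simp
        rw [Complex.mul_conj, Complex.normSq_eq_norm_sq, norm_toC]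
        push_cast; ring
  have hfun : radAng (fun r => (besselJ N (k * r) : ℂ)) m = fun x =>
      (k / 2 : ℂ) ^ N * ((besselEntire N (k ^ 2 * ‖x‖ ^ 2 / 4) : ℝ) : ℂ)
        * (if 0 ≤ m then toC x ^ N else (starRingEnd ℂ (toC x)) ^ N) := by
    funext x
    rw [radAng, hJ, ← hz]; ring
  rw [hfun]
  refine (contDiff_const.mul hE).mul ?_
  split_ifs
  · exact contDiff_toC.pow N
  · exact (Complex.conjCLE.contDiff.comp contDiff_toC).pow N

/-- A smooth function equal to `1` near the origin and to `0` for `r ≥ 2/3`. -/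
def cutoff (r : ℝ) : ℝ := Real.smoothTransition (2 - 3 * r)

lemma contDiff_cutoff : Smooth cutoff :=
  Real.smoothTransition.contDiff.comp (contDiff_const.sub (contDiff_const.mul contDiff_id))

lemma cutoff_eq_one {r : ℝ} (hr : r ≤ 1 / 3) : cutoff r = 1 :=
  Real.smoothTransition.one_of_one_le (by linarith)

lemma cutoff_eq_zero {r : ℝ} (hr : 2 / 3 ≤ r) : cutoff r = 0 :=
  Real.smoothTransition.zero_of_nonpos (by linarith)

lemma hasDerivAt_cutoff (r : ℝ) : HasDerivAt cutoff (deriv cutoff r) r :=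
  (contDiff_cutoff.differentiable (by simp) r).hasDerivAt

lemma contDiff_deriv_cutoff : Smooth (deriv cutoff) :=
  (contDiff_infty_iff_deriv.1 contDiff_cutoff).2

lemma hasDerivAt_deriv_cutoff (r : ℝ) :
    HasDerivAt (deriv cutoff) (deriv (deriv cutoff) r) r :=
  (contDiff_deriv_cutoff.differentiable (by simp) r).hasDerivAt

lemma deriv_cutoff_eq_zero {r : ℝ} (hr : r < 1 / 3 ∨ 2 / 3 < r) :
    deriv cutoff r = 0 ∧ deriv (deriv cutoff) r = 0 := by
  have h : ∀ᶠ y in 𝓝 r, deriv cutoff y = 0 := by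
    rcases hr with hr | hr
    · filter_upwards [Iio_mem_nhds hr] with y hy
      have : cutoff =ᶠ[𝓝 y] fun _ => 1 := by
        filter_upwards [Iio_mem_nhds hy] with z hz using cutoff_eq_one (le_of_lt hz)
      rw [this.deriv_eq, deriv_const]
    · filter_upwards [Ioi_mem_nhds hr] with y hy
      have : cutoff =ᶠ[𝓝 y] fun _ => 0 := by
        filter_upwards [Ioi_mem_nhds hy] with z hz using cutoff_eq_zero (le_of_lt hz)
      rw [this.deriv_eq, deriv_const]
  refine ⟨h.self_of_nhds, ?_⟩
  have : deriv cutoff =ᶠ[𝓝 r] fun _ => 0 := h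
  rw [this.deriv_eq, deriv_const]

/-- The test function that detects the singular part of the Fourier coefficient of order
`-m` of a solution: the regular mode of order `m`, cut off inside the cloaked region. -/
def detector (k : ℝ) (m : ℤ) : Plane → ℂ :=
  radAng (fun r => (cutoff r : ℂ) * besselJ m.natAbs (k * r)) m

lemma detector_eq (k : ℝ) (m : ℤ) : detector k m = fun x =>
    (cutoff ‖x‖ : ℂ) * radAng (fun r => (besselJ m.natAbs (k * r) : ℂ)) m x := by
  funext x; simp only [detector, radAng]; ring

lemma contDiff_detector (k : ℝ) (m : ℤ) : Smooth (detector k m) := by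
  rw [detector_eq]
  refine ContDiff.mul ?_ (contDiff_besselMode k m)
  refine Complex.ofRealCLM.contDiff.comp (contDiff_iff_contDiffAt.2 fun x => ?_)
  rcases eq_or_ne x 0 with rfl | hx
  · refine (contDiffAt_const (c := (1 : ℝ))).congr_of_eventuallyEq ?_
    filter_upwards [Metric.ball_mem_nhds (0 : Plane) (by norm_num : (0 : ℝ) < 1 / 3)] with x hx
    exact cutoff_eq_one (mem_ball_zero_iff.1 hx).le
  · exact contDiff_cutoff.contDiffAt.comp x (contDiffAt_norm ℝ hx)

lemma tsupport_detector (k : ℝ) (m : ℤ) :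
    tsupport (detector k m) ⊆ Metric.closedBall 0 (2 / 3) := by
  refine closure_minimal (fun x hx => ?_) Metric.isClosed_closedBall
  by_contra hx'
  rw [mem_closedBall_zero_iff, not_le] at hx'
  exact hx (by simp [detector, radAng, cutoff_eq_zero hx'.le])

lemma hasCompactSupport_detector (k : ℝ) (m : ℤ) : HasCompactSupport (detector k m) :=
  (isCompact_closedBall (0 : Plane) (2 / 3)).of_isClosed_subset (isClosed_tsupport _)
    (tsupport_detector k m)

/-- First derivative of `C_n(kr)`, in terms of `besselD`. -/
lemma BesselFamily.hasDerivAt_comp {C : ℕ → ℝ → ℝ} (hC : BesselFamily C) {k : ℝ} (hk : 0 < k)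
    (n : ℕ) {r : ℝ} (hr : 0 < r) :
    HasDerivAt (fun r : ℝ => (C n (k * r) : ℂ)) ((besselD C n (k * r) / r : ℝ) : ℂ) r := by
  have h1 := (hC.hasDerivAt n (mul_pos hk hr)).comp r ((hasDerivAt_id r).const_mul k)
  refine (h1.congr_deriv ?_).ofReal_comp
  field_simp

lemma BesselFamily.hasDerivAt_comp_deriv {C : ℕ → ℝ → ℝ} (hC : BesselFamily C) {k : ℝ} (hk : 0 < k)
    (n : ℕ) {r : ℝ} (hr : 0 < r) :
    HasDerivAt (fun r : ℝ => ((besselD C n (k * r) / r : ℝ) : ℂ))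
      ((((n : ℝ) ^ 2 - (k * r) ^ 2) / r ^ 2 * C n (k * r) - besselD C n (k * r) / r ^ 2 : ℝ) : ℂ)
      r := by
  have h1 := ((hC.hasDerivAt_besselD n (mul_pos hk hr)).comp r
    ((hasDerivAt_id r).const_mul k)).div (hasDerivAt_id r) hr.ne'
  refine (h1.congr_deriv ?_).ofReal_comp
  simp only [Function.comp_apply, id]
  field_simp

/-- The radial profile of `(Δ + k²)` applied to the detector. -/
def detectorRHS (k : ℝ) (n : ℕ) (r : ℝ) : ℝ :=
  deriv (deriv cutoff) r * besselJ n (k * r)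
    + 2 * deriv cutoff r * (besselD besselJ n (k * r) / r)
    + deriv cutoff r * besselJ n (k * r) / r

lemma natAbs_sq_cast (m : ℤ) : ((m.natAbs : ℕ) : ℂ) ^ 2 = (m : ℂ) ^ 2 := by
  rw [Nat.cast_natAbs, ← Int.cast_pow, sq_abs, Int.cast_pow]

lemma lap_detector {k : ℝ} (hk : 0 < k) (m : ℤ) {x : Plane} (hx : x ≠ 0) :
    lap (detector k m) x + (k : ℂ) ^ 2 * detector k m x
      = radAng (fun r => (detectorRHS k m.natAbs r : ℂ)) m x := by
  have hc (r : ℝ) : HasDerivAt (fun r : ℝ => (cutoff r : ℂ)) ((deriv cutoff r : ℝ) : ℂ) r :=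
    (hasDerivAt_cutoff r).ofReal_comp
  have hc' (r : ℝ) : HasDerivAt (fun r : ℝ => ((deriv cutoff r : ℝ) : ℂ))
      ((deriv (deriv cutoff) r : ℝ) : ℂ) r := (hasDerivAt_deriv_cutoff r).ofReal_comp
  have hJ := besselFamily_besselJ
  have h1 (r : ℝ) (hr : r > 0) := (hc r).mul (hJ.hasDerivAt_comp hk m.natAbs hr)
  have h2 (r : ℝ) (hr : r > 0) := ((hc' r).mul (hJ.hasDerivAt_comp hk m.natAbs hr)).add
    ((hc r).mul (hJ.hasDerivAt_comp_deriv hk m.natAbs hr))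
  have h3 := lap_radAng h1 h2 m hx
  have hr : (‖x‖ : ℂ) ≠ 0 := mod_cast norm_ne_zero_iff.2 hx
  have h4 : detector k m = radAng ((fun r => (cutoff r : ℂ)) *
    fun r => (besselJ m.natAbs (k * r) : ℂ)) m := rfl
  rw [h4, h3]
  simp only [radAng, detectorRHS, Pi.mul_apply, ← natAbs_sq_cast m]
  push_cast
  field_simp
  ring

end

noncomputable section

lemma test_lineDeriv_apply (φ : 𝓓(Omega, ℝ)) (v x : Plane) :
    (∂_{v} φ : 𝓓(Omega, ℝ)) x = fderiv ℝ φ x v := by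
  rw [TestFunction.lineDerivOp_eq_lineDerivCLM ℝ,
    TestFunction.lineDerivCLM_apply_of_le (by simp),
    ((φ.contDiff.differentiable (by simp)) x).lineDeriv_eq_fderiv]

/-- The Helmholtz operator `Δ + k²` on test functions. -/
def helmTest (k : ℝ) (φ : 𝓓(Omega, ℝ)) : 𝓓(Omega, ℝ) :=
  ∑ j, ∂_{e j} (∂_{e j} φ) + k ^ 2 • φ

lemma helmTest_apply (k : ℝ) (φ : 𝓓(Omega, ℝ)) (x : Plane) : helmTest k φ x
    = ∑ j, fderiv ℝ (fun y => fderiv ℝ φ y (e j)) x (e j) + k ^ 2 * φ x := by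
  have h (j : Fin 2) : (⇑(∂_{e j} φ : 𝓓(Omega, ℝ)) : Plane → ℝ) = fun y => fderiv ℝ φ y (e j) :=
    funext fun y => test_lineDeriv_apply φ (e j) y
  rw [helmTest, Fin.sum_univ_two, Fin.sum_univ_two, ← h 0, ← h 1, ← test_lineDeriv_apply,
    ← test_lineDeriv_apply]
  rfl

lemma helmTest_testPart (k : ℝ) (L : ℂ →L[ℝ] ℝ) (ψ : Plane → ℂ) (h1 : Smooth ψ)
    (h2 : HasCompactSupport ψ) (h3 : tsupport ψ ⊆ Omega) (x : Plane) :
    helmTest k (testPart L Omega ψ h1 h2 h3) x = L (lap ψ x + (k : ℂ) ^ 2 * ψ x) := by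
  rw [helmTest_apply, map_add, lap, map_sum, testPart_apply]
  congr 1
  · refine Finset.sum_congr rfl fun j _ => ?_
    simp only [fderiv_testPart]
    have h4 : Smooth (fun y => fderiv ℝ ψ y (e j)) :=
      (h1.fderiv_right (by simp)).clm_apply contDiff_const
    exact congrArg (· (e j))
      ((L.hasFDerivAt.comp x (h4.differentiable (by simp) x).hasFDerivAt).fderiv)
  · have : (k : ℂ) ^ 2 * ψ x = (k ^ 2 : ℝ) • ψ x := by rw [Complex.real_smul]; push_cast; ring
    rw [this, map_smul, smul_eq_mul]

lemma mul_helmTest {ω σa lam k : ℝ} (hk2 : k ^ 2 * (σa * lam) = ω ^ 2) (u : 𝓓'(Omega, ℂ))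
    (φ : 𝓓(Omega, ℝ)) : (lam * σa : ℂ) * u (helmTest k φ)
      = (lam * σa : ℂ) * ∑ j : Fin 2, (∂_{e j} (∂_{e j} u)) φ + (ω : ℂ) ^ 2 * u φ := by
  have h2 : (k : ℂ) ^ 2 * (σa * lam) = (ω : ℂ) ^ 2 := mod_cast hk2
  have h3 (j : Fin 2) : (∂_{e j} (∂_{e j} u)) φ = u (∂_{e j} (∂_{e j} φ)) := by
    change -(-(u (TestFunction.lineDerivCLM ℝ (e j) (TestFunction.lineDerivCLM ℝ (e j) φ)))) = _
    rw [neg_neg]; rfl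
  rw [helmTest, map_add, map_sum, map_smul, Complex.real_smul, Fin.sum_univ_two, Fin.sum_univ_two,
    h3, h3]
  push_cast
  linear_combination (u φ) * h2

lemma IsSolution.inner_helm {ω σa lam R k : ℝ} {N : ℕ} {q : ℕ × ℕ → ℂ} {f : ℝ → ℂ}
    {u : 𝓓'(Omega, ℂ)} {U : Plane → ℂ} (h : IsSolution ω σa lam R N q f u U)
    (hk2 : k ^ 2 * (σa * lam) = ω ^ 2)
    (φ : 𝓓(Omega, ℝ)) (hφ : tsupport φ ⊆ Metric.ball (0 : Plane) R) :
    (lam * σa : ℂ) * u (helmTest k φ) = source σa lam N q φ := by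
  rw [mul_helmTest hk2, h.inner_eq φ hφ]

/-- The pairing of the source with the detector of order `m`. -/
def sourceMoment (σa lam k : ℝ) (N : ℕ) (q : ℕ × ℕ → ℂ) (m : ℤ) : ℂ :=
  source σa lam N q (testPart Complex.reCLM Omega (detector k m) (contDiff_detector k m)
      (hasCompactSupport_detector k m)
      ((tsupport_detector k m).trans (Metric.closedBall_subset_ball (by norm_num))))
    + I * source σa lam N q (testPart Complex.imCLM Omega (detector k m)
      (contDiff_detector k m) (hasCompactSupport_detector k m)
      ((tsupport_detector k m).trans (Metric.closedBall_subset_ball (by norm_num))))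

lemma detectorRHS_eq_zero {k : ℝ} {n : ℕ} {r : ℝ} (hr : r < 1 / 3 ∨ 2 / 3 < r) :
    detectorRHS k n r = 0 := by
  obtain ⟨h1, h2⟩ := deriv_cutoff_eq_zero hr
  simp [detectorRHS, h1, h2]

/-- Pairing the detector with a radial solution picks out the coefficient of the Neumann function:
the integrand is the derivative of `r χ' J V - β χ`, by the Wronskian identity. -/
lemma integral_detectorRHS {k : ℝ} (hk : 0 < k) (n : ℕ) (α β : ℂ) :
    ∫ r in Ioo (0 : ℝ) 3, r * (detectorRHS k n r : ℂ)
      * (α * besselJ n (k * r) + β * besselY n (k * r)) = β := by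
  have hJ := besselFamily_besselJ
  have hY := besselFamily_besselY
  set V : ℝ → ℂ := fun r => α * besselJ n (k * r) + β * besselY n (k * r) with hV
  set V1 : ℝ → ℂ := fun r => α * (besselD besselJ n (k * r) / r : ℝ)
    + β * (besselD besselY n (k * r) / r : ℝ) with hV1
  have hVd (r : ℝ) (hr : 0 < r) : HasDerivAt V (V1 r) r :=
    ((hJ.hasDerivAt_comp hk n hr).const_mul α).add ((hY.hasDerivAt_comp hk n hr).const_mul β)
  set F : ℝ → ℂ := fun r => r * ((deriv cutoff r : ℝ) : ℂ) * (besselJ n (k * r)) * V r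
    - β * cutoff r with hF
  have hFd (r : ℝ) (hr : 0 < r) : HasDerivAt F (r * (detectorRHS k n r : ℂ) * V r) r := by
    have h0 : HasDerivAt (fun r : ℝ => (r : ℂ)) 1 r := Complex.ofRealCLM.hasDerivAt
    have h1 := (((h0.mul (hasDerivAt_deriv_cutoff r).ofReal_comp).mul
      (hJ.hasDerivAt_comp hk n hr)).mul (hVd r hr)).sub
      ((hasDerivAt_cutoff r).ofReal_comp.const_mul β)
    refine h1.congr_deriv ?_
    have hw := wronskian n (mul_pos hk hr)
    have hw' : (besselJ n (k * r) : ℂ) * besselD besselY n (k * r)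
      - besselD besselJ n (k * r) * besselY n (k * r) = 1 := mod_cast hw
    have hr0 : (r : ℂ) ≠ 0 := mod_cast hr.ne'
    simp only [hV, hV1, detectorRHS, Pi.mul_apply]
    push_cast
    field_simp
    linear_combination ((deriv cutoff r : ℝ) : ℂ) * β * hw'
  have hcont : ContinuousOn (fun r : ℝ => r * (detectorRHS k n r : ℂ) * V r)
      (Set.uIcc (1 / 4) 1) := by
    intro r hr
    rw [Set.uIcc_of_le (by norm_num)] at hr
    have hr0 : 0 < r := by linarith [hr.1]
    have e1 := (hJ.hasDerivAt_comp hk n hr0).continuousAt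
    have e2 := (hJ.hasDerivAt_comp_deriv hk n hr0).continuousAt
    have e3 := (hasDerivAt_deriv_cutoff r).ofReal_comp.continuousAt
    have e4 : ContinuousAt (fun r => ((deriv (deriv cutoff) r : ℝ) : ℂ)) r :=
      (Complex.continuous_ofReal.comp (contDiff_deriv_cutoff.continuous_deriv
        (by simp))).continuousAt
    have e5 : ContinuousAt (fun r : ℝ => (r : ℂ)) r := Complex.continuous_ofReal.continuousAt
    have hr0' : (r : ℂ) ≠ 0 := mod_cast hr0.ne'
    have e6 : ContinuousAt (fun r : ℝ => (detectorRHS k n r : ℂ)) r := by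
      simp only [detectorRHS]
      push_cast
      simp only [Complex.ofReal_div] at e2
      exact ((e4.mul e1).add ((continuousAt_const.mul e3).mul e2)).add ((e3.mul e1).div e5 hr0')
    exact ((e5.mul e6).mul (hVd r hr0).continuousAt).continuousWithinAt
  have hFTC := intervalIntegral.integral_eq_sub_of_hasDerivAt (a := 1 / 4) (b := 1)
    (fun r hr => hFd r (by
      rw [Set.uIcc_of_le (by norm_num)] at hr; linarith [hr.1])) hcont.intervalIntegrable
  have hF1 : F 1 = 0 := by
    simp [hF, (deriv_cutoff_eq_zero (r := 1) (Or.inr (by norm_num))).1,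
      cutoff_eq_zero (r := 1) (by norm_num)]
  have hF4 : F (1 / 4) = -β := by
    simp [hF, (deriv_cutoff_eq_zero (r := 1 / 4) (Or.inl (by norm_num))).1,
      cutoff_eq_one (r := 1 / 4) (by norm_num), - one_div]
  rw [hF1, hF4, zero_sub, neg_neg, intervalIntegral.integral_of_le (by norm_num)] at hFTC
  refine Eq.trans ?_ hFTC
  refine setIntegral_eq_of_subset_of_forall_sdiff_eq_zero measurableSet_Ioo
    (fun r hr => ⟨by linarith [hr.1], by linarith [hr.2]⟩) fun r hr => ?_
  have : detectorRHS k n r = 0 := by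
    refine detectorRHS_eq_zero ?_
    by_contra hc
    push Not at hc
    exact hr.2 ⟨by linarith [hc.1], by linarith [hc.2]⟩
  simp [this]

/-- The source determines the singular part of every Fourier coefficient of a solution. -/
lemma IsSolution.detect {ω σa lam R k : ℝ} {N : ℕ} {q : ℕ × ℕ → ℂ} {f : ℝ → ℂ}
    {u : 𝓓'(Omega, ℂ)} {U : Plane → ℂ} (h : IsSolution ω σa lam R N q f u U)
    (hk : 0 < k) (hk2 : k ^ 2 * (σa * lam) = ω ^ 2) (hR : 1 < R) (l : ℤ) {α β : ℂ}
    (hin : ∀ᵐ r, r ∈ Ioo (0 : ℝ) R →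
      circ U l r = α * besselJ l.natAbs (k * r) + β * besselY l.natAbs (k * r)) :
    (lam * σa : ℂ) * β = sourceMoment σa lam k N q (-l) := by
  have hb : tsupport (detector k (-l)) ⊆ Metric.ball (0 : Plane) R :=
    (tsupport_detector k _).trans (Metric.closedBall_subset_ball (by linarith))
  have hΩ : tsupport (detector k (-l)) ⊆ (Omega : Set Plane) :=
    (tsupport_detector k _).trans (Metric.closedBall_subset_ball (by norm_num))
  set T : (ℂ →L[ℝ] ℝ) → 𝓓(Omega, ℝ) := fun L => testPart L Omega (detector k (-l))
    (contDiff_detector k _) (hasCompactSupport_detector k _) hΩ with hT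
  set K : ℝ → ℂ := fun r => (detectorRHS k l.natAbs r : ℂ) with hK
  have hval (L : ℂ →L[ℝ] ℝ) (x : Plane) (hx : x ≠ 0) :
      helmTest k (T L) x = L (radAng K (-l) x) := by
    rw [hT, helmTest_testPart, lap_detector hk _ hx, Int.natAbs_neg]
  have hnear (L : ℂ →L[ℝ] ℝ) : (0 : Plane) ∉ tsupport (helmTest k (T L)) := by
    have hz : ∀ x : Plane, x ≠ 0 → ‖x‖ < 1 / 3 → helmTest k (T L) x = 0 := fun x hx hx' => by
      rw [hval L x hx, radAng, hK]
      simp [detectorRHS_eq_zero (Or.inl hx')]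
    have hmem : Metric.ball (0 : Plane) (1 / 3) ∈ 𝓝 (0 : Plane) :=
      Metric.ball_mem_nhds _ (by norm_num)
    have hz0 : helmTest k (T L) 0 = 0 := by
      by_contra hne
      have h1 := ((helmTest k (T L)).continuous.continuousAt.eventually_ne hne).filter_mono
        (nhdsWithin_le_nhds (s := {0}ᶜ))
      have h2 : ∀ᶠ x in 𝓝[≠] (0 : Plane), helmTest k (T L) x = 0 := by
        filter_upwards [self_mem_nhdsWithin, nhdsWithin_le_nhds hmem] with x hx hx'
        exact hz x hx (by simpa using hx')
      obtain ⟨x, hx1, hx2⟩ := (h1.and h2).exists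
      exact hx1 hx2
    refine notMem_tsupport_iff_eventuallyEq.2 ?_
    filter_upwards [hmem] with x hx
    rcases eq_or_ne x 0 with rfl | hx0
    · exact hz0
    · exact hz x hx0 (by simpa using hx)
  have hu (L : ℂ →L[ℝ] ℝ) : u (helmTest k (T L))
      = ∫ x in 𝔹, ((L (radAng K (-l) x) : ℝ) : ℂ) * U x := by
    rw [h.eq_fun _ (hnear L)]
    have h0 : ∀ᵐ x : Plane, x ≠ 0 := by simp [ae_iff]
    refine integral_congr_ae ?_
    filter_upwards [ae_restrict_of_ae h0] with x hx
    rw [hval L x hx]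
  have hm : L2Away U := h.memLp
  have hKm : BddCut K := by
    refine ⟨?_, 1 / 3, by norm_num, fun r hr => by simp [hK, detectorRHS_eq_zero (Or.inl hr)], ?_⟩
    · refine Complex.measurable_ofReal.comp ?_
      have m1 : Measurable fun r => besselJ l.natAbs (k * r) :=
        (continuous_besselJ _).measurable.comp (measurable_const_mul k)
      have m2 : Measurable fun r => besselD besselJ l.natAbs (k * r) :=
        (continuous_besselD_besselJ _).measurable.comp (measurable_const_mul k)
      have m3 : Measurable (deriv cutoff) := measurable_deriv _
      have m4 : Measurable (deriv (deriv cutoff)) := measurable_deriv _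
      exact ((m4.mul m1).add ((measurable_const.mul m3).mul (m2.div measurable_id))).add
        ((m3.mul m1).div measurable_id)
    · have hc : ContinuousOn (fun r => detectorRHS k l.natAbs r) (Icc (1 / 4) 3) := by
        intro r hr
        have hr0 : r ≠ 0 := by linarith [hr.1]
        have e1 : ContinuousAt (fun r => besselJ l.natAbs (k * r)) r :=
          ((continuous_besselJ _).comp (continuous_const_mul k)).continuousAt
        have e2 : ContinuousAt (fun r => besselD besselJ l.natAbs (k * r)) r :=
          ((continuous_besselD_besselJ _).comp (continuous_const_mul k)).continuousAt
        have e3 := (hasDerivAt_deriv_cutoff r).continuousAt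
        have e4 : ContinuousAt (deriv (deriv cutoff)) r :=
          (contDiff_deriv_cutoff.continuous_deriv (by simp)).continuousAt
        exact (((e4.mul e1).add ((continuousAt_const.mul e3).mul (e2.div continuousAt_id hr0))).add
          ((e3.mul e1).div continuousAt_id hr0)).continuousWithinAt
      obtain ⟨C, hC⟩ := isCompact_Icc.exists_bound_of_continuousOn hc
      refine ⟨max 0 C, fun r hr => ?_⟩
      rcases lt_or_ge r (1 / 4) with h4 | h4
      · simp [hK, detectorRHS_eq_zero (k := k) (n := l.natAbs) (r := r) (Or.inl (by linarith))]
      · rw [hK, Complex.norm_real]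
        exact (hC r ⟨h4, hr.le⟩).trans (le_max_right _ _)
  have hint := hKm.integrableOn hm (-l)
  have hi (L : ℂ →L[ℝ] ℝ) : IntegrableOn
      (fun x => ((L (radAng K (-l) x) : ℝ) : ℂ) * U x) 𝔹 := by
    obtain ⟨mK, ε, hε, hz, C, hC⟩ := hKm
    have := hm.integrableOn_mul (w := fun x => ((L (radAng K (-l) x) : ℝ) : ℂ)) (C := ‖L‖ * C)
      (Complex.measurable_ofReal.comp (L.continuous.measurable.comp
        ((mK.comp measurable_norm).mul (measurable_angular (-l))))) hε (fun x hx => ?_) fun x hx => by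
        simp [radAng, hz _ hx]
    · simpa only [mul_comm] using this
    · rw [Complex.norm_real]
      refine (L.le_opNorm _).trans (mul_le_mul_of_nonneg_left ?_ (norm_nonneg _))
      rw [radAng, norm_mul]
      have h1 := hC ‖x‖ (by simpa using hx)
      calc _ ≤ C * 1 := mul_le_mul h1 (norm_angular_le _ x) (norm_nonneg _)
            ((norm_nonneg _).trans h1)
        _ = C := mul_one C
  have hsum : u (helmTest k (T Complex.reCLM)) + I * u (helmTest k (T Complex.imCLM)) = β := by
    rw [hu, hu, ← integral_const_mul, ← integral_add (hi _) ((hi _).const_mul _)]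
    rw [← integral_detectorRHS hk l.natAbs α β]
    have h5 := integral_mul_radAng hm hKm l
    calc _ = ∫ x in 𝔹, U x * radAng K (-l) x := by
          congr 1; funext x
          have := Complex.re_add_im (radAng K (-l) x)
          simp only [Complex.reCLM_apply, Complex.imCLM_apply]
          linear_combination U x * this
      _ = _ := by
          rw [h5]
          refine setIntegral_congr_ae measurableSet_Ioo ?_
          filter_upwards [hin] with r hr hr'
          by_cases hrR : r < R
          · rw [hr ⟨hr'.1, hrR⟩]
          · simp [hK, detectorRHS_eq_zero (k := k) (n := l.natAbs) (r := r) (Or.inr (by linarith))]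
  have hs (L : ℂ →L[ℝ] ℝ) := h.inner_helm hk2 (T L)
    ((tsupport_comp_subset (map_zero L) _).trans hb)
  have e1 := hs Complex.reCLM
  have e2 := hs Complex.imCLM
  have e3 : sourceMoment σa lam k N q (-l) = source σa lam N q (T Complex.reCLM)
    + I * source σa lam N q (T Complex.imCLM) := rfl
  rw [← hsum, e3]
  linear_combination e1 + I * e2

end

noncomputable section

/-! ### Fourier modes of a solution -/

/-- The unnormalized Fourier coefficient of the boundary data. -/
def dataCoeff (f : ℝ → ℂ) (l : ℤ) : ℂ :=
  ∫ θ in 0..2 * π, exp (-((l : ℂ) * (θ : ℂ) * I)) * f θ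

lemma fourierCoeffOn_eq_dataCoeff (f : ℝ → ℂ) (l : ℤ) :
    fourierCoeffOn Real.two_pi_pos f l = (1 / (2 * π) : ℝ) • dataCoeff f l := by
  rw [fourierCoeffOn_eq_integral, sub_zero, dataCoeff]
  congr 1
  refine intervalIntegral.integral_congr fun θ _ => ?_
  simp only [fourier_coe_apply, smul_eq_mul]
  congr 2
  have : (π : ℂ) ≠ 0 := mod_cast Real.pi_ne_zero
  push_cast
  field_simp

lemma kappa_pos {σa lam : ℝ} (hσ : 0 < σa) (hlam : 0 < lam) : 0 < kappa σa lam :=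
  inv_pos.2 (Real.sqrt_pos.2 (mul_pos hσ hlam))

lemma kappa_sq {σa lam : ℝ} (hσ : 0 < σa) (hlam : 0 < lam) (ω : ℝ) :
    (kappa σa lam * ω) ^ 2 * (σa * lam) = ω ^ 2 := by
  have h := mul_pos hσ hlam
  rw [kappa, mul_pow, inv_pow, Real.sq_sqrt h.le]
  field_simp

lemma NonResonant.besselD_ne_zero {ω σa lam : ℝ} (hω : 0 < ω) (hσ : 0 < σa) (hlam : 0 < lam)
    (h : NonResonant ω σa lam) (n : ℕ) :
    σa * besselD besselJ n (kappa σa lam * ω) + n * besselJ n (kappa σa lam * ω) ≠ 0 := by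
  have hk : 0 < kappa σa lam * ω := mul_pos (kappa_pos hσ hlam) hω
  have h1 := (h n).1
  rw [(besselFamily_besselJ.hasDerivAt n hk).deriv, mul_div_cancel₀ _ hk.ne'] at h1
  exact h1

/-- The radial function `αJ_n(kr) + βY_n(kr)`. -/
def innerMode (k : ℝ) (n : ℕ) (α β : ℂ) (r : ℝ) : ℂ :=
  α * besselJ n (k * r) + β * besselY n (k * r)

lemma hasDerivAt_innerMode {k : ℝ} (hk : 0 < k) (n : ℕ) (α β : ℂ) {r : ℝ} (hr : 0 < r) :
    HasDerivAt (innerMode k n α β)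
      (α * (besselD besselJ n (k * r) / r : ℝ) + β * (besselD besselY n (k * r) / r : ℝ)) r :=
  ((besselFamily_besselJ.hasDerivAt_comp hk n hr).const_mul α).add
    ((besselFamily_besselY.hasDerivAt_comp hk n hr).const_mul β)

lemma contDiffOn_innerMode {k : ℝ} (hk : 0 < k) (n : ℕ) (α β : ℂ) :
    ContDiffOn ℝ 1 (innerMode k n α β) (Ioi 0) := by
  have h1 : (1 : WithTop ℕ∞) = 0 + 1 := by simp
  rw [h1, contDiffOn_succ_iff_deriv_of_isOpen isOpen_Ioi]
  refine ⟨fun r hr => (hasDerivAt_innerMode hk n α β hr).differentiableAt.differentiableWithinAt,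
    by simp, contDiffOn_zero.2 ?_⟩
  refine ContinuousOn.congr (f := fun r : ℝ => α * (besselD besselJ n (k * r) / r : ℝ)
    + β * (besselD besselY n (k * r) / r : ℝ)) (fun r hr => ?_)
    fun r hr => (hasDerivAt_innerMode hk n α β hr).deriv
  exact (((besselFamily_besselJ.hasDerivAt_comp_deriv hk n hr).const_mul α).add
    ((besselFamily_besselY.hasDerivAt_comp_deriv hk n hr).const_mul β)).continuousAt.continuousWithinAt

section

variable {ω σa lam R k : ℝ} {N : ℕ} {q : ℕ × ℕ → ℂ} {f : ℝ → ℂ}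
  {u : 𝓓'(Omega, ℂ)} {U : Plane → ℂ}

/-- The Fourier coefficients of a solution: they solve the radial system, and their singular part
is determined by the source alone. -/
lemma IsSolution.exists_mode (h : IsSolution ω σa lam R N q f u U) (hσ : 0 < σa)
    (hlam : 0 < lam) (hk : 0 < k) (hk2 : k ^ 2 * (σa * lam) = ω ^ 2) (hR : 1 < R) (hR2 : R < 2)
    (hf : MemLp f 2 dθ) (n : ℤ) :
    ∃ (v p : ℝ → ℂ) (α : ℂ), ModeSol ω σa lam R n v p ∧ v 3 = dataCoeff f n ∧
      (∀ᵐ r, r ∈ Ioo (0 : ℝ) 3 → circ U n r = v r) ∧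
      ∀ r ∈ Ioc 0 R,
        v r = α * besselJ n.natAbs (k * r)
          + sourceMoment σa lam k N q (-n) / (lam * σa) * besselY n.natAbs (k * r) ∧
        p r = σa * (α * besselD besselJ n.natAbs (k * r)
          + sourceMoment σa lam k N q (-n) / (lam * σa) * besselD besselY n.natAbs (k * r)) := by
  obtain ⟨G, hW⟩ := h.exists_weakSol hσ hlam hR hf
  obtain ⟨v, p, hm, h3, hae⟩ := hW.exists_modeSol hf hσ hlam hR n
  obtain ⟨α, β, hin⟩ := hm.inner_span hσ hlam hk hk2 hR hR2
  have hβ := h.detect hk hk2 hR n (α := α) (β := β) (by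
    filter_upwards [hae] with r hr hr'
    rw [hr ⟨hr'.1, by linarith [hr'.2]⟩, (hin r ⟨hr'.1, hr'.2.le⟩).1])
  have hne : (lam * σa : ℂ) ≠ 0 := mod_cast (mul_pos hlam hσ).ne'
  have hβ' : β = sourceMoment σa lam k N q (-n) / (lam * σa) := by
    rw [eq_div_iff hne, mul_comm]; exact hβ
  exact ⟨v, p, α, hm, h3, hae, hβ' ▸ hin⟩

/-- The Fourier coefficients of a solution are `C¹` up to `r = R` from the inside, and their boundary
expressions depend on `R` only through `modeBdry`, with fixed data. -/
lemma IsSolution.exists_innerCoeff (h : IsSolution ω σa lam R N q f u U) (hω : 0 < ω) (hσ : 0 < σa)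
    (hlam : 0 < lam) (hk : 0 < k) (hk2 : k ^ 2 * (σa * lam) = ω ^ 2) (hR : 1 < R) (hR2 : R < 2)
    (hf : MemLp f 2 dθ) (n : ℤ)
    (hJ : besselJ n.natAbs (3 * ω) ≠ 0) (hdet : transDet ω σa k n.natAbs R ≠ 0) :
    ∃ v : ℝ → ℂ, IsInnerCoeff U R n v ∧ boundaryExpr σa R n v
      = modeBdry ω σa k n.natAbs (dataCoeff f n)
          (sourceMoment σa lam k N q (-n) / (lam * σa)) R := by
  obtain ⟨v, p, α, hm, h3, hae, hin⟩ := h.exists_mode hσ hlam hk hk2 hR hR2 hf n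
  set β := sourceMoment σa lam k N q (-n) / (lam * σa)
  have hR0 : 0 < R := by linarith
  refine ⟨innerMode k n.natAbs α β, ⟨(contDiffOn_innerMode hk _ _ _).mono fun r hr => hr.1, ?_⟩, ?_⟩
  · refine (ae_restrict_iff' measurableSet_Ioo).2 ?_
    filter_upwards [hae] with r hr hr'
    have := hr ⟨hr'.1, by linarith [hr'.2]⟩
    rw [circ] at this
    rw [this, innerMode, (hin r ⟨hr'.1, hr'.2.le⟩).1]
  · have hRR : R ∈ Ioc 0 R := ⟨hR0, le_rfl⟩
    rw [← h3, ← hm.bdry_eq hω hk hR hR2 hJ hdet (hin R hRR), boundaryExpr,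
      ((hasDerivAt_innerMode hk _ α β hR0).hasDerivWithinAt).derivWithin
        (uniqueDiffOn_Ioc 0 R R hRR), innerMode, ← (hin R hRR).1, (hin R hRR).2]
    have hRc : (R : ℂ) ≠ 0 := mod_cast hR0.ne'
    rw [← Nat.cast_natAbs]
    push_cast
    field_simp

end

/-- The boundary expressions of any family of solutions with the same source and boundary data
tend to `0` at the stated rates. -/
lemma boundary_asymptotics {ω σa lam R₀ : ℝ} (hω : 0 < ω) (hσ : 0 < σa) (hlam : 0 < lam)
    (hres : NonResonant ω σa lam) (hR₀ : 1 < R₀) (hR₀2 : R₀ ≤ 2)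
    (hdet : ∀ R ∈ Ioo 1 R₀, ∀ n, transDet ω σa (kappa σa lam * ω) n R ≠ 0)
    {N : ℕ} {q : ℕ × ℕ → ℂ} {f : ℝ → ℂ}
    (hf : MemLp f 2 dθ)
    (u : ℝ → 𝓓'(Omega, ℂ)) (U : ℝ → Plane → ℂ)
    (h : ∀ R ∈ Ioo 1 R₀, IsSolution ω σa lam R N q f (u R) (U R)) (n : ℤ) :
    ∃ v : ℝ → ℝ → ℂ,
      (∀ R ∈ Ioo 1 R₀, IsInnerCoeff (U R) R n (v R)) ∧
      Tendsto (fun R => boundaryExpr σa R n (v R)) (𝓝[>] 1) (𝓝 0) ∧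
      (n = 0 → (fun R => boundaryExpr σa R n (v R))
        =O[𝓝[>] 1] fun R => 1 / Real.log (2 * (R - 1))) ∧
      (|n| = 1 → (fun R => boundaryExpr σa R n (v R)) =O[𝓝[>] 1] fun R => 2 * (R - 1)) ∧
      (|n| = 1 → fourierCoeffOn Real.two_pi_pos f n = 0 →
        (fun R => boundaryExpr σa R n (v R))
          =O[𝓝[>] 1] fun R => (2 * (R - 1)) ^ 2 * Real.log (2 * (R - 1))) ∧
      (2 ≤ |n| → (fun R => boundaryExpr σa R n (v R)) =O[𝓝[>] 1] fun R => (2 * (R - 1)) ^ 2) := by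
  set k := kappa σa lam * ω with hk_def
  have hk : 0 < k := mul_pos (kappa_pos hσ hlam) hω
  have hk2 : k ^ 2 * (σa * lam) = ω ^ 2 := kappa_sq hσ hlam ω
  set β := sourceMoment σa lam k N q (-n) / (lam * σa) with hβ
  have hex (R : ℝ) : ∃ v : ℝ → ℂ, R ∈ Ioo 1 R₀ → IsInnerCoeff (U R) R n v ∧
      boundaryExpr σa R n v = modeBdry ω σa k n.natAbs (dataCoeff f n) β R := by
    by_cases hR : R ∈ Ioo 1 R₀
    · obtain ⟨v, hv⟩ := (h R hR).exists_innerCoeff hω hσ hlam hk hk2 hR.1 (hR.2.trans_le hR₀2) hf n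
        (hres _).2 (hdet R hR _)
      exact ⟨v, fun _ => hv⟩
    · exact ⟨0, fun hR' => absurd hR' hR⟩
  choose v hv using hex
  have hev : modeBdry ω σa k n.natAbs (dataCoeff f n) β
      =ᶠ[𝓝[>] 1] fun R => boundaryExpr σa R n (v R) := by
    filter_upwards [Ioo_mem_nhdsGT hR₀] with R hR using (hv R hR).2.symm
  have hres' := hres.besselD_ne_zero hω hσ hlam
  have h0 : n = 0 → (fun R => boundaryExpr σa R n (v R))
      =O[𝓝[>] 1] fun R => 1 / Real.log (2 * (R - 1)) := by
    intro hn
    refine IsBigO.congr' ?_ hev EventuallyEq.rfl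
    have : n.natAbs = 0 := by simp [hn]
    rw [this]
    exact modeBdry_isBigO_zero hω (by simpa using hres' 0) _ _
  have h1 : |n| = 1 → (fun R => boundaryExpr σa R n (v R)) =O[𝓝[>] 1] fun R => 2 * (R - 1) := by
    intro hn
    refine IsBigO.congr' ?_ hev EventuallyEq.rfl
    have : n.natAbs = 1 := by rw [Int.abs_eq_natAbs] at hn; omega
    rw [this]
    exact modeBdry_isBigO_one hω (by simpa using hres' 1) _ _
  have h2 : 2 ≤ |n| → (fun R => boundaryExpr σa R n (v R))
      =O[𝓝[>] 1] fun R => (2 * (R - 1)) ^ 2 := by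
    intro hn
    refine IsBigO.congr' ?_ hev EventuallyEq.rfl
    obtain ⟨m, hm⟩ : ∃ m, n.natAbs = m + 2 := ⟨n.natAbs - 2, by
      rw [Int.abs_eq_natAbs] at hn; omega⟩
    rw [hm]
    exact modeBdry_isBigO_two hω m (by simpa using hres' (m + 2)) _ _
  refine ⟨v, fun R hR => (hv R hR).1, ?_, h0, h1, fun hn hfn => ?_, h2⟩
  · have hρ : Tendsto (fun R : ℝ => 2 * (R - 1)) (𝓝[>] 1) (𝓝 0) :=
      tendsto_two_mul_sub.mono_right nhdsWithin_le_nhds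
    rcases lt_trichotomy |n| 1 with hn | hn | hn
    · refine (h0 (by rw [Int.abs_eq_natAbs] at hn; omega)).trans_tendsto ?_
      simp only [one_div]
      exact tendsto_inv_log.comp tendsto_two_mul_sub
    · exact (h1 hn).trans_tendsto hρ
    · exact (h2 hn).trans_tendsto (by simpa using hρ.pow 2)
  · refine IsBigO.congr' ?_ hev EventuallyEq.rfl
    have : n.natAbs = 1 := by rw [Int.abs_eq_natAbs] at hn; omega
    rw [fourierCoeffOn_eq_dataCoeff] at hfn
    have hd : dataCoeff f n = 0 := (smul_eq_zero.1 hfn).resolve_left (by positivity)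
    rw [this, hd]
    exact modeBdry_isBigO_one' hω (by simpa using hres' 1) _

end

noncomputable section

/-! ### Green's formula for a single mode -/

/-- The weighted mean of a function over the circle of radius `r`. -/
def circleMean (w : ℝ → ℂ) (ψ : Plane → ℂ) (r : ℝ) : ℂ :=
  ∫ θ in 0..2 * π, w θ * ψ (polar r θ)

lemma hasDerivAt_circleMean {w : ℝ → ℂ} (hw : Continuous w) {ψ : Plane → ℂ}
    (hψ : Smooth ψ) (r : ℝ) :
    HasDerivAt (circleMean w ψ)
      (∫ θ in 0..2 * π, w θ * fderiv ℝ ψ (polar r θ) (polar 1 θ)) r := by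
  have hc : Continuous fun p : ℝ × ℝ => w p.2 * fderiv ℝ ψ (polar p.1 p.2) (polar 1 p.2) :=
    (hw.comp continuous_snd).mul (((hψ.continuous_fderiv (by simp)).comp continuous_polar).clm_apply
      ((continuous_polar_angle 1).comp continuous_snd))
  have hc0 (s : ℝ) : Continuous fun θ => w θ * ψ (polar s θ) :=
    hw.mul (hψ.continuous.comp (continuous_polar_angle s))
  obtain ⟨C, hC⟩ := (isCompact_Icc.prod isCompact_Icc).exists_bound_of_continuousOn
    (s := Icc (r - 1) (r + 1) ×ˢ Icc (0 : ℝ) (2 * π)) hc.continuousOn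
  refine (intervalIntegral.hasDerivAt_integral_of_dominated_loc_of_deriv_le
    (F := fun s θ => w θ * ψ (polar s θ))
    (F' := fun s θ => w θ * fderiv ℝ ψ (polar s θ) (polar 1 θ)) (bound := fun _ => C)
    (s := Ioo (r - 1) (r + 1)) (Ioo_mem_nhds (by linarith) (by linarith))
    (Eventually.of_forall fun s => (hc0 s).aestronglyMeasurable)
    ((hc0 r).intervalIntegrable _ _)
    (hc.comp (Continuous.prodMk_right r)).aestronglyMeasurable
    (Eventually.of_forall fun θ hθ s hs => ?_) intervalIntegrable_const
    (Eventually.of_forall fun θ hθ s hs => ?_)).2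
  · rw [Set.uIoc_of_le Real.two_pi_pos.le] at hθ
    exact hC (s, θ) ⟨Set.Ioo_subset_Icc_self hs, Set.Ioc_subset_Icc_self hθ⟩
  · exact (hasDerivAt_comp_polar_radius (hψ.differentiable (by simp) _)).const_mul _

lemma continuous_circleMean {w : ℝ → ℂ} (hw : Continuous w) {ψ : Plane → ℂ}
    (hψ : Smooth ψ) : Continuous (circleMean w ψ) :=
  continuous_iff_continuousAt.2 fun r => (hasDerivAt_circleMean hw hψ r).continuousAt

lemma polar_two_pi (r : ℝ) : polar r (2 * π) = polar r 0 := by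
  ext i; fin_cases i <;> simp [polar]

lemma continuous_perp_polar (r : ℝ) : Continuous fun θ => perp (polar r θ) := by
  refine (PiLp.continuous_toLp 2 _).comp (continuous_pi fun i => ?_)
  have h0 : Continuous fun θ => polar r θ 0 :=
    (contDiff_apply (n := 0) 0).continuous.comp (continuous_polar_angle r)
  have h1 : Continuous fun θ => polar r θ 1 :=
    (contDiff_apply (n := 0) 1).continuous.comp (continuous_polar_angle r)
  fin_cases i
  · exact h1.neg
  · exact h0

/-- Integration by parts in the angle. -/
lemma integral_angle_by_parts {w w' : ℝ → ℂ} (hw : ∀ θ, HasDerivAt w (w' θ) θ)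
    (hw' : Continuous w') (hper : w (2 * π) = w 0) {ψ : Plane → ℂ}
    (hψ : Smooth ψ) (r : ℝ) :
    ∫ θ in 0..2 * π, w θ * fderiv ℝ ψ (polar r θ) (perp (polar r θ))
      = -circleMean w' ψ r := by
  have hd (θ : ℝ) := (hw θ).mul
    (hasDerivAt_comp_polar_angle (r := r) (θ := θ) (hψ.differentiable (by simp) _))
  have hcw : Continuous w := continuous_iff_continuousAt.2 fun θ => (hw θ).continuousAt
  have hp : Continuous fun θ => perp (polar r θ) := continuous_perp_polar r
  have hc1 : Continuous fun θ => w' θ * ψ (polar r θ) :=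
    hw'.mul (hψ.continuous.comp (continuous_polar_angle r))
  have hc2 : Continuous fun θ => w θ * fderiv ℝ ψ (polar r θ) (perp (polar r θ)) :=
    hcw.mul (((hψ.continuous_fderiv (by simp)).comp (continuous_polar_angle r)).clm_apply hp)
  have h1 := intervalIntegral.integral_eq_sub_of_hasDerivAt (a := 0) (b := 2 * π)
    (fun θ _ => hd θ) ((hc1.add hc2).intervalIntegrable _ _)
  rw [intervalIntegral.integral_add (hc1.intervalIntegrable _ _) (hc2.intervalIntegrable _ _)] at h1
  simp only [Pi.mul_apply, polar_two_pi, hper, sub_self] at h1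
  rw [circleMean]
  linear_combination h1

/-- The fundamental theorem of calculus on `(0, 3)`, off finitely many points and with a limit at
`0`. -/
lemma integral_Ioo_eq_sub {w g : ℝ → ℂ} {w0 : ℂ} {S : Set ℝ} (hS : S.Countable)
    (hw : ContinuousOn w (Ioc 0 3)) (hd : ∀ r ∈ Ioo (0 : ℝ) 3, r ∉ S → HasDerivAt w (g r) r)
    (hg : IntegrableOn g (Ioo 0 3)) (hlim : Tendsto w (𝓝[>] 0) (𝓝 w0)) :
    ∫ r in Ioo (0 : ℝ) 3, g r = w 3 - w0 := by
  set W : ℝ → ℂ := Function.update w 0 w0 with hW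
  have hWeq {r : ℝ} (hr : r ≠ 0) : W r = w r := Function.update_of_ne hr _ _
  have hc : ContinuousOn W (Icc 0 3) := by
    intro r hr
    rcases eq_or_lt_of_le hr.1 with rfl | h0
    · have h1 : W 0 = w0 := Function.update_self _ _ _
      rw [ContinuousWithinAt, h1]
      have h2 : Tendsto W (𝓝[>] 0) (𝓝 w0) := hlim.congr' (by
        filter_upwards [self_mem_nhdsWithin] with r hr using (hWeq (ne_of_gt hr)).symm)
      have h3 : Tendsto W (𝓝[≥] 0) (𝓝 w0) := by
        rw [← Set.Ioi_insert, nhdsWithin_insert, tendsto_sup]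
        refine ⟨?_, h2⟩
        rw [tendsto_pure_left]
        intro s hs
        rw [h1]; exact mem_of_mem_nhds hs
      exact h3.mono_left (nhdsWithin_mono _ fun r hr => hr.1)
    · have h1 : ContinuousWithinAt w (Icc 0 3) r := by
        refine (hw r ⟨h0, hr.2⟩).mono_of_mem_nhdsWithin ?_
        filter_upwards [self_mem_nhdsWithin, nhdsWithin_le_nhds (Ioi_mem_nhds h0)] with y hy hy'
          using ⟨hy', hy.2⟩
      refine h1.congr_of_eventuallyEq ?_ (hWeq h0.ne')
      filter_upwards [nhdsWithin_le_nhds (Ioi_mem_nhds h0)] with y hy using hWeq (ne_of_gt hy)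
  have h := integral_eq_of_hasDerivAt_off_countable_of_le W g (a := 0) (b := 3) (by norm_num) hS hc
    (fun r hr => by
      refine (hd r hr.1 hr.2).congr_of_eventuallyEq ?_
      filter_upwards [Ioi_mem_nhds hr.1.1] with y hy using hWeq (ne_of_gt hy))
    ((intervalIntegrable_iff_integrableOn_Ioo_of_le (by norm_num)).2 hg)
  rw [intervalIntegral.integral_of_le (by norm_num), integral_Ioc_eq_integral_Ioo] at h
  rw [h, hWeq (by norm_num), hW, Function.update_self]

/-- The components of the gradient of `u(r) e^{inθ}`, where `r σ u' = p`. -/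
def modeGrad (σa R : ℝ) (n : ℤ) (u p : ℝ → ℂ) (j : Fin 2) (x : Plane) : ℂ :=
  (p ‖x‖ / (sigRad σa R ‖x‖ : ℂ) * x j + I * n * u ‖x‖ * perp x j) / (‖x‖ : ℂ) ^ 2
    * angular n x

lemma hasDerivAt_expI (n : ℤ) (θ : ℝ) :
    HasDerivAt (fun θ : ℝ => exp (n * θ * I))
      (I * n * exp (n * θ * I)) θ := by
  have h6 : HasDerivAt (fun t : ℝ => (n : ℂ) * (t : ℂ) * I) (n * 1 * I) θ :=
    ((Complex.ofRealCLM.hasDerivAt).const_mul _).mul_const _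
  refine h6.cexp.congr_deriv ?_
  ring

lemma continuous_expI (n : ℤ) : Continuous fun θ : ℝ => exp (n * θ * I) := by
  fun_prop

lemma expI_two_pi (n : ℤ) : exp (n * ((2 * π : ℝ) : ℂ) * I) = 1 := by
  rw [Complex.exp_eq_one_iff]
  exact ⟨n, by push_cast; ring⟩

lemma hasDerivAt_polar_coord (j : Fin 2) (θ : ℝ) :
    HasDerivAt (fun θ => (polar 1 θ j : ℂ)) ((perp (polar 1 θ) j : ℝ) : ℂ) θ := by
  refine HasDerivAt.ofReal_comp ?_
  fin_cases j
  · simpa [polar, perp] using Real.hasDerivAt_cos θ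
  · simpa [polar, perp] using Real.hasDerivAt_sin θ

lemma hasDerivAt_perp_coord (j : Fin 2) (θ : ℝ) :
    HasDerivAt (fun θ => ((perp (polar 1 θ) j : ℝ) : ℂ)) (-(polar 1 θ j : ℂ)) θ := by
  have : HasDerivAt (fun θ => perp (polar 1 θ) j) (-(polar 1 θ j)) θ := by
    fin_cases j
    · simpa [polar, perp] using (Real.hasDerivAt_sin θ).fun_neg
    · simpa [polar, perp] using Real.hasDerivAt_cos θ
  exact_mod_cast this.ofReal_comp

section

variable {ω σa lam R : ℝ} {n : ℤ} {u p : ℝ → ℂ}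

/-- Green's formula for a single mode. After integrating by parts in the angle, the radial integrand
is the derivative of `r u m`, where `m` is the mean of the test function. -/
lemma ModeSol.green (hm : ModeSol ω σa lam R n u p) (hσ : 0 < σa) (hR : 1 < R) (j : Fin 2)
    {ψ : Plane → ℂ} (hψ : Smooth ψ)
    (hF : IntegrableOn (fun x => radAng u n x * fderiv ℝ ψ x (e j) + modeGrad σa R n u p j x * ψ x)
      𝔹)
    (hlim : Tendsto (fun r : ℝ => r * u r
      * circleMean (fun θ => exp (n * θ * I) * polar 1 θ j) ψ r) (𝓝[>] 0) (𝓝 0)) :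
    ∫ x in 𝔹,
        (radAng u n x * fderiv ℝ ψ x (e j) + modeGrad σa R n u p j x * ψ x)
      = 3 * u 3 * circleMean (fun θ => exp (n * θ * I) * polar 1 θ j) ψ 3 := by
  set w : ℝ → ℂ := fun θ => exp (n * θ * I) * polar 1 θ j with hw
  have hcj : Continuous fun θ => (polar 1 θ j : ℂ) :=
    continuous_iff_continuousAt.2 fun θ => (hasDerivAt_polar_coord j θ).continuousAt
  have hpj : Continuous fun θ => ((perp (polar 1 θ) j : ℝ) : ℂ) :=
    continuous_iff_continuousAt.2 fun θ => (hasDerivAt_perp_coord j θ).continuousAt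
  have hwc : Continuous w := (continuous_expI n).mul hcj
  have hvd (θ : ℝ) := (hasDerivAt_expI n θ).mul (hasDerivAt_perp_coord j θ)
  set v' : ℝ → ℂ := fun θ => I * n * exp (n * θ * I)
    * ((perp (polar 1 θ) j : ℝ) : ℂ) + exp (n * θ * I) * -(polar 1 θ j : ℂ) with hv'
  have hv'c : Continuous v' := ((continuous_const.mul (continuous_expI n)).mul hpj).add
    ((continuous_expI n).mul hcj.neg)
  have hF' : IntegrableOn (fun x => radAng u n x * fderiv ℝ ψ x (e j)
      + modeGrad σa R n u p j x * ψ x) {x | ‖x‖ ∈ Ioo (0 : ℝ) 3} :=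
    hF.mono_set fun x hx => by simpa using hx.2
  -- the radial integrand
  have hrad (r : ℝ) (hr : r ∈ Ioo (0 : ℝ) 3) :
      r • ∫ θ in 0..2 * π, (radAng u n (polar r θ) * fderiv ℝ ψ (polar r θ) (e j)
        + modeGrad σa R n u p j (polar r θ) * ψ (polar r θ))
      = (1 * u r + r * (p r / (r * sigRad σa R r : ℝ))) * circleMean w ψ r
        + r * u r * ∫ θ in 0..2 * π, w θ * fderiv ℝ ψ (polar r θ) (polar 1 θ) := by
    have hr0 : (r : ℂ) ≠ 0 := mod_cast hr.1.ne'
    have hs0 : (sigRad σa R r : ℂ) ≠ 0 := mod_cast (sigRad_pos hσ hR hr.1).ne'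
    have hparts := integral_angle_by_parts (w' := v') hvd hv'c (by
      simp only [Pi.mul_apply, expI_two_pi, polar_two_pi]; simp) hψ r
    have hc1 : Continuous fun θ => w θ * fderiv ℝ ψ (polar r θ) (polar 1 θ) :=
      hwc.mul (((hψ.continuous_fderiv (by simp)).comp (continuous_polar_angle r)).clm_apply
        (continuous_polar_angle 1))
    have hc2 : Continuous fun θ => w θ * ψ (polar r θ) :=
      hwc.mul (hψ.continuous.comp (continuous_polar_angle r))
    have hc3 : Continuous fun θ => v' θ * ψ (polar r θ) :=
      hv'c.mul (hψ.continuous.comp (continuous_polar_angle r))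
    have hp : Continuous fun θ => perp (polar r θ) := continuous_perp_polar r
    have hc4 : Continuous fun θ => (fun θ : ℝ => exp (n * θ * I)) θ
        * ((perp (polar 1 θ) j : ℝ) : ℂ) * fderiv ℝ ψ (polar r θ) (perp (polar r θ)) :=
      ((continuous_expI n).mul hpj).mul
        (((hψ.continuous_fderiv (by simp)).comp (continuous_polar_angle r)).clm_apply hp)
    have hpt (θ : ℝ) : (r : ℂ) * (radAng u n (polar r θ) * fderiv ℝ ψ (polar r θ) (e j)
        + modeGrad σa R n u p j (polar r θ) * ψ (polar r θ))
        = r * u r * (w θ * fderiv ℝ ψ (polar r θ) (polar 1 θ))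
          + u r * (exp (n * θ * I) * ((perp (polar 1 θ) j : ℝ) : ℂ)
            * fderiv ℝ ψ (polar r θ) (perp (polar r θ)))
          + (u r + p r / sigRad σa R r) * (w θ * ψ (polar r θ))
          + u r * (v' θ * ψ (polar r θ)) := by
      have e1 : fderiv ℝ ψ (polar r θ) (e j)
          = (polar 1 θ j : ℂ) * fderiv ℝ ψ (polar r θ) (polar 1 θ)
            + ((perp (polar 1 θ) j : ℝ) : ℂ) * fderiv ℝ ψ (polar r θ) (perp (polar 1 θ)) := by
        conv_lhs => rw [e_eq j θ]
        simp
      have e2 : fderiv ℝ ψ (polar r θ) (perp (polar r θ))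
          = r * fderiv ℝ ψ (polar r θ) (perp (polar 1 θ)) := by
        have : perp (polar r θ) = r • perp (polar 1 θ) := by
          ext i; fin_cases i <;> simp [perp, polar]
        rw [this, map_smul, Complex.real_smul]
      have e3 : ((polar r θ j : ℝ) : ℂ) = r * (polar 1 θ j : ℂ) := by
        rw [smul_polar r θ]; simp
      have e4 : ((perp (polar r θ) j : ℝ) : ℂ) = r * ((perp (polar 1 θ) j : ℝ) : ℂ) := by
        fin_cases j <;> simp [perp, polar]
      rw [modeGrad, radAng_polar _ _ hr.1, angular_polar _ hr.1, norm_polar_of_pos hr.1, e1, e2, e3,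
        e4]
      simp only [hw, hv']
      field_simp
      ring
    rw [Complex.real_smul, ← intervalIntegral.integral_const_mul]
    simp only [hpt]
    have i1 := (hc1.const_mul (r * u r)).intervalIntegrable (μ := volume) 0 (2 * π)
    have i2 := (hc4.const_mul (u r)).intervalIntegrable (μ := volume) 0 (2 * π)
    have i3 := (hc2.const_mul (u r + p r / sigRad σa R r)).intervalIntegrable (μ := volume) 0
      (2 * π)
    have i4 := (hc3.const_mul (u r)).intervalIntegrable (μ := volume) 0 (2 * π)
    rw [intervalIntegral.integral_add ((i1.add i2).add i3) i4,
      intervalIntegral.integral_add (i1.add i2) i3, intervalIntegral.integral_add i1 i2]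
    simp only [intervalIntegral.integral_const_mul]
    simp only [Pi.mul_apply] at hparts
    rw [hparts]
    simp only [circleMean]
    push_cast
    field_simp
    ring
  rw [setIntegral_congr_set (ball_ae_eq 3),
    setIntegral_polar measurableSet_Ioo (fun r hr => hr.1) hF',
    setIntegral_congr_fun measurableSet_Ioo hrad]
  have hInt := (integrableOn_circle measurableSet_Ioo (fun r hr => hr.1) hF').congr_fun hrad
    measurableSet_Ioo
  have hcont : ContinuousOn (fun r : ℝ => r * u r * circleMean w ψ r) (Ioc 0 3) :=
    (Complex.continuous_ofReal.continuousOn.mul hm.cont_u).mul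
      (continuous_circleMean hwc hψ).continuousOn
  have := integral_Ioo_eq_sub (S := {R, 2}) (by simp) hcont (fun r hr hrS => by
    have h1 : r ≠ R := fun h => hrS (by simp [h])
    have h2 : r ≠ 2 := fun h => hrS (by simp [h])
    have h0 : HasDerivAt (fun r : ℝ => (r : ℂ)) 1 r := Complex.ofRealCLM.hasDerivAt
    exact (h0.mul (hm.deriv_u r hr h1 h2)).mul (hasDerivAt_circleMean hwc hψ r)) hInt hlim
  rw [this, sub_zero]
  push_cast
  rfl

/-- The weak equation for a single mode. After integrating by parts in the angle, the radial
integrand is the derivative of `-p m`. -/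
lemma ModeSol.weak (hm : ModeSol ω σa lam R n u p) (hσ : 0 < σa) (hlam : 0 < lam) (hR : 1 < R)
    {φ : Plane → ℂ} (hφ : Smooth φ) (hsupp : tsupport φ ⊆ 𝔹)
    (hF : IntegrableOn (fun x =>
      (-(∑ j : Fin 2, ∑ k : Fin 2,
          (sigmaR σa R x j k : ℂ) * modeGrad σa R n u p k x * fderiv ℝ φ x (e j))
        + (ω : ℂ) ^ 2 / (lambdaR lam R x : ℂ) * radAng u n x * φ x)) 𝔹)
    {L : ℂ} (hlim : Tendsto (fun r : ℝ => p r
      * circleMean (fun θ => exp (n * θ * I)) φ r) (𝓝[>] 0) (𝓝 L)) :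
    ∫ x in 𝔹,
      (-(∑ j : Fin 2, ∑ k : Fin 2,
          (sigmaR σa R x j k : ℂ) * modeGrad σa R n u p k x * fderiv ℝ φ x (e j))
        + (ω : ℂ) ^ 2 / (lambdaR lam R x : ℂ) * radAng u n x * φ x) = L := by
  set w : ℝ → ℂ := fun θ => exp (n * θ * I) with hw
  have hwc : Continuous w := continuous_expI n
  have hw'c : Continuous fun θ => I * n * w θ := continuous_const.mul hwc
  set F : Plane → ℂ := fun x => (-(∑ j : Fin 2, ∑ k : Fin 2,
          (sigmaR σa R x j k : ℂ) * modeGrad σa R n u p k x * fderiv ℝ φ x (e j))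
        + (ω : ℂ) ^ 2 / (lambdaR lam R x : ℂ) * radAng u n x * φ x) with hFdef
  have hF' : IntegrableOn F {x | ‖x‖ ∈ Ioo (0 : ℝ) 3} :=
    hF.mono_set fun x hx => by simpa using hx.2
  have hrad (r : ℝ) (hr : r ∈ Ioo (0 : ℝ) 3) :
      r • ∫ θ in 0..2 * π, F (polar r θ)
      = -((coefB ω σa lam R n r : ℝ) * u r * circleMean w φ r
        + p r * ∫ θ in 0..2 * π, w θ * fderiv ℝ φ (polar r θ) (polar 1 θ)) := by
    have hr0 : (r : ℂ) ≠ 0 := mod_cast hr.1.ne'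
    have hs0 : (sigRad σa R r : ℂ) ≠ 0 := mod_cast (sigRad_pos hσ hR hr.1).ne'
    have hl0 : (lamRad lam R r : ℂ) ≠ 0 := by
      exact_mod_cast (inv_lamRad_le hlam hR hr.1).1.ne'
    have hparts := integral_angle_by_parts (w' := fun θ => I * n * w θ) (hasDerivAt_expI n)
      hw'c (by rw [expI_two_pi]; simp) hφ r
    have hpt (θ : ℝ) : (r : ℂ) * F (polar r θ)
        = -p r * (w θ * fderiv ℝ φ (polar r θ) (polar 1 θ))
          + -(sigTan σa R r * (I * n * u r) / r)
            * (w θ * fderiv ℝ φ (polar r θ) (perp (polar r θ)))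
          + ω ^ 2 * r / lamRad lam R r * u r * (w θ * φ (polar r θ)) := by
      have hx : polar r θ ≠ 0 := by
        rw [← norm_pos_iff, norm_polar_of_pos hr.1]; exact hr.1
      set x := polar r θ with hxdef
      have hn : ‖x‖ = r := norm_polar_of_pos hr.1 θ
      have e1 : ∑ j, (x j : ℂ) * fderiv ℝ φ x (e j) = r * fderiv ℝ φ x (polar 1 θ) := by
        have h1 : fderiv ℝ φ x x = r * fderiv ℝ φ x (polar 1 θ) := by
          conv_lhs => rw [hxdef, smul_polar r θ]
          rw [map_smul, Complex.real_smul, ← smul_polar]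
        rw [← h1, clm_apply_eq (fderiv ℝ φ x) x]
        simp
      have e2 : ∑ j, (perp x j : ℂ) * fderiv ℝ φ x (e j) = fderiv ℝ φ x (perp x) := by
        rw [clm_apply_eq (fderiv ℝ φ x) (perp x)]
        simp
      have h3 : ((‖x‖ : ℂ)) ^ 2 = (x 0 : ℂ) ^ 2 + (x 1 : ℂ) ^ 2 := mod_cast norm_sq_eq x
      rw [hn] at h3
      have e3 : ∑ k, (x k : ℂ) * modeGrad σa R n u p k x = p r / sigRad σa R r * w θ := by
        simp only [Fin.sum_univ_two, modeGrad, hn, perp_apply_zero, perp_apply_one, hw]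
        rw [hxdef, angular_polar n hr.1, ← hxdef]
        push_cast
        field_simp
        linear_combination (-p r) * h3
      have e4 : ∑ k, (perp x k : ℂ) * modeGrad σa R n u p k x = I * n * u r * w θ := by
        simp only [Fin.sum_univ_two, modeGrad, hn, perp_apply_zero, perp_apply_one, hw]
        rw [hxdef, angular_polar n hr.1, ← hxdef]
        push_cast
        field_simp
        linear_combination (-I * n * u r * sigRad σa R r) * h3
      simp only [hFdef]
      rw [sum_sigmaR σa R hx (fun k => modeGrad σa R n u p k x) fun j => fderiv ℝ φ x (e j), e1, e2,
        e3, e4, hn, lambdaR_eq, hn, hxdef, radAng_polar _ _ hr.1]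
      simp only [hw]
      field_simp
      ring
    have hp : Continuous fun θ => perp (polar r θ) := continuous_perp_polar r
    have hfd : Continuous fun θ => fderiv ℝ φ (polar r θ) :=
      (hφ.continuous_fderiv (by simp)).comp (continuous_polar_angle r)
    have hc1 : Continuous fun θ => w θ * fderiv ℝ φ (polar r θ) (polar 1 θ) :=
      hwc.mul (hfd.clm_apply (continuous_polar_angle 1))
    have hc2 : Continuous fun θ => w θ * fderiv ℝ φ (polar r θ) (perp (polar r θ)) :=
      hwc.mul (hfd.clm_apply hp)
    have hc3 : Continuous fun θ => w θ * φ (polar r θ) :=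
      hwc.mul (hφ.continuous.comp (continuous_polar_angle r))
    have i1 := (hc1.const_mul (-p r)).intervalIntegrable (μ := volume) 0 (2 * π)
    have i2 := (hc2.const_mul (-(sigTan σa R r * (I * n * u r) / r))).intervalIntegrable
      (μ := volume) 0 (2 * π)
    have i3 := (hc3.const_mul (ω ^ 2 * r / lamRad lam R r * u r)).intervalIntegrable (μ := volume) 0
      (2 * π)
    rw [Complex.real_smul, ← intervalIntegral.integral_const_mul]
    simp only [hpt]
    rw [intervalIntegral.integral_add (i1.add i2) i3, intervalIntegral.integral_add i1 i2]
    simp only [intervalIntegral.integral_const_mul]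
    rw [hparts]
    simp only [circleMean, coefB, mul_assoc, intervalIntegral.integral_const_mul]
    push_cast
    field_simp
    linear_combination (sigTan σa R r * (n : ℂ) ^ 2 * u r * lamRad lam R r
      * ∫ θ in 0..2 * π, w θ * φ (polar r θ)) * Complex.I_sq
  rw [setIntegral_congr_set (ball_ae_eq 3),
    setIntegral_polar measurableSet_Ioo (fun r hr => hr.1) hF',
    setIntegral_congr_fun measurableSet_Ioo hrad]
  have hInt := (integrableOn_circle measurableSet_Ioo (fun r hr => hr.1) hF').congr_fun hrad
    measurableSet_Ioo
  have hcont : ContinuousOn (fun r : ℝ => p r * circleMean w φ r) (Ioc 0 3) :=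
    hm.cont_p.mul (continuous_circleMean hwc hφ).continuousOn
  have := integral_Ioo_eq_sub (S := {R, 2}) (by simp) hcont.neg (fun r hr hrS => by
    have h1 : r ≠ R := fun h => hrS (by simp [h])
    have h2 : r ≠ 2 := fun h => hrS (by simp [h])
    exact ((hm.deriv_p r hr h1 h2).mul (hasDerivAt_circleMean hwc hφ r)).neg) hInt hlim.neg
  rw [this]
  have h3 : circleMean w φ 3 = 0 := by
    rw [circleMean]
    have (θ : ℝ) : φ (polar 3 θ) = 0 := by
      refine image_eq_zero_of_notMem_tsupport fun h => ?_
      have := hsupp h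
      rw [mem_ball_zero_iff, norm_polar_of_pos three_pos] at this
      exact lt_irrefl _ this
    simp [this]
  simp [h3]

end

end

noncomputable section

/-! ### Superposition of solutions -/

lemma L2Away.const_mul {V : Plane → ℂ} (hV : L2Away V) (c : ℂ) : L2Away fun x => c * V x :=
  fun ε hε => (hV ε hε).const_mul c

lemma L2Away.of_continuousOn {V : Plane → ℂ}
    (hV : ContinuousOn V (Metric.closedBall (0 : Plane) 3 \ {0})) : L2Away V := by
  intro ε hε
  have hK : IsCompact (Metric.closedBall (0 : Plane) 3 \ Metric.ball 0 ε) :=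
    (isCompact_closedBall _ _).diff Metric.isOpen_ball
  have hsub : Metric.closedBall (0 : Plane) 3 \ Metric.ball 0 ε ⊆ Metric.closedBall 0 3 \ {0} :=
    Set.sdiff_subset_sdiff_right (by simpa using hε)
  have hsub' : 𝔹 \ Metric.ball 0 ε
      ⊆ Metric.closedBall (0 : Plane) 3 \ Metric.ball 0 ε :=
    Set.sdiff_subset_sdiff_left Metric.ball_subset_closedBall
  obtain ⟨C, hC⟩ := hK.exists_bound_of_continuousOn (hV.mono hsub)
  have hm := measurableSet_ball.diff (measurableSet_ball (x := (0 : Plane)) (ε := ε))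
    (s₁ := 𝔹)
  have : IsFiniteMeasure (volume.restrict (𝔹 \ Metric.ball 0 ε)) :=
    ⟨by
      rw [Measure.restrict_apply_univ]
      exact (measure_mono Set.sdiff_subset).trans_lt measure_ball_lt_top⟩
  refine MemLp.of_bound ((hV.mono (hsub'.trans hsub)).aestronglyMeasurable hm) C ?_
  filter_upwards [ae_restrict_mem hm] with x hx using hC x (hsub' hx)

lemma continuousOn_radAng {h : ℝ → ℂ} (hh : ContinuousOn h (Ioc 0 3)) (m : ℤ) :
    ContinuousOn (radAng h m) (Metric.closedBall (0 : Plane) 3 \ {0}) := by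
  refine ContinuousOn.mul (hh.comp continuous_norm.continuousOn fun x hx => ?_) fun x hx => ?_
  · exact ⟨norm_pos_iff.2 hx.2, mem_closedBall_zero_iff.1 hx.1⟩
  · exact (contDiffAt_angular (n := 0) m hx.2).continuousAt.continuousWithinAt

/-- Integrability of the integrand in Green's formula. -/
lemma integrableOn_green {U V : Plane → ℂ} (hU : L2Away U) (hV : L2Away V) {ψ : Plane → ℂ}
    (h1 : Smooth ψ) (h0 : (0 : Plane) ∉ tsupport ψ) (v : Plane) :
    IntegrableOn (fun x => U x * fderiv ℝ ψ x v + V x * ψ x) 𝔹 := by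
  obtain ⟨ε, hε, h⟩ := exists_ball_zero h0
  exact (hU.integrableOn_mul_of_continuous (continuous_fderiv_apply h1 _) hε
      fun x hx => by simp [(h x hx).2]).add
    (hV.integrableOn_mul_of_continuous h1.continuous hε fun x hx => (h x hx).1)

/-- Integrability of the integrand in the weak equation. -/
lemma integrableOn_weak {ω σa lam R : ℝ} (hσ : 0 < σa) (hlam : 0 < lam) (hR : 1 < R)
    {U : Plane → ℂ} {G : Fin 2 → Plane → ℂ} (hU : L2Away U) (hG : ∀ j, L2Away (G j)) {φ : Plane → ℂ}
    (h1 : Smooth φ) (h0 : (0 : Plane) ∉ tsupport φ) :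
    IntegrableOn (fun x =>
      (-(∑ j : Fin 2, ∑ k : Fin 2, (sigmaR σa R x j k : ℂ) * G k x * fderiv ℝ φ x (e j))
        + (ω : ℂ) ^ 2 / (lambdaR lam R x : ℂ) * U x * φ x)) 𝔹 := by
  obtain ⟨ε, hε, h⟩ := exists_ball_zero h0
  refine Integrable.add (Integrable.neg (integrable_finsetSum _ fun j _ => ?_)) ?_
  · simp_rw [← Finset.sum_mul]
    exact (L2Away.flux hσ hR hG j).integrableOn_mul_of_continuous (continuous_fderiv_apply h1 _) hε
      fun x hx => by simp [(h x hx).2]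
  · exact (hU.inv_lambdaR hlam hR _).integrableOn_mul_of_continuous h1.continuous hε
      fun x hx => (h x hx).1

section

variable {ω σa lam R k : ℝ} {f : ℝ → ℂ}

lemma WeakSol.zero : WeakSol ω σa lam R 0 0 0 where
  memU _ _ := MemLp.zero
  memG _ _ _ := MemLp.zero
  green j ψ _ _ _ := by simp
  weak φ _ _ _ _ := by simp

/-- Addition of a multiple of a solution with vanishing boundary values. -/
lemma WeakSol.add_smul (hσ : 0 < σa) (hlam : 0 < lam) (hR : 1 < R) {U₁ U₂ : Plane → ℂ}
    {G₁ G₂ : Fin 2 → Plane → ℂ} (h₁ : WeakSol ω σa lam R f U₁ G₁)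
    (h₂ : WeakSol ω σa lam R 0 U₂ G₂) (c : ℂ) :
    WeakSol ω σa lam R f (fun x => U₁ x + c * U₂ x) (fun j x => G₁ j x + c * G₂ j x) where
  memU := h₁.memU.add (h₂.memU.const_mul c)
  memG j := (h₁.memG j).add ((h₂.memG j).const_mul c)
  green j ψ hψ hc h0 := by
    have h2 := h₂.green j ψ hψ hc h0
    simp only [Pi.zero_apply, zero_mul, mul_zero, intervalIntegral.integral_zero] at h2
    rw [← h₁.green j ψ hψ hc h0, ← add_zero (∫ x in _, (U₁ x * _ + _)), ← mul_zero c, ← h2,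
      ← integral_const_mul, ← integral_add (integrableOn_green h₁.memU (h₁.memG j) hψ h0 _)
        ((integrableOn_green h₂.memU (h₂.memG j) hψ h0 _).const_mul c)]
    congr 1; funext x; ring
  weak φ hφ hc hs h0 := by
    have i1 := integrableOn_weak (ω := ω) hσ hlam hR h₁.memU h₁.memG hφ h0
    have i2 := integrableOn_weak (ω := ω) hσ hlam hR h₂.memU h₂.memG hφ h0
    have := integral_add i1 (i2.const_mul c)
    rw [integral_const_mul, h₁.weak φ hφ hc hs h0, h₂.weak φ hφ hc hs h0, mul_zero, add_zero]
      at this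
    rw [← this]
    congr 1; funext x
    simp only [Fin.sum_univ_two]
    ring

lemma ModeSol.l2Away_u {n : ℤ} {u p : ℝ → ℂ} (hm : ModeSol ω σa lam R n u p) (m : ℤ) :
    L2Away (radAng u m) :=
  .of_continuousOn (continuousOn_radAng hm.cont_u m)

lemma inv_sigRad_le (hσ : 0 < σa) (hR : 1 < R) (r : ℝ) :
    0 < sigRad σa R r ∧ (sigRad σa R r)⁻¹ ≤ σa⁻¹ + 2 / (R - 1) + 1 := by
  have h0 : 0 < 2 / (R - 1) := div_pos two_pos (by linarith)
  have h3 : 0 < σa⁻¹ := inv_pos.2 hσ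
  rw [sigRad]
  split_ifs with h1 h2
  · exact ⟨hσ, by linarith⟩
  · refine ⟨div_pos (by linarith) (by linarith), ?_⟩
    have : r / (r - 1) ≤ 2 / (R - 1) := div_le_div₀ (by norm_num) h2 (by linarith) (by linarith)
    rw [inv_div]; linarith
  · exact ⟨one_pos, by rw [inv_one]; linarith⟩

lemma l2Away_modeGrad (hσ : 0 < σa) (hR : 1 < R) {u p : ℝ → ℂ} (hu : ContinuousOn u (Ioc 0 3))
    (hp : ContinuousOn p (Ioc 0 3)) (n : ℤ) (j : Fin 2) : L2Away (modeGrad σa R n u p j) := by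
  have hsq : ContinuousOn (fun r : ℝ => (r : ℂ) ^ 2) (Ioc 0 3) := by fun_prop
  have hne (r : ℝ) (hr : r ∈ Ioc (0 : ℝ) 3) : (r : ℂ) ^ 2 ≠ 0 :=
    pow_ne_zero 2 (mod_cast hr.1.ne')
  have h1 : L2Away fun x => (x j : ℂ) * radAng (fun r => p r / (r : ℂ) ^ 2) n x :=
    .of_continuousOn ((Complex.continuous_ofReal.comp
      (contDiff_apply (n := 0) j).continuous).continuousOn.mul
        (continuousOn_radAng (hp.div hsq hne) n))
  have hpj : Continuous fun x : Plane => perp x j := by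
    fin_cases j
    · exact (contDiff_apply (n := 0) 1).continuous.neg
    · exact (contDiff_apply (n := 0) 0).continuous
  have h2 : L2Away fun x =>
      (perp x j : ℂ) * radAng (fun r => I * n * u r / (r : ℂ) ^ 2) n x :=
    .of_continuousOn ((Complex.continuous_ofReal.comp hpj).continuousOn.mul
      (continuousOn_radAng ((continuousOn_const.mul hu).div hsq hne) n))
  have h3 := h1.bdd_mul (w := fun x => ((sigRad σa R ‖x‖)⁻¹ : ℝ))
    (C := σa⁻¹ + 2 / (R - 1) + 1)
    (Complex.measurable_ofReal.comp (measurable_sigRad.comp measurable_norm).inv) fun x _ => by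
      obtain ⟨e1, e2⟩ := inv_sigRad_le hσ hR ‖x‖
      rw [Complex.norm_real, Real.norm_of_nonneg (inv_pos.2 e1).le]
      exact e2
  convert h3.add h2 using 2 with x
  rw [modeGrad]
  simp only [radAng]
  push_cast
  ring

/-- A test function that vanishes near the origin has vanishing circular means there. -/
lemma tendsto_mul_circleMean_zero (a : ℝ → ℂ) (w : ℝ → ℂ) {ψ : Plane → ℂ}
    (h0 : (0 : Plane) ∉ tsupport ψ) :
    Tendsto (fun r => a r * circleMean w ψ r) (𝓝[>] 0) (𝓝 0) := by
  obtain ⟨ε, hε, h⟩ := exists_ball_zero h0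
  refine tendsto_const_nhds.congr' ?_
  filter_upwards [Ioo_mem_nhdsGT hε] with r hr
  have (θ : ℝ) : ψ (polar r θ) = 0 := (h _ (by rw [norm_polar_of_pos hr.1]; exact hr.2)).1
  simp [circleMean, this]

/-- A mode is a weak solution off the origin. -/
lemma ModeSol.weakSol {n : ℤ} {u p : ℝ → ℂ} (hm : ModeSol ω σa lam R n u p) (hσ : 0 < σa)
    (hlam : 0 < lam) (hR : 1 < R) :
    WeakSol ω σa lam R (fun θ => u 3 * exp (n * θ * I)) (radAng u n)
      (modeGrad σa R n u p) where
  memU := hm.l2Away_u n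
  memG := l2Away_modeGrad hσ hR hm.cont_u hm.cont_p n
  green j ψ hψ hc h0 := by
    rw [hm.green hσ hR j hψ (integrableOn_green (hm.l2Away_u n)
      (l2Away_modeGrad hσ hR hm.cont_u hm.cont_p n j) hψ h0 _) (tendsto_mul_circleMean_zero _ _ h0),
      circleMean, ← intervalIntegral.integral_const_mul]
    congr 1; funext θ; ring
  weak φ hφ hc hs h0 := hm.weak hσ hlam hR hφ hs (integrableOn_weak hσ hlam hR (hm.l2Away_u n)
    (l2Away_modeGrad hσ hR hm.cont_u hm.cont_p n) hφ h0) (tendsto_mul_circleMean_zero _ _ h0)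

/-- A solution of the cloaking problem with an arbitrary distribution `s` as source, where `k` is
the wave number in the cloaked region. -/
structure SourceSol (ω σa lam R k : ℝ) (s : 𝓓'(Omega, ℂ)) (f : ℝ → ℂ) (u : 𝓓'(Omega, ℂ))
    (U : Plane → ℂ) : Prop where
  eq_fun : ∀ φ : 𝓓(Omega, ℝ), (0 : Plane) ∉ tsupport φ →
    u φ = ∫ x in 𝔹, (φ x : ℂ) * U x
  inner : ∀ φ : 𝓓(Omega, ℝ), tsupport φ ⊆ Metric.ball (0 : Plane) R →
    (lam * σa : ℂ) * u (helmTest k φ) = s φ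
  outer : ∃ G, WeakSol ω σa lam R f U G

lemma integrableOn_test_mul {U : Plane → ℂ} (hU : L2Away U) (φ : 𝓓(Omega, ℝ))
    (h0 : (0 : Plane) ∉ tsupport φ) :
    IntegrableOn (fun x => (φ x : ℂ) * U x) 𝔹 := by
  obtain ⟨ε, hε, h⟩ := exists_ball_zero h0
  simp_rw [mul_comm _ (U _)]
  exact hU.integrableOn_mul_of_continuous (Complex.continuous_ofReal.comp φ.contDiff.continuous) hε
    fun x hx => by simp [(h x hx).1]

lemma SourceSol.add_smul (hσ : 0 < σa) (hlam : 0 < lam) (hR : 1 < R) {s₁ s₂ u₁ u₂ : 𝓓'(Omega, ℂ)}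
    {U₁ U₂ : Plane → ℂ} (h₁ : SourceSol ω σa lam R k s₁ f u₁ U₁)
    (h₂ : SourceSol ω σa lam R k s₂ 0 u₂ U₂) (c : ℂ) :
    SourceSol ω σa lam R k (s₁ + c • s₂) f (u₁ + c • u₂) (fun x => U₁ x + c * U₂ x) := by
  obtain ⟨G₁, hG₁⟩ := h₁.outer
  obtain ⟨G₂, hG₂⟩ := h₂.outer
  refine ⟨fun φ hφ => ?_, fun φ hφ => ?_, ⟨_, hG₁.add_smul hσ hlam hR hG₂ c⟩⟩
  · change u₁ φ + c * u₂ φ = _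
    rw [h₁.eq_fun φ hφ, h₂.eq_fun φ hφ, ← integral_const_mul,
      ← integral_add (integrableOn_test_mul hG₁.memU φ hφ)
        ((integrableOn_test_mul hG₂.memU φ hφ).const_mul c)]
    congr 1; funext x; ring
  · change _ * (u₁ _ + c * u₂ _) = s₁ φ + c * s₂ φ
    rw [← h₁.inner φ hφ, ← h₂.inner φ hφ]
    ring

/-- Passing from real to complex-valued functions. -/
lemma contDiff_ofReal_test {Ω : TopologicalSpace.Opens Plane} (ψ : 𝓓(Ω, ℝ)) :
    Smooth fun x => (ψ x : ℂ) :=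
  Complex.ofRealCLM.contDiff.comp ψ.contDiff

lemma fderiv_ofReal_test {Ω : TopologicalSpace.Opens Plane} (ψ : 𝓓(Ω, ℝ)) (x v : Plane) :
    fderiv ℝ (fun x => (ψ x : ℂ)) x v = ((fderiv ℝ (⇑ψ) x v : ℝ) : ℂ) :=
  congrArg (· v) ((Complex.ofRealCLM.hasFDerivAt.comp x
    ((ψ.contDiff.differentiable (by simp)) x).hasFDerivAt).fderiv)

lemma tsupport_ofReal_test {Ω : TopologicalSpace.Opens Plane} (ψ : 𝓓(Ω, ℝ)) :
    tsupport (fun x => (ψ x : ℂ)) ⊆ tsupport ψ :=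
  tsupport_comp_subset Complex.ofReal_zero ψ

lemma hasCompactSupport_ofReal_test {Ω : TopologicalSpace.Opens Plane} (ψ : 𝓓(Ω, ℝ)) :
    HasCompactSupport fun x => (ψ x : ℂ) :=
  ψ.hasCompactSupport.comp_left (g := Complex.ofReal) Complex.ofReal_zero

lemma SourceSol.isSolution {N : ℕ} {q : ℕ × ℕ → ℂ} {u : 𝓓'(Omega, ℂ)} {U : Plane → ℂ}
    (h : SourceSol ω σa lam R k (source σa lam N q) f u U) (hk2 : k ^ 2 * (σa * lam) = ω ^ 2) :
    IsSolution ω σa lam R N q f u U := by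
  obtain ⟨G, hG⟩ := h.outer
  refine ⟨h.eq_fun, hG.memU, fun φ hφ => ?_, G, hG.memG, fun j ψ => ?_, fun φ h0 => ?_⟩
  · rw [← h.inner φ hφ, mul_helmTest hk2]
  · have h0 : (0 : Plane) ∉ tsupport (fun x => (ψ x : ℂ)) := fun h0 =>
      ψ.tsupport_subset (tsupport_ofReal_test ψ h0) rfl
    have := hG.green j _ (contDiff_ofReal_test ψ) (hasCompactSupport_ofReal_test ψ) h0
    simp only [fderiv_ofReal_test, intervalIntegral.integral_const_mul] at this ⊢
    exact this
  · have := hG.weak _ (contDiff_ofReal_test φ) (hasCompactSupport_ofReal_test φ)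
      ((tsupport_ofReal_test φ).trans φ.tsupport_subset) fun hx => h0 (tsupport_ofReal_test φ hx)
    simp only [fderiv_ofReal_test] at this
    exact this

end

end

noncomputable section

/-! ### Orthogonal series -/

instance : IsFiniteMeasure (volume.restrict 𝔹) :=
  ⟨by rw [Measure.restrict_apply_univ]; exact measure_ball_lt_top⟩

lemma iUnion_ball_diff :
    ⋃ n : ℕ, 𝔹 \ Metric.ball 0 (1 / ((n : ℝ) + 1))
      = 𝔹 \ {0} := by
  ext x
  simp only [Set.mem_iUnion, Set.mem_sdiff, mem_ball_zero_iff, not_lt, Set.mem_singleton_iff]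
  constructor
  · rintro ⟨n, h1, h2⟩
    exact ⟨h1, fun h0 => by
      rw [h0, norm_zero] at h2
      exact absurd h2 (not_le.2 (by positivity))⟩
  · rintro ⟨h1, h2⟩
    obtain ⟨n, hn⟩ := exists_nat_one_div_lt (norm_pos_iff.2 h2)
    exact ⟨n, h1, hn.le⟩

lemma ball_diff_ae_eq :
    (𝔹 \ {0} : Set Plane) =ᵐ[volume] 𝔹 :=
  sdiff_null_ae_eq_self (by simp)

/-- A bounded function that is square integrable away from the origin is square integrable. -/
lemma L2Away.memLp_of_bound {V : Plane → ℂ} (hV : L2Away V) {C : ℝ}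
    (hC : ∀ x ∈ 𝔹, x ≠ 0 → ‖V x‖ ≤ C) :
    MemLp V 2 (volume.restrict 𝔹) := by
  have hm : AEStronglyMeasurable V (volume.restrict (𝔹 \ {0})) := by
    rw [← iUnion_ball_diff]
    exact aestronglyMeasurable_iUnion_iff.2 fun n => (hV _ (by positivity)).aestronglyMeasurable
  rw [← Measure.restrict_congr_set ball_diff_ae_eq]
  have : IsFiniteMeasure (volume.restrict (𝔹 \ {0})) := by
    rw [Measure.restrict_congr_set ball_diff_ae_eq]; infer_instance
  refine MemLp.of_bound hm C ?_
  filter_upwards [ae_restrict_mem (measurableSet_ball.diff (measurableSet_singleton 0))] with x hx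
    using hC x hx.1 hx.2

lemma integral_expI {l : ℤ} (hl : l ≠ 0) :
    ∫ θ in 0..2 * π, exp (l * θ * I) = 0 := by
  have h1 := intervalIntegral.integral_eq_sub_of_hasDerivAt (a := 0) (b := 2 * π)
    (fun θ _ => hasDerivAt_expI l θ)
    ((continuous_const.mul (continuous_expI l)).intervalIntegrable _ _)
  rw [intervalIntegral.integral_const_mul, expI_two_pi] at h1
  simp only [Complex.ofReal_zero, mul_zero, zero_mul, Complex.exp_zero, sub_self] at h1
  refine (mul_eq_zero.1 h1).resolve_left ?_
  simp [hl]

/-- The pairing of two functions with separated variables. -/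
lemma integral_conj_radAng_mul {h g : ℝ → ℂ} {m n : ℤ}
    (hh : MemLp (radAng h m) 2 (volume.restrict 𝔹))
    (hg : MemLp (radAng g n) 2 (volume.restrict 𝔹)) :
    ∫ x in 𝔹, starRingEnd ℂ (radAng h m x) * radAng g n x
      = (∫ r in Ioo (0 : ℝ) 3, r * (starRingEnd ℂ (h r) * g r))
        * ∫ θ in 0..2 * π, exp ((n - m : ℤ) * θ * I) := by
  have hi : IntegrableOn (fun x => starRingEnd ℂ (radAng h m x) * radAng g n x)
      𝔹 := hh.star.integrable_mul hg
  rw [setIntegral_congr_set (ball_ae_eq 3), setIntegral_polar measurableSet_Ioo (fun r hr => hr.1)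
    (hi.mono_set fun x hx => by simpa using hx.2), ← integral_mul_const]
  refine setIntegral_congr_fun measurableSet_Ioo fun r hr => ?_
  rw [Complex.real_smul, mul_assoc]
  congr 1
  rw [← intervalIntegral.integral_const_mul]
  congr 1; funext θ
  simp only [radAng_polar _ _ hr.1, map_mul, ← Complex.exp_conj, Complex.conj_I, map_intCast,
    Complex.conj_ofReal]
  have : ((n - m : ℤ) : ℂ) * θ * I = m * θ * -I + n * θ * I := by
    push_cast; ring
  rw [this, Complex.exp_add]
  ring

/-- A pairwise orthogonal family with square summable norms is summable. -/
lemma summable_of_orthogonal {E : Type*} [NormedAddCommGroup E] [InnerProductSpace ℂ E]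
    [CompleteSpace E] {v : ℤ → E} (h : ∀ m n, m ≠ n → inner ℂ (v m) (v n) = 0)
    (hs : Summable fun n => ‖v n‖ ^ 2) : Summable v := by
  have h1 := OrthogonalFamily.of_pairwise (𝕜 := ℂ) (V := fun n => Submodule.span ℂ {v n})
    fun m n hmn => by
      rw [Function.onFun, Submodule.isOrtho_span]
      rintro _ rfl _ rfl
      exact h m n hmn
  exact (h1.summable_iff_norm_sq_summable
    fun n => ⟨v n, Submodule.mem_span_singleton_self _⟩).2 hs

/-- A series `∑ hₙ(r) e^{i(n+s)θ}` converges in `L²` if the squared norms are summable. The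
convergence is stated in terms of pairings. -/
lemma exists_sum_radAng {h : ℤ → ℝ → ℂ} (s : ℤ)
    (hL : ∀ n, MemLp (radAng (h n) (n + s)) 2 (volume.restrict 𝔹))
    (hs : Summable fun n => ∫ r in Ioo (0 : ℝ) 3, r * ‖h n r‖ ^ 2) :
    ∃ V : Plane → ℂ, MemLp V 2 (volume.restrict 𝔹) ∧
      ∀ w : Plane → ℂ, MemLp w 2 (volume.restrict 𝔹) →
        HasSum (fun n => ∫ x in 𝔹, radAng (h n) (n + s) x * w x)
          (∫ x in 𝔹, V x * w x) := by
  set v : ℤ → Lp ℂ 2 (volume.restrict 𝔹) := fun n => (hL n).toLp with hv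
  have hin (m n : ℤ) : inner ℂ (v m) (v n) = ∫ x in 𝔹,
      starRingEnd ℂ (radAng (h m) (m + s) x) * radAng (h n) (n + s) x := by
    rw [L2.inner_def]
    refine integral_congr_ae ?_
    filter_upwards [(hL m).coeFn_toLp, (hL n).coeFn_toLp] with x h1 h2
    rw [h1, h2, RCLike.inner_apply']
  have hsum : Summable v := by
    refine summable_of_orthogonal (fun m n hmn => ?_) ?_
    · rw [hin, integral_conj_radAng_mul (hL m) (hL n), integral_expI (by omega), mul_zero]
    · refine (hs.mul_left (2 * π)).congr fun n => ?_
      have h1 : ((‖v n‖ ^ 2 : ℝ) : ℂ)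
          = ((2 * π * ∫ r in Ioo (0 : ℝ) 3, r * ‖h n r‖ ^ 2 : ℝ) : ℂ) := by
        have h2 := hin n n
        rw [inner_self_eq_norm_sq_to_K, integral_conj_radAng_mul (hL n) (hL n)] at h2
        have h3 (r : ℝ) : (r : ℂ) * (starRingEnd ℂ (h n r) * h n r) = ((r * ‖h n r‖ ^ 2 : ℝ) : ℂ) := by
          rw [← Complex.normSq_eq_conj_mul_self, Complex.normSq_eq_norm_sq]
          push_cast; rfl
        simp only [h3, integral_complex_ofReal] at h2
        push_cast
        refine h2.trans ?_
        simp
        ring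
      exact_mod_cast h1.symm
  obtain ⟨V, hV⟩ := hsum
  refine ⟨V, Lp.memLp V, fun w hw => ?_⟩
  set w' := hw.star.toLp with hw'
  have h1 := hV.mapL (innerSL ℂ w')
  have h2 (F : Plane → ℂ) (F' : Lp ℂ 2 (volume.restrict 𝔹))
      (hF : F' =ᵐ[volume.restrict 𝔹] F) :
      innerSL ℂ w' F' = ∫ x in 𝔹, F x * w x := by
    rw [innerSL_apply_apply, L2.inner_def]
    refine integral_congr_ae ?_
    filter_upwards [hw.star.coeFn_toLp, hF] with x e1 e2
    rw [hw', e1, e2, RCLike.inner_apply']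
    simp [mul_comm]
  rw [h2 V V (ae_eq_refl _)] at h1
  have h3 (n : ℤ) := h2 _ (v n) (hL n).coeFn_toLp
  simpa only [h3] using h1

/-- Parseval's identity for the pairing of two functions on the circle. -/
lemma hasSum_fourier_pairing {f g : ℝ → ℂ}
    (hf : MemLp f 2 dθ)
    (hg : MemLp g 2 dθ) :
    HasSum (fun n : ℤ => fourierCoeffOn Real.two_pi_pos f n
        * ∫ θ in 0..2 * π, exp (n * θ * I) * g θ)
      (∫ θ in 0..2 * π, f θ * g θ) := by
  have hfact : Fact (0 < 2 * π - 0) := ⟨by simpa using Real.pi_pos⟩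
  have hI : Ioc 0 (2 * π) = Ioc 0 (0 + (2 * π - 0)) := by simp
  set g' : ℝ → ℂ := fun θ => starRingEnd ℂ (g θ) with hg'
  have hgs : MemLp g' 2 dθ := hg.star
  have hf0 := hf
  have hgs0 := hgs
  rw [hI] at hf0 hgs0
  have h1 := hf0.memLp_liftIoc.haarAddCircle
  have h2 := hgs0.memLp_liftIoc.haarAddCircle
  have h3 := (fourierBasis.hasSum_inner_mul_inner h2.toLp h1.toLp).mul_left (2 * π : ℂ)
  have hπ : (π : ℂ) ≠ 0 := mod_cast Real.pi_ne_zero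
  have e1 (h : ℝ → ℂ) (n : ℤ) :
      fourierCoeffOn (by simpa using Real.pi_pos : (0 : ℝ) < 0 + (2 * π - 0)) h n
        = fourierCoeffOn Real.two_pi_pos h n := by simp
  have key1 (n : ℤ) : (2 * π : ℂ) * (inner ℂ h2.toLp (fourierBasis n)
      * inner ℂ (fourierBasis n) h1.toLp) = fourierCoeffOn Real.two_pi_pos f n
        * ∫ θ in 0..2 * π, exp (n * θ * I) * g θ := by
    rw [← inner_conj_symm, ← fourierBasis.repr_apply_apply, ← fourierBasis.repr_apply_apply,
      fourierBasis_repr, fourierBasis_repr, fourierCoeff_congr_ae h1.coeFn_toLp,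
      fourierCoeff_congr_ae h2.coeFn_toLp, fourierCoeff_liftIoc_eq, fourierCoeff_liftIoc_eq,
      e1, e1, fourierCoeffOn_eq_dataCoeff g', dataCoeff, Complex.real_smul, map_mul,
      Complex.conj_ofReal, intervalIntegral.integral_of_le Real.two_pi_pos.le, ← integral_conj,
      ← intervalIntegral.integral_of_le Real.two_pi_pos.le]
    have e3 (θ : ℝ) : starRingEnd ℂ (exp (-(n * θ * I)) * g' θ)
        = exp (n * θ * I) * g θ := by
      simp [hg', ← Complex.exp_conj]
    simp only [e3]
    generalize ∫ θ in 0..2 * π, exp (n * θ * I) * g θ = z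
    push_cast
    field_simp
  have e2 (x : AddCircle (2 * π - 0)) :
      AddCircle.liftIoc (2 * π - 0) 0 (fun θ => f θ * g θ) x
      = AddCircle.liftIoc (2 * π - 0) 0 f x
        * starRingEnd ℂ (AddCircle.liftIoc (2 * π - 0) 0 g' x) :=
    congrArg (_ * ·) (Complex.conj_conj _).symm
  have key2 : (2 * π : ℂ) * inner ℂ h2.toLp h1.toLp
      = ∫ θ in 0..2 * π, f θ * g θ := by
    have e3 : inner ℂ h2.toLp h1.toLp
        = ∫ x, AddCircle.liftIoc (2 * π - 0) 0 (fun θ => f θ * g θ) x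
          ∂AddCircle.haarAddCircle := by
      rw [L2.inner_def]
      refine integral_congr_ae ?_
      filter_upwards [h1.coeFn_toLp, h2.coeFn_toLp] with x a b
      rw [a, b, RCLike.inner_apply', e2, mul_comm]
    rw [e3, AddCircle.integral_haarAddCircle, AddCircle.integral_liftIoc_eq_intervalIntegral]
    simp only [zero_add, sub_zero, Complex.real_smul]
    push_cast
    field_simp
  rw [← key2]
  simpa only [key1] using h3

end

noncomputable section

/-! ### Solutions that are regular at the origin -/

lemma exists_besselJ_le (n : ℕ) (X : ℝ) :
    ∃ C, ∀ x ∈ Icc 0 X, |n * besselJ n x| ≤ C * x ∧ |besselD besselJ n x| ≤ C * x := by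
  obtain ⟨g, hg, hgn⟩ : ∃ g : ℝ → ℝ, Continuous g ∧ ∀ x, 0 ≤ x → n * besselJ n x = x * g x := by
    rcases n with _ | n
    · exact ⟨0, continuous_const, by simp⟩
    · refine ⟨fun x => (besselJ n x + besselJ (n + 2) x) / 2,
        ((continuous_besselJ n).add (continuous_besselJ (n + 2))).div_const _, fun x hx => ?_⟩
      rcases eq_or_lt_of_le hx with rfl | hx
      · simp [besselJ_succ_zero]
      · have := besselFamily_besselJ.recurrence n hx
        field_simp at this ⊢
        push_cast at this ⊢
        linarith
  obtain ⟨C, hC⟩ := isCompact_Icc.exists_bound_of_continuousOn (s := Icc 0 X) hg.continuousOn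
  obtain ⟨D, hD⟩ := isCompact_Icc.exists_bound_of_continuousOn (s := Icc 0 X)
    (continuous_besselJ (n + 1)).continuousOn
  refine ⟨C + D, fun x hx => ?_⟩
  have h1 := hC x hx
  have h2 := hD x hx
  rw [Real.norm_eq_abs] at h1 h2
  have hx0 := hx.1
  have h4 : |n * besselJ n x| ≤ C * x := by
    rw [hgn x hx.1, abs_mul, abs_of_nonneg hx.1, mul_comm]
    gcongr
  constructor
  · have := (abs_nonneg _).trans h2
    nlinarith
  · rw [besselD]
    refine (abs_sub _ _).trans ?_
    rw [add_mul]
    refine add_le_add h4 ?_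
    rw [abs_mul, abs_of_nonneg hx.1, mul_comm]
    gcongr

/-- The radial factors of `(∂₀ ± i ∂₁)(u(r) e^{inθ})`, for `s = ±1`. -/
def ladder (σa R : ℝ) (n : ℤ) (u p : ℝ → ℂ) (s : ℤ) (r : ℝ) : ℂ :=
  (p r / sigRad σa R r - s * n * u r) / r

lemma ladder_angular {σa R : ℝ} {n : ℤ} {u p : ℝ → ℂ} {x : Plane} (hx : x ≠ 0) :
    radAng (ladder σa R n u p 1) (n + 1) x
        = modeGrad σa R n u p 0 x + I * modeGrad σa R n u p 1 x ∧
    radAng (ladder σa R n u p (-1)) (n + -1) x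
        = modeGrad σa R n u p 0 x - I * modeGrad σa R n u p 1 x := by
  have hr : (‖x‖ : ℂ) ≠ 0 := mod_cast norm_ne_zero_iff.2 hx
  have hz : toC x ≠ 0 := by
    rw [← norm_pos_iff, norm_toC]; exact norm_pos_iff.2 hx
  have h3 : ((‖x‖ : ℂ)) ^ 2 = (x 0 : ℂ) ^ 2 + (x 1 : ℂ) ^ 2 := mod_cast norm_sq_eq x
  have e1 : angular 1 x = ((x 0 : ℂ) + (x 1 : ℂ) * I) / ‖x‖ := by
    rw [angular, zpow_one, toC]
  have e2 : angular (-1) x = ((x 0 : ℂ) - (x 1 : ℂ) * I) / ‖x‖ := by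
    rw [angular, zpow_neg_one, inv_div, div_eq_div_iff hz hr, toC]
    linear_combination h3 + (x 1 : ℂ) ^ 2 * Complex.I_sq
  constructor
  · rw [radAng, angular_add _ _ hx, e1]
    simp only [ladder, modeGrad, perp_apply_zero, perp_apply_one]
    push_cast
    generalize p ‖x‖ / (sigRad σa R ‖x‖ : ℂ) = P
    field_simp
    linear_combination (-n * u ‖x‖ * x 0 * angular n x) * Complex.I_sq
  · rw [radAng, angular_add _ _ hx, e2]
    simp only [ladder, modeGrad, perp_apply_zero, perp_apply_one]
    push_cast
    generalize p ‖x‖ / (sigRad σa R ‖x‖ : ℂ) = P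
    field_simp
    linear_combination (n * u ‖x‖ * x 0 * angular n x) * Complex.I_sq

section

variable {ω σa lam R k : ℝ} {n : ℤ} {u p : ℝ → ℂ}

lemma l2Away_ladder (hσ : 0 < σa) (hR : 1 < R) (hu : ContinuousOn u (Ioc 0 3))
    (hp : ContinuousOn p (Ioc 0 3)) {s : ℤ} (hs : s = 1 ∨ s = -1) :
    L2Away (radAng (ladder σa R n u p s) (n + s)) := by
  have h0 := l2Away_modeGrad hσ hR hu hp n 0
  have h1 := (l2Away_modeGrad hσ hR hu hp n 1).const_mul I
  intro ε hε
  have key {V W : Plane → ℂ} (hV : L2Away V) (h : ∀ x, x ≠ 0 → W x = V x) :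
      MemLp W 2 (volume.restrict (𝔹 \ Metric.ball 0 ε)) := by
    refine (hV ε hε).ae_eq ?_
    filter_upwards [ae_restrict_mem (measurableSet_ball.diff measurableSet_ball)] with x hx
    refine (h x fun h0 => hx.2 ?_).symm
    rw [h0]
    exact Metric.mem_ball_self hε
  rcases hs with rfl | rfl
  · exact key (h0.add h1) fun x hx => (ladder_angular hx).1
  · exact key (h0.sub h1) fun x hx => (ladder_angular hx).2

lemma ModeSol.exists_bound (h : ModeSol ω σa lam R n u p) (hk : 0 < k) (hR : 1 < R) {α : ℂ}
    (hin : ∀ r ≤ R, u r = α * besselJ n.natAbs (k * r) ∧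
      p r = σa * (α * besselD besselJ n.natAbs (k * r))) :
    ∃ C, 0 ≤ C ∧ ∀ r ∈ Ioc (0 : ℝ) 3, ‖u r‖ ≤ C ∧ ‖n * u r‖ ≤ C * r ∧ ‖p r‖ ≤ C * r := by
  obtain ⟨hcu, hcp⟩ := h.continuousOn_Icc hR hin
  obtain ⟨A, hA⟩ := isCompact_Icc.exists_bound_of_continuousOn hcu
  obtain ⟨A', hA'⟩ := isCompact_Icc.exists_bound_of_continuousOn hcp
  obtain ⟨B, hB⟩ := exists_besselJ_le n.natAbs (k * 1)
  have hA0 : 0 ≤ A := (norm_nonneg _).trans (hA 0 (by simp))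
  have hA'0 : 0 ≤ A' := (norm_nonneg _).trans (hA' 0 (by simp))
  have hB0 : 0 ≤ B := by
    have := ((abs_nonneg _).trans (hB (k * 1) ⟨by linarith, le_rfl⟩).1)
    by_contra! hneg
    nlinarith
  have hC : 0 ≤ ‖α‖ * B * k + |σa| * (‖α‖ * B * k) := by positivity
  refine ⟨A + ‖(n : ℂ)‖ * A + A' + (‖α‖ * B * k + |σa| * (‖α‖ * B * k)), by positivity,
    fun r hr => ?_⟩
  have h1 := hA r (Set.Ioc_subset_Icc_self hr)
  have h2 := hA' r (Set.Ioc_subset_Icc_self hr)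
  have hnA : 0 ≤ ‖(n : ℂ)‖ * A := by positivity
  have hr0 := hr.1.le
  refine ⟨by linarith, ?_⟩
  rcases le_total r 1 with hr1 | hr1
  · obtain ⟨b1, b2⟩ := hB (k * r) ⟨by positivity, by gcongr⟩
    obtain ⟨e1, e2⟩ := hin r (by linarith)
    have t1 : ‖n * u r‖ ≤ ‖α‖ * B * k * r := by
      have : ‖n * u r‖ = ‖α‖ * |n.natAbs * besselJ n.natAbs (k * r)| := by
        rw [e1, norm_mul, norm_mul, Complex.norm_real, Real.norm_eq_abs, abs_mul, Nat.abs_cast,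
          Complex.norm_intCast, Nat.cast_natAbs, Int.cast_abs]
        ring
      rw [this]
      calc _ ≤ ‖α‖ * (B * (k * r)) := by gcongr
        _ = _ := by ring
    have t2 : ‖p r‖ ≤ |σa| * (‖α‖ * B * k) * r := by
      rw [e2, norm_mul, norm_mul, Complex.norm_real, Complex.norm_real, Real.norm_eq_abs,
        Real.norm_eq_abs]
      calc _ ≤ |σa| * (‖α‖ * (B * (k * r))) := by gcongr
        _ = _ := by ring
    have : 0 ≤ ‖α‖ * B * k := by positivity
    have : 0 ≤ |σa| * (‖α‖ * B * k) := by positivity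
    constructor
    · refine t1.trans ?_
      gcongr
      linarith
    · refine t2.trans ?_
      gcongr
      linarith
  · constructor
    · rw [norm_mul]
      have : ‖(n : ℂ)‖ * ‖u r‖ ≤ ‖(n : ℂ)‖ * A := by gcongr
      nlinarith
    · nlinarith

lemma memLp_ladder {C : ℝ} (hσ : 0 < σa) (hR : 1 < R) (hu : ContinuousOn u (Ioc 0 3))
    (hp : ContinuousOn p (Ioc 0 3))
    (hC : ∀ r ∈ Ioc (0 : ℝ) 3, ‖u r‖ ≤ C ∧ ‖n * u r‖ ≤ C * r ∧ ‖p r‖ ≤ C * r) {s : ℤ}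
    (hs : s = 1 ∨ s = -1) : MemLp (radAng (ladder σa R n u p s) (n + s)) 2
      (volume.restrict 𝔹) := by
  refine (l2Away_ladder hσ hR hu hp hs).memLp_of_bound
    (C := (σa⁻¹ + 2 / (R - 1) + 1) * C + C) fun x hx h0 => ?_
  have hr := norm_pos_iff.2 h0
  obtain ⟨-, h2, h3⟩ := hC ‖x‖ ⟨hr, (mem_ball_zero_iff.1 hx).le⟩
  obtain ⟨h4, h5⟩ := inv_sigRad_le hσ hR ‖x‖
  have h6 := (inv_pos.2 h4).le
  have h7 : ‖(s : ℂ)‖ = 1 := by rcases hs with rfl | rfl <;> simp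
  rw [radAng, norm_mul, norm_angular _ h0, mul_one, ladder, norm_div, Complex.norm_real, norm_norm,
    div_le_iff₀ hr]
  refine (norm_sub_le _ _).trans ?_
  rw [mul_assoc, norm_mul (s : ℂ), h7, one_mul, div_eq_inv_mul, norm_mul, norm_inv,
    Complex.norm_real, Real.norm_of_nonneg h4.le, add_mul, mul_assoc]
  gcongr

lemma memLp_modeGrad {C : ℝ} (hσ : 0 < σa) (hR : 1 < R) (hu : ContinuousOn u (Ioc 0 3))
    (hp : ContinuousOn p (Ioc 0 3))
    (hC : ∀ r ∈ Ioc (0 : ℝ) 3, ‖u r‖ ≤ C ∧ ‖n * u r‖ ≤ C * r ∧ ‖p r‖ ≤ C * r) (j : Fin 2) :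
    MemLp (modeGrad σa R n u p j) 2 (volume.restrict 𝔹) := by
  have h1 := memLp_ladder hσ hR hu hp hC (Or.inl rfl)
  have h2 := memLp_ladder hσ hR hu hp hC (Or.inr rfl)
  have h0 : ∀ᵐ x ∂(volume.restrict 𝔹), x ≠ 0 :=
    ae_restrict_of_ae (by simp [ae_iff])
  fin_cases j
  · refine ((h1.add h2).const_mul (2⁻¹ : ℂ)).ae_eq ?_
    filter_upwards [h0] with x hx
    simp only [Pi.add_apply, (ladder_angular hx).1, (ladder_angular hx).2]
    simp
    ring
  · refine ((h1.sub h2).const_mul (2 * I)⁻¹).ae_eq ?_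
    filter_upwards [h0] with x hx
    simp only [Pi.sub_apply, (ladder_angular hx).1, (ladder_angular hx).2]
    have := Complex.I_ne_zero
    field_simp
    simp
    ring

lemma inv_sigTan_le (hσ : 0 < σa) (hR : 1 < R) {r : ℝ} (hr : 0 < r) :
    (sigTan σa R r)⁻¹ ≤ σa⁻¹ + 2 / (R - 1) + 1 := by
  have h0 : 0 < 2 / (R - 1) := div_pos two_pos (by linarith)
  have h3 : 0 < σa⁻¹ := inv_pos.2 hσ
  rw [sigTan]
  split_ifs with h1 h2
  · linarith
  · have : (r - 1) / r ≤ 1 := by rw [div_le_one hr]; linarith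
    rw [inv_div]; linarith
  · rw [inv_one]; linarith

/-- The `L²` norms of a mode of high order and of its gradient are controlled by the energy. -/
lemma ModeSol.integral_le (h : ModeSol ω σa lam R n u p) (hσ : 0 < σa) (hlam : 0 < lam)
    (hk : 0 < k) (hk2 : k ^ 2 * (σa * lam) = ω ^ 2) (hR : 1 < R) (hR2 : R < 2) {α : ℂ}
    (hin : ∀ r ≤ R, u r = α * besselJ n.natAbs (k * r) ∧
      p r = σa * (α * besselD besselJ n.natAbs (k * r)))
    (hn : 18 * ω ^ 2 ≤ n ^ 2) (hn' : 8 * k ^ 2 ≤ n ^ 2) :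
    (∫ r in Ioo (0 : ℝ) 3, r * ‖u r‖ ^ 2) ≤ 18 * (σa⁻¹ + 2 / (R - 1) + 1)
      * (max 1 σa * n.natAbs * ‖u 3‖ ^ 2) ∧
    ∀ s : ℤ, s = 1 ∨ s = -1 → (∫ r in Ioo (0 : ℝ) 3, r * ‖ladder σa R n u p s r‖ ^ 2)
      ≤ 18 * (σa⁻¹ + 2 / (R - 1) + 1) * (max 1 σa * n.natAbs * ‖u 3‖ ^ 2) := by
  obtain ⟨hi, he⟩ := h.energy hσ hlam hk hk2 hR hR2 hin hn hn'
  set M := σa⁻¹ + 2 / (R - 1) + 1 with hM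
  have hM0 : 0 < M := by
    have : 0 < 2 / (R - 1) := div_pos two_pos (by linarith)
    positivity
  have hn1 : (1 : ℝ) ≤ (n : ℝ) ^ 2 := by
    have h0 : n ≠ 0 := by
      rintro rfl
      have : 0 < k ^ 2 := by positivity
      simp at hn'; linarith
    have : 1 ≤ n ^ 2 := Int.add_one_le_iff.2 (sq_pos_iff.2 h0)
    exact_mod_cast this
  have key (F : ℝ → ℝ) (hF0 : ∀ r ∈ Ioo (0 : ℝ) 3, 0 ≤ F r)
      (hF : ∀ r ∈ Ioo (0 : ℝ) 3, F r ≤ 18 * M * energyDensity ω σa lam R n u p r) :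
      ∫ r in Ioo (0 : ℝ) 3, F r ≤ 18 * M * (max 1 σa * n.natAbs * ‖u 3‖ ^ 2) := by
    refine (integral_mono_of_nonneg ?_ ((hi.mono_set Set.Ioo_subset_Ioc_self).const_mul (18 * M))
      ?_).trans ?_
    · filter_upwards [ae_restrict_mem measurableSet_Ioo] with r hr using hF0 r hr
    · filter_upwards [ae_restrict_mem measurableSet_Ioo] with r hr using hF r hr
    · rw [integral_const_mul, ← integral_Ioc_eq_integral_Ioo]
      gcongr
  have aux (r : ℝ) (hr : r ∈ Ioo (0 : ℝ) 3) :
      (n : ℝ) ^ 2 * ‖u r‖ ^ 2 / r ≤ 2 * M * (coefB ω σa lam R n r * ‖u r‖ ^ 2) ∧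
      0 ≤ ‖p r‖ ^ 2 / (r * sigRad σa R r) := by
    have hr0 := hr.1
    have h1 := coefB_ge hσ hlam hk hk2 hR hR2 hn hn' ⟨hr.1, hr.2.le⟩
    have h2 := inv_sigTan_le hσ hR hr.1
    have h3 := sigTan_pos hσ hR hr.1
    refine ⟨?_, by have := (inv_sigRad_le hσ hR r).1; positivity⟩
    have h4 : (n : ℝ) ^ 2 / r ≤ 2 * M * coefB ω σa lam R n r := by
      calc (n : ℝ) ^ 2 / r
          = 2 * (sigTan σa R r)⁻¹ * (n ^ 2 * sigTan σa R r / (2 * r)) := by field_simp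
        _ ≤ 2 * M * coefB ω σa lam R n r := by gcongr
    calc (n : ℝ) ^ 2 * ‖u r‖ ^ 2 / r = (n : ℝ) ^ 2 / r * ‖u r‖ ^ 2 := by ring
      _ ≤ 2 * M * coefB ω σa lam R n r * ‖u r‖ ^ 2 := by gcongr
      _ = _ := by ring
  constructor
  · refine key _ (fun r hr => by have := hr.1; positivity) fun r hr => ?_
    obtain ⟨a1, a2⟩ := aux r hr
    have hr0 := hr.1
    have a3 : r * ‖u r‖ ^ 2 ≤ 9 * ((n : ℝ) ^ 2 * ‖u r‖ ^ 2 / r) := by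
      rw [mul_div_assoc', le_div_iff₀ hr0]
      have e1 : r * ‖u r‖ ^ 2 * r = r ^ 2 * (1 * ‖u r‖ ^ 2) := by ring
      have e2 : r ^ 2 ≤ 9 := by nlinarith [hr.2]
      rw [e1]
      gcongr
    rw [energyDensity]
    nlinarith [mul_nonneg hM0.le a2]
  · intro s hs
    refine key _ (fun r hr => by have := hr.1; positivity) fun r hr => ?_
    obtain ⟨a1, a2⟩ := aux r hr
    have hr0 := hr.1
    obtain ⟨h4, h5⟩ := inv_sigRad_le hσ hR r
    have h7 : ‖(s : ℂ)‖ = 1 := by rcases hs with rfl | rfl <;> simp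
    have b1 : ‖p r / sigRad σa R r - s * n * u r‖ ≤ ‖p r‖ / sigRad σa R r + |(n : ℝ)| * ‖u r‖ := by
      refine (norm_sub_le _ _).trans ?_
      rw [norm_mul, norm_mul, h7, one_mul, norm_div, Complex.norm_real, Real.norm_of_nonneg h4.le,
        Complex.norm_intCast]
    have b2 : r * ‖ladder σa R n u p s r‖ ^ 2
        ≤ 2 * ((sigRad σa R r)⁻¹ * (‖p r‖ ^ 2 / (r * sigRad σa R r)))
          + 2 * ((n : ℝ) ^ 2 * ‖u r‖ ^ 2 / r) := by
      rw [ladder, norm_div, Complex.norm_real, Real.norm_of_nonneg hr0.le, div_pow]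
      calc _ ≤ r * ((‖p r‖ / sigRad σa R r + |(n : ℝ)| * ‖u r‖) ^ 2 / r ^ 2) := by gcongr
        _ ≤ r * (2 * ((‖p r‖ / sigRad σa R r) ^ 2 + (|(n : ℝ)| * ‖u r‖) ^ 2) / r ^ 2) := by
          gcongr; exact add_sq_le
        _ = _ := by rw [mul_pow |(n : ℝ)|, sq_abs]; field_simp
    have b3 := mul_le_mul_of_nonneg_right h5 a2
    have b4 : (n : ℝ) ^ 2 * ‖u r‖ ^ 2 / r ≥ 0 := by positivity
    rw [energyDensity]
    nlinarith [mul_nonneg hM0.le a2]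

end

end

noncomputable section

/-- A weak solution across the origin: test functions need not vanish there. -/
structure RegSol (ω σa lam R : ℝ) (f : ℝ → ℂ) (U : Plane → ℂ) (G : Fin 2 → Plane → ℂ) : Prop where
  memU : MemLp U 2 (volume.restrict 𝔹)
  memG : ∀ j, MemLp (G j) 2 (volume.restrict 𝔹)
  green : ∀ j, ∀ ψ : Plane → ℂ, Smooth ψ →
    ∫ x in 𝔹, (U x * fderiv ℝ ψ x (e j) + G j x * ψ x)
      = ∫ θ in 0..2 * π, 3 * (f θ * (polar 1 θ j : ℂ) * ψ (polar 3 θ))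
  weak : ∀ φ : Plane → ℂ, Smooth φ → tsupport φ ⊆ 𝔹 →
    ∫ x in 𝔹,
      (-(∑ j : Fin 2, ∑ k : Fin 2, (sigmaR σa R x j k : ℂ) * G k x * fderiv ℝ φ x (e j))
        + (ω : ℂ) ^ 2 / (lambdaR lam R x : ℂ) * U x * φ x) = 0

lemma memLp_bdd_mul {w V : Plane → ℂ} (hw : Measurable w) {C : ℝ} (hC : ∀ x, ‖w x‖ ≤ C)
    (hV : MemLp V 2 (volume.restrict 𝔹)) :
    MemLp (fun x => w x * V x) 2 (volume.restrict 𝔹) :=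
  MemLp.of_le_mul hV (hw.aestronglyMeasurable.mul hV.aestronglyMeasurable)
    (Eventually.of_forall fun x => by
      rw [norm_mul]; exact mul_le_mul_of_nonneg_right (hC x) (norm_nonneg _))

lemma memLp_of_continuous {w : Plane → ℂ} (hw : Continuous w) :
    MemLp w 2 (volume.restrict 𝔹) := by
  obtain ⟨C, hC⟩ := (isCompact_closedBall (0 : Plane) 3).exists_bound_of_continuousOn
    hw.continuousOn
  refine MemLp.of_bound hw.aestronglyMeasurable C ?_
  filter_upwards [ae_restrict_mem measurableSet_ball] with x hx
    using hC x (Metric.ball_subset_closedBall hx)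

/-- The weight of the `k`-th gradient component in the weak equation. -/
def fluxWeight (σa R : ℝ) (φ : Plane → ℂ) (k : Fin 2) (x : Plane) : ℂ :=
  -∑ j, (sigmaR σa R x j k : ℂ) * fderiv ℝ φ x (e j)

lemma memLp_fluxWeight {σa R : ℝ} (hσ : 0 < σa) (hR : 1 < R) {φ : Plane → ℂ}
    (hφ : Smooth φ) (k : Fin 2) :
    MemLp (fluxWeight σa R φ k) 2 (volume.restrict 𝔹) := by
  have h (j : Fin 2) : MemLp (fun x => (sigmaR σa R x j k : ℂ) * fderiv ℝ φ x (e j)) 2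
      (volume.restrict 𝔹) := by
    obtain ⟨C, hC⟩ := abs_sigmaR_le hσ hR j k
    exact memLp_bdd_mul (Complex.measurable_ofReal.comp (measurable_sigmaR σa R j k))
      (fun x => by simpa using hC x) (memLp_of_continuous (continuous_fderiv_apply hφ _))
  have := ((h 0).add (h 1)).neg
  refine this.ae_eq (Eventually.of_forall fun x => ?_)
  simp only [fluxWeight, Fin.sum_univ_two]
  rfl

lemma memLp_massWeight {ω lam R : ℝ} (hlam : 0 < lam) (hR : 1 < R) {φ : Plane → ℂ}
    (hφ : Smooth φ) :
    MemLp (fun x => (ω : ℂ) ^ 2 / (lambdaR lam R x : ℂ) * φ x) 2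
      (volume.restrict 𝔹) := by
  refine memLp_bdd_mul (C := ‖(ω : ℂ) ^ 2‖ * (1 / lam + 4)) ?_ (fun x => ?_)
    (memLp_of_continuous hφ.continuous)
  · exact measurable_const.div (Complex.measurable_ofReal.comp (measurable_lambdaR lam R))
  · rw [div_eq_mul_inv, norm_mul]
    exact mul_le_mul_of_nonneg_left (inv_lambdaR_bdd hlam hR x) (norm_nonneg _)

/-- The integrand of the weak equation, arranged as a sum of pairings. -/
lemma weak_integrand_eq (ω σa lam R : ℝ) (U : Plane → ℂ) (G : Fin 2 → Plane → ℂ) (φ : Plane → ℂ) :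
    (fun x => (-(∑ j : Fin 2, ∑ k : Fin 2, (sigmaR σa R x j k : ℂ) * G k x * fderiv ℝ φ x (e j))
        + (ω : ℂ) ^ 2 / (lambdaR lam R x : ℂ) * U x * φ x))
      = fun x => G 0 x * fluxWeight σa R φ 0 x + G 1 x * fluxWeight σa R φ 1 x
        + U x * ((ω : ℂ) ^ 2 / (lambdaR lam R x : ℂ) * φ x) := by
  funext x
  simp only [fluxWeight, Fin.sum_univ_two]
  ring

lemma integral_weak_eq {ω σa lam R : ℝ} (hσ : 0 < σa) (hlam : 0 < lam) (hR : 1 < R)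
    {U : Plane → ℂ} {G : Fin 2 → Plane → ℂ}
    (hU : MemLp U 2 (volume.restrict 𝔹))
    (hG : ∀ j, MemLp (G j) 2 (volume.restrict 𝔹)) {φ : Plane → ℂ}
    (hφ : Smooth φ) :
    IntegrableOn (fun x =>
      (-(∑ j : Fin 2, ∑ k : Fin 2, (sigmaR σa R x j k : ℂ) * G k x * fderiv ℝ φ x (e j))
        + (ω : ℂ) ^ 2 / (lambdaR lam R x : ℂ) * U x * φ x)) 𝔹 ∧
    ∫ x in 𝔹,
      (-(∑ j : Fin 2, ∑ k : Fin 2, (sigmaR σa R x j k : ℂ) * G k x * fderiv ℝ φ x (e j))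
        + (ω : ℂ) ^ 2 / (lambdaR lam R x : ℂ) * U x * φ x)
      = (∫ x in 𝔹, G 0 x * fluxWeight σa R φ 0 x)
        + (∫ x in 𝔹, G 1 x * fluxWeight σa R φ 1 x)
        + ∫ x in 𝔹, U x * ((ω : ℂ) ^ 2 / (lambdaR lam R x : ℂ) * φ x) := by
  have i0 : IntegrableOn (fun x => G 0 x * fluxWeight σa R φ 0 x) 𝔹 :=
    (hG 0).integrable_mul (memLp_fluxWeight hσ hR hφ 0)
  have i1 : IntegrableOn (fun x => G 1 x * fluxWeight σa R φ 1 x) 𝔹 :=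
    (hG 1).integrable_mul (memLp_fluxWeight hσ hR hφ 1)
  have i2 : IntegrableOn (fun x => U x * ((ω : ℂ) ^ 2 / (lambdaR lam R x : ℂ) * φ x))
      𝔹 := hU.integrable_mul (memLp_massWeight hlam hR hφ)
  rw [weak_integrand_eq]
  have i01 : IntegrableOn (fun x => G 0 x * fluxWeight σa R φ 0 x + G 1 x * fluxWeight σa R φ 1 x)
    𝔹 := i0.add i1
  exact ⟨i01.add i2, by rw [integral_add i01 i2, integral_add i0 i1]⟩

lemma integral_green_eq {U V : Plane → ℂ}
    (hU : MemLp U 2 (volume.restrict 𝔹))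
    (hV : MemLp V 2 (volume.restrict 𝔹)) {ψ : Plane → ℂ}
    (hψ : Smooth ψ) (v : Plane) :
    IntegrableOn (fun x => U x * fderiv ℝ ψ x v + V x * ψ x) 𝔹 ∧
    ∫ x in 𝔹, (U x * fderiv ℝ ψ x v + V x * ψ x)
      = (∫ x in 𝔹, U x * fderiv ℝ ψ x v)
        + ∫ x in 𝔹, V x * ψ x := by
  have i0 : IntegrableOn (fun x => U x * fderiv ℝ ψ x v) 𝔹 :=
    hU.integrable_mul (memLp_of_continuous (continuous_fderiv_apply hψ v))
  have i1 : IntegrableOn (fun x => V x * ψ x) 𝔹 :=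
    hV.integrable_mul (memLp_of_continuous hψ.continuous)
  exact ⟨i0.add i1, integral_add i0 i1⟩

section

variable {ω σa lam R k : ℝ} {f : ℝ → ℂ}

lemma RegSol.weakSol {U : Plane → ℂ} {G : Fin 2 → Plane → ℂ} (h : RegSol ω σa lam R f U G) :
    WeakSol ω σa lam R f U G where
  memU _ _ := h.memU.mono_measure (Measure.restrict_mono Set.sdiff_subset le_rfl)
  memG j _ _ := (h.memG j).mono_measure (Measure.restrict_mono Set.sdiff_subset le_rfl)
  green j ψ hψ _ _ := h.green j ψ hψ
  weak φ hφ _ hs _ := h.weak φ hφ hs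

/-- A mode that is regular at the origin is a weak solution across the origin. -/
lemma ModeSol.regSol {n : ℤ} {u p : ℝ → ℂ} (hm : ModeSol ω σa lam R n u p) (hσ : 0 < σa)
    (hlam : 0 < lam) (hk : 0 < k) (hR : 1 < R) {α : ℂ}
    (hin : ∀ r ≤ R, u r = α * besselJ n.natAbs (k * r) ∧
      p r = σa * (α * besselD besselJ n.natAbs (k * r))) :
    RegSol ω σa lam R (fun θ => u 3 * exp (n * θ * I)) (radAng u n)
      (modeGrad σa R n u p) := by
  obtain ⟨C, hC0, hC⟩ := hm.exists_bound hk hR hin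
  have hU : MemLp (radAng u n) 2 (volume.restrict 𝔹) := by
    refine (hm.l2Away_u n).memLp_of_bound (C := C) fun x hx h0 => ?_
    rw [radAng, norm_mul, norm_angular _ h0, mul_one]
    exact (hC _ ⟨norm_pos_iff.2 h0, (mem_ball_zero_iff.1 hx).le⟩).1
  have hG := memLp_modeGrad hσ hR hm.cont_u hm.cont_p hC
  have hlim (a : ℝ → ℂ) (ha : ∀ r ∈ Ioc (0 : ℝ) 3, ‖a r‖ ≤ C * r) {w : ℝ → ℂ} (hw : Continuous w)
      {ψ : Plane → ℂ} (hψ : Smooth ψ) :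
      Tendsto (fun r => a r * circleMean w ψ r) (𝓝[>] 0) (𝓝 0) := by
    have h1 : Tendsto a (𝓝[>] 0) (𝓝 0) := by
      refine squeeze_zero_norm' (a := fun r => C * r) ?_ ?_
      · filter_upwards [Ioo_mem_nhdsGT (by norm_num : (0 : ℝ) < 3)] with r hr
        exact ha r ⟨hr.1, hr.2.le⟩
      · have : Tendsto (fun r : ℝ => C * r) (𝓝[>] 0) (𝓝 (C * 0)) :=
          (continuous_const.mul continuous_id).continuousAt.tendsto.mono_left nhdsWithin_le_nhds
        simpa using this
    have h2 := h1.mul ((continuous_circleMean hw hψ).continuousAt.tendsto.mono_left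
      (nhdsWithin_le_nhds (a := (0 : ℝ)) (s := Ioi 0)))
    simpa using h2
  refine ⟨hU, hG, fun j ψ hψ => ?_, fun φ hφ hs => ?_⟩
  · have hcj : Continuous fun θ => (polar 1 θ j : ℂ) :=
      continuous_iff_continuousAt.2 fun θ => (hasDerivAt_polar_coord j θ).continuousAt
    rw [hm.green hσ hR j hψ (integral_green_eq hU (hG j) hψ _).1
      (hlim (fun r => r * u r) (fun r hr => ?_) ((continuous_expI n).mul hcj) hψ), circleMean,
      ← intervalIntegral.integral_const_mul]
    · congr 1; funext θ; ring
    · have hr0 := hr.1.le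
      rw [norm_mul, Complex.norm_real, Real.norm_of_nonneg hr.1.le, mul_comm]
      gcongr
      exact (hC r hr).1
  · exact hm.weak hσ hlam hR hφ hs (integral_weak_eq hσ hlam hR hU hG hφ).1
      (hlim p (fun r hr => (hC r hr).2.2) (continuous_expI n) hφ)

/-- Boundary data in `H^{1/2}` are attained by a solution without sources: the series of the modes
converges in the energy norm. -/
lemma exists_regSol (hω : 0 < ω) (hσ : 0 < σa) (hlam : 0 < lam) (hk : 0 < k)
    (hk2 : k ^ 2 * (σa * lam) = ω ^ 2) (hR : 1 < R) (hR2 : R < 2)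
    (hJ : ∀ n, besselJ n (3 * ω) ≠ 0) (hdet : ∀ n, transDet ω σa k n R ≠ 0) (hf : MemHHalf f) :
    ∃ U G, RegSol ω σa lam R f U G := by
  have hex (n : ℤ) : ∃ (u p : ℝ → ℂ) (α : ℂ), ModeSol ω σa lam R n u p ∧
      u 3 = fourierCoeffOn Real.two_pi_pos f n ∧ ∀ r ≤ R, u r = α * besselJ n.natAbs (k * r) ∧
        p r = σa * (α * besselD besselJ n.natAbs (k * r)) := by
    obtain ⟨u, p, α, hm, h3, hin⟩ := exists_modeSol hω hσ hlam hk hk2 hR hR2 n (hJ _) (hdet _) 0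
      (fourierCoeffOn Real.two_pi_pos f n)
    exact ⟨u, p, α, hm, h3, fun r hr => by simpa using hin r hr⟩
  choose u p α hm h3 hin using hex
  have hreg (n : ℤ) := (hm n).regSol hσ hlam hk hR (hin n)
  set K := 18 * (σa⁻¹ + 2 / (R - 1) + 1) * max 1 σa with hK
  have hK0 : 0 ≤ K := by
    have : 0 < 2 / (R - 1) := div_pos two_pos (by linarith)
    positivity
  have hlarge : ∀ᶠ n : ℤ in cofinite, 18 * ω ^ 2 ≤ (n : ℝ) ^ 2 ∧ 8 * k ^ 2 ≤ (n : ℝ) ^ 2 := by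
    have h1 : Tendsto (fun n : ℤ => |(n : ℝ)|) cofinite atTop := by
      have := Int.tendsto_coe_cofinite
      rw [Metric.cobounded_eq_cocompact.symm] at this
      exact tendsto_norm_cobounded_atTop.comp this
    have h2 := (tendsto_pow_atTop two_ne_zero).comp h1
    filter_upwards [h2.eventually_ge_atTop (18 * ω ^ 2), h2.eventually_ge_atTop (8 * k ^ 2)]
      with n e1 e2
    simp only [Function.comp_apply, sq_abs] at e1 e2
    exact ⟨e1, e2⟩
  have hsum (F : ℤ → ℝ) (hF0 : ∀ n, 0 ≤ F n)
      (hF : ∀ n : ℤ, 18 * ω ^ 2 ≤ (n : ℝ) ^ 2 → 8 * k ^ 2 ≤ (n : ℝ) ^ 2 →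
        F n ≤ 18 * (σa⁻¹ + 2 / (R - 1) + 1) * (max 1 σa * n.natAbs * ‖u n 3‖ ^ 2)) :
      Summable F := by
    refine Summable.of_norm_bounded_eventually (hf.2.mul_left K) ?_
    filter_upwards [hlarge] with n hn
    rw [Real.norm_of_nonneg (hF0 n), ← h3 n]
    refine (hF n hn.1 hn.2).trans ?_
    have h4 : (n.natAbs : ℝ) ≤ Real.sqrt (1 + (n : ℝ) ^ 2) := by
      refine Real.le_sqrt_of_sq_le ?_
      rw [natAbs_cast_sq]; linarith
    calc _ = K * (n.natAbs * ‖u n 3‖ ^ 2) := by rw [hK]; ring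
      _ ≤ _ := by gcongr
  have hpos (g : ℝ → ℂ) : 0 ≤ ∫ r in Ioo (0 : ℝ) 3, r * ‖g r‖ ^ 2 :=
    setIntegral_nonneg measurableSet_Ioo fun r hr => mul_nonneg hr.1.le (sq_nonneg _)
  have hbd (n : ℤ) := (hm n).integral_le hσ hlam hk hk2 hR hR2 (hin n)
  obtain ⟨U, hU, hUs⟩ := exists_sum_radAng (h := u) 0 (fun n => by simpa using (hreg n).memU)
    (hsum _ (fun n => hpos _) fun n e1 e2 => (hbd n e1 e2).1)
  have hA (s : ℤ) (hs : s = 1 ∨ s = -1) := exists_sum_radAng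
    (h := fun n => ladder σa R n (u n) (p n) s) s (fun n => by
      obtain ⟨C, -, hC⟩ := (hm n).exists_bound hk hR (hin n)
      exact memLp_ladder hσ hR (hm n).cont_u (hm n).cont_p hC hs)
    (hsum _ (fun n => hpos _) fun n e1 e2 => (hbd n e1 e2).2 s hs)
  -- `A` and `B` are the sums of the modes of `∂₀U + i∂₁U` and `∂₀U - i∂₁U`, which are pure Fourier
  -- modes and hence orthogonal for different `n`; the gradient is recovered from them
  obtain ⟨A, hAm, hAs⟩ := hA 1 (Or.inl rfl)
  obtain ⟨B, hBm, hBs⟩ := hA (-1) (Or.inr rfl)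
  simp only [add_zero] at hUs
  have hG0 : MemLp (fun x => (2 : ℂ)⁻¹ * (A x + B x)) 2
    (volume.restrict 𝔹) := (hAm.add hBm).const_mul _
  have hG1 : MemLp (fun x => -I / 2 * (A x - B x)) 2
    (volume.restrict 𝔹) := (hAm.sub hBm).const_mul _
  set G : Fin 2 → Plane → ℂ := ![fun x => (2 : ℂ)⁻¹ * (A x + B x),
    fun x => -I / 2 * (A x - B x)] with hGdef
  have hG (j : Fin 2) : MemLp (G j) 2 (volume.restrict 𝔹) := by
    revert j
    exact Fin.forall_fin_two.2 ⟨hG0, hG1⟩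
  have hx0 : ∀ᵐ x ∂(volume.restrict 𝔹), x ≠ 0 :=
    ae_restrict_of_ae (by simp [ae_iff])
  have hGs (j : Fin 2) (w : Plane → ℂ)
      (hw : MemLp w 2 (volume.restrict 𝔹)) :
      HasSum (fun n => ∫ x in 𝔹, modeGrad σa R n (u n) (p n) j x * w x)
        (∫ x in 𝔹, G j x * w x) := by
    have iA : IntegrableOn (fun x => A x * w x) 𝔹 := hAm.integrable_mul hw
    have iB : IntegrableOn (fun x => B x * w x) 𝔹 := hBm.integrable_mul hw
    have i0 (n : ℤ) : IntegrableOn (fun x => modeGrad σa R n (u n) (p n) 0 x * w x)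
      𝔹 := ((hreg n).memG 0).integrable_mul hw
    have i1 (n : ℤ) : IntegrableOn (fun x => I * (modeGrad σa R n (u n) (p n) 1 x * w x))
      𝔹 := (((hreg n).memG 1).integrable_mul hw).const_mul _
    have eA (n : ℤ) : ∫ x in 𝔹,
        radAng (ladder σa R n (u n) (p n) 1) (n + 1) x * w x
        = (∫ x in 𝔹, modeGrad σa R n (u n) (p n) 0 x * w x)
          + I * ∫ x in 𝔹, modeGrad σa R n (u n) (p n) 1 x * w x := by
      rw [← integral_const_mul, ← integral_add (i0 n) (i1 n)]
      refine integral_congr_ae ?_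
      filter_upwards [hx0] with x hx
      rw [(ladder_angular hx).1]; ring
    have eB (n : ℤ) : ∫ x in 𝔹,
        radAng (ladder σa R n (u n) (p n) (-1)) (n + -1) x * w x
        = (∫ x in 𝔹, modeGrad σa R n (u n) (p n) 0 x * w x)
          - I * ∫ x in 𝔹, modeGrad σa R n (u n) (p n) 1 x * w x := by
      rw [← integral_const_mul, ← integral_sub (i0 n) (i1 n)]
      refine integral_congr_ae ?_
      filter_upwards [hx0] with x hx
      rw [(ladder_angular hx).2]; ring
    have sA := hAs w hw
    have sB := hBs w hw
    simp only [eA] at sA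
    simp only [eB] at sB
    revert j
    refine Fin.forall_fin_two.2 ⟨?_, ?_⟩
    · have h1 := (sA.add sB).mul_left (2 : ℂ)⁻¹
      have h2 : ∫ x in 𝔹, G 0 x * w x = (2 : ℂ)⁻¹
          * ((∫ x in 𝔹, A x * w x)
            + ∫ x in 𝔹, B x * w x) := by
        rw [← integral_add iA iB, ← integral_const_mul]
        congr 1; funext x
        change (2 : ℂ)⁻¹ * (A x + B x) * w x = _
        ring
      rw [h2]
      refine (iff_of_eq (congrArg (HasSum · _ _) (funext fun n => ?_))).2 h1
      ring
    · have h1 := (sA.sub sB).mul_left (-I / 2)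
      have h2 : ∫ x in 𝔹, G 1 x * w x = -I / 2
          * ((∫ x in 𝔹, A x * w x)
            - ∫ x in 𝔹, B x * w x) := by
        rw [← integral_sub iA iB, ← integral_const_mul]
        congr 1; funext x
        change -I / 2 * (A x - B x) * w x = _
        ring
      rw [h2]
      refine (iff_of_eq (congrArg (HasSum · _ _) (funext fun n => ?_))).2 h1
      linear_combination
        (∫ x in 𝔹, modeGrad σa R n (u n) (p n) 1 x * w x) * Complex.I_sq
  refine ⟨U, G, hU, hG, fun j ψ hψ => ?_, fun φ hφ hs => ?_⟩
  · rw [(integral_green_eq hU (hG j) hψ _).2]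
    have s1 := (hUs _ (memLp_of_continuous (continuous_fderiv_apply hψ (e j)))).add
      (hGs j ψ (memLp_of_continuous hψ.continuous))
    have hcj : Continuous fun θ => (polar 1 θ j : ℂ) :=
      continuous_iff_continuousAt.2 fun θ => (hasDerivAt_polar_coord j θ).continuousAt
    have hgc : Continuous fun θ => 3 * ((polar 1 θ j : ℂ) * ψ (polar 3 θ)) :=
      continuous_const.mul (hcj.mul (hψ.continuous.comp (continuous_polar_angle 3)))
    have hg : MemLp (fun θ => 3 * ((polar 1 θ j : ℂ) * ψ (polar 3 θ))) 2
        dθ := by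
      obtain ⟨C, hC⟩ := isCompact_Icc.exists_bound_of_continuousOn (s := Icc 0 (2 * π))
        hgc.continuousOn
      refine MemLp.of_bound hgc.aestronglyMeasurable C ?_
      filter_upwards [ae_restrict_mem measurableSet_Ioc] with θ hθ
        using hC θ (Set.Ioc_subset_Icc_self hθ)
    have s2 := hasSum_fourier_pairing hf.1 hg
    have e1 (n : ℤ) : (∫ x in 𝔹, radAng (u n) n x * fderiv ℝ ψ x (e j))
        + ∫ x in 𝔹, modeGrad σa R n (u n) (p n) j x * ψ x
        = fourierCoeffOn Real.two_pi_pos f n * ∫ θ in 0..2 * π,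
          exp (n * θ * I) * (3 * ((polar 1 θ j : ℂ) * ψ (polar 3 θ))) := by
      rw [← (integral_green_eq (hreg n).memU ((hreg n).memG j) hψ _).2, (hreg n).green j ψ hψ,
        ← h3 n, ← intervalIntegral.integral_const_mul]
      congr 1; funext θ; ring
    simp only [e1] at s1
    rw [s1.unique s2]
    congr 1; funext θ; ring
  · rw [(integral_weak_eq hσ hlam hR hU hG hφ).2]
    have s1 := ((hGs 0 _ (memLp_fluxWeight hσ hR hφ 0)).add
      (hGs 1 _ (memLp_fluxWeight hσ hR hφ 1))).add (hUs _ (memLp_massWeight (ω := ω) hlam hR hφ))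
    have e1 (n : ℤ) := (hreg n).weak φ hφ hs
    simp only [(integral_weak_eq hσ hlam hR (hreg _).memU (hreg _).memG hφ).2] at e1
    simp only [e1] at s1
    exact s1.unique hasSum_zero

end

end

noncomputable section

/-! ### The equation in the cloaked region -/

/-- The distribution on `Ω` given by an integrable function. -/
def funDist (U : Plane → ℂ) : 𝓓'(Omega, ℂ) :=
  (TestFunction.integralAgainstBilinCLM (ContinuousLinearMap.lsmul ℝ ℝ) volume U :
    𝓓(Omega, ℝ) →L[ℝ] ℂ)

lemma funDist_apply {U : Plane → ℂ} (hU : IntegrableOn U 𝔹)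
    (φ : 𝓓(Omega, ℝ)) : funDist U φ = ∫ x in 𝔹, (φ x : ℂ) * U x := by
  have h1 : LocallyIntegrableOn U Omega := hU.locallyIntegrableOn
  refine (TestFunction.integralAgainstBilinCLM_eq_integral h1).trans ?_
  have h2 : ∫ x in 𝔹, (φ x : ℂ) * U x = ∫ x, (φ x : ℂ) * U x :=
    setIntegral_eq_integral_of_forall_compl_eq_zero fun x hx => by
      rw [image_eq_zero_of_notMem_tsupport fun h => hx (φ.tsupport_subset h)]; simp
  rw [h2]
  simp

lemma ofReal_helmTest (k : ℝ) (φ : 𝓓(Omega, ℝ)) (x : Plane) :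
    (helmTest k φ x : ℂ) = lap (fun x => (φ x : ℂ)) x + (k : ℂ) ^ 2 * φ x := by
  have h (φ : 𝓓(Omega, ℝ)) (j : Fin 2) : (fun y => fderiv ℝ (fun x => (φ x : ℂ)) y (e j))
      = fun y => ((∂_{e j} φ : 𝓓(Omega, ℝ)) y : ℂ) := by
    funext y; rw [fderiv_ofReal_test, test_lineDeriv_apply]
  have h' (j : Fin 2) : (fun y => fderiv ℝ φ y (e j)) = ⇑(∂_{e j} φ : 𝓓(Omega, ℝ)) :=
    funext fun y => (test_lineDeriv_apply φ (e j) y).symm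
  rw [helmTest_apply, lap]
  simp only [h]
  simp only [h', fderiv_ofReal_test]
  push_cast
  rfl

lemma contDiff_fderiv_apply {φ : Plane → ℂ} (hφ : Smooth φ) (v : Plane) :
    Smooth fun x => fderiv ℝ φ x v :=
  (hφ.fderiv_right (by simp)).clm_apply contDiff_const

lemma tsupport_fderiv_apply (φ : Plane → ℂ) (v : Plane) :
    tsupport (fun x => fderiv ℝ φ x v) ⊆ tsupport φ := by
  have h : Function.support (fun x => fderiv ℝ φ x v) ⊆ Function.support (fderiv ℝ φ) :=
    fun x hx h0 => hx (by simp only [h0, zero_apply])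
  exact (closure_mono h).trans (tsupport_fderiv_subset ℝ)

lemma lap_eq_zero {φ : Plane → ℂ} {x : Plane} (hx : x ∉ tsupport φ) : lap φ x = 0 := by
  rw [lap]
  refine Finset.sum_eq_zero fun j _ => ?_
  rw [image_eq_zero_of_notMem_tsupport (f := fderiv ℝ fun y => fderiv ℝ φ y (e j))
    fun h => hx (tsupport_fderiv_apply φ _ (tsupport_fderiv_subset ℝ h))]
  simp

lemma continuous_lap {φ : Plane → ℂ} (hφ : Smooth φ) : Continuous (lap φ) :=
  continuous_finsetSum _ fun _ _ => continuous_fderiv_apply (contDiff_fderiv_apply hφ _) _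

/-- In the cloaked region, Green's formula for the derivatives of a test function and the weak
equation combine to the equation in the sense of distributions. -/
lemma inner_of_green_of_weak {ω σa lam R k : ℝ} (hlam : 0 < lam)
    (hk2 : k ^ 2 * (σa * lam) = ω ^ 2) {U : Plane → ℂ} {G : Fin 2 → Plane → ℂ} {φ : Plane → ℂ} {L : ℂ}
    (hs : tsupport φ ⊆ Metric.ball 0 R)
    (i1 : ∀ j, IntegrableOn (fun x => U x * fderiv ℝ (fun y => fderiv ℝ φ y (e j)) x (e j)
      + G j x * fderiv ℝ φ x (e j)) 𝔹)
    (g : ∀ j, ∫ x in 𝔹, (U x * fderiv ℝ (fun y => fderiv ℝ φ y (e j)) x (e j)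
      + G j x * fderiv ℝ φ x (e j)) = 0)
    (i2 : IntegrableOn (fun x =>
      (-(∑ j : Fin 2, ∑ k : Fin 2, (sigmaR σa R x j k : ℂ) * G k x * fderiv ℝ φ x (e j))
        + (ω : ℂ) ^ 2 / (lambdaR lam R x : ℂ) * U x * φ x)) 𝔹)
    (w : ∫ x in 𝔹,
      (-(∑ j : Fin 2, ∑ k : Fin 2, (sigmaR σa R x j k : ℂ) * G k x * fderiv ℝ φ x (e j))
        + (ω : ℂ) ^ 2 / (lambdaR lam R x : ℂ) * U x * φ x) = L) :
    σa * ∫ x in 𝔹, U x * (lap φ x + (k : ℂ) ^ 2 * φ x) = L := by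
  have i01 := ((i1 0).add (i1 1)).const_mul (σa : ℂ)
  have h := integral_add i01 i2
  rw [integral_const_mul, integral_add' (i1 0) (i1 1), g, g, w, add_zero, mul_zero, zero_add] at h
  rw [← h, ← integral_const_mul]
  congr 1; funext x
  have hlam' : (lam : ℂ) ≠ 0 := mod_cast hlam.ne'
  have hk2' : (k : ℂ) ^ 2 * (σa * lam) = (ω : ℂ) ^ 2 := mod_cast hk2
  by_cases hx : x ∈ tsupport φ
  · have hx' : ‖x‖ ≤ R := (mem_ball_zero_iff.1 (hs hx)).le
    have hσ' : sigmaR σa R x = σa • (1 : Matrix (Fin 2) (Fin 2) ℝ) := by rw [sigmaR, if_pos hx']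
    have hl' : lambdaR lam R x = lam := by rw [lambdaR, if_pos hx']
    rw [hσ', hl', ← hk2']
    simp only [lap, Fin.sum_univ_two, Pi.add_apply, Matrix.smul_apply, Matrix.one_apply, smul_eq_mul]
    simp only [Fin.isValue, if_true, zero_ne_one, one_ne_zero, if_false]
    push_cast
    field_simp
    ring
  · have e1 : φ x = 0 := image_eq_zero_of_notMem_tsupport hx
    have e2 : fderiv ℝ φ x = 0 :=
      image_eq_zero_of_notMem_tsupport fun h => hx (tsupport_fderiv_subset ℝ h)
    have e3 (j : Fin 2) : fderiv ℝ (fun y => fderiv ℝ φ y (e j)) x = 0 :=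
      image_eq_zero_of_notMem_tsupport
        fun h => hx (tsupport_fderiv_apply φ _ (tsupport_fderiv_subset ℝ h))
    simp [lap_eq_zero hx, e1, e2, e3]

section

variable {ω σa lam R k : ℝ} {f : ℝ → ℂ}

lemma circle_eq_zero {φ : Plane → ℂ} (hs : tsupport φ ⊆ 𝔹) (θ : ℝ) :
    φ (polar 3 θ) = 0 := by
  refine image_eq_zero_of_notMem_tsupport fun h => ?_
  have := hs h
  rw [mem_ball_zero_iff, norm_polar_of_pos three_pos] at this
  exact lt_irrefl _ this

/-- A weak solution across the origin solves the problem without sources. -/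
lemma RegSol.sourceSol {U : Plane → ℂ} {G : Fin 2 → Plane → ℂ} (h : RegSol ω σa lam R f U G)
    (hσ : 0 < σa) (hlam : 0 < lam) (hk2 : k ^ 2 * (σa * lam) = ω ^ 2) (hR : 1 < R) (hR2 : R < 2) :
    SourceSol ω σa lam R k 0 f (funDist U) U := by
  have hU := h.memU.integrable one_le_two
  refine ⟨fun φ _ => funDist_apply hU φ, fun φ hφ => ?_, G, h.weakSol⟩
  have hψ := contDiff_ofReal_test φ
  have hs := (tsupport_ofReal_test φ).trans hφ
  have hs3 := hs.trans (Metric.ball_subset_ball (by linarith : R ≤ 3))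
  have := inner_of_green_of_weak (k := k) hlam hk2 hs
    (fun j => (integral_green_eq h.memU (h.memG j) (contDiff_fderiv_apply hψ (e j)) (e j)).1)
    (fun j => by
      rw [h.green j _ (contDiff_fderiv_apply hψ (e j))]
      have h0 := circle_eq_zero ((tsupport_fderiv_apply _ (e j)).trans hs3)
      simp only [h0, mul_zero, intervalIntegral.integral_zero])
    (integral_weak_eq hσ hlam hR h.memU h.memG hψ).1 (h.weak _ hψ hs3)
  rw [funDist_apply hU]
  simp only [ofReal_helmTest]
  change _ = (0 : ℂ)
  rw [mul_assoc]
  simp only [mul_comm _ (U _)]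
  rw [this, mul_zero]

/-- The smooth modes satisfy the Helmholtz equation. -/
lemma integral_besselJ_helm (hk : 0 < k) (m : ℤ) {φ : Plane → ℂ} (hφ : Smooth φ)
    (hs : tsupport φ ⊆ 𝔹) :
    ∫ x in 𝔹, radAng (fun r => (besselJ m.natAbs (k * r) : ℂ)) m x
      * (lap φ x + (k : ℂ) ^ 2 * φ x) = 0 := by
  set J : Plane → ℂ := radAng (fun r => (besselJ m.natAbs (k * r) : ℂ)) m with hJdef
  have hJ : Smooth J := contDiff_besselMode k m
  have hc : HasCompactSupport φ := HasCompactSupport.of_support_subset_isCompact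
    (isCompact_closedBall (0 : Plane) 3)
    ((subset_tsupport φ).trans (hs.trans Metric.ball_subset_closedBall))
  have hcs {ψ : Plane → ℂ} (hψ : tsupport ψ ⊆ tsupport φ) : HasCompactSupport ψ :=
    hc.of_isClosed_subset (isClosed_tsupport _) hψ
  have hint {a ψ : Plane → ℂ} (ha : Continuous a) (hψ : Continuous ψ)
      (h : tsupport ψ ⊆ tsupport φ) : Integrable (fun x => a x * ψ x) :=
    (ha.mul hψ).integrable_of_hasCompactSupport (hcs h).mul_left
  have hd {a : Plane → ℂ} (ha : Smooth a) (x : Plane) : DifferentiableAt ℝ a x :=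
    ha.differentiable (by simp) x
  -- integration by parts, twice
  have parts {a b : Plane → ℂ} (ha : Smooth a) (hb : Smooth b)
      (hbs : tsupport b ⊆ tsupport φ) (v : Plane) :
      ∫ x, a x * fderiv ℝ b x v = -∫ x, fderiv ℝ a x v * b x :=
    integral_mul_fderiv_eq_neg_fderiv_mul_of_integrable
      (hint (continuous_fderiv_apply ha v) hb.continuous hbs)
      (hint ha.continuous (continuous_fderiv_apply hb v) ((tsupport_fderiv_apply b v).trans hbs))
      (hint ha.continuous hb.continuous hbs) (fun x _ => hd ha x) (fun x _ => hd hb x)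
  have twice (j : Fin 2) : ∫ x, J x * fderiv ℝ (fun y => fderiv ℝ φ y (e j)) x (e j)
      = ∫ x, fderiv ℝ (fun y => fderiv ℝ J y (e j)) x (e j) * φ x := by
    rw [parts hJ (contDiff_fderiv_apply hφ _) (tsupport_fderiv_apply φ _),
      parts (contDiff_fderiv_apply hJ _) hφ subset_rfl, neg_neg]
  have hB := besselFamily_besselJ
  have hlap : ∀ᵐ x : Plane, lap J x = -(k : ℂ) ^ 2 * J x := by
    have h0 : ∀ᵐ x : Plane, x ≠ 0 := by simp [ae_iff]
    filter_upwards [h0] with x hx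
    have hr : (‖x‖ : ℂ) ≠ 0 := mod_cast norm_ne_zero_iff.2 hx
    rw [hJdef, lap_radAng (fun r hr => hB.hasDerivAt_comp hk m.natAbs hr)
      (fun r hr => hB.hasDerivAt_comp_deriv hk m.natAbs hr) m hx]
    simp only [radAng, ← natAbs_sq_cast m]
    push_cast
    field_simp
    ring
  have hts (j : Fin 2) : tsupport (fun x => fderiv ℝ (fun y => fderiv ℝ φ y (e j)) x (e j))
      ⊆ tsupport φ := (tsupport_fderiv_apply _ _).trans (tsupport_fderiv_apply φ _)
  have i1 (j : Fin 2) : Integrable fun x => J x * fderiv ℝ (fun y => fderiv ℝ φ y (e j)) x (e j) :=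
    hint hJ.continuous (continuous_fderiv_apply (contDiff_fderiv_apply hφ _) _) (hts j)
  have i2 (j : Fin 2) : Integrable fun x => fderiv ℝ (fun y => fderiv ℝ J y (e j)) x (e j) * φ x :=
    hint (continuous_fderiv_apply (contDiff_fderiv_apply hJ _) _) hφ.continuous subset_rfl
  have i3 : Integrable fun x => (k : ℂ) ^ 2 * (J x * φ x) :=
    (hint hJ.continuous hφ.continuous subset_rfl).const_mul _
  have i12 : Integrable fun x => J x * fderiv ℝ (fun y => fderiv ℝ φ y (e 0)) x (e 0)
      + J x * fderiv ℝ (fun y => fderiv ℝ φ y (e 1)) x (e 1) := (i1 0).add (i1 1)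
  have i22 : Integrable fun x => fderiv ℝ (fun y => fderiv ℝ J y (e 0)) x (e 0) * φ x
      + fderiv ℝ (fun y => fderiv ℝ J y (e 1)) x (e 1) * φ x := (i2 0).add (i2 1)
  rw [setIntegral_eq_integral_of_forall_compl_eq_zero fun x hx => by
    rw [lap_eq_zero fun h => hx (hs h), image_eq_zero_of_notMem_tsupport fun h => hx (hs h)]; simp]
  calc ∫ x, J x * (lap φ x + (k : ℂ) ^ 2 * φ x)
      = ∫ x, (J x * fderiv ℝ (fun y => fderiv ℝ φ y (e 0)) x (e 0)
          + J x * fderiv ℝ (fun y => fderiv ℝ φ y (e 1)) x (e 1)) + (k : ℂ) ^ 2 * (J x * φ x) := by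
        congr 1; funext x; rw [lap, Fin.sum_univ_two]; ring
    _ = ∫ x, (fderiv ℝ (fun y => fderiv ℝ J y (e 0)) x (e 0) * φ x
          + fderiv ℝ (fun y => fderiv ℝ J y (e 1)) x (e 1) * φ x) + (k : ℂ) ^ 2 * (J x * φ x) := by
        rw [integral_add i12 i3, integral_add (i1 0) (i1 1), twice, twice,
          ← integral_add (i2 0) (i2 1), ← integral_add i22 i3]
    _ = ∫ x : Plane, (0 : ℂ) := by
        refine integral_congr_ae ?_
        filter_upwards [hlap] with x hx
        rw [lap, Fin.sum_univ_two] at hx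
        linear_combination (φ x) * hx
    _ = 0 := integral_zero _ _

/-- The singularity of the gradient of the fundamental solution is integrable in the plane. -/
lemma integrableOn_inv_norm :
    IntegrableOn (fun x : Plane => ‖x‖⁻¹) 𝔹 := by
  refine ⟨measurable_norm.inv.aestronglyMeasurable, ?_⟩
  have hm : Measurable fun x : Plane => ‖‖x‖⁻¹‖ₑ := measurable_norm.inv.enorm
  rw [hasFiniteIntegral_iff_enorm, ← lintegral_indicator measurableSet_ball, lintegral_polar
    (hm.indicator measurableSet_ball)]
  refine (lintegral_mono_ae (g := (Ioo (0 : ℝ) 3).indicator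
    fun _ => ENNReal.ofReal (2 * π)) ?_).trans_lt ?_
  · filter_upwards [ae_restrict_mem measurableSet_Ioi] with r hr
    have hr0 : 0 < r := hr
    by_cases h3 : r < 3
    · rw [Set.indicator_of_mem (show r ∈ Ioo (0 : ℝ) 3 from ⟨hr0, h3⟩)]
      have (θ : ℝ) : ENNReal.ofReal r * (𝔹).indicator
          (fun x => ‖‖x‖⁻¹‖ₑ) (polar r θ) = 1 := by
        rw [Set.indicator_of_mem (by rw [mem_ball_zero_iff, norm_polar_of_pos hr0]; exact h3),
          norm_polar_of_pos hr0, Real.enorm_of_nonneg (inv_pos.2 hr0).le,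
          ← ENNReal.ofReal_mul hr0.le, mul_inv_cancel₀ hr0.ne', ENNReal.ofReal_one]
      simp [this]
    · have (θ : ℝ) : (𝔹).indicator
          (fun x => ‖‖x‖⁻¹‖ₑ) (polar r θ) = 0 :=
        Set.indicator_of_notMem (by rw [mem_ball_zero_iff, norm_polar_of_pos hr0]; exact h3) _
      simp [this]
  · refine (lintegral_mono' Measure.restrict_le_self le_rfl).trans_lt ?_
    rw [lintegral_indicator measurableSet_Ioo, setLIntegral_const, Real.volume_Ioo]
    exact ENNReal.mul_lt_top ENNReal.ofReal_lt_top ENNReal.ofReal_lt_top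

lemma L2Away.aestronglyMeasurable {V : Plane → ℂ} (hV : L2Away V) :
    AEStronglyMeasurable V (volume.restrict 𝔹) := by
  rw [← Measure.restrict_congr_set ball_diff_ae_eq, ← iUnion_ball_diff]
  exact aestronglyMeasurable_iUnion_iff.2 fun n => (hV _ (by positivity)).aestronglyMeasurable

lemma L2Away.integrableOn_of_bound {V : Plane → ℂ} (hV : L2Away V) {C : ℝ}
    (hC : ∀ x ∈ 𝔹, x ≠ 0 → ‖V x‖ ≤ C * ‖x‖⁻¹) :
    IntegrableOn V 𝔹 := by
  refine Integrable.mono' (integrableOn_inv_norm.const_mul C) hV.aestronglyMeasurable ?_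
  have h0 : ∀ᵐ x : Plane, x ≠ 0 := by simp [ae_iff]
  filter_upwards [ae_restrict_mem measurableSet_ball, ae_restrict_of_ae h0] with x hx h0
    using hC x hx h0

lemma integrableOn_mul_continuous {V w : Plane → ℂ} (hV : IntegrableOn V 𝔹)
    (hw : Continuous w) : IntegrableOn (fun x => V x * w x) 𝔹 := by
  obtain ⟨C, hC⟩ := (isCompact_closedBall (0 : Plane) 3).exists_bound_of_continuousOn
    hw.continuousOn
  refine Integrable.mul_bdd (c := C) hV hw.aestronglyMeasurable ?_
  filter_upwards [ae_restrict_mem measurableSet_ball] with x hx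
    using hC x (Metric.ball_subset_closedBall hx)

end

end

noncomputable section

/-! ### The fundamental solution -/

lemma exists_bound_Ioc {g : ℝ → ℂ} {L : ℂ} (hg : ContinuousOn g (Ioc 0 3))
    (hL : Tendsto g (𝓝[>] 0) (𝓝 L)) : ∃ C : ℝ, 0 ≤ C ∧ ∀ r ∈ Ioc (0 : ℝ) 3, ‖g r‖ ≤ C := by
  have h1 : ∀ᶠ r in 𝓝[>] (0 : ℝ), ‖g r‖ < ‖L‖ + 1 :=
    hL.norm.eventually (gt_mem_nhds (by linarith))
  obtain ⟨δ, hδ, h⟩ := mem_nhdsGT_iff_exists_Ioo_subset.1 h1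
  obtain ⟨C, hC⟩ := (isCompact_Icc (a := δ) (b := (3 : ℝ))).exists_bound_of_continuousOn
    (hg.mono fun r hr => ⟨lt_of_lt_of_le hδ hr.1, hr.2⟩)
  refine ⟨max (‖L‖ + 1) C, le_max_of_le_left (by positivity), fun r hr => ?_⟩
  rcases lt_or_ge r δ with h' | h'
  · exact le_max_of_le_left (le_of_lt (h ⟨hr.1, h'⟩))
  · exact le_max_of_le_right (hC r ⟨h', hr.2⟩)

lemma le_mul_inv_norm {x : Plane} {a C : ℝ} (h0 : x ≠ 0) (h : ‖x‖ * a ≤ C) : a ≤ C * ‖x‖⁻¹ := by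
  have := norm_pos_iff.2 h0
  rw [← div_eq_mul_inv, le_div_iff₀ this]
  linarith

/-- A radially singular function of order less than or equal to one is integrable. -/
lemma integrableOn_radAng_of_tendsto {h : ℝ → ℂ} {L : ℂ} (hc : ContinuousOn h (Ioc 0 3))
    (hL : Tendsto (fun r : ℝ => r * h r) (𝓝[>] 0) (𝓝 L)) (m : ℤ) :
    IntegrableOn (radAng h m) 𝔹 := by
  obtain ⟨C, -, hC⟩ := exists_bound_Ioc (Complex.continuous_ofReal.continuousOn.mul hc) hL
  refine (L2Away.of_continuousOn (continuousOn_radAng hc m)).integrableOn_of_bound (C := C)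
    fun x hx h0 => le_mul_inv_norm h0 ?_
  have := hC ‖x‖ ⟨norm_pos_iff.2 h0, (mem_ball_zero_iff.1 hx).le⟩
  rw [Pi.mul_apply, norm_mul, Complex.norm_of_nonneg (norm_nonneg _)] at this
  rw [radAng, norm_mul, norm_angular m h0, mul_one]
  exact this

variable {ω σa lam R k : ℝ}

lemma continuousOn_besselY_comp (hk : 0 < k) (n : ℕ) :
    ContinuousOn (fun r : ℝ => (besselY n (k * r) : ℂ)) (Ioi 0) :=
  fun _ hr => (besselFamily_besselY.hasDerivAt_comp hk n hr).continuousAt.continuousWithinAt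

lemma tendsto_const_mul_nhdsGT (hk : 0 < k) : Tendsto (fun r => k * r) (𝓝[>] 0) (𝓝[>] 0) := by
  refine tendsto_nhdsWithin_iff.2 ⟨?_, ?_⟩
  · simpa using tendsto_nhdsGT_of_continuous (continuous_const_mul k) 0
  · filter_upwards [self_mem_nhdsWithin] with r hr using mul_pos hk hr

lemma tendsto_mul_besselY_comp (hk : 0 < k) :
    Tendsto (fun r : ℝ => (r : ℂ) * (besselY 0 (k * r) : ℂ)) (𝓝[>] 0) (𝓝 0) := by
  have h := (tendsto_mul_besselY_zero.comp (tendsto_const_mul_nhdsGT hk)).const_mul k⁻¹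
  rw [mul_zero] at h
  refine ((Complex.continuous_ofReal.tendsto' 0 0 Complex.ofReal_zero).comp h).congr fun r => ?_
  simp only [Function.comp]
  push_cast
  have : (k : ℂ) ≠ 0 := mod_cast hk.ne'
  field_simp

lemma integrableOn_besselY_zero (hk : 0 < k) :
    IntegrableOn (radAng (fun r => (besselY 0 (k * r) : ℂ)) 0) 𝔹 :=
  integrableOn_radAng_of_tendsto ((continuousOn_besselY_comp hk 0).mono fun _ h => h.1)
    (tendsto_mul_besselY_comp hk) 0

/-- `Y₀(k r) / (2π)` is a fundamental solution of the Helmholtz operator. -/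
lemma integral_besselY_helm (hω : 0 < ω) (hσ : 0 < σa) (hlam : 0 < lam) (hk : 0 < k)
    (hk2 : k ^ 2 * (σa * lam) = ω ^ 2) (hR : 1 < R) (hR2 : R < 2)
    (hJ : ∀ n : ℕ, besselJ n (3 * ω) ≠ 0) (hdet : ∀ n : ℕ, transDet ω σa k n R ≠ 0) {φ : Plane → ℂ} (hφ : Smooth φ)
    (hs : tsupport φ ⊆ Metric.ball 0 R) :
    ∫ x in 𝔹, radAng (fun r => (besselY 0 (k * r) : ℂ)) 0 x
      * (lap φ x + (k : ℂ) ^ 2 * φ x) = 2 * π * φ 0 := by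
  obtain ⟨u, p, α, hm, -, hin⟩ := exists_modeSol hω hσ hlam hk hk2 hR hR2 0 (hJ 0) (hdet 0) 1 0
  have hin' (r : ℝ) (hr : r ≤ R) := hin r hr
  simp only [Int.natAbs_zero, one_mul] at hin'
  have hs3 := hs.trans (Metric.ball_subset_ball (by linarith : R ≤ 3))
  have hR0 : (0 : ℝ) < R := by linarith
  have hof {g : ℝ → ℝ} (hg : Continuous g) : Tendsto (fun r => (g (k * r) : ℂ)) (𝓝[>] 0)
      (𝓝 (g 0)) := by
    have := tendsto_nhdsGT_of_continuous (hg.comp (continuous_const_mul k)) 0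
    simp only [Function.comp, mul_zero] at this
    exact (Complex.continuous_ofReal.tendsto _).comp this
  have hid : Tendsto (fun r : ℝ => (r : ℂ)) (𝓝[>] 0) (𝓝 0) :=
    (Complex.continuous_ofReal.tendsto' 0 0 Complex.ofReal_zero).mono_left nhdsWithin_le_nhds
  -- the singular behaviour of the mode with one unit of charge
  have hu : Tendsto (fun r : ℝ => r * u r) (𝓝[>] 0) (𝓝 0) := by
    have h := ((hid.mul (hof (continuous_besselJ 0))).const_mul α).add (tendsto_mul_besselY_comp hk)
    rw [zero_mul, mul_zero, add_zero] at h
    refine h.congr' ?_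
    filter_upwards [Ioo_mem_nhdsGT hR0] with r hr
    rw [(hin' r hr.2.le).1]
    ring
  have hp : Tendsto p (𝓝[>] 0) (𝓝 σa) := by
    have h1 : Tendsto (fun r => (besselD besselY 0 (k * r) : ℂ)) (𝓝[>] 0) (𝓝 (1 : ℝ)) :=
      (Complex.continuous_ofReal.tendsto _).comp
        (tendsto_besselD_besselY_zero.comp (tendsto_const_mul_nhdsGT hk))
    have h := (((hof (continuous_besselD_besselJ 0)).const_mul α).add h1).const_mul (σa : ℂ)
    rw [besselD_besselJ_zero, Complex.ofReal_zero, mul_zero, zero_add, Complex.ofReal_one,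
      mul_one] at h
    refine h.congr' ?_
    filter_upwards [Ioo_mem_nhdsGT hR0] with r hr
    rw [(hin' r hr.2.le).2]
  have hU : IntegrableOn (radAng u 0) 𝔹 :=
    integrableOn_radAng_of_tendsto hm.cont_u hu 0
  have hG (j : Fin 2) : IntegrableOn (modeGrad σa R 0 u p j) 𝔹 := by
    obtain ⟨C, hC0, hC⟩ := exists_bound_Ioc hm.cont_p hp
    obtain ⟨c, hc⟩ : ∃ c : ℝ, ∀ r, 0 < sigRad σa R r ∧ (sigRad σa R r)⁻¹ ≤ c :=
      ⟨_, inv_sigRad_le hσ hR⟩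
    refine (l2Away_modeGrad hσ hR hm.cont_u hm.cont_p 0 j).integrableOn_of_bound (C := C * c)
      fun x hx h0 => le_mul_inv_norm h0 ?_
    have hx0 := norm_pos_iff.2 h0
    obtain ⟨hs0, hsc⟩ := hc ‖x‖
    have hj : |x j| ≤ ‖x‖ := by
      rw [← Real.norm_eq_abs]; exact PiLp.norm_apply_le x j
    have e1 : ‖modeGrad σa R 0 u p j x‖ = ‖p ‖x‖‖ * (sigRad σa R ‖x‖)⁻¹ * |x j| / ‖x‖ ^ 2 := by
      rw [modeGrad, norm_mul, norm_angular 0 h0]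
      simp [abs_of_pos hs0, div_eq_mul_inv]
    rw [e1]
    calc ‖x‖ * (‖p ‖x‖‖ * (sigRad σa R ‖x‖)⁻¹ * |x j| / ‖x‖ ^ 2)
        ≤ ‖x‖ * (C * c * ‖x‖ / ‖x‖ ^ 2) := by
          have := hC _ ⟨hx0, (mem_ball_zero_iff.1 hx).le⟩
          have h1 : ‖p ‖x‖‖ * (sigRad σa R ‖x‖)⁻¹ ≤ C * c :=
            mul_le_mul this hsc (inv_pos.2 hs0).le hC0
          have h2 : 0 ≤ C * c := mul_nonneg hC0 ((inv_pos.2 hs0).le.trans hsc)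
          gcongr
      _ = C * c := by field_simp
  have hcm (w : ℝ → ℂ) (hw : Continuous w) {ψ : Plane → ℂ} (hψ : Smooth ψ) :
      Tendsto (circleMean w ψ) (𝓝[>] 0) (𝓝 (circleMean w ψ 0)) :=
    ((continuous_circleMean hw hψ).tendsto 0).mono_left nhdsWithin_le_nhds
  have hcj (j : Fin 2) : Continuous fun θ => (polar 1 θ j : ℂ) :=
    continuous_iff_continuousAt.2 fun θ => (hasDerivAt_polar_coord j θ).continuousAt
  have ig (j : Fin 2) := (integrableOn_mul_continuous hU
      (continuous_fderiv_apply (contDiff_fderiv_apply hφ (e j)) (e j))).add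
    (integrableOn_mul_continuous (hG j) (contDiff_fderiv_apply hφ (e j)).continuous)
  have iw : IntegrableOn (fun x =>
      (-(∑ j : Fin 2, ∑ k : Fin 2,
          (sigmaR σa R x j k : ℂ) * modeGrad σa R 0 u p k x * fderiv ℝ φ x (e j))
        + (ω : ℂ) ^ 2 / (lambdaR lam R x : ℂ) * radAng u 0 x * φ x)) 𝔹 := by
    -- on the support of the test function the coefficients are constant
    have h := ((((integrableOn_mul_continuous (hG 0) (contDiff_fderiv_apply hφ (e 0)).continuous).add
      (integrableOn_mul_continuous (hG 1) (contDiff_fderiv_apply hφ (e 1)).continuous)).const_mul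
        (-σa : ℂ)).add
      ((integrableOn_mul_continuous hU hφ.continuous).const_mul ((ω : ℂ) ^ 2 / lam)))
    refine h.congr (ae_of_all _ fun x => ?_)
    by_cases hx : x ∈ tsupport φ
    · have hx' : ‖x‖ ≤ R := (mem_ball_zero_iff.1 (hs hx)).le
      have hσ' : sigmaR σa R x = σa • (1 : Matrix (Fin 2) (Fin 2) ℝ) := by rw [sigmaR, if_pos hx']
      have hl' : lambdaR lam R x = lam := by rw [lambdaR, if_pos hx']
      simp only [hσ', hl', Fin.sum_univ_two, Pi.add_apply, Matrix.smul_apply, Matrix.one_apply, smul_eq_mul]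
      simp only [Fin.isValue, if_true, zero_ne_one, one_ne_zero, if_false]
      push_cast
      ring
    · have e1 : φ x = 0 := image_eq_zero_of_notMem_tsupport hx
      have e2 : fderiv ℝ φ x = 0 :=
        image_eq_zero_of_notMem_tsupport fun h => hx (tsupport_fderiv_subset ℝ h)
      simp [e1, e2]
  have w := hm.weak hσ hlam hR hφ hs3 iw (L := σa * (2 * π * φ 0)) (by
    have h := hp.mul (hcm _ (continuous_expI 0) hφ)
    have e0 : circleMean (fun θ => exp ((0 : ℤ) * θ * I)) φ 0
        = 2 * π * φ 0 := by
      have h0 (θ : ℝ) : polar 0 θ = 0 := by ext i; fin_cases i <;> simp [polar]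
      simp [circleMean, h0]
    rw [e0] at h
    exact h)
  have g (j : Fin 2) := hm.green hσ hR j (contDiff_fderiv_apply hφ (e j)) (ig j) (by
    have h := hu.mul (hcm (fun θ => exp ((0 : ℤ) * θ * I) * polar 1 θ j)
      ((continuous_expI 0).mul (hcj j)) (contDiff_fderiv_apply hφ (e j)))
    rwa [zero_mul] at h)
  have hfin := inner_of_green_of_weak hlam hk2 hs ig (fun j => by
    rw [g j, circleMean]
    simp only [circle_eq_zero ((tsupport_fderiv_apply φ (e j)).trans hs3), mul_zero,
      intervalIntegral.integral_zero]) iw w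
  have hσ' : (σa : ℂ) ≠ 0 := mod_cast hσ.ne'
  have hUi := mul_left_cancel₀ hσ' hfin
  have hJi := integral_besselJ_helm hk 0 hφ hs3
  have hφ' : Continuous fun x => lap φ x + (k : ℂ) ^ 2 * φ x :=
    (continuous_lap hφ).add (continuous_const.mul hφ.continuous)
  have iJ := integrableOn_mul_continuous
    ((contDiff_besselMode (n := ⊤) k 0).continuous.continuousOn.integrableOn_compact
      (isCompact_closedBall (0 : Plane) 3) |>.mono_set Metric.ball_subset_closedBall) hφ'
  have := integral_sub (integrableOn_mul_continuous hU hφ') (iJ.const_mul α)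
  rw [integral_const_mul, hJi, hUi, mul_zero, sub_zero] at this
  rw [← this]
  congr 1; funext x
  by_cases hx : x ∈ tsupport φ
  · have hx' : ‖x‖ ≤ R := (mem_ball_zero_iff.1 (hs hx)).le
    simp only [radAng, (hin' _ hx').1, Int.natAbs_zero]
    ring
  · simp [lap_eq_zero hx, image_eq_zero_of_notMem_tsupport hx]

end

noncomputable section

/-! ### Derivatives of the fundamental solution -/

/-- The mode `C_{|m|}(k r) e^{imθ}`. -/
def besselMode (C : ℕ → ℝ → ℝ) (k : ℝ) (m : ℤ) : Plane → ℂ :=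
  radAng (fun r => (C m.natAbs (k * r) : ℂ)) m

/-- The span of the regular and the singular modes, which is stable under differentiation. -/
def modeSpan (k : ℝ) : Submodule ℂ (Plane → ℂ) :=
  Submodule.span ℂ (Set.range (besselMode besselJ k) ∪ Set.range (besselMode besselY k))

/-- The recurrence `C_a' - a C_a / x = ∓ C_{a+1}` for all integers `a`, up to a sign due to `natAbs`. -/
lemma BesselFamily.exists_ladder {C : ℕ → ℝ → ℝ} (hC : BesselFamily C) {k : ℝ} (hk : 0 < k)
    (a : ℤ) : ∃ c : ℂ, ∀ r > 0, deriv (fun r : ℝ => (C a.natAbs (k * r) : ℂ)) r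
      - a * C a.natAbs (k * r) / r = c * C (a + 1).natAbs (k * r) := by
  rcases a with n | n
  · refine ⟨-k, fun r hr => ?_⟩
    have hr' : (r : ℂ) ≠ 0 := mod_cast hr.ne'
    have e1 : (Int.ofNat n + 1).natAbs = n + 1 := rfl
    rw [(hC.hasDerivAt_comp hk _ hr).deriv, e1]
    simp only [besselD, Int.ofNat_eq_natCast, Int.natAbs_natCast]
    push_cast
    field_simp
    ring
  · refine ⟨k, fun r hr => ?_⟩
    have hr' : (r : ℂ) ≠ 0 := mod_cast hr.ne'
    have e1 : (Int.negSucc n + 1).natAbs = n := by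
      rw [Int.negSucc_eq]; simp
    have e2 : (Int.negSucc n).natAbs = n + 1 := rfl
    have h := (hC.hasDerivAt_up n _ (mul_pos hk hr)).unique
      (hC.hasDerivAt_down (n + 1) _ (mul_pos hk hr))
    have h' : (k * r) * C n (k * r) - (n + 1) * C (n + 1) (k * r)
        = besselD C (n + 1) (k * r) := by
      have := mul_pos hk hr
      rw [besselD]
      field_simp at h
      push_cast at h ⊢
      linarith
    rw [(hC.hasDerivAt_comp hk _ hr).deriv, e1, e2, ← h', Int.cast_negSucc]
    push_cast
    field_simp
    ring

lemma BesselFamily.besselMode_fderiv {C : ℕ → ℝ → ℝ} (hC : BesselFamily C) {k : ℝ} (hk : 0 < k)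
    (m : ℤ) : (∀ x ≠ 0, DifferentiableAt ℝ (besselMode C k m) x) ∧
      ∀ j, ∃ a b : ℂ, ∀ x ≠ 0, fderiv ℝ (besselMode C k m) x (e j)
        = a * besselMode C k (m + 1) x + b * besselMode C k (m - 1) x := by
  have hd (x : Plane) (hx : x ≠ 0) :=
    (hC.hasDerivAt_comp hk m.natAbs (norm_pos_iff.2 hx)).differentiableAt
  refine ⟨fun x hx => differentiableAt_radAng m hx (hd x hx), ?_⟩
  obtain ⟨c, hc⟩ := hC.exists_ladder hk m
  obtain ⟨c', hc'⟩ := hC.exists_ladder hk (-m)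
  rw [Int.natAbs_neg, show -m + 1 = -(m - 1) by ring, Int.natAbs_neg] at hc'
  have h1 (x : Plane) (hx : x ≠ 0) : fderiv ℝ (besselMode C k m) x (e 0)
      + I * fderiv ℝ (besselMode C k m) x (e 1) = c * besselMode C k (m + 1) x := by
    rw [besselMode, fderiv_radAng_add m hx (hd x hx), besselMode, radAng, radAng,
      hc _ (norm_pos_iff.2 hx)]
    ring
  have h2 (x : Plane) (hx : x ≠ 0) : fderiv ℝ (besselMode C k m) x (e 0)
      - I * fderiv ℝ (besselMode C k m) x (e 1) = c' * besselMode C k (m - 1) x := by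
    rw [besselMode, fderiv_radAng_sub m hx (hd x hx), besselMode, radAng, radAng, ← mul_assoc,
      ← hc' _ (norm_pos_iff.2 hx)]
    push_cast
    ring
  refine Fin.forall_fin_two.2 ⟨⟨c / 2, c' / 2, fun x hx => ?_⟩,
    ⟨-I * c / 2, I * c' / 2, fun x hx => ?_⟩⟩
  · linear_combination (h1 x hx + h2 x hx) / 2
  · linear_combination (-I) * (h1 x hx - h2 x hx) / 2
      + fderiv ℝ (besselMode C k m) x (e 1) * Complex.I_mul_I

/-- Partial derivatives of modes are combinations of modes, by the recurrences for Bessel functions. -/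
lemma modeSpan_fderiv {k : ℝ} (hk : 0 < k) {τ : Plane → ℂ} (hτ : τ ∈ modeSpan k) :
    (∀ x ≠ 0, DifferentiableAt ℝ τ x) ∧
      ∀ j, ∃ τ' ∈ modeSpan k, ∀ x ≠ 0, fderiv ℝ τ x (e j) = τ' x := by
  induction hτ using Submodule.span_induction with
  | mem τ hτ =>
    obtain ⟨C, m, hC, rfl, hmem⟩ : ∃ (C : ℕ → ℝ → ℝ) (m : ℤ), BesselFamily C ∧
        besselMode C k m = τ ∧ ∀ n, besselMode C k n ∈ modeSpan k := by
      rcases hτ with ⟨m, rfl⟩ | ⟨m, rfl⟩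
      · exact ⟨_, m, besselFamily_besselJ, rfl, fun n => Submodule.subset_span (.inl ⟨n, rfl⟩)⟩
      · exact ⟨_, m, besselFamily_besselY, rfl, fun n => Submodule.subset_span (.inr ⟨n, rfl⟩)⟩
    obtain ⟨h1, h2⟩ := hC.besselMode_fderiv hk m
    refine ⟨h1, fun j => ?_⟩
    obtain ⟨a, b, h⟩ := h2 j
    exact ⟨a • besselMode C k (m + 1) + b • besselMode C k (m - 1),
      add_mem (Submodule.smul_mem _ _ (hmem _)) (Submodule.smul_mem _ _ (hmem _)), h⟩
  | zero => exact ⟨fun x _ => differentiableAt_const _, fun j => ⟨0, zero_mem _, fun x _ => by simp⟩⟩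
  | add τ₁ τ₂ _ _ h₁ h₂ =>
    refine ⟨fun x hx => (h₁.1 x hx).add (h₂.1 x hx), fun j => ?_⟩
    obtain ⟨τ₁', m₁, e₁⟩ := h₁.2 j
    obtain ⟨τ₂', m₂, e₂⟩ := h₂.2 j
    refine ⟨τ₁' + τ₂', add_mem m₁ m₂, fun x hx => ?_⟩
    rw [fderiv_add (h₁.1 x hx) (h₂.1 x hx), Pi.add_apply, ← e₁ x hx, ← e₂ x hx]
    rfl
  | smul c τ _ h =>
    refine ⟨fun x hx => (h.1 x hx).const_smul c, fun j => ?_⟩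
    obtain ⟨τ', m, h'⟩ := h.2 j
    refine ⟨c • τ', Submodule.smul_mem _ _ m, fun x hx => ?_⟩
    rw [fderiv_const_smul (h.1 x hx), Pi.smul_apply, ← h' x hx]
    rfl

lemma modeSpan_l2Away {k : ℝ} (hk : 0 < k) {τ : Plane → ℂ} (hτ : τ ∈ modeSpan k) : L2Away τ :=
  .of_continuousOn fun x hx =>
    ((modeSpan_fderiv hk hτ).1 x hx.2).continuousAt.continuousWithinAt

lemma lineDeriv_comm (φ : 𝓓(Omega, ℝ)) (v w : Plane) :
    (∂_{v} (∂_{w} φ) : 𝓓(Omega, ℝ)) = ∂_{w} (∂_{v} φ) := by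
  have h (v : Plane) : (⇑(∂_{v} φ : 𝓓(Omega, ℝ)) : Plane → ℝ) = fun y => fderiv ℝ φ y v :=
    funext fun y => test_lineDeriv_apply φ v y
  ext x
  have hd : DifferentiableAt ℝ (fderiv ℝ φ) x :=
    ((φ.contDiff.of_le (m := 2) (WithTop.coe_le_coe.2 (le_top : (2 : ℕ∞) ≤ ⊤))).fderiv_right (m := 1) le_rfl).differentiable one_ne_zero x
  have hs : IsSymmSndFDerivAt ℝ φ x := 
    φ.contDiff.contDiffAt.isSymmSndFDerivAt (by
      rw [minSmoothness_of_isRCLikeNormedField]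
      exact WithTop.coe_le_coe.2 (le_top : (2 : ℕ∞) ≤ ⊤))
  rw [test_lineDeriv_apply, test_lineDeriv_apply, h, h]
  rw [fderiv_clm_apply hd (differentiableAt_const _), fderiv_clm_apply hd (differentiableAt_const _)]
  simpa using hs v w

/-- The Helmholtz operator commutes with directional derivatives. -/
lemma helmTest_lineDeriv (k : ℝ) (φ : 𝓓(Omega, ℝ)) (v : Plane) :
    helmTest k (∂_{v} φ) = ∂_{v} (helmTest k φ) := by
  rw [helmTest, helmTest, LineDeriv.lineDerivOp_add, LineDeriv.lineDerivOp_smul,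
    LineDeriv.lineDerivOp_sum]
  congr 1
  refine Finset.sum_congr rfl fun j _ => ?_
  rw [lineDeriv_comm φ, lineDeriv_comm (∂_{e j} φ)]

lemma lineDeriv_dist_apply (T : 𝓓'(Omega, ℂ)) (v : Plane) (φ : 𝓓(Omega, ℝ)) :
    (∂_{v} T : 𝓓'(Omega, ℂ)) φ = -T (∂_{v} φ) := rfl

lemma tsupport_lineDeriv (φ : 𝓓(Omega, ℝ)) (v : Plane) :
    tsupport (∂_{v} φ : 𝓓(Omega, ℝ)) ⊆ tsupport φ := by
  have h : Function.support (∂_{v} φ : 𝓓(Omega, ℝ)) ⊆ Function.support (fderiv ℝ φ) :=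
    fun x hx h0 => hx (by rw [test_lineDeriv_apply, h0, zero_apply])
  exact (closure_mono h).trans (tsupport_fderiv_subset ℝ)

/-- The distribution `T` solves the Helmholtz equation in the disc of radius `R` with the source
`s`, and it is a combination of modes off the origin. -/
structure PointSol (R k : ℝ) (s T : 𝓓'(Omega, ℂ)) (τ : Plane → ℂ) : Prop where
  mem : τ ∈ modeSpan k
  eq_fun : ∀ φ : 𝓓(Omega, ℝ), (0 : Plane) ∉ tsupport φ →
    T φ = ∫ x in 𝔹, (φ x : ℂ) * τ x
  inner : ∀ φ : 𝓓(Omega, ℝ), tsupport φ ⊆ Metric.ball (0 : Plane) R → T (helmTest k φ) = s φ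

lemma PointSol.lineDeriv {R k : ℝ} (hk : 0 < k) {s T : 𝓓'(Omega, ℂ)} {τ : Plane → ℂ}
    (h : PointSol R k s T τ) (j : Fin 2) :
    ∃ τ', PointSol R k (∂_{e j} s) (∂_{e j} T) τ' := by
  obtain ⟨hd, h'⟩ := modeSpan_fderiv hk h.mem
  obtain ⟨τ', hmem, hτ'⟩ := h' j
  refine ⟨τ', hmem, fun φ h0 => ?_, fun φ hφ => ?_⟩
  · have h0' : (0 : Plane) ∉ tsupport (∂_{e j} φ : 𝓓(Omega, ℝ)) :=
      fun h => h0 (tsupport_lineDeriv φ _ h)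
    rw [lineDeriv_dist_apply, h.eq_fun _ h0']
    have hex {ψ : 𝓓(Omega, ℝ)} (V : Plane → ℂ) (x : Plane) (hx : x ∉ 𝔹) :
        (ψ x : ℂ) * V x = 0 := by
      rw [image_eq_zero_of_notMem_tsupport fun h => hx (ψ.tsupport_subset h)]; simp
    have hint {ψ : 𝓓(Omega, ℝ)} (hψ : (0 : Plane) ∉ tsupport ψ) {V : Plane → ℂ} (hV : L2Away V) :
        Integrable fun x => (ψ x : ℂ) * V x :=
      (integrableOn_iff_integrable_of_support_subset fun x hx => by
        by_contra hc; exact hx (hex V x hc)).1 (integrableOn_test_mul hV ψ hψ)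
    rw [setIntegral_eq_integral_of_forall_compl_eq_zero (hex τ),
      setIntegral_eq_integral_of_forall_compl_eq_zero (hex τ')]
    have h0s : (0 : Plane) ∉ tsupport fun x => (φ x : ℂ) := fun h => h0 (tsupport_ofReal_test φ h)
    have hae : ∀ᵐ x : Plane, x ≠ 0 := by simp [ae_iff]
    have i1 : Integrable fun x => fderiv ℝ τ x (e j) * (φ x : ℂ) := by
      refine (hint h0 (modeSpan_l2Away hk hmem)).congr ?_
      filter_upwards [hae] with x hx
      rw [hτ' x hx, mul_comm]
    have i2 : Integrable fun x => τ x * fderiv ℝ (fun x => (φ x : ℂ)) x (e j) := by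
      refine (hint h0' (modeSpan_l2Away hk h.mem)).congr (ae_of_all _ fun x => ?_)
      beta_reduce
      rw [fderiv_ofReal_test, test_lineDeriv_apply, mul_comm]
    have i3 : Integrable fun x => τ x * (φ x : ℂ) := by
      simpa only [mul_comm] using hint h0 (modeSpan_l2Away hk h.mem)
    have := integral_mul_fderiv_eq_neg_fderiv_mul_of_integrable i1 i2 i3
      (fun x hx => hd x fun h => h0s (h ▸ hx))
      fun x _ => (contDiff_ofReal_test φ).differentiable (by simp) x
    rw [← neg_eq_iff_eq_neg] at this
    calc -∫ x, ((∂_{e j} φ : 𝓓(Omega, ℝ)) x : ℂ) * τ x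
        = -∫ x, τ x * fderiv ℝ (fun x => (φ x : ℂ)) x (e j) := by
          congr 2; funext x
          rw [fderiv_ofReal_test, test_lineDeriv_apply, mul_comm]
      _ = ∫ x, fderiv ℝ τ x (e j) * (φ x : ℂ) := this
      _ = ∫ x, (φ x : ℂ) * τ' x := by
          refine integral_congr_ae ?_
          filter_upwards [hae] with x hx
          rw [hτ' x hx, mul_comm]
  · rw [lineDeriv_dist_apply, lineDeriv_dist_apply, ← helmTest_lineDeriv,
      h.inner _ ((tsupport_lineDeriv φ _).trans hφ)]

lemma PointSol.partialDeriv {R k : ℝ} (hk : 0 < k) {s T : 𝓓'(Omega, ℂ)} {τ : Plane → ℂ}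
    (h : PointSol R k s T τ) (α : ℕ × ℕ) :
    ∃ τ', PointSol R k (partialDeriv α s) (partialDeriv α T) τ' := by
  have key (j : Fin 2) (n : ℕ) {s T : 𝓓'(Omega, ℂ)} (h : ∃ τ, PointSol R k s T τ) :
      ∃ τ', PointSol R k ((fun S : 𝓓'(Omega, ℂ) => ∂_{e j} S)^[n] s)
        ((fun S : 𝓓'(Omega, ℂ) => ∂_{e j} S)^[n] T) τ' := by
    induction n with
    | zero => exact h
    | succ n ih =>
      obtain ⟨τ, hτ⟩ := ih
      rw [Function.iterate_succ_apply', Function.iterate_succ_apply']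
      exact hτ.lineDeriv hk j
  exact key 0 α.1 (key 1 α.2 ⟨τ, h⟩)

end

noncomputable section

/-! ### Existence -/

variable {ω σa lam R k : ℝ} {f : ℝ → ℂ}

lemma integrableOn_besselMode_besselJ (k : ℝ) (m : ℤ) :
    IntegrableOn (besselMode besselJ k m) 𝔹 :=
  ((contDiff_besselMode (n := ⊤) k m).continuous.continuousOn.integrableOn_compact
    (isCompact_closedBall (0 : Plane) 3)).mono_set Metric.ball_subset_closedBall

lemma integrableOn_besselMode_besselY (hk : 0 < k) :
    IntegrableOn (besselMode besselY k 0) 𝔹 :=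
  integrableOn_besselY_zero hk

lemma helmTest_eq_zero {φ : 𝓓(Omega, ℝ)} {x : Plane} (hx : x ∉ tsupport φ) :
    (helmTest k φ x : ℂ) = 0 := by
  have hx' : x ∉ tsupport fun x => (φ x : ℂ) := fun h => hx (tsupport_ofReal_test φ h)
  rw [ofReal_helmTest, lap_eq_zero hx', image_eq_zero_of_notMem_tsupport hx]
  simp

lemma funDist_besselJ_helmTest (hk : 0 < k) (m : ℤ) (φ : 𝓓(Omega, ℝ)) :
    funDist (besselMode besselJ k m) (helmTest k φ) = 0 := by
  rw [funDist_apply (integrableOn_besselMode_besselJ k m)]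
  simp only [ofReal_helmTest, mul_comm _ (besselMode besselJ k m _)]
  exact integral_besselJ_helm hk m (contDiff_ofReal_test φ)
    ((tsupport_ofReal_test φ).trans φ.tsupport_subset)

/-- `W` continues the singularity `τ` at the origin to a solution in the whole disc with vanishing
boundary values; the distribution `v` is the regular part `W - τ`. -/
structure Continuation (ω σa lam R k : ℝ) (τ : Plane → ℂ) (v : 𝓓'(Omega, ℂ)) (W : Plane → ℂ) :
    Prop where
  eq_fun : ∀ φ : 𝓓(Omega, ℝ), (0 : Plane) ∉ tsupport φ →
    v φ = (∫ x in 𝔹, (φ x : ℂ) * W x)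
      - ∫ x in 𝔹, (φ x : ℂ) * τ x
  inner : ∀ φ : 𝓓(Omega, ℝ), tsupport φ ⊆ Metric.ball (0 : Plane) R → v (helmTest k φ) = 0
  outer : ∃ G, WeakSol ω σa lam R 0 W G

lemma Continuation.zero : Continuation ω σa lam R k 0 0 0 where
  eq_fun φ _ := by simp
  inner φ _ := rfl
  outer := ⟨0, .zero⟩

lemma Continuation.add_smul (hσ : 0 < σa) (hlam : 0 < lam) (hR : 1 < R) {τ₁ τ₂ W₁ W₂ : Plane → ℂ}
    {v₁ v₂ : 𝓓'(Omega, ℂ)} (h₁ : Continuation ω σa lam R k τ₁ v₁ W₁)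
    (h₂ : Continuation ω σa lam R k τ₂ v₂ W₂) (hτ₁ : L2Away τ₁) (hτ₂ : L2Away τ₂) (c : ℂ) :
    Continuation ω σa lam R k (τ₁ + c • τ₂) (v₁ + c • v₂) (fun x => W₁ x + c * W₂ x) := by
  obtain ⟨G₁, hG₁⟩ := h₁.outer
  obtain ⟨G₂, hG₂⟩ := h₂.outer
  have hint {V₁ V₂ : Plane → ℂ} (hV₁ : L2Away V₁) (hV₂ : L2Away V₂) (φ : 𝓓(Omega, ℝ))
      (hφ : (0 : Plane) ∉ tsupport φ) :
      ∫ x in 𝔹, (φ x : ℂ) * (V₁ x + c * V₂ x)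
        = (∫ x in 𝔹, (φ x : ℂ) * V₁ x)
          + c * ∫ x in 𝔹, (φ x : ℂ) * V₂ x := by
    rw [← integral_const_mul, ← integral_add (integrableOn_test_mul hV₁ φ hφ)
        ((integrableOn_test_mul hV₂ φ hφ).const_mul c)]
    congr 1; funext x; ring
  refine ⟨fun φ hφ => ?_, fun φ hφ => ?_, ⟨_, hG₁.add_smul hσ hlam hR hG₂ c⟩⟩
  · change v₁ φ + c * v₂ φ = _ - ∫ x in 𝔹, (φ x : ℂ) * (τ₁ x + c * τ₂ x)
    rw [hint hG₁.memU hG₂.memU φ hφ, hint hτ₁ hτ₂ φ hφ, h₁.eq_fun φ hφ, h₂.eq_fun φ hφ]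
    ring
  · change v₁ _ + c * v₂ _ = 0
    rw [h₁.inner φ hφ, h₂.inner φ hφ, mul_zero, add_zero]

lemma continuation_besselJ (hk : 0 < k) (m : ℤ) :
    Continuation ω σa lam R k (besselMode besselJ k m) (-funDist (besselMode besselJ k m)) 0 where
  eq_fun φ _ := by
    change -funDist _ φ = _
    simp [funDist_apply (integrableOn_besselMode_besselJ k m)]
  inner φ _ := by
    change -funDist _ _ = (0 : ℂ)
    rw [funDist_besselJ_helmTest hk, neg_zero]
  outer := ⟨0, .zero⟩

variable (hω : 0 < ω) (hσ : 0 < σa) (hlam : 0 < lam) (hk : 0 < k)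
  (hk2 : k ^ 2 * (σa * lam) = ω ^ 2) (hR : 1 < R) (hR2 : R < 2)
  (hJ : ∀ n : ℕ, besselJ n (3 * ω) ≠ 0) (hdet : ∀ n : ℕ, transDet ω σa k n R ≠ 0)
include hω hσ hlam hk hk2 hR hR2 hJ hdet

/-- The fundamental solution is a solution for the Dirac mass. -/
lemma pointSol_dirac :
    PointSol R k dirac ((2 * π : ℂ)⁻¹ • funDist (besselMode besselY k 0))
      ((2 * π : ℂ)⁻¹ • besselMode besselY k 0) where
  mem := Submodule.smul_mem _ _ (Submodule.subset_span (.inr ⟨0, rfl⟩))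
  eq_fun φ _ := by
    change _ * funDist (besselMode besselY k 0) φ = _
    rw [funDist_apply (integrableOn_besselMode_besselY hk), ← integral_const_mul]
    congr 1; funext x
    simp only [Pi.smul_apply, smul_eq_mul]
    ring
  inner φ hφ := by
    change _ * funDist (besselMode besselY k 0) _ = ((φ 0 : ℝ) : ℂ)
    have := integral_besselY_helm hω hσ hlam hk hk2 hR hR2 hJ hdet (contDiff_ofReal_test φ)
      ((tsupport_ofReal_test φ).trans hφ)
    rw [funDist_apply (integrableOn_besselMode_besselY hk)]
    simp only [ofReal_helmTest, mul_comm _ (besselMode besselY k 0 _)]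
    refine (congrArg (_ * ·) this).trans ?_
    have : (2 * π : ℂ) ≠ 0 := mod_cast Real.two_pi_pos.ne'
    field_simp

/-- A singular mode of the cloaked region extends to a mode of the disc that vanishes at `r = 3`; their
difference in the cloaked region is a regular mode. -/
lemma exists_continuation_besselY (m : ℤ) :
    ∃ v W, Continuation ω σa lam R k (besselMode besselY k m) v W := by
  obtain ⟨u, p, α, hm, h3, hin⟩ := exists_modeSol hω hσ hlam hk hk2 hR hR2 m (hJ _) (hdet _) 1 0
  set d : ℝ → ℂ := fun r => u r - besselY m.natAbs (k * r) with hd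
  have hdin (r : ℝ) (hr : r ≤ R) : d r = α * besselJ m.natAbs (k * r) := by
    rw [hd]; beta_reduce; rw [(hin r hr).1]; ring
  have hcd : ContinuousOn d (Ioc 0 3) :=
    hm.cont_u.sub ((continuousOn_besselY_comp hk m.natAbs).mono fun _ h => h.1)
  -- the singular parts of the mode and of the Neumann function agree
  have hi : IntegrableOn (radAng d m) 𝔹 := by
    refine integrableOn_radAng_of_tendsto (L := 0) hcd ?_ m
    have hg : Continuous fun r : ℝ => (r : ℂ) * (α * (besselJ m.natAbs (k * r) : ℂ)) := by
      have := continuous_besselJ m.natAbs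
      fun_prop
    have := (hg.tendsto' 0 0 (by simp)).mono_left (nhdsWithin_le_nhds (s := Ioi 0))
    refine this.congr' ?_
    filter_upwards [Ioo_mem_nhdsGT (show (0 : ℝ) < R by linarith)] with r hr
    rw [hdin r hr.2.le]
  have hY : L2Away (besselMode besselY k m) :=
    modeSpan_l2Away hk (Submodule.subset_span (.inr ⟨m, rfl⟩))
  refine ⟨funDist (radAng d m), radAng u m, fun φ hφ => ?_, fun φ hφ => ?_,
    modeGrad σa R m u p, ?_⟩
  · rw [funDist_apply hi, ← integral_sub (integrableOn_test_mul (hm.l2Away_u m) φ hφ)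
      (integrableOn_test_mul hY φ hφ)]
    congr 1; funext x
    simp only [radAng, besselMode, hd]
    ring
  · have h0 := funDist_besselJ_helmTest hk m φ
    rw [funDist_apply (integrableOn_besselMode_besselJ k m)] at h0
    rw [funDist_apply hi, ← mul_zero α, ← h0, ← integral_const_mul]
    congr 1; funext x
    by_cases hx : x ∈ tsupport φ
    · simp only [radAng, besselMode, hdin _ (mem_ball_zero_iff.1 (hφ hx)).le]
      ring
    · simp [helmTest_eq_zero hx]
  · convert hm.weakSol hσ hlam hR using 1
    funext θ
    simp [h3]

/-- Finite combinations of modes are continued term by term. -/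
lemma exists_continuation
    {τ : Plane → ℂ} (hτ : τ ∈ modeSpan k) : ∃ v W, Continuation ω σa lam R k τ v W := by
  induction hτ using Submodule.span_induction with
  | mem τ hτ =>
    rcases hτ with ⟨m, rfl⟩ | ⟨m, rfl⟩
    · exact ⟨_, _, continuation_besselJ hk m⟩
    · exact exists_continuation_besselY hω hσ hlam hk hk2 hR hR2 hJ hdet m
  | zero => exact ⟨_, _, .zero⟩
  | add τ₁ τ₂ hτ₁ hτ₂ h₁ h₂ =>
    obtain ⟨v₁, W₁, h₁⟩ := h₁
    obtain ⟨v₂, W₂, h₂⟩ := h₂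
    have := h₁.add_smul hσ hlam hR h₂ (modeSpan_l2Away hk hτ₁) (modeSpan_l2Away hk hτ₂) 1
    rw [one_smul] at this
    exact ⟨_, _, this⟩
  | smul c τ hτ h =>
    obtain ⟨v, W, h⟩ := h
    have := Continuation.zero.add_smul hσ hlam hR h (fun _ _ => MemLp.zero)
      (modeSpan_l2Away hk hτ) c
    rw [zero_add] at this
    exact ⟨_, _, this⟩

/-- A point source with a single derivative. -/
lemma exists_sourceSol_partialDeriv
    (α : ℕ × ℕ) : ∃ u U, SourceSol ω σa lam R k ((lam * σa : ℂ) • partialDeriv α dirac) 0 u U := by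
  obtain ⟨T, τ, hτ⟩ : ∃ T τ, PointSol R k (partialDeriv α dirac) T τ :=
    ⟨_, (pointSol_dirac hω hσ hlam hk hk2 hR hR2 hJ hdet).partialDeriv hk α⟩
  obtain ⟨v, W, hW⟩ := exists_continuation hω hσ hlam hk hk2 hR hR2 hJ hdet hτ.mem
  refine ⟨T + v, W, fun φ hφ => ?_, fun φ hφ => ?_, hW.outer⟩
  · exact (congrArg₂ (· + ·) (hτ.eq_fun φ hφ) (hW.eq_fun φ hφ)).trans (add_sub_cancel _ _)
  · exact congrArg (_ * ·) ((congrArg₂ (· + ·) (hτ.inner φ hφ) (hW.inner φ hφ)).trans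
      (add_zero _))

/-- Existence: the solution for the boundary data without sources, plus the continued derivatives of
the fundamental solution. -/
theorem exists_isSolution
    (N : ℕ) (q : ℕ × ℕ → ℂ) (hf : MemHHalf f) :
    ∃ u U, IsSolution ω σa lam R N q f u U := by
  obtain ⟨U₀, G₀, h₀⟩ := exists_regSol hω hσ hlam hk hk2 hR hR2 hJ hdet hf
  have h₀' := h₀.sourceSol hσ hlam hk2 hR hR2
  choose u U h using exists_sourceSol_partialDeriv hω hσ hlam hk hk2 hR hR2 hJ hdet
  have hsum (S : Finset (ℕ × ℕ)) : ∃ v V, SourceSol ω σa lam R k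
      (∑ α ∈ S, q α • (lam * σa : ℂ) • partialDeriv α dirac) f v V := by
    induction S using Finset.induction_on with
    | empty => exact ⟨_, _, h₀'⟩
    | insert α S hα ih =>
      obtain ⟨v, V, hv⟩ := ih
      rw [Finset.sum_insert hα, add_comm]
      exact ⟨_, _, hv.add_smul hσ hlam hR (h α) (q α)⟩
  obtain ⟨v, V, hv⟩ := hsum
    ((Finset.range (N + 1) ×ˢ Finset.range (N + 1)).filter fun α => α.1 + α.2 ≤ N)
  have hs : source σa lam N q = ∑ α ∈ (Finset.range (N + 1) ×ˢ Finset.range (N + 1)).filter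
      fun α => α.1 + α.2 ≤ N, q α • (lam * σa : ℂ) • partialDeriv α dirac := by
    have e1 : (((kappa σa lam : ℝ) : ℂ) ^ 2)⁻¹ = lam * σa := by
      rw [kappa, Complex.ofReal_inv, inv_pow, inv_inv, ← Complex.ofReal_pow,
        Real.sq_sqrt (mul_pos hσ hlam).le]
      push_cast
      ring
    rw [source, e1, Finset.smul_sum]
    exact Finset.sum_congr rfl fun α _ => smul_comm _ _ _
  rw [← hs] at hv
  exact ⟨v, V, hv.isSolution hk2⟩

end

noncomputable section

/-! ### Uniqueness -/

lemma ae_Ioo_of_forall {P : ℝ → Prop}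
    (h : ∀ ε : ℝ, 0 < ε → ∀ᵐ r ∂(volume.restrict (Ioo ε 3)), P r) :
    ∀ᵐ r, r ∈ Ioo (0 : ℝ) 3 → P r := by
  have h1 : ∀ᵐ r, ∀ n : ℕ, r ∈ Ioo (1 / ((n : ℝ) + 1)) 3 → P r :=
    ae_all_iff.2 fun n => (ae_restrict_iff' measurableSet_Ioo).1 (h _ (by positivity))
  filter_upwards [h1] with r hr h0
  obtain ⟨n, hn⟩ := exists_nat_one_div_lt h0.1
  exact hr n ⟨hn, h0.2⟩

lemma L2Away.sq_integrable {V : Plane → ℂ} (hV : L2Away V) {ε : ℝ} (hε : 0 < ε) :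
    IntegrableOn (fun x => ‖V x‖ ^ 2) {x | ‖x‖ ∈ Ioo ε 3} := by
  have h := ((memLp_two_iff_integrable_sq_norm (hV ε hε).1).1 (hV ε hε))
  rw [ball_diff_ball_eq] at h
  exact IntegrableOn.mono_set h fun x hx => Set.Ioo_subset_Ico_self hx

lemma L2Away.ae_memLp_circle {V : Plane → ℂ} (hV : L2Away V) :
    ∀ᵐ r, r ∈ Ioo (0 : ℝ) 3 →
      MemLp (fun θ => V (polar r θ)) 2 dθ := by
  refine ae_Ioo_of_forall fun ε hε => ?_
  have hI : IntegrableOn V {x | ‖x‖ ∈ Ioo ε 3} := by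
    have := hV.integrableOn hε
    rw [ball_diff_ball_eq] at this
    exact this.mono_set fun x hx => Set.Ioo_subset_Ico_self hx
  have h1 := (integrable_polar measurableSet_Ioo (Ioo_subset_Ioi' hε) hI).prod_right_ae
  have h2 := (integrable_polar measurableSet_Ioo (Ioo_subset_Ioi' hε)
    (hV.sq_integrable hε)).prod_right_ae
  filter_upwards [h1, h2, ae_restrict_mem measurableSet_Ioo] with r h1 h2 hr
  have hr0 : r ≠ 0 := (hε.trans hr.1).ne'
  have h1' := (integrable_smul_iff hr0 _).1 h1
  have h2' := (integrable_smul_iff hr0 _).1 h2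
  exact (memLp_two_iff_integrable_sq_norm h1'.1).2 h2'

/-- A function is determined by the Fourier coefficients on the circles. -/
lemma L2Away.integral_mul_eq_zero {V : Plane → ℂ} (hV : L2Away V)
    (h : ∀ l : ℤ, ∀ᵐ r, r ∈ Ioo (0 : ℝ) 3 → circ V l r = 0) (φ : 𝓓(Omega, ℝ))
    (h0 : (0 : Plane) ∉ tsupport φ) :
    ∫ x in 𝔹, (φ x : ℂ) * V x = 0 := by
  have hi := integrableOn_test_mul hV φ h0
  rw [setIntegral_congr_set (ball_ae_eq 3)]
  rw [integrableOn_congr_set_ae (ball_ae_eq 3)] at hi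
  rw [setIntegral_polar measurableSet_Ioo (fun r hr => hr.1) hi]
  refine integral_eq_zero_of_ae ?_
  rw [EventuallyEq, ae_restrict_iff' measurableSet_Ioo]
  filter_upwards [ae_all_iff.2 h, hV.ae_memLp_circle] with r hr hm hr3
  have hs := hasSum_sq_fourierCoeffOn Real.two_pi_pos (hm hr3)
  have hz (l : ℤ) : ‖fourierCoeffOn Real.two_pi_pos (fun θ => V (polar r θ)) l‖ ^ 2 = 0 := by
    rw [fourierCoeffOn_eq_dataCoeff]
    have : dataCoeff (fun θ => V (polar r θ)) l = 0 := hr l hr3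
    simp [this]
  simp only [hz] at hs
  have h1 := (hs.unique hasSum_zero)
  rw [smul_eq_zero_iff_right (by simp),
    intervalIntegral.integral_of_le Real.two_pi_pos.le,
    integral_eq_zero_iff_of_nonneg (fun θ => by positivity)
      ((memLp_two_iff_integrable_sq_norm (hm hr3).1).1 (hm hr3))] at h1
  have h2 : ∫ θ in 0..2 * π, (φ (polar r θ) : ℂ) * V (polar r θ) = 0 := by
    rw [intervalIntegral.integral_of_le Real.two_pi_pos.le]
    refine integral_eq_zero_of_ae ?_
    filter_upwards [h1] with θ hθ
    have : V (polar r θ) = 0 := by simpa using hθ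
    simp [this]
  rw [h2]; simp

/-! ### Local solvability of the Helmholtz equation -/

/-- The convolution of complex-valued functions on the plane. -/
def conv (E g : Plane → ℂ) : Plane → ℂ := convolution E g (ContinuousLinearMap.mul ℝ ℂ) volume

lemma conv_apply (E g : Plane → ℂ) (x : Plane) : conv E g x = ∫ t, E t * g (x - t) := rfl

lemma contDiff_conv {E g : Plane → ℂ} (hE : LocallyIntegrable E) (hg : Smooth g)
    (hc : HasCompactSupport g) : Smooth (conv E g) :=
  hc.contDiff_convolution_right _ hE hg

lemma fderiv_conv {E g : Plane → ℂ} (hE : LocallyIntegrable E) (hg : Smooth g)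
    (hc : HasCompactSupport g) (x v : Plane) :
    fderiv ℝ (conv E g) x v = conv E (fun y => fderiv ℝ g y v) x := by
  have h := hc.hasFDerivAt_convolution_right (μ := volume) (ContinuousLinearMap.mul ℝ ℂ) hE
    (hg.of_le (mod_cast le_top)) x
  have h' : fderiv ℝ (conv E g) x = _ := h.fderiv
  rw [h', convolution_precompR_apply _ hE (hc.fderiv ℝ) (hg.continuous_fderiv (by simp))]
  rfl

lemma fderiv_comp_const_sub' {g : Plane → ℂ} (hg : Smooth g) (x y v : Plane) :
    fderiv ℝ (fun t => g (x - t)) y v = -fderiv ℝ g (x - y) v := by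
  have h := (hg.differentiable (by simp) (x - y)).hasFDerivAt.comp y
    ((hasFDerivAt_id y).const_sub x)
  have h' : fderiv ℝ (fun t => g (x - t)) y = _ := h.fderiv
  rw [h']
  simp

lemma lap_comp_const_sub {g : Plane → ℂ} (hg : Smooth g) (x y : Plane) :
    lap (fun t => g (x - t)) y = lap g (x - y) := by
  refine Finset.sum_congr rfl fun j _ => ?_
  have h1 : (fun t => fderiv ℝ (fun t => g (x - t)) t (e j))
      = fun t => -fderiv ℝ g (x - t) (e j) :=
    funext fun t => fderiv_comp_const_sub' hg x t (e j)
  have h2 : fderiv ℝ (fun t => -fderiv ℝ g (x - t) (e j)) y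
      = -fderiv ℝ (fun t => fderiv ℝ g (x - t) (e j)) y := fderiv_fun_neg
  rw [h1, h2, neg_apply, fderiv_comp_const_sub' (contDiff_fderiv_apply hg (e j)), neg_neg]

/-- The Helmholtz operator may be moved under the convolution. -/
lemma helm_conv {E g : Plane → ℂ} (hE : LocallyIntegrable E) (hg : Smooth g)
    (hc : HasCompactSupport g) (k : ℂ) (x : Plane) :
    lap (conv E g) x + k * conv E g x
      = ∫ t, E t * (lap (fun t => g (x - t)) t + k * g (x - t)) := by
  have hcd (j : Fin 2) : HasCompactSupport fun y => fderiv ℝ g y (e j) :=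
    hc.of_isClosed_subset (isClosed_tsupport _) (tsupport_fderiv_apply g _)
  have hcdd (j : Fin 2) : HasCompactSupport fun y => fderiv ℝ (fun y => fderiv ℝ g y (e j)) y (e j) :=
    (hcd j).of_isClosed_subset (isClosed_tsupport _) (tsupport_fderiv_apply _ _)
  have hgj (j : Fin 2) := contDiff_fderiv_apply hg (e j)
  have hgjj (j : Fin 2) := contDiff_fderiv_apply (hgj j) (e j)
  have h1 (j : Fin 2) : fderiv ℝ (fun y => fderiv ℝ (conv E g) y (e j)) x (e j)
      = conv E (fun y => fderiv ℝ (fun y => fderiv ℝ g y (e j)) y (e j)) x := by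
    rw [← fderiv_conv hE (hgj j) (hcd j)]
    simp only [fderiv_conv hE hg hc]
  have hint {h : Plane → ℂ} (hh : Continuous h) (hch : HasCompactSupport h) :
      Integrable fun t => E t * h (x - t) :=
    (hch.convolutionExists_right (ContinuousLinearMap.mul ℝ ℂ) hE hh) x
  have i0 := hint (hgjj 0).continuous (hcdd 0)
  have i1 := hint (hgjj 1).continuous (hcdd 1)
  have i01 : Integrable fun t => E t * fderiv ℝ (fun y => fderiv ℝ g y (e 0)) (x - t) (e 0)
    + E t * fderiv ℝ (fun y => fderiv ℝ g y (e 1)) (x - t) (e 1) := i0.add i1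
  have i2 := (hint hg.continuous hc).const_mul k
  rw [lap, Fin.sum_univ_two, h1, h1, conv_apply, conv_apply, conv_apply, ← integral_const_mul,
    ← integral_add i0 i1, ← integral_add i01 i2]
  congr 1; funext t
  rw [lap_comp_const_sub hg, lap, Fin.sum_univ_two]
  ring

end

noncomputable section

variable {ω σa lam R k : ℝ} {f : ℝ → ℂ}

lemma lap_congr {φ ψ : Plane → ℂ} {x : Plane} (h : φ =ᶠ[𝓝 x] ψ) :
    lap φ x = lap ψ x := by
  refine Finset.sum_congr rfl fun j _ => ?_
  have h1 : (fun y => fderiv ℝ φ y (e j)) =ᶠ[𝓝 x] fun y => fderiv ℝ ψ y (e j) :=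
    (h.fderiv (𝕜 := ℝ)).mono fun y hy => congrArg (· (e j)) hy
  rw [h1.fderiv_eq]

variable (hω : 0 < ω) (hσ : 0 < σa) (hlam : 0 < lam) (hk : 0 < k)
  (hk2 : k ^ 2 * (σa * lam) = ω ^ 2) (hR : 1 < R) (hR2 : R < 2)
  (hJ : ∀ n : ℕ, besselJ n (3 * ω) ≠ 0) (hdet : ∀ n : ℕ, transDet ω σa k n R ≠ 0)
include hω hσ hlam hk hk2 hR hR2 hJ hdet

/-- Local regularity: a distribution that vanishes off the origin and satisfies the homogeneous
Helmholtz equation vanishes. -/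
lemma dist_eq_zero {w : 𝓓'(Omega, ℂ)}
    (h0 : ∀ φ : 𝓓(Omega, ℝ), (0 : Plane) ∉ tsupport φ → w φ = 0)
    (h1 : ∀ φ : 𝓓(Omega, ℝ), tsupport φ ⊆ Metric.ball (0 : Plane) R → w (helmTest k φ) = 0) :
    w = 0 := by
  ext φ
  change w φ = 0
  -- solve `Δψ + k²ψ = 2πφ` near the origin
  let χ : ContDiffBump (0 : Plane) := ⟨1 / 4, 1 / 2, by norm_num, by norm_num⟩
  have hχ : Smooth fun x => (χ x : ℂ) := Complex.ofRealCLM.contDiff.comp χ.contDiff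
  have hχs {a : Plane → ℂ} : tsupport (fun x => (χ x : ℂ) * a x) ⊆ Metric.closedBall 0 (1 / 2) := by
    refine closure_minimal (fun x hx => ?_) Metric.isClosed_closedBall
    by_contra hc
    refine hx ?_
    have : χ x = 0 := χ.zero_of_le_dist (not_le.1 hc).le
    simp [this]
  have hcχ {a : Plane → ℂ} : HasCompactSupport fun x => (χ x : ℂ) * a x :=
    (isCompact_closedBall (0 : Plane) (1 / 2)).of_isClosed_subset (isClosed_tsupport _) hχs
  set g : Plane → ℂ := fun x => (χ x : ℂ) * φ x with hg_def
  have hg : Smooth g := hχ.mul (contDiff_ofReal_test φ)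
  set E : Plane → ℂ := (𝔹).indicator (besselMode besselY k 0) with hE_def
  have hE : LocallyIntegrable E := ((integrable_indicator_iff measurableSet_ball).2
    (integrableOn_besselMode_besselY hk)).locallyIntegrable
  have hc := contDiff_conv hE hg hcχ
  have hhelm {x : Plane} (hx : ‖x‖ < 1 / 4) :
      lap (conv E g) x + (k : ℂ) ^ 2 * conv E g x = 2 * π * φ x := by
    have hs : tsupport (fun t => g (x - t)) ⊆ Metric.ball 0 R := by
      have : tsupport (fun t => g (x - t)) ⊆ Metric.closedBall 0 (3 / 4) := by
        refine closure_minimal (fun t ht => ?_) Metric.isClosed_closedBall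
        have h1 : x - t ∈ Metric.closedBall (0 : Plane) (1 / 2) :=
          hχs (subset_tsupport g ht)
        rw [mem_closedBall_zero_iff] at h1 ⊢
        have h2 := norm_sub_le x (x - t)
        rw [sub_sub_cancel] at h2
        linarith
      exact this.trans (Metric.closedBall_subset_ball (by linarith))
    have h := integral_besselY_helm hω hσ hlam hk hk2 hR hR2 hJ hdet
      (hg.comp (contDiff_const.sub contDiff_id)) hs
    have hχx : χ x = 1 := χ.one_of_mem_closedBall (mem_closedBall_zero_iff.2 hx.le)
    rw [helm_conv hE hg hcχ]
    calc ∫ t, E t * (lap (fun t => g (x - t)) t + (k : ℂ) ^ 2 * g (x - t))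
        = ∫ t in 𝔹, besselMode besselY k 0 t
            * (lap (fun t => g (x - t)) t + (k : ℂ) ^ 2 * g (x - t)) := by
          rw [← integral_indicator measurableSet_ball]
          congr 1; funext t
          rw [Set.indicator_mul_left]
      _ = 2 * π * g (x - 0) := h
      _ = 2 * π * φ x := by rw [sub_zero, hg_def]; simp [hχx]
  set ψ : Plane → ℂ := fun x => (χ x : ℂ) * conv E g x with hψ_def
  have hψs : tsupport ψ ⊆ Metric.closedBall (0 : Plane) (1 / 2) := hχs
  set η : 𝓓(Omega, ℝ) := testPart Complex.reCLM Omega ψ (hχ.mul hc) hcχ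
    (hψs.trans (Metric.closedBall_subset_ball (by norm_num))) with hη_def
  have hη : tsupport η ⊆ Metric.ball (0 : Plane) R :=
    ((tsupport_comp_subset (map_zero Complex.reCLM) ψ).trans hψs).trans
      (Metric.closedBall_subset_ball (by linarith))
  have hz : (0 : Plane) ∉ tsupport (helmTest k η - (2 * π) • φ) := by
    rw [notMem_tsupport_iff_eventuallyEq]
    filter_upwards [Metric.ball_mem_nhds (0 : Plane) (show (0 : ℝ) < 1 / 4 by norm_num)] with x hx
    have hx' := mem_ball_zero_iff.1 hx
    have heq : ψ =ᶠ[𝓝 x] conv E g := by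
      filter_upwards [Metric.isOpen_ball.mem_nhds hx] with y hy
      have : χ y = 1 := χ.one_of_mem_closedBall (Metric.ball_subset_closedBall hy)
      simp [hψ_def, this]
    change helmTest k η x - (2 * π) * φ x = 0
    rw [helmTest_testPart, lap_congr heq, heq.eq_of_nhds, hhelm hx']
    have : (2 * π * φ x : ℂ) = ((2 * π * φ x : ℝ) : ℂ) := by push_cast; ring
    rw [this]
    exact sub_self _
  have h2 := h0 _ hz
  rw [map_sub, map_smul, h1 η hη, zero_sub, neg_eq_zero] at h2
  exact (smul_eq_zero.1 h2).resolve_left Real.two_pi_pos.ne'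

/-- Uniqueness: the modes of a difference have neither boundary values nor singular parts, so that it
is supported at the origin, where local solvability applies. -/
theorem IsSolution.unique
    {N : ℕ} {q : ℕ × ℕ → ℂ} (hf : MemLp f 2 dθ)
    {u₁ u₂ : 𝓓'(Omega, ℂ)} {U₁ U₂ : Plane → ℂ} (h₁ : IsSolution ω σa lam R N q f u₁ U₁)
    (h₂ : IsSolution ω σa lam R N q f u₂ U₂) : u₁ = u₂ := by
  have hl : (lam * σa : ℂ) ≠ 0 := mod_cast (mul_pos hlam hσ).ne'
  have hU₁ : L2Away U₁ := h₁.memLp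
  have hU₂ : L2Away U₂ := h₂.memLp
  have hcirc (l : ℤ) : ∀ᵐ r, r ∈ Ioo (0 : ℝ) 3 → circ (fun x => U₁ x - U₂ x) l r = 0 := by
    obtain ⟨v₁, p₁, α₁, m₁, f₁, c₁, i₁⟩ := h₁.exists_mode hσ hlam hk hk2 hR hR2 hf l
    obtain ⟨v₂, p₂, α₂, m₂, f₂, c₂, i₂⟩ := h₂.exists_mode hσ hlam hk hk2 hR hR2 hf l
    have hm : ModeSol ω σa lam R l (fun r => v₁ r - v₂ r) fun r => p₁ r - p₂ r :=
      ⟨m₁.cont_u.sub m₂.cont_u, m₁.cont_p.sub m₂.cont_p,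
        fun r hr h1 h2 => ((m₁.deriv_u r hr h1 h2).sub (m₂.deriv_u r hr h1 h2)).congr_deriv (by ring),
        fun r hr h1 h2 => ((m₁.deriv_p r hr h1 h2).sub (m₂.deriv_p r hr h1 h2)).congr_deriv (by ring)⟩
    have hz {r : ℝ} (hr : r ∈ Ioc (0 : ℝ) 3) := hm.eq_zero hω hσ hk hR hR2 (hJ _) (hdet _) (α := α₁ - α₂)
      (fun r hr => by
        obtain ⟨a1, a2⟩ := i₁ r hr
        obtain ⟨b1, b2⟩ := i₂ r hr
        rw [a1, a2, b1, b2]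
        exact ⟨by ring, by ring⟩) (by rw [f₁, f₂, sub_self]) hr
    filter_upwards [c₁, c₂, hU₁.ae_memLp_circle, hU₂.ae_memLp_circle] with r hc₁ hc₂ hm₁ hm₂ hr
    have hexp : Continuous fun θ : ℝ => exp (-((l : ℂ) * (θ : ℂ) * I)) := by
      fun_prop
    have i₁ := (intervalIntegrable_of_memLp (hm₁ hr)).continuousOn_mul hexp.continuousOn
    have i₂ := (intervalIntegrable_of_memLp (hm₂ hr)).continuousOn_mul hexp.continuousOn
    have := intervalIntegral.integral_sub i₁ i₂
    simp only [← mul_sub] at this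
    refine this.trans ?_
    refine (congrArg₂ (· - ·) (hc₁ hr) (hc₂ hr)).trans ?_
    exact hz ⟨hr.1, hr.2.le⟩
  refine sub_eq_zero.1 (dist_eq_zero hω hσ hlam hk hk2 hR hR2 hJ hdet (fun φ h0 => ?_)
    fun φ hφ => ?_)
  · change u₁ φ - u₂ φ = 0
    rw [h₁.eq_fun φ h0, h₂.eq_fun φ h0, ← integral_sub (integrableOn_test_mul hU₁ φ h0)
      (integrableOn_test_mul hU₂ φ h0)]
    simp only [← mul_sub]
    exact (hU₁.sub hU₂).integral_mul_eq_zero hcirc φ h0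
  · change u₁ _ - u₂ _ = 0
    refine mul_left_cancel₀ hl ?_
    rw [mul_sub, h₁.inner_helm hk2 φ hφ, h₂.inner_helm hk2 φ hφ, sub_self, mul_zero]

end

end Cloak

theorem lemma1 (ω σa lam : ℝ) (hω : 0 < ω) (hσ : 0 < σa) (hlam : 0 < lam)
    (hres : Cloak.NonResonant ω σa lam) :
    ∃ R₀ : ℝ, 1 < R₀ ∧ R₀ ≤ 2 ∧
      ∀ (N : ℕ) (q : ℕ × ℕ → ℂ) (f : ℝ → ℂ), Cloak.MemHHalf f →
        (∀ R ∈ Set.Ioo 1 R₀,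
          ∃! u : 𝓓'(Cloak.Omega, ℂ), ∃ U : Cloak.Plane → ℂ,
            Cloak.IsSolution ω σa lam R N q f u U) ∧
        ∀ (u : ℝ → 𝓓'(Cloak.Omega, ℂ)) (U : ℝ → Cloak.Plane → ℂ),
          (∀ R ∈ Set.Ioo 1 R₀, Cloak.IsSolution ω σa lam R N q f (u R) (U R)) →
          ∀ n : ℤ, |n| ≤ N →
            ∃ v : ℝ → ℝ → ℂ,
              (∀ R ∈ Set.Ioo 1 R₀, Cloak.IsInnerCoeff (U R) R n (v R)) ∧
              Tendsto (fun R => Cloak.boundaryExpr σa R n (v R)) (𝓝[>] 1) (𝓝 0) ∧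
              (n = 0 →
                (fun R => Cloak.boundaryExpr σa R n (v R))
                  =O[𝓝[>] 1] fun R => 1 / Real.log (2 * (R - 1))) ∧
              (|n| = 1 →
                (fun R => Cloak.boundaryExpr σa R n (v R))
                  =O[𝓝[>] 1] fun R => 2 * (R - 1)) ∧
              (|n| = 1 → fourierCoeffOn Real.two_pi_pos f n = 0 →
                (fun R => Cloak.boundaryExpr σa R n (v R))
                  =O[𝓝[>] 1] fun R => (2 * (R - 1)) ^ 2 * Real.log (2 * (R - 1))) ∧
              (2 ≤ |n| →
                (fun R => Cloak.boundaryExpr σa R n (v R))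
                  =O[𝓝[>] 1] fun R => (2 * (R - 1)) ^ 2) := by
  have hk : 0 < Cloak.kappa σa lam * ω := mul_pos (Cloak.kappa_pos hσ hlam) hω
  have hk2 := Cloak.kappa_sq hσ hlam ω
  obtain ⟨R₀, hR₀, hR₀2, hdet⟩ := Cloak.exists_forall_transDet_ne_zero hω hσ hk
    (fun n => (hres n).2) (hres.besselD_ne_zero hω hσ hlam)
  refine ⟨R₀, hR₀, hR₀2, fun N q f hf => ⟨fun R hR => ?_, fun u U h n _ =>
    Cloak.boundary_asymptotics hω hσ hlam hres hR₀ hR₀2 hdet hf.1 u U h n⟩⟩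
  have hR2 : R < 2 := hR.2.trans_le hR₀2
  obtain ⟨u, U, hu⟩ := Cloak.exists_isSolution hω hσ hlam hk hk2 hR.1 hR2 (fun n => (hres n).2)
    (hdet R hR) N q hf
  exact ⟨u, ⟨U, hu⟩, fun v ⟨V, hv⟩ => hv.unique hω hσ hlam hk hk2 hR.1 hR2 (fun n => (hres n).2)
    (hdet R hR) hf.1 hu⟩
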